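/- **Setting.** Let $k$ be a field of characteristic $0$, $(V,\omega)$ a symplectic $k$-vector space of dimension $2n\ge 2$, and $\mathfrak x\subset V$ a Lagrangian subspace. Let $D$ be the enveloping algebra of the Heisenberg Lie algebra $V\oplus k\hbar$ (with $[x,y]=\omega(x,y)\hbar$ and $\hbar$ central), graded by $\deg V=1$, $\deg\hbar=2$. Put $\mathcal D=\prod_{i\ge 0}D^i$, $\mathcal D^{\ge j}=\prod_{i\ge j}D^i$, $K=k[[\hbar]]\subset\mathcal D$, $\mathcal M=\mathcal D/\mathcal D\mathfrak x$, and $\mathcal J=\mathcal D\mathfrak x+\mathcal D\hbar$. - $\mathrm{Aut}(\mathcal D)_{\mathcal J}$ is the group of $K$-linear algebra automorphisms of $\mathcal D$ that preserve $\mathcal J$, and $\mathrm{Der}(\mathcal D)_{\mathcal J}$ is the Lie algebra of continuous $K$-linear derivations of $\mathcal D$ that preserve $\mathcal J$. - $\mathrm{Aut}(\mathcal D,\mathcal M)$ is the group of pairs $(f,h)$, where $f$ is a $K$-linear algebra automorphism of $\mathcal D$ and $h$ is a continuous $K$-linear automorphism of $\mathcal M$ with $h(um)=f(u)h(m)$.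 $\mathrm{Der}(\mathcal D,\mathcal M)$ is the Lie algebra of pairs $(\delta,\delta')$, where $\delta$ is a continuous $K$-linear derivation of $\mathcal D$ and $\delta'$ is a continuous $K$-linear endomorphism of $\mathcal M$ with $\delta'(um)=\delta(u)m+u\,\delta'(m)$. The map $\mathsf F$ forgets the second component, and $\varepsilon$ sends $c\in K^\times$ to $(\mathrm{id},c\cdot\mathrm{id})$ and $c\in K$ to $(0,c\cdot\mathrm{id})$. - $\mathfrak G=\frac1\hbar\mathcal D/\frac1\hbar k$ with the commutator bracket, and $\varphi_{\mathcal D}:\mathfrak G\to\mathrm{Der}(\mathcal D)$ is $a\mapsto[a,-]$. Let $\mathcal G^{\ge1}=\exp\bigl(\frac1\hbar\mathcal D^{\ge3}\bigr)$, a prounipotent group, and $\mathcal G=k^\times\times(Sp(V)\ltimes\mathcal G^{\ge1})$. Its Lie algebra $k\oplus\mathfrak{sp}(V)\oplus\frac1\hbar\mathcal D^{\ge3}$ is embedded in $\mathfrak G$ by means of the isomorphism $\sigma$ from $\mathfrak{sp}(V)$ onto $[\frac1\hbar D^2,\frac1\hbar D^2]$ with $[\sigma(s),v]=s(v)$ for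 $v\in V$. The map $\Phi_{\mathcal D}:\mathcal G\to\mathrm{Aut}(\mathcal D)$ is trivial on $k^\times$, is the natural action on $Sp(V)$, and is $\exp(a)\mapsto\exp([a,-])$ on $\mathcal G^{\ge1}$. - $\mathcal G_{\mathcal J}=\Phi_{\mathcal D}^{-1}(\mathrm{Aut}(\mathcal D)_{\mathcal J})$ and $\mathfrak G_{\mathcal J}=\varphi_{\mathcal D}^{-1}(\mathrm{Der}(\mathcal D)_{\mathcal J})$. Every element of $\mathfrak G_{\mathcal J}$ is the class of a unique element of $\frac1\hbar\mathcal J$, and $\varphi_{\mathcal D,\mathcal M}:\mathfrak G_{\mathcal J}\cong\frac1\hbar\mathcal J\to\mathrm{Der}(\mathcal D,\mathcal M)$ sends $a=\frac1\hbar u$ to the pair $\bigl([a,-],\ m\mapsto\frac1\hbar um\bigr)$. - $K=\frac1\hbar(\hbar K)$ is embedded in $\mathfrak G_{\mathcal J}$, and $K^\times=k^\times\times(1+\hbar K)$ is embedded in $\mathcal G_{\mathcal J}\subset k^\times\times(Sp(V)\ltimes\mathcal G^{\ge1})$. The elements $\pm1\in k^\times$ are identified with their images in $\mathcal G_{\mathcal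 J}$ and in $\mathrm{Aut}(\mathcal D,\mathcal M)$. **Proposition.** The maps $\varphi_{\mathcal D,\mathcal M}$ and $\varphi_{\mathcal D}$ on $\mathfrak G_{\mathcal J}$ are well defined, $\varphi_{\mathcal D,\mathcal M}$ is an isomorphism of Lie algebras $\mathfrak G_{\mathcal J}\cong\mathrm{Der}(\mathcal D,\mathcal M)$, and there is an isomorphism of proalgebraic groups $$\Phi_{\mathcal D,\mathcal M}:\ \mathcal G_{\mathcal J}/\{\pm1\}\ \xrightarrow{\ \sim\ }\ \mathrm{Aut}(\mathcal D,\mathcal M)/\{\pm1\}$$ with the following properties. 1. $\langle\Phi_{\mathcal D,\mathcal M},\varphi_{\mathcal D,\mathcal M}\rangle$ is an isomorphism of Harish-Chandra pairs: the differential of $\Phi_{\mathcal D,\mathcal M}$ is the restriction of $\varphi_{\mathcal D,\mathcal M}$ to $\mathrm{Lie}\,\mathcal G_{\mathcal J}\subset\mathfrak G_{\mathcal J}$, and $\varphi_{\mathcal D,\mathcal M}(\mathrm{Ad}(g)a)=\Phi_{\mathcal D,\mathcal M}(g)\,\varphi_{\mathcal D,\mathcal M}(a)\,\Phi_{\mathcal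 D,\mathcal M}(g)^{-1}$, where $\mathrm{Ad}(g)(\frac1\hbar u)=\frac1\hbar\Phi_{\mathcal D}(g)(u)$. 2. It fits into a commutative diagram of central extensions of Harish-Chandra pairs $$\begin{array}{ccccc}\langle K^\times/\{\pm1\},K\rangle&\hookrightarrow&\langle\mathcal G_{\mathcal J}/\{\pm1\},\mathfrak G_{\mathcal J}\rangle&\xrightarrow{\langle\Phi_{\mathcal D},\varphi_{\mathcal D}\rangle}&\langle\mathrm{Aut}(\mathcal D)_{\mathcal J},\mathrm{Der}(\mathcal D)_{\mathcal J}\rangle\\ \|&&\downarrow\cong&&\|\\ \langle K^\times/\{\pm1\},K\rangle&\xrightarrow{\ \varepsilon\ }&\langle\mathrm{Aut}(\mathcal D,\mathcal M)/\{\pm1\},\mathrm{Der}(\mathcal D,\mathcal M)\rangle&\xrightarrow{\ \mathsf F\ }&\langle\mathrm{Aut}(\mathcal D)_{\mathcal J},\mathrm{Der}(\mathcal D)_{\mathcal J}\rangle\end{array}$$ whose rows are exact and central, both for the groups (also before passing to the quotients by $\{\pm1\}$) and for the Lie algebras. 3. On the parabolic subgroup $P\subset Sp(V)$ of the elements that preserve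 $\mathfrak x$, the isomorphism involves a square root of the determinant: if $p\in P$ and $r\in k$ satisfy $r^2\det(p|_{\mathfrak x})=1$, then $\Phi_{\mathcal D,\mathcal M}(p)$ is the class of $\pm\varepsilon(r)\,\Theta_{\mathcal D,\mathcal M}(p)$, where $\Theta_{\mathcal D,\mathcal M}(p)$ is the pair of automorphisms of $\mathcal D$ and $\mathcal M=\mathcal D/\mathcal D\mathfrak x$ induced by $p$. -/

import Mathlib

noncomputable section

open scoped PowerSeries LaurentSeries TensorProduct

attribute [local instance 100] LieRing.ofAssociativeRing

namespace LabelExt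

universe u v

/-- A symplectic form on a `k`-vector space. -/
structure SymplecticForm (k : Type u) (V : Type v) [Field k] [AddCommGroup V] [Module k V] where
  form : V →ₗ[k] V →ₗ[k] k
  isAlt : ∀ v, form v v = 0
  nondegenerate : ∀ v, (∀ w, form v w = 0) → v = 0

variable {k : Type u} {V : Type v} [Field k] [AddCommGroup V] [Module k V]

/-- A Lagrangian subspace: one that is equal to its own orthogonal complement. -/
def IsLagrangian (ω : SymplecticForm k V) (𝔵 : Submodule k V) : Prop :=
  ∀ v, v ∈ 𝔵 ↔ ∀ w ∈ 𝔵, ω.form v w = 0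

/-! ### The Heisenberg Lie algebra and its enveloping algebra `D` -/

/-- The Heisenberg Lie algebra `V ⊕ k ħ`, with `[x, y] = ω(x, y) ħ` and `ħ` central. -/
def Heisenberg (_ω : SymplecticForm k V) : Type (max u v) := V × k

namespace Heisenberg

variable (ω : SymplecticForm k V)

instance : AddCommGroup (Heisenberg ω) := inferInstanceAs (AddCommGroup (V × k))
instance : Module k (Heisenberg ω) := inferInstanceAs (Module k (V × k))

/-- The element `v + t ħ`. -/
def mk (v : V) (t : k) : Heisenberg ω := ((v, t) : V × k)

variable {ω}

/-- The component in `V`. -/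
def vec : Heisenberg ω →ₗ[k] V := LinearMap.fst k V k

/-- The coefficient of `ħ`. -/
def scal : Heisenberg ω →ₗ[k] k := LinearMap.snd k V k

@[simp] theorem vec_mk (v : V) (t : k) : vec (mk ω v t) = v := rfl

@[simp] theorem scal_mk (v : V) (t : k) : scal (mk ω v t) = t := rfl

theorem ext_iff' {a b : Heisenberg ω} : a = b ↔ vec a = vec b ∧ scal a = scal b := Prod.ext_iff

instance : LieRing (Heisenberg ω) where
  bracket a b := mk ω 0 (ω.form (vec a) (vec b))
  add_lie a b c := ext_iff'.2 (by simp)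
  lie_add a b c := ext_iff'.2 (by simp)
  lie_self a := ext_iff'.2 (by simp [ω.isAlt])
  leibniz_lie a b c := ext_iff'.2 (by simp)

theorem bracket_def (a b : Heisenberg ω) : ⁅a, b⁆ = mk ω 0 (ω.form (vec a) (vec b)) := rfl

instance : LieAlgebra k (Heisenberg ω) where
  lie_smul t a b := ext_iff'.2 (by simp [bracket_def])

end Heisenberg

variable (ω : SymplecticForm k V)

/-- The homogeneous Weyl algebra `D`: the enveloping algebra of the Heisenberg Lie algebra. -/
abbrev HWeyl : Type (max u v) := UniversalEnvelopingAlgebra k (Heisenberg ω)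

/-- The embedding of `V` into `D`. -/
def incl : V →ₗ[k] HWeyl ω where
  toFun v := UniversalEnvelopingAlgebra.ι k (Heisenberg.mk ω v 0)
  map_add' v w := by
    rw [← map_add]; congr 1; exact Heisenberg.ext_iff'.2 (by simp)
  map_smul' t v := by
    rw [RingHom.id_apply, ← map_smul]; congr 1; exact Heisenberg.ext_iff'.2 (by simp)

/-- The central element `ħ` of `D`. -/
def hbarD : HWeyl ω := UniversalEnvelopingAlgebra.ι k (Heisenberg.mk ω 0 1)

theorem ι_mk_zero (t : k) :
    UniversalEnvelopingAlgebra.ι k (Heisenberg.mk ω 0 t) = t • hbarD ω := by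
  rw [hbarD, ← map_smul]; congr 1; exact Heisenberg.ext_iff'.2 (by simp)

theorem incl_comm (v w : V) :
    incl ω v * incl ω w - incl ω w * incl ω v = ω.form v w • hbarD ω := by
  have h := (UniversalEnvelopingAlgebra.ι k (L := Heisenberg ω)).map_lie
    (Heisenberg.mk ω v 0) (Heisenberg.mk ω w 0)
  rw [LieRing.of_associative_ring_bracket, Heisenberg.bracket_def, ι_mk_zero] at h
  exact h.symm

theorem hbarD_comm_incl (v : V) : hbarD ω * incl ω v = incl ω v * hbarD ω := by
  have h := (UniversalEnvelopingAlgebra.ι k (L := Heisenberg ω)).map_lie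
    (Heisenberg.mk ω 0 1) (Heisenberg.mk ω v 0)
  rw [LieRing.of_associative_ring_bracket, Heisenberg.bracket_def, ι_mk_zero] at h
  simp only [Heisenberg.vec_mk, map_zero, LinearMap.zero_apply, zero_smul] at h
  exact sub_eq_zero.mp h.symm

/-- Monomials of weight `i` in `D`: products of elements of `V` (weight `1`) and of `ħ`
(weight `2`). -/
inductive IsMonomial : ℕ → HWeyl ω → Prop
  | one : IsMonomial 0 1
  | incl_mul (v : V) {i : ℕ} {m : HWeyl ω} : IsMonomial i m → IsMonomial (i + 1) (incl ω v * m)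
  | hbar_mul {i : ℕ} {m : HWeyl ω} : IsMonomial i m → IsMonomial (i + 2) (hbarD ω * m)

/-- The homogeneous component `D^i` of the grading of `D`. -/
def gr (i : ℕ) : Submodule k (HWeyl ω) := Submodule.span k {m | IsMonomial ω i m}

variable {ω}

theorem IsMonomial.mul {i j : ℕ} {a b : HWeyl ω} (ha : IsMonomial ω i a) (hb : IsMonomial ω j b) :
    IsMonomial ω (i + j) (a * b) := by
  induction ha with
  | one => simpa using hb
  | incl_mul v _ ih =>
    rw [mul_assoc, add_right_comm]; exact ih.incl_mul v
  | hbar_mul _ ih =>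
    rw [mul_assoc, add_right_comm]; exact ih.hbar_mul

theorem mul_mem_gr {i j : ℕ} {a b : HWeyl ω} (ha : a ∈ gr ω i) (hb : b ∈ gr ω j) :
    a * b ∈ gr ω (i + j) := by
  have h := Submodule.mul_mem_mul ha hb
  rw [gr, gr, Submodule.span_mul_span] at h
  refine Submodule.span_mono ?_ h
  rintro _ ⟨x, hx, y, hy, rfl⟩
  exact hx.mul hy

theorem one_mem_gr : (1 : HWeyl ω) ∈ gr ω 0 := Submodule.subset_span .one

theorem incl_mem_gr (v : V) : incl ω v ∈ gr ω 1 :=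
  Submodule.subset_span (by simpa using IsMonomial.one.incl_mul v)

theorem hbarD_mem_gr : hbarD ω ∈ gr ω 2 :=
  Submodule.subset_span (by simpa using IsMonomial.one.hbar_mul)

theorem hbarD_pow_mem_gr (m : ℕ) : hbarD ω ^ m ∈ gr ω (2 * m) := by
  induction m with
  | zero => simpa using one_mem_gr
  | succ m ih => rw [pow_succ, mul_add]; exact mul_mem_gr ih hbarD_mem_gr

theorem IsMonomial.comm_hbar {i : ℕ} {m : HWeyl ω} (h : IsMonomial ω i m) :
    hbarD ω * m = m * hbarD ω := by
  induction h with
  | one => simp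
  | incl_mul v _ ih => rw [← mul_assoc, hbarD_comm_incl, mul_assoc, ih, mul_assoc]
  | hbar_mul _ ih => rw [mul_assoc, ← ih]

theorem gr_comm_hbar {i : ℕ} {a : HWeyl ω} (ha : a ∈ gr ω i) :
    hbarD ω * a = a * hbarD ω := by
  induction ha using Submodule.span_induction with
  | mem x hx => exact hx.comm_hbar
  | zero => simp
  | add x y _ _ hx hy => rw [mul_add, add_mul, hx, hy]
  | smul t x _ hx => rw [mul_smul_comm, smul_mul_assoc, hx]

theorem gr_comm_hbar_pow {i : ℕ} {a : HWeyl ω} (ha : a ∈ gr ω i) (m : ℕ) :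
    hbarD ω ^ m * a = a * hbarD ω ^ m :=
  (Commute.pow_left (gr_comm_hbar ha) m)

/-- `ħ D^{d-2}`, which is zero for `d < 2`. -/
def hbarGr (ω : SymplecticForm k V) (d : ℕ) : Submodule k (HWeyl ω) :=
  Submodule.span k {y | ∃ e w, w ∈ gr ω e ∧ e + 2 = d ∧ y = hbarD ω * w}

theorem hbarGr_lt {d : ℕ} (hd : d < 2) {y : HWeyl ω} (hy : y ∈ hbarGr ω d) : y = 0 := by
  have : hbarGr ω d = ⊥ := by
    rw [hbarGr, Submodule.span_eq_bot]
    rintro _ ⟨e, w, _, h, _⟩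
    omega
  simpa [this] using hy

theorem hbarGr_exists {d : ℕ} {y : HWeyl ω} (hy : y ∈ hbarGr ω (d + 2)) :
    ∃ w ∈ gr ω d, y = hbarD ω * w := by
  induction hy using Submodule.span_induction with
  | mem x hx =>
    obtain ⟨e, w, hw, h, rfl⟩ := hx
    obtain rfl : e = d := by omega
    exact ⟨w, hw, rfl⟩
  | zero => exact ⟨0, zero_mem _, by simp⟩
  | add x y _ _ hx hy =>
    obtain ⟨a, ha, rfl⟩ := hx
    obtain ⟨b, hb, rfl⟩ := hy
    exact ⟨a + b, add_mem ha hb, by rw [mul_add]⟩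
  | smul t x _ hx =>
    obtain ⟨a, ha, rfl⟩ := hx
    exact ⟨t • a, Submodule.smul_mem _ _ ha, by rw [mul_smul_comm]⟩

theorem mul_mem_hbarGr_left {i j : ℕ} {a y : HWeyl ω} (ha : a ∈ gr ω i) (hy : y ∈ hbarGr ω j) :
    a * y ∈ hbarGr ω (i + j) := by
  induction hy using Submodule.span_induction with
  | mem x hx =>
    obtain ⟨e, w, hw, rfl, rfl⟩ := hx
    refine Submodule.subset_span ⟨i + e, a * w, mul_mem_gr ha hw, by omega, ?_⟩
    rw [← mul_assoc, ← mul_assoc, gr_comm_hbar ha]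
  | zero => simp
  | add x y _ _ hx hy => rw [mul_add]; exact add_mem hx hy
  | smul t x _ hx => rw [mul_smul_comm]; exact Submodule.smul_mem _ _ hx

theorem mul_mem_hbarGr_right {i j : ℕ} {a y : HWeyl ω} (ha : a ∈ gr ω i) (hy : y ∈ hbarGr ω j) :
    y * a ∈ hbarGr ω (j + i) := by
  induction hy using Submodule.span_induction with
  | mem x hx =>
    obtain ⟨e, w, hw, rfl, rfl⟩ := hx
    exact Submodule.subset_span ⟨e + i, w * a, mul_mem_gr hw ha, by omega, by rw [mul_assoc]⟩
  | zero => simp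
  | add x y _ _ hx hy => rw [add_mul]; exact add_mem hx hy
  | smul t x _ hx => rw [smul_mul_assoc]; exact Submodule.smul_mem _ _ hx

theorem IsMonomial.comm_incl {j : ℕ} {m : HWeyl ω} (h : IsMonomial ω j m) (v : V) :
    incl ω v * m - m * incl ω v ∈ hbarGr ω (1 + j) := by
  induction h with
  | one => simp
  | @incl_mul w i m hm ih =>
    have e : incl ω v * (incl ω w * m) - incl ω w * m * incl ω v
        = (incl ω v * incl ω w - incl ω w * incl ω v) * m
          + incl ω w * (incl ω v * m - m * incl ω v) := by noncomm_ring
    rw [e, incl_comm]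
    refine add_mem ?_ ?_
    · rw [smul_mul_assoc]
      exact Submodule.smul_mem _ _
        (Submodule.subset_span ⟨i, m, Submodule.subset_span hm, by omega, rfl⟩)
    · have := mul_mem_hbarGr_left (incl_mem_gr (ω := ω) w) ih
      convert this using 2; omega
  | @hbar_mul i m hm ih =>
    have e : incl ω v * (hbarD ω * m) - hbarD ω * m * incl ω v
        = hbarD ω * (incl ω v * m - m * incl ω v) := by
      rw [← mul_assoc, ← hbarD_comm_incl]; noncomm_ring
    rw [e]
    have := mul_mem_hbarGr_left (hbarD_mem_gr (ω := ω)) ih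
    convert this using 2; omega

theorem IsMonomial.comm {i j : ℕ} {a b : HWeyl ω} (ha : IsMonomial ω i a)
    (hb : IsMonomial ω j b) : a * b - b * a ∈ hbarGr ω (i + j) := by
  induction ha with
  | one => simp
  | @incl_mul v i m hm ih =>
    have e : incl ω v * m * b - b * (incl ω v * m)
        = incl ω v * (m * b - b * m) + (incl ω v * b - b * incl ω v) * m := by noncomm_ring
    rw [e]
    refine add_mem ?_ ?_
    · have := mul_mem_hbarGr_left (incl_mem_gr (ω := ω) v) ih
      convert this using 2; omega
    · have := mul_mem_hbarGr_right (Submodule.subset_span hm : m ∈ gr ω i) (hb.comm_incl v)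
      convert this using 2; omega
  | @hbar_mul i m hm ih =>
    have e : hbarD ω * m * b - b * (hbarD ω * m) = hbarD ω * (m * b - b * m) := by
      rw [← mul_assoc b, ← hb.comm_hbar]; noncomm_ring
    rw [e]
    have := mul_mem_hbarGr_left (hbarD_mem_gr (ω := ω)) ih
    convert this using 2; omega

theorem gr_comm {i j : ℕ} {a b : HWeyl ω} (ha : a ∈ gr ω i) (hb : b ∈ gr ω j) :
    a * b - b * a ∈ hbarGr ω (i + j) := by
  induction ha using Submodule.span_induction with
  | mem x hx =>
    induction hb using Submodule.span_induction with
    | mem y hy => exact hx.comm hy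
    | zero => simp
    | add y z _ _ hy hz =>
      have e : x * (y + z) - (y + z) * x = (x * y - y * x) + (x * z - z * x) := by noncomm_ring
      rw [e]; exact add_mem hy hz
    | smul t y _ hy =>
      rw [mul_smul_comm, smul_mul_assoc, ← smul_sub]; exact Submodule.smul_mem _ _ hy
  | zero => simp
  | add y z _ _ hy hz =>
    have e : (y + z) * b - b * (y + z) = (y * b - b * y) + (z * b - b * z) := by noncomm_ring
    rw [e]; exact add_mem hy hz
  | smul t y _ hy =>
    rw [mul_smul_comm, smul_mul_assoc, ← smul_sub]; exact Submodule.smul_mem _ _ hy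


/-! ### The completed algebra `𝒟 = ∏ D^i` -/

open PowerSeries in
/-- `∏ D^i`, realised inside `D⟦t⟧` as the subalgebra of the series whose `i`-th coefficient
is homogeneous of degree `i`; the product is the Cauchy product. -/
def completion (ω : SymplecticForm k V) : Subalgebra k (HWeyl ω)⟦X⟧ where
  carrier := {f | ∀ i, coeff i f ∈ gr ω i}
  mul_mem' {f g} hf hg i := by
    rw [coeff_mul]
    refine sum_mem fun p hp => ?_
    rw [← Finset.HasAntidiagonal.mem_antidiagonal.mp hp]
    exact mul_mem_gr (hf _) (hg _)
  add_mem' {f g} hf hg i := by rw [map_add]; exact add_mem (hf i) (hg i)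
  algebraMap_mem' t i := by
    rw [PowerSeries.algebraMap_apply, coeff_C]
    split_ifs with h
    · subst h
      rw [Algebra.algebraMap_eq_smul_one]
      exact Submodule.smul_mem _ _ one_mem_gr
    · exact zero_mem _

/-- The completed Weyl algebra `𝒟 = ∏ D^i`. -/
def FWeyl (ω : SymplecticForm k V) : Type (max u v) := completion ω

namespace FWeyl

instance : Ring (FWeyl ω) := inferInstanceAs (Ring (completion ω))
instance : Algebra k (FWeyl ω) := inferInstanceAs (Algebra k (completion ω))

/-- The underlying series of homogeneous components. -/
def toSeries : FWeyl ω →ₐ[k] (HWeyl ω)⟦X⟧ := (completion ω).val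

/-- The homogeneous component of degree `i`. -/
def comp (i : ℕ) : FWeyl ω →ₗ[k] HWeyl ω where
  toFun f := PowerSeries.coeff i (toSeries f)
  map_add' f g := by rw [map_add, map_add]
  map_smul' t f := by rw [map_smul]; rfl

theorem comp_mem (f : FWeyl ω) (i : ℕ) : comp i f ∈ gr ω i := f.2 i

theorem ext {f g : FWeyl ω} (h : ∀ i, comp i f = comp i g) : f = g :=
  Subtype.ext (PowerSeries.ext h)

/-- The element with prescribed homogeneous components. -/
def mk (f : ℕ → HWeyl ω) (hf : ∀ i, f i ∈ gr ω i) : FWeyl ω :=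
  ⟨PowerSeries.mk f, fun i => by rw [PowerSeries.coeff_mk]; exact hf i⟩

@[simp] theorem comp_mk (f : ℕ → HWeyl ω) (hf : ∀ i, f i ∈ gr ω i) (i : ℕ) :
    comp i (mk f hf) = f i := PowerSeries.coeff_mk i f

theorem comp_mul (f g : FWeyl ω) (d : ℕ) :
    comp d (f * g) = ∑ p ∈ Finset.HasAntidiagonal.antidiagonal d, comp p.1 f * comp p.2 g :=
  PowerSeries.coeff_mul d (toSeries f) (toSeries g)

theorem comp_mul' (f g : FWeyl ω) (d : ℕ) :
    comp d (f * g) =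
      ∑ p ∈ Finset.HasAntidiagonal.antidiagonal d, comp p.2 f * comp p.1 g := by
  rw [comp_mul, ← Finset.Nat.sum_antidiagonal_swap]
  rfl

theorem comp_one (d : ℕ) : comp d (1 : FWeyl ω) = if d = 0 then 1 else 0 :=
  PowerSeries.coeff_one d

/-- A homogeneous element of `D`, viewed in `𝒟`. -/
def homog {d : ℕ} (a : HWeyl ω) (ha : a ∈ gr ω d) : FWeyl ω :=
  mk (fun i => if i = d then a else 0) fun i => by
    split_ifs with h
    · exact h ▸ ha
    · exact zero_mem _

/-- The embedding of `V` into `𝒟`. -/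
def ofV (v : V) : FWeyl ω := homog (incl ω v) (incl_mem_gr v)

/-- The element `∑ c_m ħ^m` of `𝒟`, for `∑ c_m ħ^m` in `K = k⟦ħ⟧`. -/
def ofKFun (c : k⟦X⟧) : FWeyl ω :=
  mk (fun i => if Even i then PowerSeries.coeff (i / 2) c • hbarD ω ^ (i / 2) else 0) fun i => by
    split_ifs with h
    · obtain ⟨m, rfl⟩ := h
      rw [← two_mul, Nat.mul_div_cancel_left m two_pos]
      exact Submodule.smul_mem _ _ (hbarD_pow_mem_gr m)
    · exact zero_mem _

theorem comp_ofKFun_even (c : k⟦X⟧) (m : ℕ) :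
    comp (2 * m) (ofKFun c : FWeyl ω) = PowerSeries.coeff m c • hbarD ω ^ m := by
  simp [ofKFun]

theorem comp_ofKFun_odd (c : k⟦X⟧) {i : ℕ} (h : ¬ Even i) :
    comp i (ofKFun c : FWeyl ω) = 0 := by
  simp [ofKFun, h]

/-- `K = k⟦ħ⟧` maps to `𝒟`. -/
def ofK : k⟦X⟧ →+* FWeyl ω where
  toFun := ofKFun
  map_zero' := ext fun i => by simp [ofKFun]
  map_add' c d := ext fun i => by
    rw [map_add]; simp only [ofKFun, comp_mk]; split_ifs <;> simp [add_smul]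
  map_one' := ext fun i => by
    rw [comp_one]
    rcases Nat.even_or_odd' i with ⟨m, rfl | rfl⟩
    · rw [comp_ofKFun_even, PowerSeries.coeff_one]
      by_cases h : m = 0 <;> simp [h]
    · rw [comp_ofKFun_odd _ (by simp)]; simp
  map_mul' c d := ext fun i => by
    rw [comp_mul]
    rcases Nat.even_or_odd' i with ⟨m, rfl | rfl⟩
    · rw [comp_ofKFun_even, PowerSeries.coeff_mul, Finset.sum_smul]
      symm
      rw [← Finset.sum_subset (s₁ := (Finset.HasAntidiagonal.antidiagonal m).image fun p => (2 * p.1, 2 * p.2))]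
      · rw [Finset.sum_image]
        · refine Finset.sum_congr rfl fun p hp => ?_
          rw [comp_ofKFun_even, comp_ofKFun_even, smul_mul_smul_comm, ← pow_add,
            Finset.HasAntidiagonal.mem_antidiagonal.mp hp]
        · rintro ⟨a, b⟩ _ ⟨a', b'⟩ _ h
          simpa using h
      · rintro ⟨a, b⟩ h
        simp only [Finset.mem_image, Finset.HasAntidiagonal.mem_antidiagonal, Prod.mk.injEq, Prod.exists] at h ⊢
        obtain ⟨x, y, hxy, rfl, rfl⟩ := h
        omega
      · rintro ⟨a, b⟩ h h'
        have ha : ¬ Even a := by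
          rintro ⟨x, rfl⟩
          rw [Finset.HasAntidiagonal.mem_antidiagonal] at h
          refine h' (Finset.mem_image.2 ⟨(x, m - x), ?_, ?_⟩)
          · rw [Finset.HasAntidiagonal.mem_antidiagonal]; dsimp only at *; omega
          · ext <;> dsimp only at * <;> omega
        rw [comp_ofKFun_odd _ ha, zero_mul]
    · rw [comp_ofKFun_odd _ (by simp)]
      symm
      refine Finset.sum_eq_zero ?_
      rintro ⟨a, b⟩ h
      rw [Finset.HasAntidiagonal.mem_antidiagonal] at h
      dsimp only at h ⊢
      by_cases ha : Even a
      · have hb : ¬ Even b := by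
          intro hb
          have := ha.add hb
          rw [h] at this
          simp at this
        rw [comp_ofKFun_odd _ hb, mul_zero]
      · rw [comp_ofKFun_odd _ ha, zero_mul]

theorem ofK_comm (c : k⟦X⟧) (f : FWeyl ω) : ofK c * f = f * ofK c := by
  refine ext fun d => ?_
  rw [comp_mul, comp_mul']
  refine Finset.sum_congr rfl ?_
  rintro ⟨a, b⟩ -
  change comp a (ofKFun c) * _ = _ * comp a (ofKFun c)
  rcases Nat.even_or_odd' a with ⟨m, rfl | rfl⟩
  · rw [comp_ofKFun_even, smul_mul_assoc, mul_smul_comm, gr_comm_hbar_pow (comp_mem f b)]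
  · rw [comp_ofKFun_odd _ (by simp)]; simp

instance : Algebra k⟦X⟧ (FWeyl ω) where
  smul c f := ofK c * f
  algebraMap := ofK
  commutes' c f := ofK_comm c f
  smul_def' _ _ := rfl

theorem ofK_C (t : k) : ofK (PowerSeries.C t) = algebraMap k (FWeyl ω) t := by
  rw [Algebra.algebraMap_eq_smul_one]
  refine ext fun i => ?_
  rw [map_smul, comp_one]
  change comp i (ofKFun _) = _
  rcases Nat.even_or_odd' i with ⟨m, rfl | rfl⟩
  · rw [comp_ofKFun_even, PowerSeries.coeff_C]
    by_cases h : m = 0 <;> simp [h]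
  · rw [comp_ofKFun_odd _ (by simp)]; simp

instance : IsScalarTower k k⟦X⟧ (FWeyl ω) := IsScalarTower.of_algebraMap_eq fun t => (ofK_C t).symm

/-- The element `ħ` of `𝒟`. -/
def hbar (ω : SymplecticForm k V) : FWeyl ω := algebraMap k⟦X⟧ (FWeyl ω) PowerSeries.X

theorem comp_hbar (d : ℕ) : comp d (hbar ω) = if d = 2 then hbarD ω else 0 := by
  change comp d (ofKFun _) = _
  rcases Nat.even_or_odd' d with ⟨m, rfl | rfl⟩
  · rw [comp_ofKFun_even, PowerSeries.coeff_X]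
    by_cases h : m = 1
    · subst h; simp
    · rw [if_neg h, if_neg (by omega), zero_smul]
  · rw [comp_ofKFun_odd _ (by simp), if_neg (by omega)]

theorem comp_hbar_mul (f : FWeyl ω) (d : ℕ) : comp (d + 2) (hbar ω * f) = hbarD ω * comp d f := by
  rw [comp_mul, Finset.sum_eq_single (2, d)]
  · simp [comp_hbar]
  · rintro ⟨a, b⟩ h h'
    rw [comp_hbar, if_neg, zero_mul]
    rintro rfl
    rw [Finset.HasAntidiagonal.mem_antidiagonal] at h
    exact h' (by ext <;> dsimp only at * ; omega)
  · intro h; exact absurd (Finset.HasAntidiagonal.mem_antidiagonal.2 (by dsimp only; omega)) h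

theorem comp_hbar_mul_lt (f : FWeyl ω) {d : ℕ} (hd : d < 2) : comp d (hbar ω * f) = 0 := by
  rw [comp_mul]
  refine Finset.sum_eq_zero ?_
  rintro ⟨a, b⟩ h
  rw [Finset.HasAntidiagonal.mem_antidiagonal] at h
  rw [comp_hbar, if_neg, zero_mul]
  dsimp only at *; omega

theorem comp_comm (f g : FWeyl ω) (d : ℕ) : comp d (f * g - g * f) ∈ hbarGr ω d := by
  rw [map_sub, comp_mul, comp_mul', ← Finset.sum_sub_distrib]
  refine sum_mem fun p hp => ?_
  rw [← Finset.HasAntidiagonal.mem_antidiagonal.mp hp]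
  exact gr_comm (comp_mem _ _) (comp_mem _ _)

/-- Commutators in `𝒟` are divisible by `ħ`. -/
theorem exists_comm_eq (f g : FWeyl ω) : ∃ w : FWeyl ω, f * g - g * f = hbar ω * w := by
  choose w hw h using fun d => hbarGr_exists (comp_comm f g (d + 2))
  refine ⟨mk w hw, ext fun d => ?_⟩
  match d with
  | 0 => rw [comp_hbar_mul_lt _ (by omega), hbarGr_lt (by omega) (comp_comm f g 0)]
  | 1 => rw [comp_hbar_mul_lt _ (by omega), hbarGr_lt (by omega) (comp_comm f g 1)]
  | d + 2 => rw [comp_hbar_mul, comp_mk, h]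

/-- The filtration `𝒟^{≥ j}`. -/
def filt (ω : SymplecticForm k V) (j : ℕ) : Submodule k (FWeyl ω) where
  carrier := {f | ∀ i < j, comp i f = 0}
  add_mem' hf hg i hi := by rw [map_add, hf i hi, hg i hi, add_zero]
  zero_mem' i _ := map_zero _
  smul_mem' t f hf i hi := by rw [map_smul, hf i hi, smul_zero]

end FWeyl

/-! ### The Lie algebra `𝔊` -/

/-- `k((ħ)) ⊗_K 𝒟`, where `K = k⟦ħ⟧`. -/
def Loc (ω : SymplecticForm k V) : Type (max u v) := k⸨X⸩ ⊗[k⟦X⟧] FWeyl ω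

namespace Loc

instance : Ring (Loc ω) := inferInstanceAs (Ring (k⸨X⸩ ⊗[k⟦X⟧] FWeyl ω))
instance : Algebra k⟦X⟧ (Loc ω) := inferInstanceAs (Algebra k⟦X⟧ (k⸨X⸩ ⊗[k⟦X⟧] FWeyl ω))
instance : Algebra k (Loc ω) := Algebra.compHom (Loc ω) (algebraMap k k⟦X⟧)
instance : IsScalarTower k k⟦X⟧ (Loc ω) := IsScalarTower.of_algebraMap_eq fun _ => rfl

end Loc

/-- The map `𝒟 → k((ħ)) ⊗ 𝒟`. -/
def toLoc : FWeyl ω →ₐ[k⟦X⟧] Loc ω :=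
  (Algebra.TensorProduct.includeRight : FWeyl ω →ₐ[k⟦X⟧] k⸨X⸩ ⊗[k⟦X⟧] FWeyl ω)

/-- The map `u ↦ (1/ħ) u` from `𝒟` to `k((ħ)) ⊗ 𝒟`. -/
def overHbar : FWeyl ω →ₗ[k⟦X⟧] Loc ω :=
  (TensorProduct.mk k⟦X⟧ k⸨X⸩ (FWeyl ω) (HahnSeries.single (-1) 1) :
    FWeyl ω →ₗ[k⟦X⟧] k⸨X⸩ ⊗[k⟦X⟧] FWeyl ω)

theorem X_smul_single (a : ℤ) :
    (PowerSeries.X : k⟦X⟧) • (HahnSeries.single a (1 : k) : k⸨X⸩) = HahnSeries.single (a + 1) 1 := by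
  rw [Algebra.smul_def]
  change (HahnSeries.ofPowerSeries ℤ k) PowerSeries.X * _ = _
  rw [HahnSeries.ofPowerSeries_X, HahnSeries.single_mul_single, one_mul, add_comm]

theorem tmul_hbar_mul (a : ℤ) (w : FWeyl ω) :
    (HahnSeries.single a (1 : k) : k⸨X⸩) ⊗ₜ[k⟦X⟧] (FWeyl.hbar ω * w) =
      (HahnSeries.single (a + 1) (1 : k) : k⸨X⸩) ⊗ₜ[k⟦X⟧] w := by
  rw [FWeyl.hbar, ← Algebra.smul_def, ← TensorProduct.smul_tmul, X_smul_single]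

theorem tmul_comm (a b : ℤ) {f g w : FWeyl ω} (h : f * g - g * f = FWeyl.hbar ω * w) :
    ((HahnSeries.single a (1 : k) : k⸨X⸩) ⊗ₜ[k⟦X⟧] f) *
        ((HahnSeries.single b (1 : k) : k⸨X⸩) ⊗ₜ[k⟦X⟧] g) -
      ((HahnSeries.single b (1 : k) : k⸨X⸩) ⊗ₜ[k⟦X⟧] g) *
        ((HahnSeries.single a (1 : k) : k⸨X⸩) ⊗ₜ[k⟦X⟧] f) =
      (HahnSeries.single (a + b + 1) (1 : k) : k⸨X⸩) ⊗ₜ[k⟦X⟧] w := by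
  rw [Algebra.TensorProduct.tmul_mul_tmul, Algebra.TensorProduct.tmul_mul_tmul,
    HahnSeries.single_mul_single, HahnSeries.single_mul_single, one_mul, add_comm b a,
    ← TensorProduct.tmul_sub, h, tmul_hbar_mul]

theorem lie_overHbar_toLoc {f g w : FWeyl ω} (h : f * g - g * f = FWeyl.hbar ω * w) :
    ⁅overHbar f, toLoc g⁆ = toLoc w := tmul_comm (-1) 0 h

theorem lie_overHbar {f g w : FWeyl ω} (h : f * g - g * f = FWeyl.hbar ω * w) :
    ⁅overHbar f, overHbar g⁆ = overHbar w := tmul_comm (-1) (-1) h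

variable (ω)

/-- The Lie algebra `(1/ħ) 𝒟` with the commutator bracket. -/
def invHbarD : LieSubalgebra k (Loc ω) where
  toSubmodule := LinearMap.range ((overHbar (ω := ω)).restrictScalars k)
  lie_mem' := by
    rintro _ _ ⟨f, rfl⟩ ⟨g, rfl⟩
    obtain ⟨w, hw⟩ := FWeyl.exists_comm_eq f g
    exact ⟨w, (lie_overHbar hw).symm⟩

variable {ω}

/-- The element `(1/ħ) u` of `(1/ħ) 𝒟`. -/
def divHbar : FWeyl ω →ₗ[k] invHbarD ω :=
  ((overHbar (ω := ω)).restrictScalars k).rangeRestrict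

theorem divHbar_surjective : Function.Surjective (divHbar (ω := ω)) :=
  LinearMap.surjective_rangeRestrict _

theorem lie_divHbar {f g w : FWeyl ω} (h : f * g - g * f = FWeyl.hbar ω * w) :
    ⁅divHbar f, divHbar g⁆ = divHbar w := Subtype.ext (lie_overHbar h)

theorem lie_divHbar_one (a : invHbarD ω) : ⁅a, divHbar (1 : FWeyl ω)⁆ = 0 := by
  obtain ⟨f, rfl⟩ := divHbar_surjective a
  rw [lie_divHbar (w := 0) (by simp), map_zero]

variable (ω)

/-- The central ideal `(1/ħ) k` of `(1/ħ) 𝒟`. -/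
def invHbark : LieIdeal k (invHbarD ω) where
  toSubmodule := Submodule.span k {divHbar 1}
  lie_mem {x m} hm := by
    obtain ⟨t, rfl⟩ := Submodule.mem_span_singleton.mp hm
    rw [lie_smul, lie_divHbar_one, smul_zero]
    exact (Submodule.span k {divHbar (1 : FWeyl ω)}).zero_mem

/-- The Lie algebra `𝔊 = (1/ħ) 𝒟 / (1/ħ) k`. -/
abbrev 𝔊 : Type (max u v) := invHbarD ω ⧸ invHbark ω

variable {ω}

/-- The class of `(1/ħ) u` in `𝔊`. -/
def cls : FWeyl ω →ₗ[k] 𝔊 ω :=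
  (LieSubmodule.Quotient.mk' (invHbark ω)).toLinearMap ∘ₗ divHbar

theorem cls_surjective : Function.Surjective (cls (ω := ω)) := fun a => by
  obtain ⟨b, rfl⟩ := LieSubmodule.Quotient.surjective_mk' (invHbark ω) a
  obtain ⟨f, rfl⟩ := divHbar_surjective b
  exact ⟨f, rfl⟩

theorem lie_cls {f g w : FWeyl ω} (h : f * g - g * f = FWeyl.hbar ω * w) :
    ⁅cls f, cls g⁆ = cls w := by
  change ⁅(LieSubmodule.Quotient.mk (divHbar f) : 𝔊 ω), LieSubmodule.Quotient.mk (divHbar g)⁆ = _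
  rw [← LieSubmodule.Quotient.mk_bracket, lie_divHbar h]
  rfl

/-! ### The ideal `𝒥` -/

section Lagrangian

variable (ω) (𝔵 : Submodule k V)

/-- The left ideal `𝒟 𝔵` of `𝒟`. -/
def leftIdeal : Ideal (FWeyl ω) := Ideal.span (FWeyl.ofV '' (𝔵 : Set V))

/-- The ideal `𝒥`: the preimage in `𝒟` of the ideal of `𝒟 / ħ 𝒟` generated by `𝔵`,
that is, `𝒟 𝔵 + 𝒟 ħ`. -/
def JIdeal : Ideal (FWeyl ω) := leftIdeal ω 𝔵 ⊔ Ideal.span {FWeyl.hbar ω}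

/-- The `𝒟`-module `𝓜 = 𝒟 / 𝒟 𝔵`. -/
abbrev FMod : Type (max u v) := FWeyl ω ⧸ leftIdeal ω 𝔵


/-- The filtration `𝓜^{≥ j}`: the image of `𝒟^{≥ j}`. -/
def filtMod (j : ℕ) : Submodule k (FMod ω 𝔵) :=
  (FWeyl.filt ω j).map ((Submodule.mkQ (leftIdeal ω 𝔵)).restrictScalars k)

variable {ω 𝔵}

/-- Continuity of an additive self-map of `𝒟`. -/
def IsContD (f : FWeyl ω → FWeyl ω) : Prop :=
  ∀ i, ∃ j, ∀ x ∈ FWeyl.filt ω j, f x ∈ FWeyl.filt ω i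

/-- Continuity of an additive self-map of `𝓜`. -/
def IsContM (f : FMod ω 𝔵 → FMod ω 𝔵) : Prop :=
  ∀ i, ∃ j, ∀ x ∈ filtMod ω 𝔵 j, f x ∈ filtMod ω 𝔵 i

theorem IsContD.comp {f g : FWeyl ω → FWeyl ω} (hf : IsContD f) (hg : IsContD g) :
    IsContD (f ∘ g) := fun i => by
  obtain ⟨j, hj⟩ := hf i
  obtain ⟨l, hl⟩ := hg j
  exact ⟨l, fun x hx => hj _ (hl x hx)⟩

theorem IsContM.comp {f g : FMod ω 𝔵 → FMod ω 𝔵} (hf : IsContM f) (hg : IsContM g) :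
    IsContM (f ∘ g) := fun i => by
  obtain ⟨j, hj⟩ := hf i
  obtain ⟨l, hl⟩ := hg j
  exact ⟨l, fun x hx => hj _ (hl x hx)⟩

theorem FWeyl.filt_anti {i j : ℕ} (h : i ≤ j) : FWeyl.filt ω j ≤ FWeyl.filt ω i :=
  fun _ hx l hl => hx l (hl.trans_le h)

theorem filtMod_anti {i j : ℕ} (h : i ≤ j) : filtMod ω 𝔵 j ≤ filtMod ω 𝔵 i :=
  Submodule.map_mono (FWeyl.filt_anti h)

theorem IsContD.sub {f g : FWeyl ω → FWeyl ω} (hf : IsContD f) (hg : IsContD g) :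
    IsContD (fun x => f x - g x) := fun i => by
  obtain ⟨j, hj⟩ := hf i
  obtain ⟨l, hl⟩ := hg i
  exact ⟨max j l, fun x hx => sub_mem (hj x (FWeyl.filt_anti (le_max_left _ _) hx))
    (hl x (FWeyl.filt_anti (le_max_right _ _) hx))⟩

theorem IsContD.add {f g : FWeyl ω → FWeyl ω} (hf : IsContD f) (hg : IsContD g) :
    IsContD (fun x => f x + g x) := fun i => by
  obtain ⟨j, hj⟩ := hf i
  obtain ⟨l, hl⟩ := hg i
  exact ⟨max j l, fun x hx => add_mem (hj x (FWeyl.filt_anti (le_max_left _ _) hx))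
    (hl x (FWeyl.filt_anti (le_max_right _ _) hx))⟩

theorem IsContM.sub {f g : FMod ω 𝔵 → FMod ω 𝔵} (hf : IsContM f) (hg : IsContM g) :
    IsContM (fun x => f x - g x) := fun i => by
  obtain ⟨j, hj⟩ := hf i
  obtain ⟨l, hl⟩ := hg i
  exact ⟨max j l, fun x hx => sub_mem (hj x (filtMod_anti (le_max_left _ _) hx))
    (hl x (filtMod_anti (le_max_right _ _) hx))⟩

theorem IsContM.add {f g : FMod ω 𝔵 → FMod ω 𝔵} (hf : IsContM f) (hg : IsContM g) :
    IsContM (fun x => f x + g x) := fun i => by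
  obtain ⟨j, hj⟩ := hf i
  obtain ⟨l, hl⟩ := hg i
  exact ⟨max j l, fun x hx => add_mem (hj x (filtMod_anti (le_max_left _ _) hx))
    (hl x (filtMod_anti (le_max_right _ _) hx))⟩

variable (ω 𝔵)

/-! ### Automorphisms and derivations -/

/-- The group `Aut(𝒟)` of `K`-linear algebra automorphisms. -/
abbrev AutD : Type (max u v) := FWeyl ω ≃ₐ[k⟦X⟧] FWeyl ω

/-- The subgroup `Aut(𝒟)_𝒥` of the automorphisms that preserve `𝒥`. -/
def AutJ : Subgroup (AutD ω) where
  carrier := {f | ∀ x, f x ∈ JIdeal ω 𝔵 ↔ x ∈ JIdeal ω 𝔵}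
  mul_mem' {f g} hf hg x := (hf (g x)).trans (hg x)
  one_mem' _ := Iff.rfl
  inv_mem' {f} hf x := by
    have := hf (f⁻¹ x)
    rw [show f (f⁻¹ x) = x from f.apply_symm_apply x] at this
    exact this.symm

/-- The group `Aut(𝒟, 𝓜)` of automorphisms of the pair `(𝒟, 𝓜)`. -/
def AutDM : Subgroup (AutD ω × (FMod ω 𝔵 ≃ₗ[k⟦X⟧] FMod ω 𝔵)) where
  carrier := {f | (∀ (u : FWeyl ω) (m : FMod ω 𝔵), f.2 (u • m) = f.1 u • f.2 m) ∧
    IsContM f.2 ∧ IsContM f.2.symm}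
  mul_mem' {f g} hf hg := by
    refine ⟨fun u m => ?_, hf.2.1.comp hg.2.1, hg.2.2.comp hf.2.2⟩
    change f.2 (g.2 (u • m)) = f.1 (g.1 u) • f.2 (g.2 m)
    rw [hg.1, hf.1]
  one_mem' := ⟨fun _ _ => rfl, fun i => ⟨i, fun _ h => h⟩, fun i => ⟨i, fun _ h => h⟩⟩
  inv_mem' {f} hf := by
    refine ⟨fun u m => ?_, hf.2.2, hf.2.1⟩
    change f.2.symm (u • m) = f.1.symm u • f.2.symm m
    apply f.2.injective
    rw [hf.1, f.2.apply_symm_apply, f.2.apply_symm_apply, f.1.apply_symm_apply]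

/-- The Lie algebra `Der(𝒟)_𝒥` of continuous `K`-linear derivations of `𝒟` that preserve `𝒥`. -/
def DerJ : LieSubalgebra k (Module.End k⟦X⟧ (FWeyl ω)) where
  carrier := {δ | (∀ x y, δ (x * y) = δ x * y + x * δ y) ∧ IsContD δ ∧
    ∀ x ∈ JIdeal ω 𝔵, δ x ∈ JIdeal ω 𝔵}
  add_mem' {δ ε} hδ hε := by
    refine ⟨fun x y => ?_, hδ.2.1.add hε.2.1, fun x hx => add_mem (hδ.2.2 x hx) (hε.2.2 x hx)⟩
    simp only [LinearMap.add_apply, hδ.1, hε.1]; noncomm_ring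
  zero_mem' := ⟨fun x y => by simp, fun i => ⟨i, fun _ _ => zero_mem _⟩, fun _ _ => zero_mem _⟩
  smul_mem' t δ hδ := by
    refine ⟨fun x y => ?_, fun i => ?_, fun x hx => ?_⟩
    · simp only [LinearMap.smul_apply, hδ.1, smul_add, smul_mul_assoc, mul_smul_comm]
    · obtain ⟨j, hj⟩ := hδ.2.1 i
      exact ⟨j, fun x hx => Submodule.smul_mem _ t (hj x hx)⟩
    · rw [LinearMap.smul_apply, Algebra.smul_def]
      exact Ideal.mul_mem_left _ _ (hδ.2.2 x hx)
  lie_mem' {δ ε} hδ hε := by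
    refine ⟨fun x y => ?_, ?_, fun x hx => ?_⟩
    · simp only [LieRing.of_associative_ring_bracket, LinearMap.sub_apply, Module.End.mul_apply,
        hδ.1, hε.1, map_add]
      noncomm_ring
    · exact (hδ.2.1.comp hε.2.1).sub (hε.2.1.comp hδ.2.1)
    · exact sub_mem (hδ.2.2 _ (hε.2.2 x hx)) (hε.2.2 _ (hδ.2.2 x hx))

/-- The Lie algebra `Der(𝒟, 𝓜)` of derivations of the pair `(𝒟, 𝓜)`. -/
def DerDM : LieSubalgebra k (Module.End k⟦X⟧ (FWeyl ω) × Module.End k⟦X⟧ (FMod ω 𝔵)) where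
  carrier := {δ | (∀ x y, δ.1 (x * y) = δ.1 x * y + x * δ.1 y) ∧
    (∀ (x : FWeyl ω) (m : FMod ω 𝔵), δ.2 (x • m) = δ.1 x • m + x • δ.2 m) ∧
    IsContD δ.1 ∧ IsContM δ.2}
  add_mem' {δ ε} hδ hε := by
    refine ⟨fun x y => ?_, fun x m => ?_, hδ.2.2.1.add hε.2.2.1, hδ.2.2.2.add hε.2.2.2⟩
    · simp only [Prod.fst_add, LinearMap.add_apply, hδ.1, hε.1]; noncomm_ring
    · simp only [Prod.fst_add, Prod.snd_add, LinearMap.add_apply, hδ.2.1, hε.2.1, add_smul,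
        smul_add]
      abel
  zero_mem' := ⟨fun x y => by simp, fun x m => by simp, fun i => ⟨i, fun _ _ => zero_mem _⟩,
    fun i => ⟨i, fun _ _ => zero_mem _⟩⟩
  smul_mem' t δ hδ := by
    refine ⟨fun x y => ?_, fun x m => ?_, fun i => ?_, fun i => ?_⟩
    · simp only [Prod.smul_fst, LinearMap.smul_apply, hδ.1, smul_add, smul_mul_assoc,
        mul_smul_comm]
    · simp only [Prod.smul_fst, Prod.smul_snd, LinearMap.smul_apply, hδ.2.1, smul_add,
        smul_assoc, smul_comm x t]
    · obtain ⟨j, hj⟩ := hδ.2.2.1 i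
      exact ⟨j, fun x hx => Submodule.smul_mem _ t (hj x hx)⟩
    · obtain ⟨j, hj⟩ := hδ.2.2.2 i
      exact ⟨j, fun x hx => Submodule.smul_mem _ t (hj x hx)⟩
  lie_mem' {δ ε} hδ hε := by
    refine ⟨fun x y => ?_, fun x m => ?_, ?_, ?_⟩
    · simp only [LieRing.of_associative_ring_bracket, Prod.fst_sub,
        Prod.fst_mul, LinearMap.sub_apply, Module.End.mul_apply, hδ.1, hε.1, map_add]
      noncomm_ring
    · simp only [LieRing.of_associative_ring_bracket, Prod.fst_sub, Prod.snd_sub,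
        Prod.fst_mul, Prod.snd_mul, LinearMap.sub_apply, Module.End.mul_apply, hδ.2.1, hε.2.1, map_add, sub_smul, smul_sub]
      abel
    · exact (hδ.2.2.1.comp hε.2.2.1).sub (hε.2.2.1.comp hδ.2.2.1)
    · exact (hδ.2.2.2.comp hε.2.2.2).sub (hε.2.2.2.comp hδ.2.2.2)

end Lagrangian

/-! ### The symplectic group and its action -/

section Sp

variable (ω)

/-- The symplectic group `Sp(V)`. -/
def Sp : Subgroup (V ≃ₗ[k] V) where
  carrier := {g | ∀ v w, ω.form (g v) (g w) = ω.form v w}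
  mul_mem' {f g} hf hg v w := (hf (g v) (g w)).trans (hg v w)
  one_mem' _ _ := rfl
  inv_mem' {f} hf v w := by
    have := hf (f⁻¹ v) (f⁻¹ w)
    rw [show f (f⁻¹ v) = v from f.apply_symm_apply v,
      show f (f⁻¹ w) = w from f.apply_symm_apply w] at this
    exact this.symm

variable {ω}

/-- The automorphism of the Heisenberg algebra given by an element of `Sp(V)`. -/
def heisMap (s : Sp ω) : Heisenberg ω →ₗ⁅k⁆ Heisenberg ω where
  toFun a := Heisenberg.mk ω (s.1 (Heisenberg.vec a)) (Heisenberg.scal a)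
  map_add' a b := Heisenberg.ext_iff'.2 (by simp)
  map_smul' t a := Heisenberg.ext_iff'.2 (by simp)
  map_lie' {a b} := Heisenberg.ext_iff'.2 (by
    simp only [Heisenberg.bracket_def, Heisenberg.vec_mk, Heisenberg.scal_mk, map_zero, true_and]
    exact (s.2 _ _).symm)

/-- The action of `Sp(V)` on `D`. -/
def thetaD : Sp ω →* (HWeyl ω →ₐ[k] HWeyl ω) where
  toFun s := UniversalEnvelopingAlgebra.lift k ((UniversalEnvelopingAlgebra.ι k).comp (heisMap s))
  map_one' := by
    ext a
    simp only [LieHom.comp_apply, AlgHom.coe_toLieHom, UniversalEnvelopingAlgebra.lift_ι_apply]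
    rfl
  map_mul' s t := by
    ext a
    change UniversalEnvelopingAlgebra.lift k _ (UniversalEnvelopingAlgebra.ι k a) =
      UniversalEnvelopingAlgebra.lift k _ (UniversalEnvelopingAlgebra.lift k _
        (UniversalEnvelopingAlgebra.ι k a))
    rw [UniversalEnvelopingAlgebra.lift_ι_apply, UniversalEnvelopingAlgebra.lift_ι_apply,
      LieHom.comp_apply, LieHom.comp_apply, UniversalEnvelopingAlgebra.lift_ι_apply]
    rfl

theorem thetaD_ι (s : Sp ω) (a : Heisenberg ω) :
    thetaD s (UniversalEnvelopingAlgebra.ι k a) =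
      UniversalEnvelopingAlgebra.ι k (heisMap s a) :=
  UniversalEnvelopingAlgebra.lift_ι_apply k _ a

theorem thetaD_incl (s : Sp ω) (v : V) : thetaD s (incl ω v) = incl ω (s.1 v) :=
  thetaD_ι s _

theorem thetaD_hbar (s : Sp ω) : thetaD s (hbarD ω) = hbarD ω :=
  (thetaD_ι s _).trans (congrArg _ (Heisenberg.ext_iff'.2 (by simp [heisMap])))

theorem thetaD_mem (s : Sp ω) {i : ℕ} {a : HWeyl ω} (ha : a ∈ gr ω i) : thetaD s a ∈ gr ω i := by
  induction ha using Submodule.span_induction with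
  | mem x hx =>
    refine Submodule.subset_span ?_
    induction hx with
    | one => rw [map_one]; exact .one
    | incl_mul v _ ih => rw [map_mul, thetaD_incl]; exact ih.incl_mul _
    | hbar_mul _ ih => rw [map_mul, thetaD_hbar]; exact ih.hbar_mul
  | zero => rw [map_zero]; exact zero_mem _
  | add x y _ _ hx hy => rw [map_add]; exact add_mem hx hy
  | smul t x _ hx => rw [map_smul]; exact Submodule.smul_mem _ _ hx

/-- The action of `Sp(V)` on `𝒟`. -/
def thetaF (s : Sp ω) (x : FWeyl ω) : FWeyl ω :=
  FWeyl.mk (fun i => thetaD s (FWeyl.comp i x)) fun i => thetaD_mem s (FWeyl.comp_mem x i)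

end Sp

/-! ### The prounipotent group `𝒢^{≥ 1}` and the group `𝒢` -/

section Groups

variable (ω)

/-- The Weyl algebra `D / (ħ - 1)`. -/
abbrev Weyl : Type (max u v) := RingQuot fun a b : HWeyl ω => a = hbarD ω ∧ b = 1

/-- The specialization `ħ = 1`. -/
def toWeyl : HWeyl ω →ₐ[k] Weyl ω := RingQuot.mkAlgHom k _

theorem toWeyl_hbar : toWeyl ω (hbarD ω) = 1 :=
  (RingQuot.mkAlgHom_rel k (s := fun a b : HWeyl ω => a = hbarD ω ∧ b = 1) ⟨rfl, rfl⟩).trans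
    (map_one _)

/-- The ambient complete algebra `W⟦t⟧`. As `D[ħ⁻¹]_d` is the part of `W` of the same parity as `d`,
this contains the degree completion of the nonnegative part of `D[ħ⁻¹]`, with `ħ` equal to `t²`. -/
abbrev WSer : Type (max u v) := (Weyl ω)⟦X⟧

variable {ω}

/-- The embedding of `𝒟` in `W⟦t⟧`: `v ∈ V` goes to `v t`, and `ħ` to `t²`. -/
def rho : FWeyl ω →+* WSer ω :=
  (PowerSeries.map (toWeyl ω).toRingHom).comp (FWeyl.toSeries (ω := ω)).toRingHom

/-- The element `(1/ħ) a` of `W⟦t⟧`, for `a ∈ 𝒟^{≥ 2}`. -/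
def overS (a : FWeyl ω) : WSer ω := PowerSeries.mk fun i => toWeyl ω (FWeyl.comp (i + 2) a)

/-- The exponential series `∑ aⁿ / n!`, for a series `a` without constant term. -/
def expS (a : WSer ω) : WSer ω :=
  PowerSeries.mk fun d => ∑ n ∈ Finset.range (d + 1),
    ((n.factorial : k)⁻¹) • PowerSeries.coeff d (a ^ n)

variable (ω)

/-- The exponentials of the elements of the pronilpotent Lie algebra
`𝔊^{≥ 1} = (1/ħ) 𝒟^{≥ 3}`. -/
def expSet : Set (WSer ω)ˣ :=
  {u | ∃ a ∈ FWeyl.filt ω 3, (u : WSer ω) = expS (overS a)}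

/-- The prounipotent group `𝒢^{≥ 1} = exp 𝔊^{≥ 1}`: the group formed by the exponentials of the
elements of `𝔊^{≥ 1}` in the complete algebra `W⟦t⟧`. -/
def G1 : Subgroup (WSer ω)ˣ := Subgroup.closure (expSet ω)

variable {ω}

/-- The endomorphism of the Weyl algebra given by an element of `Sp(V)`. -/
def thetaWHom (s : Sp ω) : Weyl ω →ₐ[k] Weyl ω :=
  RingQuot.liftAlgHom k ⟨(toWeyl ω).comp (thetaD s), by
    rintro _ _ ⟨rfl, rfl⟩
    rw [AlgHom.comp_apply, thetaD_hbar, toWeyl_hbar, map_one]⟩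

theorem thetaWHom_toWeyl (s : Sp ω) (x : HWeyl ω) :
    thetaWHom s (toWeyl ω x) = toWeyl ω (thetaD s x) :=
  RingQuot.liftAlgHom_mkAlgHom_apply k _ _ _

theorem weyl_hom_ext {f g : Weyl ω →ₐ[k] Weyl ω} (h : ∀ x, f (toWeyl ω x) = g (toWeyl ω x)) :
    f = g := RingQuot.ringQuot_ext' k _ _ (AlgHom.ext h)

/-- The action of `Sp(V)` on the Weyl algebra. -/
def thetaW : Sp ω →* (Weyl ω →ₐ[k] Weyl ω) where
  toFun := thetaWHom
  map_one' := weyl_hom_ext fun x => by rw [thetaWHom_toWeyl, map_one]; rfl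
  map_mul' s t := weyl_hom_ext fun x => by
    rw [thetaWHom_toWeyl, map_mul, AlgHom.mul_apply, AlgHom.mul_apply, thetaWHom_toWeyl,
      thetaWHom_toWeyl]

theorem thetaW_toWeyl (s : Sp ω) (x : HWeyl ω) :
    thetaW s (toWeyl ω x) = toWeyl ω (thetaD s x) := thetaWHom_toWeyl s x

/-- The action of `Sp(V)` on `W⟦t⟧`, coefficient by coefficient. -/
def thetaS : Sp ω →* RingAut (WSer ω) where
  toFun s :=
    { PowerSeries.map (thetaW s).toRingHom with
      invFun := PowerSeries.map (thetaW s⁻¹).toRingHom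
      left_inv := fun f => PowerSeries.ext fun d => by
        change thetaW s⁻¹ (thetaW s (PowerSeries.coeff d f)) = PowerSeries.coeff d f
        rw [← AlgHom.mul_apply, ← map_mul, inv_mul_cancel, map_one]; rfl
      right_inv := fun f => PowerSeries.ext fun d => by
        change thetaW s (thetaW s⁻¹ (PowerSeries.coeff d f)) = PowerSeries.coeff d f
        rw [← AlgHom.mul_apply, ← map_mul, mul_inv_cancel, map_one]; rfl }
  map_one' := by
    refine RingEquiv.ext fun f => PowerSeries.ext fun d => ?_
    change thetaW 1 (PowerSeries.coeff d f) = PowerSeries.coeff d f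
    rw [map_one]; rfl
  map_mul' s t := by
    refine RingEquiv.ext fun f => PowerSeries.ext fun d => ?_
    change thetaW (s * t) (PowerSeries.coeff d f) = thetaW s (thetaW t (PowerSeries.coeff d f))
    rw [map_mul]; rfl

theorem coeff_thetaS (s : Sp ω) (f : WSer ω) (d : ℕ) :
    PowerSeries.coeff d (thetaS s f) = thetaW s (PowerSeries.coeff d f) := rfl

theorem thetaS_expS (s : Sp ω) (a : WSer ω) : thetaS s (expS a) = expS (thetaS s a) := by
  refine PowerSeries.ext fun d => ?_
  simp only [coeff_thetaS, expS, PowerSeries.coeff_mk, map_sum, map_smul]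
  refine Finset.sum_congr rfl fun n _ => ?_
  rw [← coeff_thetaS, map_pow]

theorem thetaS_overS (s : Sp ω) (a : FWeyl ω) : thetaS s (overS a) = overS (thetaF s a) := by
  refine PowerSeries.ext fun d => ?_
  simp only [coeff_thetaS, overS, PowerSeries.coeff_mk, thetaW_toWeyl, thetaF, FWeyl.comp_mk]

theorem thetaS_mem (s : Sp ω) {u : (WSer ω)ˣ} (hu : u ∈ G1 ω) :
    Units.map (thetaS s : WSer ω →* WSer ω) u ∈ G1 ω := by
  have h : (G1 ω).map (Units.map (thetaS s : WSer ω →* WSer ω)) ≤ G1 ω := by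
    rw [G1, MonoidHom.map_closure]
    refine Subgroup.closure_mono ?_
    rintro _ ⟨u, ⟨a, ha, hu⟩, rfl⟩
    refine ⟨thetaF s a, fun i hi => ?_, ?_⟩
    · rw [thetaF, FWeyl.comp_mk, ha i hi, map_zero]
    · change thetaS s (u : WSer ω) = _
      rw [hu, thetaS_expS, thetaS_overS]
  exact h ⟨u, hu, rfl⟩

/-- The action of `Sp(V)` on `𝒢^{≥ 1}`. -/
def spAct : Sp ω →* MulAut (G1 ω) where
  toFun s :=
    { toFun := fun u => ⟨Units.map (thetaS s : WSer ω →* WSer ω) u.1, thetaS_mem s u.2⟩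
      invFun := fun u => ⟨Units.map (thetaS s⁻¹ : WSer ω →* WSer ω) u.1, thetaS_mem s⁻¹ u.2⟩
      left_inv := fun u => Subtype.ext (Units.ext (by
        change thetaS s⁻¹ (thetaS s (u.1 : WSer ω)) = _
        rw [← RingAut.mul_apply, ← map_mul, inv_mul_cancel, map_one]; rfl))
      right_inv := fun u => Subtype.ext (Units.ext (by
        change thetaS s (thetaS s⁻¹ (u.1 : WSer ω)) = _
        rw [← RingAut.mul_apply, ← map_mul, mul_inv_cancel, map_one]; rfl))
      map_mul' := fun u v => Subtype.ext (map_mul _ _ _) }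
  map_one' := by
    refine MulEquiv.ext fun u => Subtype.ext (Units.ext ?_)
    change thetaS 1 (u.1 : WSer ω) = _
    rw [map_one]; rfl
  map_mul' s t := by
    refine MulEquiv.ext fun u => Subtype.ext (Units.ext ?_)
    change thetaS (s * t) (u.1 : WSer ω) = thetaS s (thetaS t (u.1 : WSer ω))
    rw [map_mul]; rfl

variable (ω)

/-- The group `𝒢 = k^× × (𝒢^{≥ 1} ⋊ Sp(V))`. -/
abbrev 𝒢 : Type (max u v) := kˣ × (G1 ω ⋊[spAct] Sp ω)

variable {ω}

/-- Conjugation by a unit. -/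
def conjS : (WSer ω)ˣ →* RingAut (WSer ω) where
  toFun u :=
    { toFun := fun x => u * x * (u⁻¹ : (WSer ω)ˣ)
      invFun := fun x => (u⁻¹ : (WSer ω)ˣ) * x * u
      left_inv := fun x => by simp [mul_assoc]
      right_inv := fun x => by simp [mul_assoc]
      map_mul' := fun x y => by simp [mul_assoc]
      map_add' := fun x y => by simp [mul_add, add_mul] }
  map_one' := RingEquiv.ext fun x => by
    change ((1 : (WSer ω)ˣ) : WSer ω) * x * ((1⁻¹ : (WSer ω)ˣ) : WSer ω) = x
    simp
  map_mul' u v := RingEquiv.ext fun x => by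
    change ((u * v : (WSer ω)ˣ) : WSer ω) * x * (((u * v)⁻¹ : (WSer ω)ˣ) : WSer ω) =
      u * (v * x * (v⁻¹ : (WSer ω)ˣ)) * (u⁻¹ : (WSer ω)ˣ)
    simp [mul_assoc]

theorem conjS_apply (u : (WSer ω)ˣ) (x : WSer ω) : conjS u x = u * x * (u⁻¹ : (WSer ω)ˣ) := rfl

/-- The action of `𝒢` on `W⟦t⟧`: the factor `k^×` acts trivially, `Sp(V)` acts naturally and
`𝒢^{≥ 1}` by conjugation. As `exp(a) x exp(-a) = exp(ad a)(x)`, its restriction to `𝒟` is the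
homomorphism `Φ_𝒟 : 𝒢 → Aut(𝒟)`. -/
def adj : 𝒢 ω →* RingAut (WSer ω) :=
  (SemidirectProduct.lift (conjS.comp (G1 ω).subtype) thetaS fun s => by
    refine MonoidHom.ext fun u => RingEquiv.ext fun x => ?_
    change thetaS s (u.1 : WSer ω) * x *
        (((Units.map (thetaS s : WSer ω →* WSer ω) u.1)⁻¹ : (WSer ω)ˣ) : WSer ω) =
      thetaS s (u.1 * ((thetaS s)⁻¹ x) * ((u.1)⁻¹ : (WSer ω)ˣ))
    rw [map_mul, map_mul, ← map_inv, show thetaS s ((thetaS s)⁻¹ x) = x from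
      (thetaS s).apply_symm_apply x]
    rfl).comp (MonoidHom.snd _ _)

theorem adj_apply (g : 𝒢 ω) (x : WSer ω) :
    adj g x = ((g.2.left : (WSer ω)ˣ) : WSer ω) * thetaS g.2.right x *
      (((g.2.left : (WSer ω)ˣ)⁻¹ : (WSer ω)ˣ) : WSer ω) := rfl

end Groups

/-! ### The pairs `⟨𝒢_𝒥, 𝔊_𝒥⟩` and `⟨K^×, K⟩` -/

section Pairs

variable (ω) (𝔵 : Submodule k V)

/-- The preimage `𝒢_𝒥` of `Aut(𝒟)_𝒥` in `𝒢`. -/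
def GJ : Subgroup (𝒢 ω) where
  carrier := {g | adj g '' (rho '' (JIdeal ω 𝔵 : Set (FWeyl ω))) =
    rho '' (JIdeal ω 𝔵 : Set (FWeyl ω))}
  mul_mem' {g h} hg hh := by
    change adj (g * h) '' _ = _
    rw [map_mul, show ⇑(adj g * adj h) = adj g ∘ adj h from rfl, Set.image_comp,
      show adj h '' _ = _ from hh]
    exact hg
  one_mem' := by
    change adj 1 '' _ = _
    rw [map_one, show ⇑(1 : RingAut (WSer ω)) = id from rfl, Set.image_id]
  inv_mem' {g} hg := by
    change adj g⁻¹ '' _ = _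
    conv_lhs => rw [← show adj g '' _ = _ from hg]
    rw [← Set.image_comp, show adj g⁻¹ ∘ adj g = ⇑(adj g⁻¹ * adj g) from rfl, ← map_mul,
      inv_mul_cancel, map_one, show ⇑(1 : RingAut (WSer ω)) = id from rfl, Set.image_id]

/-- The Lie algebra `𝔊_𝒥`: the preimage of `Der(𝒟)_𝒥` under the map `φ_𝒟 : 𝔊 → Der(𝒟)` that sends
the class of `a ∈ (1/ħ) 𝒟` to the derivation `x ↦ [a, x]`. -/
def 𝔊J : LieSubalgebra k (𝔊 ω) where
  carrier := {a | ∃ u : FWeyl ω, cls u = a ∧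
    ∀ x ∈ JIdeal ω 𝔵, ∃ y ∈ JIdeal ω 𝔵, ⁅overHbar u, toLoc x⁆ = toLoc y}
  add_mem' := by
    rintro _ _ ⟨u, rfl, hu⟩ ⟨u', rfl, hu'⟩
    refine ⟨u + u', map_add _ _ _, fun x hx => ?_⟩
    obtain ⟨y, hy, h⟩ := hu x hx
    obtain ⟨y', hy', h'⟩ := hu' x hx
    exact ⟨y + y', add_mem hy hy', by rw [map_add, add_lie, h, h', map_add]⟩
  zero_mem' := ⟨0, map_zero _, fun x _ => ⟨0, zero_mem _, by rw [map_zero, zero_lie, map_zero]⟩⟩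
  smul_mem' := by
    rintro t _ ⟨u, rfl, hu⟩
    refine ⟨t • u, map_smul _ _ _, fun x hx => ?_⟩
    obtain ⟨y, hy, h⟩ := hu x hx
    refine ⟨t • y, ?_, ?_⟩
    · rw [Algebra.smul_def]; exact Ideal.mul_mem_left _ _ hy
    · rw [show overHbar (t • u) = t • overHbar u from
          map_smul ((overHbar (ω := ω)).restrictScalars k) t u, smul_lie, h]
      exact (map_smul ((toLoc (ω := ω)).toLinearMap.restrictScalars k) t y).symm
  lie_mem' := by
    rintro _ _ ⟨u, rfl, hu⟩ ⟨u', rfl, hu'⟩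
    obtain ⟨w, hw⟩ := FWeyl.exists_comm_eq u u'
    refine ⟨w, (lie_cls hw).symm, fun x hx => ?_⟩
    obtain ⟨y, hy, h⟩ := hu x hx
    obtain ⟨y', hy', h'⟩ := hu' x hx
    obtain ⟨z, hz, e⟩ := hu y' hy'
    obtain ⟨z', hz', e'⟩ := hu' y hy
    exact ⟨z - z', sub_mem hz hz', by
      rw [← lie_overHbar hw, lie_lie, h, h', e, e', map_sub]⟩

variable {ω 𝔵}

theorem FWeyl.mul_mem_filt (a : FWeyl ω) {j : ℕ} {x : FWeyl ω} (hx : x ∈ FWeyl.filt ω j) :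
    a * x ∈ FWeyl.filt ω j := fun i hi => by
  rw [FWeyl.comp_mul]
  refine Finset.sum_eq_zero fun p hp => ?_
  rw [Finset.HasAntidiagonal.mem_antidiagonal] at hp
  rw [hx p.2 (by omega), mul_zero]

theorem smul_mem_filtMod (c : k⟦X⟧) {j : ℕ} {m : FMod ω 𝔵} (hm : m ∈ filtMod ω 𝔵 j) :
    c • m ∈ filtMod ω 𝔵 j := by
  obtain ⟨x, hx, rfl⟩ := hm
  exact ⟨c • x, by rw [Algebra.smul_def]; exact FWeyl.mul_mem_filt _ hx, rfl⟩

variable (ω 𝔵)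

/-- The embedding `ε_Aut : K^× → Aut(𝒟, 𝓜)`, `c ↦ (id, c · id)`. -/
def epsAut : k⟦X⟧ˣ →* AutDM ω 𝔵 where
  toFun c := ⟨(1, LinearEquiv.smulOfUnit c), fun u m => by
      change (c : k⟦X⟧) • (u • m) = u • ((c : k⟦X⟧) • m)
      exact smul_comm _ _ _,
    fun i => ⟨i, fun _ hx => smul_mem_filtMod _ hx⟩,
    fun i => ⟨i, fun _ hx => smul_mem_filtMod _ hx⟩⟩
  map_one' := Subtype.ext (Prod.ext rfl (LinearEquiv.ext fun m => one_smul k⟦X⟧ m))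
  map_mul' c d := Subtype.ext (Prod.ext rfl (LinearEquiv.ext fun m => mul_smul c d m))

/-- The embedding `ε_Der : K → Der(𝒟, 𝓜)`, `a ↦ (0, a · id)`; the Lie algebra `K` is abelian. -/
def epsDer : k⟦X⟧ →ₗ⁅k⁆ DerDM ω 𝔵 where
  toFun c := ⟨(0, c • LinearMap.id), fun x y => by simp,
    fun x m => by
      change c • (x • m) = (0 : FWeyl ω) • m + x • (c • m)
      rw [zero_smul, zero_add, smul_comm],
    fun i => ⟨i, fun _ _ => zero_mem _⟩, fun i => ⟨i, fun _ hx => smul_mem_filtMod _ hx⟩⟩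
  map_add' c d := Subtype.ext (Prod.ext (add_zero _).symm (add_smul _ _ _))
  map_smul' t c := Subtype.ext (Prod.ext (smul_zero _).symm (smul_assoc _ _ _))
  map_lie' {c d} := Subtype.ext (by
    rw [LieRing.of_associative_ring_bracket, mul_comm, sub_self]
    refine Prod.ext ?_ (LinearMap.ext fun m => ?_)
    · simp [LieRing.of_associative_ring_bracket]
    · simp [LieRing.of_associative_ring_bracket, smul_comm c d m])

theorem smul_hbar_comm (c : k⟦X⟧) (x : FWeyl ω) :
    (c • FWeyl.hbar ω) * x - x * (c • FWeyl.hbar ω) = FWeyl.hbar ω * 0 := by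
  rw [smul_mul_assoc, mul_smul_comm, FWeyl.hbar, Algebra.commutes, sub_self, mul_zero]

/-- The embedding `K → 𝔊_𝒥` that sends `c` to the class of `c = (1/ħ) (ħ c)`. -/
def embK : k⟦X⟧ →ₗ⁅k⁆ 𝔊J ω 𝔵 where
  toFun c := ⟨cls (c • FWeyl.hbar ω), _, rfl, fun x _ =>
    ⟨0, zero_mem _, lie_overHbar_toLoc (smul_hbar_comm ω c x)⟩⟩
  map_add' c d := Subtype.ext (by simp [add_smul])
  map_smul' t c := Subtype.ext (by
    change cls _ = t • cls _
    rw [← map_smul, smul_assoc])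
  map_lie' {c d} := Subtype.ext (by
    change cls _ = ⁅cls _, cls _⁆
    rw [lie_cls (smul_hbar_comm ω c _), LieRing.of_associative_ring_bracket, mul_comm, sub_self,
      zero_smul])

end Pairs

/-! ### Proalgebraic groups

A proalgebraic group over the infinite field `k` whose `k`-points are dense is described by its
group `G` of `k`-points together with its coordinate ring, a subalgebra `O` of the algebra of all
functions `G → k`.  All groups below are of this kind.  If `z` is a central element of order two of
`G`, the coordinate ring of the quotient group `G / {1, z}` is the ring of those regular functions
that are invariant under translation by `z`; so the `k`-points of the quotient group need not come
from `k`-points of `G`. -/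

section Proalgebraic

/-- The ring of `z`-invariant elements of `O`, that is, the coordinate ring of `G / {1, z}`. -/
def invariants {G : Type*} [Group G] (O : Subalgebra k (G → k)) (z : G) :
    Subalgebra k (G → k) where
  carrier := {f | f ∈ O ∧ ∀ g, f (z * g) = f g}
  mul_mem' {f f'} hf hf' := ⟨mul_mem hf.1 hf'.1, fun g => by
    rw [Pi.mul_apply, Pi.mul_apply, hf.2, hf'.2]⟩
  add_mem' {f f'} hf hf' := ⟨add_mem hf.1 hf'.1, fun g => by
    rw [Pi.add_apply, Pi.add_apply, hf.2, hf'.2]⟩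
  algebraMap_mem' t := ⟨O.algebraMap_mem t, fun _ => rfl⟩

theorem invariants_le {G : Type*} [Group G] (O : Subalgebra k (G → k)) (z : G) :
    invariants O z ≤ O := fun _ hf => hf.1

/-- An isomorphism from the proalgebraic group with coordinate ring `A` to the one with coordinate
ring `B`: an isomorphism `B ≅ A` of algebras that is compatible with the comultiplications
(and hence with the counits and the antipodes).  Here `A` and `B` are rings of functions on the
groups `G` and `H`, and the comultiplication of `f` is `∑ fᵢ ⊗ fᵢ'` when
`f (h h') = ∑ fᵢ(h) fᵢ'(h')`. -/
structure ProalgIso {G H : Type*} [Group G] [Group H] (A : Subalgebra k (G → k))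
    (B : Subalgebra k (H → k)) where
  /-- The comorphism. -/
  pull : B ≃ₐ[k] A
  comul : ∀ f : B, ∃ (r : ℕ) (f₁ f₂ : Fin r → B),
    (∀ h h' : H, f.1 (h * h') = ∑ i, (f₁ i).1 h * (f₂ i).1 h') ∧
    ∀ g g' : G, (pull f).1 (g * g') = ∑ i, (pull (f₁ i)).1 g * (pull (f₂ i)).1 g'

/-- A tangent vector at the identity: a derivation `O → k` at the point `1`. -/
def IsTangent {G : Type*} [Group G] (O : Subalgebra k (G → k)) (T : O →ₗ[k] k) : Prop :=
  ∀ f f' : O, T (f * f') = f.1 1 * T f' + f'.1 1 * T f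

variable (ω) (𝔵 : Submodule k V)

/-- The continuous linear functionals on `𝒟`. -/
def IsContFunD (l : FWeyl ω →ₗ[k] k) : Prop := ∃ j, ∀ x ∈ FWeyl.filt ω j, l x = 0

/-- The continuous linear functionals on `𝓜`. -/
def IsContFunM (l : FMod ω 𝔵 →ₗ[k] k) : Prop := ∃ j, ∀ x ∈ filtMod ω 𝔵 j, l x = 0

/-- The coordinate ring of `K^×`. -/
def OK (k : Type u) [Field k] : Subalgebra k (k⟦X⟧ˣ → k) :=
  Algebra.adjoin k ({f | ∃ i, f = fun c : k⟦X⟧ˣ => PowerSeries.coeff i (c : k⟦X⟧)} ∪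
    {f | f = fun c : k⟦X⟧ˣ => PowerSeries.constantCoeff ((c⁻¹ : k⟦X⟧ˣ) : k⟦X⟧)})

/-- The coordinate ring of `Aut(𝒟)_𝒥`, generated by the matrix coefficients of an automorphism and
of its inverse. -/
def OAutJ : Subalgebra k (AutJ ω 𝔵 → k) :=
  Algebra.adjoin k {f | ∃ (l : FWeyl ω →ₗ[k] k) (x : FWeyl ω), IsContFunD ω l ∧
    ((f = fun h => l (h.1 x)) ∨ f = fun h => l (h.1.symm x))}

/-- The coordinate ring of `Aut(𝒟, 𝓜)`, generated by the matrix coefficients of an automorphism and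
of its inverse. -/
def OAutDM : Subalgebra k (AutDM ω 𝔵 → k) :=
  Algebra.adjoin k ({f | ∃ (l : FWeyl ω →ₗ[k] k) (x : FWeyl ω), IsContFunD ω l ∧
      ((f = fun h => l (h.1.1 x)) ∨ f = fun h => l (h.1.1.symm x))} ∪
    {f | ∃ (l : FMod ω 𝔵 →ₗ[k] k) (m : FMod ω 𝔵), IsContFunM ω 𝔵 l ∧
      ((f = fun h => l (h.1.2 m)) ∨ f = fun h => l (h.1.2.symm m))})

/-- The coordinate ring of the closed subgroup `𝒢_𝒥` of `𝒢 = k^× × (𝒢^{≥ 1} ⋊ Sp(V))`: the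
restrictions of the polynomials in the coordinates of `k^×`, of `Sp(V)` and of `𝒢^{≥ 1}`.  The
functions `u ↦ l (coeff_d u)` on `𝒢^{≥ 1}` generate the same ring as the coordinates of the
logarithm `log u ∈ 𝔊^{≥ 1}`. -/
def OGJ : Subalgebra k (GJ ω 𝔵 → k) :=
  Algebra.adjoin k (
    {f | (f = fun g => (g.1.1 : k)) ∨ f = fun g => ((g.1.1⁻¹ : kˣ) : k)} ∪
    {f | ∃ (l : V →ₗ[k] k) (v : V), f = fun g => l (g.1.2.right.1 v)} ∪
    {f | ∃ (l : Weyl ω →ₗ[k] k) (d : ℕ),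
      f = fun g => l (PowerSeries.coeff d ((g.1.2.left : (WSer ω)ˣ) : WSer ω))})

/-- The element `-1` of the factor `k^×` of `𝒢`. -/
def negGJ : GJ ω 𝔵 := ⟨(-1, 1), by
  change adj (-1, 1) '' _ = _
  rw [show adj ((-1, 1) : 𝒢 ω) = 1 from (map_one adj : adj (1 : 𝒢 ω) = 1),
    show ⇑(1 : RingAut (WSer ω)) = id from rfl, Set.image_id]⟩

/-- The coordinate ring of `𝒢_𝒥 / {±1}`. -/
abbrev OGJpm : Subalgebra k (GJ ω 𝔵 → k) := invariants (OGJ ω 𝔵) (negGJ ω 𝔵)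

/-- The coordinate ring of `Aut(𝒟, 𝓜) / {±1}`. -/
abbrev OAutDMpm : Subalgebra k (AutDM ω 𝔵 → k) := invariants (OAutDM ω 𝔵) (epsAut ω 𝔵 (-1))

/-- The isomorphism `σ : sp(V) ≅ [𝔊^0, 𝔊^0] ⊂ (1/ħ) D^2`: the relation `σ(s) = (1/ħ) q`, which means
that `(1/ħ) q ∈ [𝔊^0, 𝔊^0]` and `[(1/ħ) q, v] = s v` for all `v ∈ V`. -/
def IsSigma (s : V →ₗ[k] V) (q : FWeyl ω) : Prop :=
  overHbar q ∈ Submodule.span k {a : Loc ω | ∃ (p p' : HWeyl ω) (hp : p ∈ gr ω 2)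
    (hp' : p' ∈ gr ω 2),
    a = ⁅(overHbar (FWeyl.homog p hp) : Loc ω), overHbar (FWeyl.homog p' hp')⁆} ∧
  ∀ v : V, ⁅overHbar q, toLoc (FWeyl.ofV v : FWeyl ω)⁆ = (toLoc (FWeyl.ofV (s v) : FWeyl ω) : Loc ω)

/-- The embedding `Lie 𝒢_𝒥 → 𝔊`, which comes from `Lie 𝒢 = k ⊕ sp(V) ⊕ 𝔊^{≥ 1} ≅ 𝔊^{≥ 0}`: the
relation that the tangent vector `T` goes to `a = c + σ(s) + (1/ħ) b`. -/
def LieGJ (T : OGJ ω 𝔵 →ₗ[k] k) (a : 𝔊J ω 𝔵) : Prop :=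
  ∃ (c : k) (s : V →ₗ[k] V) (q b : FWeyl ω), IsSigma ω s q ∧ b ∈ FWeyl.filt ω 3 ∧
    a.1 = cls (c • FWeyl.hbar ω + q + b) ∧
    (∀ f : OGJ ω 𝔵, (∀ g, f.1 g = (g.1.1 : k)) → T f = c) ∧
    (∀ (f : OGJ ω 𝔵) (l : V →ₗ[k] k) (v : V), (∀ g, f.1 g = l (g.1.2.right.1 v)) →
      T f = l (s v)) ∧
    ∀ (f : OGJ ω 𝔵) (l : Weyl ω →ₗ[k] k) (d : ℕ),
      (∀ g, f.1 g = l (PowerSeries.coeff d ((g.1.2.left : (WSer ω)ˣ) : WSer ω))) →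
      T f = l (PowerSeries.coeff d (overS b))

/-- The embedding `Lie Aut(𝒟, 𝓜) → Der(𝒟, 𝓜)`: the relation that the tangent vector `T` goes to
the derivation `δ`. -/
def LieAutDM (T : OAutDM ω 𝔵 →ₗ[k] k) (δ : DerDM ω 𝔵) : Prop :=
  (∀ (f : OAutDM ω 𝔵) (l : FWeyl ω →ₗ[k] k) (x : FWeyl ω), IsContFunD ω l →
    (∀ h, f.1 h = l (h.1.1 x)) → T f = l (δ.1.1 x)) ∧
  ∀ (f : OAutDM ω 𝔵) (l : FMod ω 𝔵 →ₗ[k] k) (m : FMod ω 𝔵), IsContFunM ω 𝔵 l →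
    (∀ h, f.1 h = l (h.1.2 m)) → T f = l (δ.1.2 m)

/-- The central extension `⟨K^×, K⟩ → ⟨𝒢_𝒥, 𝔊_𝒥⟩ → ⟨Aut(𝒟)_𝒥, Der(𝒟)_𝒥⟩`. The maps are determined
by the fields `inl_spec`, `Phi_spec` and `phi_spec`. -/
structure UpperRow where
  /-- The group extension given by the embedding of `K^×` and by `Φ_𝒟`. -/
  grp : GroupExtension k⟦X⟧ˣ (GJ ω 𝔵) (AutJ ω 𝔵)
  /-- The map `φ_𝒟`. -/
  phi : 𝔊J ω 𝔵 →ₗ⁅k⁆ DerJ ω 𝔵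
  /-- `K^× = k^× × (1 + ħ K)` is embedded in `k^× × 𝒢^{≥ 1}`. -/
  inl_spec : ∀ c : k⟦X⟧ˣ,
    ((grp.inl c).1.1 : k) = PowerSeries.constantCoeff (c : k⟦X⟧) ∧
    (grp.inl c).1.2.right = 1 ∧
    PowerSeries.constantCoeff (c : k⟦X⟧) •
      (((grp.inl c).1.2.left : (WSer ω)ˣ) : WSer ω) = rho (algebraMap _ _ (c : k⟦X⟧))
  Phi_spec : ∀ (g : GJ ω 𝔵) (x : FWeyl ω), rho ((grp.rightHom g).1 x) = adj g.1 (rho x)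
  phi_spec : ∀ (a : 𝔊J ω 𝔵) (u : FWeyl ω), cls u = a.1 → ∀ x : FWeyl ω,
    toLoc ((phi a).1 x) = ⁅overHbar u, toLoc x⁆
  /-- The group homomorphisms are morphisms of proalgebraic groups, the first one a closed
  embedding. -/
  inl_regular : ∀ f ∈ OGJ ω 𝔵, (fun c => f (grp.inl c)) ∈ OK k
  inl_closed : ∀ f ∈ OK k, ∃ f' ∈ OGJ ω 𝔵, f = fun c => f' (grp.inl c)
  Phi_regular : ∀ f ∈ OAutJ ω 𝔵, (fun g => f (grp.rightHom g)) ∈ OGJ ω 𝔵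
  grp_central : ∀ c, grp.inl c ∈ Subgroup.center (GJ ω 𝔵)
  lie_exact : LieAlgebra.IsExtension (embK ω 𝔵) phi
  lie_central : ∀ (c : k⟦X⟧) (a : 𝔊J ω 𝔵), ⁅embK ω 𝔵 c, a⁆ = (0 : 𝔊J ω 𝔵)

/-- The central extension `⟨K^×, K⟩ → ⟨Aut(𝒟, 𝓜), Der(𝒟, 𝓜)⟩ → ⟨Aut(𝒟)_𝒥, Der(𝒟)_𝒥⟩`. The maps are
determined by the fields `inl_spec`, `F_spec` and `f_spec`. -/
structure LowerRow where
  /-- The group extension given by `ε_Aut` and by the map `F_Aut` that forgets the action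
  on `𝓜`. -/
  grp : GroupExtension k⟦X⟧ˣ (AutDM ω 𝔵) (AutJ ω 𝔵)
  /-- The map `F_Der` that forgets the action on `𝓜`. -/
  f : DerDM ω 𝔵 →ₗ⁅k⁆ DerJ ω 𝔵
  inl_spec : grp.inl = epsAut ω 𝔵
  F_spec : ∀ h : AutDM ω 𝔵, (grp.rightHom h).1 = h.1.1
  f_spec : ∀ δ : DerDM ω 𝔵, (f δ).1 = δ.1.1
  /-- The group homomorphisms are morphisms of proalgebraic groups, the first one a closed
  embedding. -/
  inl_regular : ∀ f ∈ OAutDM ω 𝔵, (fun c => f (grp.inl c)) ∈ OK k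
  inl_closed : ∀ f ∈ OK k, ∃ f' ∈ OAutDM ω 𝔵, f = fun c => f' (grp.inl c)
  F_regular : ∀ f ∈ OAutJ ω 𝔵, (fun h => f (grp.rightHom h)) ∈ OAutDM ω 𝔵
  grp_central : ∀ c, grp.inl c ∈ Subgroup.center (AutDM ω 𝔵)
  lie_exact : LieAlgebra.IsExtension (epsDer ω 𝔵) f
  lie_central : ∀ (c : k⟦X⟧) (δ : DerDM ω 𝔵), ⁅epsDer ω 𝔵 c, δ⁆ = (0 : DerDM ω 𝔵)

variable {ω 𝔵}

/-- The Lie algebra isomorphism `φ` is `φ_{𝒟,𝓜}`: its components on `(1/ħ) u`, for `u ∈ 𝒥`, are the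
commutator with `(1/ħ) u` and the action of `(1/ħ) u` on `𝓜`. -/
def IsPhiDM (φ : 𝔊J ω 𝔵 ≃ₗ⁅k⁆ DerDM ω 𝔵) : Prop :=
  ∀ a : 𝔊J ω 𝔵, ∃ u ∈ JIdeal ω 𝔵, cls u = a.1 ∧
    (∀ x : FWeyl ω, toLoc ((φ a).1.1 x) = ⁅overHbar u, toLoc x⁆) ∧
    ∀ m : FMod ω 𝔵, FWeyl.hbar ω • (φ a).1.2 m = u • m

/-- The differential of `Φ : 𝒢_𝒥/{±1} ≅ Aut(𝒟, 𝓜)/{±1}` is the restriction of `φ` to `Lie 𝒢_𝒥`.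
Here a tangent vector of `G/{±1}` is the same as one of `G`. -/
def DifferentialEq (Φ : ProalgIso (OGJpm ω 𝔵) (OAutDMpm ω 𝔵)) (φ : 𝔊J ω 𝔵 ≃ₗ⁅k⁆ DerDM ω 𝔵) :
    Prop :=
  ∀ T : OGJ ω 𝔵 →ₗ[k] k, IsTangent (OGJ ω 𝔵) T →
    (∃ a, LieGJ ω 𝔵 T a) ∧
    ∀ a, LieGJ ω 𝔵 T a → ∃ T' : OAutDM ω 𝔵 →ₗ[k] k, IsTangent (OAutDM ω 𝔵) T' ∧
      LieAutDM ω 𝔵 T' (φ a) ∧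
      ∀ f : OAutDMpm ω 𝔵, T' ⟨f.1, f.2.1⟩ = T ⟨(Φ.pull f).1, (Φ.pull f).2.1⟩

/-- `φ` is equivariant with respect to `Φ`: one has `φ(Ad(g) a) = Φ(g) φ(a) Φ(g)⁻¹`. Here
`g ∈ 𝒢_𝒥` acts on `𝔊` by `Ad(g) ((1/ħ) u) = (1/ħ) Φ_𝒟(g)(u)`, and the equation is expressed through
the coordinates of its two sides, those of the right-hand side being regular functions of
`h ∈ Aut(𝒟, 𝓜)/{±1}` evaluated at `h = Φ(g)`. -/
def Equivariant (U : UpperRow ω 𝔵) (Φ : ProalgIso (OGJpm ω 𝔵) (OAutDMpm ω 𝔵))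
    (φ : 𝔊J ω 𝔵 ≃ₗ⁅k⁆ DerDM ω 𝔵) : Prop :=
  ∀ (g : GJ ω 𝔵) (a : 𝔊J ω 𝔵) (u : FWeyl ω), cls u = a.1 →
    ∃ a' : 𝔊J ω 𝔵, a'.1 = cls ((U.grp.rightHom g).1 u) ∧
      (∀ (l : FWeyl ω →ₗ[k] k) (x : FWeyl ω), IsContFunD ω l → ∃ f : OAutDMpm ω 𝔵,
        (∀ h : AutDM ω 𝔵, f.1 h = l (h.1.1 ((φ a).1.1 (h.1.1.symm x)))) ∧
        (Φ.pull f).1 g = l ((φ a').1.1 x)) ∧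
      ∀ (l : FMod ω 𝔵 →ₗ[k] k) (m : FMod ω 𝔵), IsContFunM ω 𝔵 l → ∃ f : OAutDMpm ω 𝔵,
        (∀ h : AutDM ω 𝔵, f.1 h = l (h.1.2 ((φ a).1.2 (h.1.2.symm m)))) ∧
        (Φ.pull f).1 g = l ((φ a').1.2 m)

/-- On the subgroup `P ⊂ Sp(V)` of the elements that preserve `𝔵`, the isomorphism `Φ` is
`p ↦ ± r Θ_{𝒟,𝓜}(p)`, where `r² = det(p|_𝔵)⁻¹`. -/
def OnParabolic (Φ : ProalgIso (OGJpm ω 𝔵) (OAutDMpm ω 𝔵)) : Prop :=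
  ∀ (p : Sp ω) (hp : ∀ v ∈ 𝔵, (p.1 : V →ₗ[k] V) v ∈ 𝔵) (r : k),
    r ^ 2 * LinearMap.det ((p.1 : V →ₗ[k] V).restrict hp) = 1 →
    ∃ (g : GJ ω 𝔵) (h : AutDM ω 𝔵), g.1 = (1, SemidirectProduct.inr p) ∧
      (∀ x : FWeyl ω, h.1.1 x = thetaF p x) ∧
      (∀ x : FWeyl ω, h.1.2 (Submodule.Quotient.mk x) = r • Submodule.Quotient.mk (thetaF p x)) ∧
      ∀ f : OAutDMpm ω 𝔵, (Φ.pull f).1 g = f.1 h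

end Proalgebraic

end LabelExt

namespace LabelExt

/-! ### Polynomials with monomials of bounded degree and fixed parity -/

section Poly

open MvPolynomial

variable {k : Type*} [Field k] {σ : Type*}

/-- The polynomials whose monomials have degree at most `d` and of the same parity as `d`. -/
def parityLE (k : Type*) [Field k] (σ : Type*) (d : ℕ) : Submodule k (MvPolynomial σ k) where
  carrier := {p | ∀ m, coeff m p ≠ 0 → ∃ j, m.degree + 2 * j = d}
  add_mem' {p q} hp hq m hm := by
    by_cases h : coeff m p = 0
    · refine hq m fun h' => hm ?_
      rw [coeff_add, h, h', add_zero]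
    · exact hp m h
  zero_mem' m hm := absurd (coeff_zero m) hm
  smul_mem' t p hp m hm := hp m fun h => hm (by rw [coeff_smul, h, smul_zero])

theorem parityLE_monomial {m : σ →₀ ℕ} {j d : ℕ} (h : m.degree + 2 * j = d) (c : k) :
    monomial m c ∈ parityLE k σ d := fun m' hm' => by
  classical
  rw [coeff_monomial] at hm'
  split_ifs at hm' with e
  · exact e ▸ ⟨j, h⟩
  · exact absurd rfl hm'

theorem eq_C_of_parityLE_zero {p : MvPolynomial σ k} (hp : p ∈ parityLE k σ 0) :
    p = C (coeff 0 p) := by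
  classical
  refine MvPolynomial.ext _ _ fun m => ?_
  rw [coeff_C]
  split_ifs with h
  · rw [h]
  · by_contra h'
    obtain ⟨j, hj⟩ := hp _ h'
    have : m.degree = 0 := by omega
    exact h ((Finsupp.degree_eq_zero_iff m).1 this).symm

theorem coeff_sum_X_mul_pderiv [Fintype σ] (p : MvPolynomial σ k) (m : σ →₀ ℕ) :
    coeff m (∑ i, X i * pderiv i p) = m.degree * coeff m p := by
  classical
  rw [coeff_sum, Finsupp.degree_eq_sum, Nat.cast_sum, Finset.sum_mul]
  refine Finset.sum_congr rfl fun i _ => ?_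
  rw [coeff_X_mul']
  split_ifs with h
  · rw [Finsupp.mem_support_iff] at h
    rw [coeff_pderiv,
      tsub_add_cancel_of_le (by rwa [Finsupp.single_le_iff, Nat.one_le_iff_ne_zero])]
    have : ((m - Finsupp.single i 1 : σ →₀ ℕ) i : k) + 1 = (m i : k) := by
      rw [← Nat.cast_succ]; congr 1; simp; omega
    rw [this, mul_comm]
  · rw [Finsupp.notMem_support_iff.1 h, Nat.cast_zero, zero_mul]

variable [CharZero k]

theorem coeff_eq_pderiv {p : MvPolynomial σ k} {m : σ →₀ ℕ} {i : σ} (h : m i ≠ 0) :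
    coeff m p = (m i : k)⁻¹ * coeff (m - Finsupp.single i 1) (pderiv i p) := by
  rw [coeff_pderiv, tsub_add_cancel_of_le (by rwa [Finsupp.single_le_iff, Nat.one_le_iff_ne_zero])]
  have : ((m - Finsupp.single i 1 : σ →₀ ℕ) i : k) + 1 = (m i : k) := by
    rw [← Nat.cast_succ]; congr 1; simp; omega
  rw [this, mul_comm, mul_assoc, mul_inv_cancel₀ (Nat.cast_ne_zero.2 h), mul_one]

/-- A polynomial without constant term is in the filtration when its partial derivatives are. -/
theorem parityLE_of_pderiv {d : ℕ} {p : MvPolynomial σ k} (h0 : coeff 0 p = 0)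
    (h : ∀ i, pderiv i p ∈ parityLE k σ d) : p ∈ parityLE k σ (d + 1) := fun m hm => by
  have hm0 : m ≠ 0 := by rintro rfl; exact hm h0
  obtain ⟨i, hi⟩ := Finsupp.ne_iff.1 hm0
  rw [coeff_eq_pderiv hi] at hm
  obtain ⟨j, hj⟩ := h i _ (right_ne_zero_of_mul hm)
  refine ⟨j, ?_⟩
  have e : m = (m - Finsupp.single i 1) + Finsupp.single i 1 := by
    rw [tsub_add_cancel_of_le]
    rwa [Finsupp.single_le_iff, Nat.one_le_iff_ne_zero]
  rw [e, map_add, Finsupp.degree_single]; omega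

theorem eq_C_of_pderiv_eq_zero {p : MvPolynomial σ k} (h : ∀ i, pderiv i p = 0) :
    p = C (coeff 0 p) := by
  classical
  refine MvPolynomial.ext _ _ fun m => ?_
  rw [coeff_C]
  split_ifs with hm
  · rw [hm]
  · obtain ⟨i, hi⟩ := Finsupp.ne_iff.1 (Ne.symm hm)
    rw [coeff_eq_pderiv hi, h, coeff_zero, mul_zero]

variable [Fintype σ]

/-- The Poincaré lemma for polynomial `1`-forms. -/
theorem exists_pderiv_eq (w : σ → MvPolynomial σ k)
    (hw : ∀ i j, pderiv i (w j) = pderiv j (w i)) :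
    ∃ u : MvPolynomial σ k, coeff 0 u = 0 ∧ ∀ i, pderiv i u = w i := by
  classical
  set p := ∑ i, X i * w i with hp
  let q : MvPolynomial σ k := ∑ m ∈ p.support, monomial m ((m.degree : k)⁻¹ * coeff m p)
  have hq : ∀ m, coeff m q = (m.degree : k)⁻¹ * coeff m p := fun m => by
    simp only [q, coeff_sum, coeff_monomial]
    rw [Finset.sum_ite_eq']
    split_ifs with h
    · rfl
    · rw [notMem_support_iff.1 h, mul_zero]
  refine ⟨q, by rw [hq]; simp, fun j => MvPolynomial.ext _ _ fun m => ?_⟩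
  have h1 : pderiv j p = w j + ∑ i, X i * pderiv i (w j) := by
    rw [hp, map_sum]
    simp only [pderiv_mul, pderiv_X, Finset.sum_add_distrib, hw]
    congr 1
    simp [Pi.single_apply]
  have h2 : coeff m (pderiv j p) = (m.degree + 1) * coeff m (w j) := by
    rw [h1, coeff_add, coeff_sum_X_mul_pderiv]; ring
  rw [coeff_pderiv, hq, mul_assoc, ← coeff_pderiv, h2, map_add, Finsupp.degree_single,
    Nat.cast_add, Nat.cast_one, inv_mul_cancel_left₀ (Nat.cast_add_one_ne_zero _)]

end Poly

/-! ### Darboux bases -/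

/-- A Darboux basis `y_i, x_i` (indexed by `inl i`, `inr i`) such that the `x_i` span `𝔵`. -/
structure Darboux {k V : Type*} [Field k] [AddCommGroup V] [Module k V] (ω : SymplecticForm k V)
    (𝔵 : Submodule k V) (ι : Type*) where
  basis : Module.Basis (ι ⊕ ι) k V
  form_inl : ∀ i j, ω.form (basis (Sum.inl i)) (basis (Sum.inl j)) = 0
  form_inr : ∀ i j, ω.form (basis (Sum.inr i)) (basis (Sum.inr j)) = 0
  form_inr_inl : ∀ i j, [DecidableEq ι] →
    ω.form (basis (Sum.inr i)) (basis (Sum.inl j)) = if i = j then 1 else 0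
  span_inr : Submodule.span k (Set.range fun i => basis (Sum.inr i)) = 𝔵

section Darboux

variable {k V : Type*} [Field k] [AddCommGroup V] [Module k V] {ω : SymplecticForm k V}
  {𝔵 : Submodule k V}

theorem form_neg (ω : SymplecticForm k V) (v w : V) : ω.form v w = - ω.form w v := by
  have h := ω.isAlt (v + w)
  simp only [map_add, LinearMap.add_apply, ω.isAlt, zero_add, add_zero] at h
  linear_combination h

theorem exists_darboux [CharZero k] [FiniteDimensional k V] (h𝔵 : IsLagrangian ω 𝔵) :
    Nonempty (Darboux ω 𝔵 (Fin (Module.finrank k 𝔵))) := by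
  classical
  obtain ⟨C, hC⟩ := Submodule.exists_isCompl 𝔵
  set n := Module.finrank k 𝔵
  let b : Module.Basis (Fin n) k 𝔵 := Module.finBasis k 𝔵
  have iso : ∀ x ∈ 𝔵, ∀ y ∈ 𝔵, ω.form x y = 0 := fun x hx => (h𝔵 x).1 hx
  -- the pairing of `𝔵` with the complement is perfect
  let f : C →ₗ[k] Module.Dual k 𝔵 :=
    (LinearMap.lcomp k k 𝔵.subtype).comp (ω.form.comp C.subtype)
  have hf : ∀ (c : C) (x : 𝔵), f c x = ω.form (c : V) (x : V) := fun c x => rfl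
  let f' : 𝔵 →ₗ[k] Module.Dual k C :=
    (LinearMap.lcomp k k C.subtype).comp (ω.form.comp 𝔵.subtype)
  have hf' : ∀ (c : C) (x : 𝔵), f' x c = ω.form (x : V) (c : V) := fun c x => rfl
  have finj : Function.Injective f := by
    rw [injective_iff_map_eq_zero]
    intro c hc
    have h1 : (c : V) ∈ 𝔵 := (h𝔵 c).2 fun w hw => by
      rw [← hf c ⟨w, hw⟩, hc, LinearMap.zero_apply]
    have : (c : V) ∈ (⊥ : Submodule k V) := by
      rw [← hC.inf_eq_bot]; exact ⟨h1, c.2⟩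
    exact Subtype.ext ((Submodule.mem_bot k).1 this)
  have finj' : Function.Injective f' := by
    rw [injective_iff_map_eq_zero]
    intro x hx
    refine Subtype.ext (ω.nondegenerate _ fun w => ?_)
    have hw : w ∈ 𝔵 ⊔ C := by rw [hC.sup_eq_top]; trivial
    obtain ⟨y, hy, c, hc, rfl⟩ := Submodule.mem_sup.1 hw
    rw [map_add, iso _ x.2 y hy, zero_add, ← hf' ⟨c, hc⟩ x, hx, LinearMap.zero_apply]
  have hdim : Module.finrank k C = Module.finrank k (Module.Dual k 𝔵) := by
    have h1 := LinearMap.finrank_le_finrank_of_injective finj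
    have h2 := LinearMap.finrank_le_finrank_of_injective finj'
    rw [Subspace.dual_finrank_eq] at h1 h2 ⊢
    exact le_antisymm h1 h2
  let e : C ≃ₗ[k] Module.Dual k 𝔵 := LinearEquiv.ofInjectiveOfFinrankEq f finj hdim
  have he : ∀ c, e c = f c := fun c => rfl
  let y' : Fin n → C := fun j => e.symm (-b.dualBasis j)
  have hy' : ∀ i j, ω.form (b i : V) (y' j : V) = if i = j then 1 else 0 := fun i j => by
    rw [form_neg, ← hf (y' j) (b i), ← he]
    simp only [y', LinearEquiv.apply_symm_apply, LinearMap.neg_apply, neg_neg]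
    rw [Module.Basis.dualBasis_apply_self]
  let a : Fin n → Fin n → k := fun i j => ω.form (y' i : V) (y' j : V)
  let y : Fin n → V := fun j => y' j + ∑ i, (2⁻¹ * a i j) • (b i : V)
  have hxy : ∀ i j, ω.form (b i : V) (y j) = if i = j then 1 else 0 := fun i j => by
    simp only [y, map_add, map_sum, map_smul, iso _ (b i).2 _ (b _).2, hy']
    simp
  have hyy : ∀ i j, ω.form (y i) (y j) = 0 := fun i j => by
    have h1 : ω.form (y i) (y j) = ω.form (y i) (y' j : V) +
        ∑ l, (2⁻¹ * a l j) * ω.form (y i) (b l : V) := by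
      simp only [y, map_add, map_sum, map_smul, smul_eq_mul]
    rw [h1]
    have h2 : ∀ l, ω.form (y i) (b l : V) = - if l = i then 1 else 0 := fun l => by
      rw [form_neg, hxy]
    simp only [h2]
    have h3 : ω.form (y i) (y' j : V) = a i j + 2⁻¹ * a j i := by
      simp only [y, map_add, map_sum, map_smul, LinearMap.add_apply, LinearMap.sum_apply,
        LinearMap.smul_apply, smul_eq_mul, hy']
      simp [a]
    rw [h3]
    have h4 : a j i = - a i j := form_neg ω _ _
    simp only [mul_neg, mul_ite, mul_one, mul_zero, Finset.sum_neg_distrib,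
      Finset.sum_ite_eq', Finset.mem_univ, if_true]
    rw [h4]
    have : (2 : k) ≠ 0 := two_ne_zero
    field_simp
    ring
  have hli : LinearIndependent k (Sum.elim y fun i => (b i : V)) := by
    rw [Fintype.linearIndependent_iff]
    intro g hg
    rw [Fintype.sum_sum_type] at hg
    simp only [Sum.elim_inl, Sum.elim_inr] at hg
    rintro (j | j)
    · have := congrArg (ω.form (b j : V)) hg
      simpa [map_add, map_sum, hxy, iso _ (b j).2 _ (b _).2] using this
    · have := congrArg (ω.form (y j)) hg
      simpa [map_add, map_sum, hyy, form_neg ω (y j), hxy] using this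
  have hspan : ⊤ ≤ Submodule.span k (Set.range (Sum.elim y fun i => (b i : V))) := by
    have hx : 𝔵 ≤ Submodule.span k (Set.range (Sum.elim y fun i => (b i : V))) := by
      intro x hx
      have := b.sum_repr ⟨x, hx⟩
      have h := congrArg (Subtype.val) this
      rw [← show _ = x from h]
      rw [Submodule.coe_sum]
      refine sum_mem fun i _ => ?_
      exact Submodule.smul_mem _ _ (Submodule.subset_span ⟨Sum.inr i, rfl⟩)
    rw [← hC.sup_eq_top]
    refine sup_le hx fun c hc => ?_
    have : (⟨c, hc⟩ : C) = ∑ j, (-(e ⟨c, hc⟩ (b j))) • y' j := by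
      apply e.injective
      rw [map_sum]
      refine (b.sum_dual_apply_smul_coord (e ⟨c, hc⟩)).symm.trans
        (Finset.sum_congr rfl fun j _ => ?_)
      rw [neg_smul, map_neg, map_smul, LinearEquiv.apply_symm_apply, smul_neg, neg_neg,
        Module.Basis.coe_dualBasis]
    have h := congrArg Subtype.val this
    rw [show c = _ from h, Submodule.coe_sum]
    refine sum_mem fun j _ => Submodule.smul_mem _ _ ?_
    have e1 : (y' j : V) = y j - ∑ i, (2⁻¹ * a i j) • (b i : V) := by simp [y]
    rw [e1]
    exact sub_mem (Submodule.subset_span ⟨Sum.inl j, rfl⟩)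
      (sum_mem fun i _ => Submodule.smul_mem _ _ (hx (b i).2))
  refine ⟨⟨Module.Basis.mk hli hspan, fun i j => ?_, fun i j => ?_, ?_, ?_⟩⟩
  · simp [hyy]
  · simp [iso _ (b i).2 _ (b j).2]
  · intro i j inst
    simp [hxy]
  · simp only [Module.Basis.mk_apply, Sum.elim_inr]
    have h := congrArg (Submodule.map 𝔵.subtype) b.span_eq
    rw [Submodule.map_top, Submodule.range_subtype, Submodule.map_span, ← Set.range_comp] at h
    exact h

end Darboux

/-! ### Normal ordering -/

section CommAeval

open MvPolynomial

variable {k A ι : Type*} [Field k] [Ring A] [Algebra k A]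

/-- Evaluation of polynomials at a commuting family of elements of a noncommutative algebra. -/
def commAeval (y : ι → A) (hy : ∀ i j, y i * y j = y j * y i) : MvPolynomial ι k →ₐ[k] A := by
  have hc : IsMulCommutative (Algebra.adjoin k (Set.range y)) :=
    Algebra.isMulCommutative_adjoin k (by rintro _ ⟨i, rfl⟩ _ ⟨j, rfl⟩; exact hy i j)
  let ac : CommSemiring (Algebra.adjoin k (Set.range y)) :=
    { Subalgebra.toSemiring (Algebra.adjoin k (Set.range y)) with
      mul_comm := fun a b => mul_comm' a b }
  let f : MvPolynomial ι k →ₐ[k] (Algebra.adjoin k (Set.range y)) :=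
    aeval (R := k) fun i => ⟨y i, Algebra.subset_adjoin ⟨i, rfl⟩⟩
  exact (Algebra.adjoin k (Set.range y)).val.comp f

@[simp] theorem commAeval_X (y : ι → A) (hy : ∀ i j, y i * y j = y j * y i) (i : ι) :
    commAeval (k := k) y hy (X i) = y i := by
  have hc : IsMulCommutative (Algebra.adjoin k (Set.range y)) :=
    Algebra.isMulCommutative_adjoin k (by rintro _ ⟨i, rfl⟩ _ ⟨j, rfl⟩; exact hy i j)
  let ac : CommSemiring (Algebra.adjoin k (Set.range y)) :=
    { Subalgebra.toSemiring (Algebra.adjoin k (Set.range y)) with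
      mul_comm := fun a b => mul_comm' a b }
  exact congrArg Subtype.val (aeval_X (R := k) (fun i => (⟨y i, Algebra.subset_adjoin ⟨i, rfl⟩⟩ :
    Algebra.adjoin k (Set.range y))) i)

@[simp] theorem commAeval_C (y : ι → A) (hy : ∀ i j, y i * y j = y j * y i) (t : k) :
    commAeval (k := k) y hy (C t) = algebraMap k A t :=
  (commAeval y hy).commutes t

end CommAeval

section PBW

open MvPolynomial

variable {k V ι : Type*} [Field k] [AddCommGroup V] [Module k V] {ω : SymplecticForm k V}
  {𝔵 : Submodule k V}

theorem ι_eq (a : Heisenberg ω) : UniversalEnvelopingAlgebra.ι k a =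
    incl ω (Heisenberg.vec a) + Heisenberg.scal a • hbarD ω := by
  rw [← ι_mk_zero]
  change _ = UniversalEnvelopingAlgebra.ι k _ + _
  rw [← map_add]
  congr 1
  exact Heisenberg.ext_iff'.2 (by simp)

/-- The induction principle for `D`: it is generated by `V` and `ħ`. -/
theorem hweyl_induction {p : HWeyl ω → Prop} (one : p 1)
    (incl_mul : ∀ v a, p a → p (incl ω v * a)) (hbar_mul : ∀ a, p a → p (hbarD ω * a))
    (add : ∀ a b, p a → p b → p (a + b)) (smul : ∀ (t : k) a, p a → p (t • a)) (a : HWeyl ω) :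
    p a := by
  obtain ⟨x, rfl⟩ : ∃ x, UniversalEnvelopingAlgebra.mkAlgHom k (Heisenberg ω) x = a :=
    Quotient.exists_rep a
  have hx : x ∈ Algebra.adjoin k (Set.range (TensorAlgebra.ι k (M := Heisenberg ω))) := by
    rw [TensorAlgebra.adjoin_range_ι]; trivial
  suffices h : ∀ b, p b → p (UniversalEnvelopingAlgebra.mkAlgHom k (Heisenberg ω) x * b) by
    simpa using h 1 one
  induction hx using Algebra.adjoin_induction with
  | mem x hx =>
    obtain ⟨a, rfl⟩ := hx
    intro b hb
    change p (UniversalEnvelopingAlgebra.ι k a * b)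
    rw [ι_eq, add_mul, smul_mul_assoc]
    exact add _ _ (incl_mul _ _ hb) (smul _ _ (hbar_mul _ hb))
  | algebraMap t =>
    intro b hb
    rw [AlgHom.commutes, ← Algebra.smul_def]
    exact smul _ _ hb
  | add x y _ _ hx hy =>
    intro b hb
    rw [map_add, add_mul]
    exact add _ _ (hx b hb) (hy b hb)
  | mul x y _ _ hx hy =>
    intro b hb
    rw [map_mul, mul_assoc]
    exact hx _ (hy b hb)

theorem hbarD_central (a : HWeyl ω) : hbarD ω * a = a * hbarD ω := by
  induction a using hweyl_induction with
  | one => simp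
  | incl_mul v a ih => rw [← mul_assoc, hbarD_comm_incl, mul_assoc, ih, mul_assoc]
  | hbar_mul a ih => rw [mul_assoc, ← ih]
  | add a b ha hb => rw [mul_add, add_mul, ha, hb]
  | smul t a ha => rw [mul_smul_comm, smul_mul_assoc, ha]

namespace Darboux

variable (B : Darboux ω 𝔵 ι)

theorem incl_comm_of_form {v w : V} (h : ω.form v w = 0) :
    incl ω v * incl ω w = incl ω w * incl ω v := by
  rw [← sub_eq_zero, incl_comm, h, zero_smul]

/-- Polynomials in the `y_i`. -/
def evalY : MvPolynomial ι k →ₐ[k] HWeyl ω :=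
  commAeval (fun i => incl ω (B.basis (Sum.inl i)))
    fun _ _ => incl_comm_of_form (B.form_inl _ _)

/-- Polynomials in the `x_i`. -/
def evalX : MvPolynomial ι k →ₐ[k] HWeyl ω :=
  commAeval (fun i => incl ω (B.basis (Sum.inr i)))
    fun _ _ => incl_comm_of_form (B.form_inr _ _)

theorem inr_mul_evalY [DecidableEq ι] (i : ι) (q : MvPolynomial ι k) :
    incl ω (B.basis (Sum.inr i)) * B.evalY q =
      B.evalY q * incl ω (B.basis (Sum.inr i)) + hbarD ω * B.evalY (pderiv i q) := by
  induction q using MvPolynomial.induction_on with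
  | C t => rw [evalY, commAeval_C, Algebra.commutes, pderiv_C, map_zero, mul_zero, add_zero]
  | add p q hp hq => simp only [map_add, mul_add, add_mul, hp, hq]; abel
  | mul_X p j hp =>
    have e : incl ω (B.basis (Sum.inr i)) * incl ω (B.basis (Sum.inl j)) =
        incl ω (B.basis (Sum.inl j)) * incl ω (B.basis (Sum.inr i)) +
          (if i = j then (1 : k) else 0) • hbarD ω := by
      rw [← B.form_inr_inl, ← incl_comm]; abel
    have hX : B.evalY (X j) = incl ω (B.basis (Sum.inl j)) := commAeval_X _ _ _
    rw [map_mul, ← mul_assoc, hp, add_mul, mul_assoc, hX, e, pderiv_mul, map_add, map_mul,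
      map_mul, hX, mul_add, mul_add, pderiv_X]
    by_cases h : i = j
    · subst h
      have h1 := hbarD_central (B.evalY p)
      have h2 : B.evalY (pderiv i p * X i) = B.evalY (pderiv i p) * incl ω (B.basis (Sum.inl i)) := by
        rw [map_mul, hX]
      rw [if_pos rfl, Pi.single_eq_same, map_one, mul_one, one_smul, h1]
      noncomm_ring
    · rw [if_neg h, Pi.single_eq_of_ne (Ne.symm h), map_zero]
      simp only [zero_smul, mul_zero]
      noncomm_ring

/-- The normally ordered monomial `y^α x^β`. -/
def normal (m : ι ⊕ ι →₀ ℕ) : HWeyl ω :=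
  B.evalY (monomial (Finsupp.sumFinsuppAddEquivProdFinsupp m).1 1) *
    B.evalX (monomial (Finsupp.sumFinsuppAddEquivProdFinsupp m).2 1)

theorem sumFinsupp_single_inl (i : ι) :
    Finsupp.sumFinsuppAddEquivProdFinsupp (Finsupp.single (Sum.inl i : ι ⊕ ι) 1) =
      (Finsupp.single i 1, (0 : ι →₀ ℕ)) := by
  classical
  refine Prod.ext (Finsupp.ext fun j => ?_) (Finsupp.ext fun j => ?_)
  · rw [Finsupp.fst_sumFinsuppAddEquivProdFinsupp, Finsupp.single_apply, Finsupp.single_apply]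
    simp
  · rw [Finsupp.snd_sumFinsuppAddEquivProdFinsupp, Finsupp.single_apply]
    simp

theorem sumFinsupp_single_inr (i : ι) :
    Finsupp.sumFinsuppAddEquivProdFinsupp (Finsupp.single (Sum.inr i : ι ⊕ ι) 1) =
      ((0 : ι →₀ ℕ), Finsupp.single i 1) := by
  classical
  refine Prod.ext (Finsupp.ext fun j => ?_) (Finsupp.ext fun j => ?_)
  · rw [Finsupp.fst_sumFinsuppAddEquivProdFinsupp, Finsupp.single_apply]
    simp
  · rw [Finsupp.snd_sumFinsuppAddEquivProdFinsupp, Finsupp.single_apply, Finsupp.single_apply]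
    simp

theorem inl_mul_normal (i : ι) (m : ι ⊕ ι →₀ ℕ) :
    incl ω (B.basis (Sum.inl i)) * B.normal m = B.normal (m + Finsupp.single (Sum.inl i) 1) := by
  have hX : B.evalY (X i) = incl ω (B.basis (Sum.inl i)) := commAeval_X _ _ _
  rw [normal, normal, ← mul_assoc, map_add, sumFinsupp_single_inl, ← hX, ← map_mul]
  simp only [Prod.fst_add, Prod.snd_add, add_zero]
  rw [X, monomial_mul, one_mul, add_comm]

theorem inr_mul_normal [DecidableEq ι] (i : ι) (m : ι ⊕ ι →₀ ℕ) :
    incl ω (B.basis (Sum.inr i)) * B.normal m = B.normal (m + Finsupp.single (Sum.inr i) 1) +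
      (m (Sum.inl i) : k) • (hbarD ω * B.normal (m - Finsupp.single (Sum.inl i) 1)) := by
  have hX : B.evalX (X i) = incl ω (B.basis (Sum.inr i)) := commAeval_X _ _ _
  rw [normal, ← mul_assoc, inr_mul_evalY, add_mul, mul_assoc]
  congr 1
  · rw [normal, map_add, sumFinsupp_single_inr, ← hX, ← map_mul]
    simp only [Prod.fst_add, Prod.snd_add, add_zero]
    rw [X, monomial_mul, one_mul, add_comm (Finsupp.single i 1)]
  · rw [pderiv_monomial, one_mul, Finsupp.fst_sumFinsuppAddEquivProdFinsupp]
    by_cases h : m (Sum.inl i) = 0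
    · simp [h]
    · have e : m = (m - Finsupp.single (Sum.inl i) 1) + Finsupp.single (Sum.inl i) 1 := by
        rw [tsub_add_cancel_of_le]
        rwa [Finsupp.single_le_iff, Nat.one_le_iff_ne_zero]
      set m' := m - Finsupp.single (Sum.inl i) 1 with hm'
      rw [normal]
      nth_rewrite 1 2 [e]
      rw [map_add, sumFinsupp_single_inl]
      simp only [Prod.fst_add, add_tsub_cancel_right]
      rw [← e]
      have e2 : (Finsupp.sumFinsuppAddEquivProdFinsupp m).2 =
          (Finsupp.sumFinsuppAddEquivProdFinsupp m').2 := by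
        rw [e, map_add, sumFinsupp_single_inl, Prod.snd_add, add_zero]
      have e3 : (monomial (Finsupp.sumFinsuppAddEquivProdFinsupp m').1) (m (Sum.inl i) : k) =
          (m (Sum.inl i) : k) • monomial (Finsupp.sumFinsuppAddEquivProdFinsupp m').1 1 := by
        rw [smul_monomial, smul_eq_mul, mul_one]
      rw [e2, e3, map_smul, mul_smul_comm, smul_mul_assoc, mul_assoc]

theorem normal_zero : B.normal 0 = 1 := by
  rw [normal, map_zero]
  simp only [Prod.fst_zero, Prod.snd_zero]
  rw [show (monomial (0 : ι →₀ ℕ)) (1 : k) = 1 from rfl, map_one, map_one, one_mul]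

/-- `D^d` is spanned by the normally ordered monomials of weight `d`. -/
theorem gr_le_span_normal [Fintype ι] (d : ℕ) : gr ω d ≤ Submodule.span k
    {a | ∃ (j : ℕ) (m : ι ⊕ ι →₀ ℕ), m.degree + 2 * j = d ∧ a = hbarD ω ^ j * B.normal m} := by
  classical
  rw [gr, Submodule.span_le]
  intro a ha
  induction ha with
  | one => exact Submodule.subset_span ⟨0, 0, by simp, by rw [normal_zero, pow_zero, one_mul]⟩
  | @hbar_mul d a _ ih =>
    change LinearMap.mulLeft k (hbarD ω) a ∈ Submodule.span k _
    rw [← Submodule.mem_comap]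
    refine Submodule.span_le.2 ?_ ih
    rintro _ ⟨j, m, h, rfl⟩
    refine Submodule.subset_span ⟨j + 1, m, by omega, ?_⟩
    rw [LinearMap.mulLeft_apply, pow_succ', mul_assoc]
  | @incl_mul v d a _ ih =>
    have key : ∀ i, incl ω (B.basis i) * a ∈ Submodule.span k
        {a | ∃ (j : ℕ) (m : ι ⊕ ι →₀ ℕ), m.degree + 2 * j = d + 1 ∧
          a = hbarD ω ^ j * B.normal m} := fun i => by
      change LinearMap.mulLeft k (incl ω (B.basis i)) a ∈ Submodule.span k _
      rw [← Submodule.mem_comap]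
      refine Submodule.span_le.2 ?_ ih
      rintro _ ⟨j, m, h, rfl⟩
      rw [SetLike.mem_coe, Submodule.mem_comap, LinearMap.mulLeft_apply, ← mul_assoc,
        ← (Commute.pow_left (hbarD_comm_incl ω _) j).eq, mul_assoc]
      rcases i with i | i
      · rw [inl_mul_normal]
        refine Submodule.subset_span ⟨j, _, ?_, rfl⟩
        rw [map_add, Finsupp.degree_single]; omega
      · rw [inr_mul_normal, mul_add]
        refine add_mem (Submodule.subset_span ⟨j, _, ?_, rfl⟩) ?_
        · rw [map_add, Finsupp.degree_single]; omega
        · by_cases h0 : m (Sum.inl i) = 0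
          · simp [h0]
          · rw [mul_smul_comm, ← mul_assoc, ← pow_succ]
            refine Submodule.smul_mem _ _ (Submodule.subset_span ⟨j + 1, _, ?_, rfl⟩)
            have e : m = (m - Finsupp.single (Sum.inl i) 1) + Finsupp.single (Sum.inl i) 1 := by
              rw [tsub_add_cancel_of_le]
              rwa [Finsupp.single_le_iff, Nat.one_le_iff_ne_zero]
            have e' := congrArg Finsupp.degree e
            rw [map_add, Finsupp.degree_single] at e'
            omega
    rw [← B.basis.sum_repr v, map_sum, Finset.sum_mul]
    refine sum_mem fun i _ => ?_
    rw [map_smul, smul_mul_assoc]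
    exact Submodule.smul_mem _ _ (key i)

/-! The action on polynomials in normal form. -/

/-- The operators on polynomials by which the elements of the Darboux basis act. -/
def opBasis : ι ⊕ ι → Module.End k (MvPolynomial (ι ⊕ ι) k)
  | Sum.inl i => LinearMap.mulLeft k (X (Sum.inl i))
  | Sum.inr i => LinearMap.mulLeft k (X (Sum.inr i)) + (pderiv (Sum.inl i)).toLinearMap

/-- The operators on polynomials by which the elements of `V` act. -/
def op : V →ₗ[k] Module.End k (MvPolynomial (ι ⊕ ι) k) := B.basis.constr k opBasis

theorem op_inl (i : ι) (p : MvPolynomial (ι ⊕ ι) k) :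
    B.op (B.basis (Sum.inl i)) p = X (Sum.inl i) * p := by
  rw [op, Module.Basis.constr_basis]; rfl

theorem op_inr (i : ι) (p : MvPolynomial (ι ⊕ ι) k) :
    B.op (B.basis (Sum.inr i)) p = X (Sum.inr i) * p + pderiv (Sum.inl i) p := by
  rw [op, Module.Basis.constr_basis]; rfl

theorem op_comm (v w : V) (p : MvPolynomial (ι ⊕ ι) k) :
    B.op v (B.op w p) - B.op w (B.op v p) = ω.form v w • p := by
  classical
  have h : ∀ i j, B.op (B.basis i) (B.op (B.basis j) p) - B.op (B.basis j) (B.op (B.basis i) p) =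
      ω.form (B.basis i) (B.basis j) • p := fun i j => by
    rcases i with i | i <;> rcases j with j | j
    · rw [B.form_inl, op_inl, op_inl, op_inl, op_inl, zero_smul]; ring
    · rw [form_neg, B.form_inr_inl, op_inl, op_inl, op_inr, op_inr, pderiv_mul, pderiv_X]
      by_cases h : i = j
      · subst h; simp; ring
      · rw [Pi.single_eq_of_ne (by simpa using h), if_neg (Ne.symm h)]; simp; ring
    · rw [B.form_inr_inl, op_inl, op_inl, op_inr, op_inr, pderiv_mul, pderiv_X]
      by_cases h : i = j
      · subst h; simp; ring
      · rw [Pi.single_eq_of_ne (by simpa using Ne.symm h), if_neg h]; simp; ring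
    · rw [B.form_inr, op_inr, op_inr, op_inr, op_inr, zero_smul, map_add, map_add, pderiv_mul,
        pderiv_mul, pderiv_X_of_ne (by simp), pderiv_X_of_ne (by simp)]
      have : pderiv (Sum.inl i) (pderiv (Sum.inl j) p) =
          pderiv (Sum.inl j) (pderiv (Sum.inl i : ι ⊕ ι) p) := by
        refine MvPolynomial.ext _ _ fun m => ?_
        simp only [coeff_pderiv, Finsupp.add_apply]
        by_cases h : i = j
        · subst h; ring
        · rw [Finsupp.single_eq_of_ne (by simpa using Ne.symm h),
            Finsupp.single_eq_of_ne (by simpa using h), add_right_comm]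
          push_cast; ring
      rw [this]; ring
  induction B.basis.mem_span v using Submodule.span_induction with
  | mem v hv =>
    obtain ⟨i, rfl⟩ := hv
    induction B.basis.mem_span w using Submodule.span_induction with
    | mem w hw =>
      obtain ⟨j, rfl⟩ := hw
      exact h i j
    | zero => simp
    | add x y _ _ hx hy =>
      simp only [map_add, LinearMap.add_apply, add_smul, ← hx, ← hy]; abel
    | smul t x _ hx => simp only [map_smul, LinearMap.smul_apply, smul_assoc, ← hx, smul_sub]
  | zero => simp
  | add x y _ _ hx hy =>
    simp only [map_add, LinearMap.add_apply, add_smul, ← hx, ← hy]; abel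
  | smul t x _ hx => simp only [map_smul, LinearMap.smul_apply, smul_assoc, ← hx, smul_sub]

/-- The action of `D` on polynomials in normal form, with `ħ = 1`. -/
def actD : HWeyl ω →ₐ[k] Module.End k (MvPolynomial (ι ⊕ ι) k) :=
  UniversalEnvelopingAlgebra.lift k
    { B.op.comp Heisenberg.vec + Heisenberg.scal.smulRight 1 with
      map_lie' := fun {a b} => LinearMap.ext fun p => by
        change B.op 0 p + ω.form (Heisenberg.vec a) (Heisenberg.vec b) • p =
          (B.op (Heisenberg.vec a) (B.op (Heisenberg.vec b) p + Heisenberg.scal b • p) +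
              Heisenberg.scal a • (B.op (Heisenberg.vec b) p + Heisenberg.scal b • p)) -
            (B.op (Heisenberg.vec b) (B.op (Heisenberg.vec a) p + Heisenberg.scal a • p) +
              Heisenberg.scal b • (B.op (Heisenberg.vec a) p + Heisenberg.scal a • p))
        rw [← op_comm, map_zero, LinearMap.zero_apply, map_add, map_add, map_smul, map_smul,
          smul_add, smul_add, smul_comm (Heisenberg.scal b)]
        abel }

theorem actD_ι (a : Heisenberg ω) (p : MvPolynomial (ι ⊕ ι) k) :
    B.actD (UniversalEnvelopingAlgebra.ι k a) p =
      B.op (Heisenberg.vec a) p + Heisenberg.scal a • p :=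
  LinearMap.congr_fun (UniversalEnvelopingAlgebra.lift_ι_apply k _ a) p

theorem actD_incl (v : V) (p : MvPolynomial (ι ⊕ ι) k) : B.actD (incl ω v) p = B.op v p := by
  refine (B.actD_ι _ p).trans ?_
  simp

theorem actD_hbar : B.actD (hbarD ω) = 1 := by
  refine LinearMap.ext fun p => (B.actD_ι _ p).trans ?_
  simp

/-- The action of the Weyl algebra on polynomials in normal form. -/
def actW : Weyl ω →ₐ[k] Module.End k (MvPolynomial (ι ⊕ ι) k) :=
  RingQuot.liftAlgHom k ⟨B.actD, by rintro _ _ ⟨rfl, rfl⟩; rw [actD_hbar, map_one]⟩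

theorem actW_toWeyl (a : HWeyl ω) : B.actW (toWeyl ω a) = B.actD a :=
  RingQuot.liftAlgHom_mkAlgHom_apply k _ _ _

/-- The normally ordered symbol of an element of the Weyl algebra. -/
def symbol : Weyl ω →ₗ[k] MvPolynomial (ι ⊕ ι) k :=
  (LinearMap.applyₗ 1).comp B.actW.toLinearMap

theorem symbol_mul (a b : Weyl ω) : B.symbol (a * b) = B.actW a (B.symbol b) := by
  change B.actW (a * b) 1 = _
  rw [map_mul]; rfl

theorem symbol_one : B.symbol 1 = 1 := by
  change B.actW 1 1 = _
  rw [map_one B.actW]; rfl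

theorem actD_evalY (q : MvPolynomial ι k) (p : MvPolynomial (ι ⊕ ι) k) :
    B.actD (B.evalY q) p = rename Sum.inl q * p := by
  induction q using MvPolynomial.induction_on generalizing p with
  | C t =>
    rw [evalY, commAeval_C, AlgHom.commutes, rename_C, ← smul_eq_C_mul]; rfl
  | add q r hq hr => rw [map_add, map_add, LinearMap.add_apply, hq, hr, map_add, add_mul]
  | mul_X q i hq =>
    have hX : B.evalY (X i) = incl ω (B.basis (Sum.inl i)) := commAeval_X _ _ _
    rw [map_mul, map_mul, Module.End.mul_apply, hX, actD_incl, op_inl, hq, map_mul, rename_X,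
      mul_assoc]

theorem actD_evalX (q r : MvPolynomial ι k) :
    B.actD (B.evalX q) (rename Sum.inr r) = rename Sum.inr (q * r) := by
  induction q using MvPolynomial.induction_on generalizing r with
  | C t =>
    rw [evalX, commAeval_C, AlgHom.commutes, ← smul_eq_C_mul, map_smul]; rfl
  | add q s hq hs => rw [map_add, map_add, LinearMap.add_apply, hq, hs, add_mul, map_add]
  | mul_X q i hq =>
    have hX : B.evalX (X i) = incl ω (B.basis (Sum.inr i)) := commAeval_X _ _ _
    have : pderiv (Sum.inl i) (rename (Sum.inr : ι → ι ⊕ ι) r) = 0 := by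
      apply pderiv_eq_zero_of_notMem_vars
      classical
      intro h
      have := vars_rename _ _ h
      simp at this
    rw [map_mul, map_mul, Module.End.mul_apply, hX, actD_incl, op_inr, this, add_zero,
      ← rename_X (R := k) Sum.inr i, ← map_mul, hq, mul_assoc]

theorem symbol_normal (m : ι ⊕ ι →₀ ℕ) : B.symbol (toWeyl ω (B.normal m)) = monomial m 1 := by
  change B.actW _ 1 = _
  rw [actW_toWeyl, normal, map_mul, Module.End.mul_apply,
    ← map_one (rename (Sum.inr : ι → ι ⊕ ι) (R := k)), actD_evalX, actD_evalY, mul_one,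
    rename_monomial, rename_monomial, monomial_mul, one_mul]
  congr 2
  ext (i | i)
  · rw [Finsupp.add_apply, Finsupp.mapDomain_apply Sum.inl_injective,
      Finsupp.mapDomain_of_notMem_range _ _ (by simp), add_zero,
      Finsupp.fst_sumFinsuppAddEquivProdFinsupp]
  · rw [Finsupp.add_apply, Finsupp.mapDomain_apply Sum.inr_injective,
      Finsupp.mapDomain_of_notMem_range _ _ (by simp), zero_add,
      Finsupp.snd_sumFinsuppAddEquivProdFinsupp]

end Darboux

end PBW

/-! ### The filtered Weyl algebra -/

section WeylFilt

variable {k V : Type*} [Field k] [AddCommGroup V] [Module k V]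

/-- The image of `D^d` in the Weyl algebra. -/
def weylF (ω : SymplecticForm k V) (d : ℕ) : Submodule k (Weyl ω) :=
  (gr ω d).map (toWeyl ω).toLinearMap

/-- The embedding of `V` into the Weyl algebra. -/
def weylV (ω : SymplecticForm k V) : V →ₗ[k] Weyl ω := (toWeyl ω).toLinearMap.comp (incl ω)

/-- The left ideal of the Weyl algebra generated by `𝔵`. -/
def weylIdeal (ω : SymplecticForm k V) (𝔵 : Submodule k V) : Ideal (Weyl ω) :=
  Ideal.span (weylV ω '' (𝔵 : Set V))

variable {ω : SymplecticForm k V}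

theorem toWeyl_surjective : Function.Surjective (toWeyl ω) := RingQuot.mkAlgHom_surjective k _

theorem weyl_induction {p : Weyl ω → Prop} (one : p 1)
    (mul : ∀ v a, p a → p (weylV ω v * a)) (add : ∀ a b, p a → p b → p (a + b))
    (smul : ∀ (t : k) a, p a → p (t • a)) (a : Weyl ω) : p a := by
  obtain ⟨a, rfl⟩ := toWeyl_surjective a
  induction a using hweyl_induction with
  | one => rwa [map_one]
  | incl_mul v a ih => rw [map_mul]; exact mul v _ ih
  | hbar_mul a ih => rwa [map_mul, toWeyl_hbar, one_mul]
  | add a b ha hb => rw [map_add]; exact add _ _ ha hb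
  | smul t a ha => rw [map_smul]; exact smul _ _ ha

theorem weylV_comm (v w : V) :
    weylV ω v * weylV ω w - weylV ω w * weylV ω v = algebraMap k _ (ω.form v w) := by
  have := congrArg (toWeyl ω) (incl_comm ω v w)
  rwa [map_sub, map_mul, map_mul, map_smul, toWeyl_hbar, ← Algebra.algebraMap_eq_smul_one] at this

theorem toWeyl_mem {a : HWeyl ω} {d : ℕ} (h : a ∈ gr ω d) : toWeyl ω a ∈ weylF ω d := ⟨a, h, rfl⟩

theorem mul_mem_weylF {i j : ℕ} {a b : Weyl ω} (ha : a ∈ weylF ω i) (hb : b ∈ weylF ω j) :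
    a * b ∈ weylF ω (i + j) := by
  obtain ⟨a, ha, rfl⟩ := ha
  obtain ⟨b, hb, rfl⟩ := hb
  exact ⟨a * b, mul_mem_gr ha hb, map_mul (toWeyl ω) _ _⟩

theorem one_mem_weylF : (1 : Weyl ω) ∈ weylF ω 0 := ⟨1, one_mem_gr, map_one (toWeyl ω)⟩

theorem algebraMap_mem_weylF (t : k) : algebraMap k (Weyl ω) t ∈ weylF ω 0 := by
  rw [Algebra.algebraMap_eq_smul_one]; exact Submodule.smul_mem _ _ one_mem_weylF

theorem weylV_mem_weylF (v : V) : weylV ω v ∈ weylF ω 1 := ⟨_, incl_mem_gr v, rfl⟩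

theorem weylF_le_add_two (d : ℕ) : weylF ω d ≤ weylF ω (d + 2) := by
  rintro _ ⟨a, ha, rfl⟩
  refine ⟨hbarD ω * a, ?_, ?_⟩
  · rw [add_comm]; exact mul_mem_gr hbarD_mem_gr ha
  · change toWeyl ω _ = toWeyl ω a
    rw [map_mul, toWeyl_hbar, one_mul]

theorem weylF_le_add (d j : ℕ) : weylF ω d ≤ weylF ω (d + 2 * j) := by
  induction j with
  | zero => exact le_rfl
  | succ j ih => exact ih.trans (weylF_le_add_two _)

theorem weylF_le {d e : ℕ} (h : ∃ j, d + 2 * j = e) : weylF ω d ≤ weylF ω e := by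
  obtain ⟨j, rfl⟩ := h
  exact weylF_le_add d j

theorem comm_mem_weylF {i j d : ℕ} (h : i + j = d + 2) {a b : Weyl ω} (ha : a ∈ weylF ω i)
    (hb : b ∈ weylF ω j) : a * b - b * a ∈ weylF ω d := by
  obtain ⟨a, ha, rfl⟩ := ha
  obtain ⟨b, hb, rfl⟩ := hb
  have hc := gr_comm ha hb
  rw [h] at hc
  obtain ⟨w, hw, e⟩ := hbarGr_exists hc
  refine ⟨w, hw, ?_⟩
  have := congrArg (toWeyl ω) e
  rw [map_sub, map_mul, map_mul, map_mul, toWeyl_hbar, one_mul] at this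
  exact this.symm

theorem iSup_gr : ⨆ d, gr ω d = ⊤ := by
  rw [eq_top_iff]
  rintro a -
  induction a using hweyl_induction with
  | one => exact Submodule.mem_iSup_of_mem 0 one_mem_gr
  | incl_mul v a ih =>
    have h : ⨆ d, gr ω d ≤ Submodule.comap (LinearMap.mulLeft k (incl ω v)) (⨆ d, gr ω d) :=
      iSup_le fun d b hb => Submodule.mem_iSup_of_mem (1 + d) (mul_mem_gr (incl_mem_gr v) hb)
    exact h ih
  | hbar_mul a ih =>
    have h : ⨆ d, gr ω d ≤ Submodule.comap (LinearMap.mulLeft k (hbarD ω)) (⨆ d, gr ω d) :=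
      iSup_le fun d b hb => Submodule.mem_iSup_of_mem (2 + d) (mul_mem_gr hbarD_mem_gr hb)
    exact h ih
  | add a b ha hb => exact add_mem ha hb
  | smul t a ha => exact Submodule.smul_mem _ _ ha

theorem iSup_weylF : ⨆ d, weylF ω d = ⊤ := by
  have := congrArg (Submodule.map (toWeyl ω).toLinearMap) (iSup_gr (ω := ω))
  rw [Submodule.map_iSup, Submodule.map_top] at this
  refine this.trans (LinearMap.range_eq_top.2 toWeyl_surjective)

end WeylFilt

namespace Darboux

open MvPolynomial

variable {k V ι : Type*} [Field k] [AddCommGroup V] [Module k V] {ω : SymplecticForm k V}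
  {𝔵 : Submodule k V} (B : Darboux ω 𝔵 ι)

theorem symbol_weylV_mul (v : V) (w : Weyl ω) : B.symbol (weylV ω v * w) = B.op v (B.symbol w) := by
  rw [symbol_mul]
  change B.actW (toWeyl ω (incl ω v)) _ = _
  rw [actW_toWeyl, actD_incl]

theorem basis_weyl_induction {p : Weyl ω → Prop} (one : p 1)
    (mul : ∀ i a, p a → p (weylV ω (B.basis i) * a)) (add : ∀ a b, p a → p b → p (a + b))
    (smul : ∀ (t : k) a, p a → p (t • a)) (a : Weyl ω) : p a := by
  induction a using weyl_induction with
  | one => exact one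
  | mul v a ha =>
    induction B.basis.mem_span v using Submodule.span_induction with
    | mem v hv => obtain ⟨i, rfl⟩ := hv; exact mul i a ha
    | zero => rw [map_zero, zero_mul]; simpa using smul 0 1 one
    | add x y _ _ hx hy => rw [map_add, add_mul]; exact add _ _ hx hy
    | smul t x _ hx => rw [map_smul, smul_mul_assoc]; exact smul _ _ hx
  | add a b ha hb => exact add a b ha hb
  | smul t a ha => exact smul t a ha

theorem pderiv_comm (i j : ι ⊕ ι) (p : MvPolynomial (ι ⊕ ι) k) :
    pderiv i (pderiv j p) = pderiv j (pderiv i p) := by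
  classical
  refine MvPolynomial.ext _ _ fun m => ?_
  simp only [coeff_pderiv, Finsupp.add_apply]
  by_cases h : i = j
  · subst h; ring
  · rw [Finsupp.single_eq_of_ne (Ne.symm h), Finsupp.single_eq_of_ne h, add_right_comm]
    push_cast; ring

theorem symbol_mul_inr (w : Weyl ω) (i : ι) :
    B.symbol (w * weylV ω (B.basis (Sum.inr i))) = X (Sum.inr i) * B.symbol w := by
  classical
  induction w using B.basis_weyl_induction with
  | one =>
    rw [one_mul, ← mul_one (weylV ω _), symbol_weylV_mul, symbol_one, op_inr]
    simp
  | mul j a ha =>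
    rw [mul_assoc, symbol_weylV_mul, symbol_weylV_mul, ha]
    rcases j with j | j
    · rw [op_inl, op_inl]; ring
    · rw [op_inr, op_inr, pderiv_mul, pderiv_X_of_ne (by simp)]; ring
  | add a b ha hb => rw [add_mul, map_add, ha, hb, map_add, mul_add]
  | smul t a ha => rw [smul_mul_assoc, map_smul, ha, map_smul, mul_smul_comm]

theorem symbol_mul_inl (w : Weyl ω) (i : ι) :
    B.symbol (w * weylV ω (B.basis (Sum.inl i))) =
      X (Sum.inl i) * B.symbol w + pderiv (Sum.inr i) (B.symbol w) := by
  classical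
  induction w using B.basis_weyl_induction with
  | one =>
    rw [one_mul, ← mul_one (weylV ω _), symbol_weylV_mul, symbol_one, op_inl]
    simp
  | mul j a ha =>
    rw [mul_assoc, symbol_weylV_mul, symbol_weylV_mul, ha]
    rcases j with j | j
    · rw [op_inl, op_inl, pderiv_mul, pderiv_X_of_ne (by simp)]; ring
    · rw [op_inr, op_inr, map_add, map_add, pderiv_mul, pderiv_mul, pderiv_comm (Sum.inl j)]
      by_cases h : j = i
      · subst h; simp; ring
      · rw [pderiv_X_of_ne (by simpa using Ne.symm h), pderiv_X_of_ne (by simpa using h)]; ring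
  | add a b ha hb => rw [add_mul, map_add, ha, hb, map_add, map_add, mul_add]; abel
  | smul t a ha =>
    rw [smul_mul_assoc, map_smul, ha, map_smul, Derivation.map_smul, mul_smul_comm, smul_add]

theorem symbol_comm_inr (w : Weyl ω) (i : ι) :
    B.symbol (weylV ω (B.basis (Sum.inr i)) * w - w * weylV ω (B.basis (Sum.inr i))) =
      pderiv (Sum.inl i) (B.symbol w) := by
  rw [map_sub, symbol_weylV_mul, symbol_mul_inr, op_inr]; ring

theorem symbol_comm_inl (w : Weyl ω) (i : ι) :
    B.symbol (w * weylV ω (B.basis (Sum.inl i)) - weylV ω (B.basis (Sum.inl i)) * w) =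
      pderiv (Sum.inr i) (B.symbol w) := by
  rw [map_sub, symbol_weylV_mul, symbol_mul_inl, op_inl]; ring

theorem normal_mem_gr (n : ℕ) (m : ι ⊕ ι →₀ ℕ) (h : m.degree = n) : B.normal m ∈ gr ω n := by
  classical
  induction n using Nat.strong_induction_on generalizing m with
  | _ n ih =>
    by_cases h0 : m = 0
    · subst h0
      rw [map_zero] at h
      rw [normal_zero, ← h]
      exact one_mem_gr
    · obtain ⟨i, hi⟩ := Finsupp.ne_iff.1 h0
      have e : m = (m - Finsupp.single i 1) + Finsupp.single i 1 := by
        rw [tsub_add_cancel_of_le]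
        rwa [Finsupp.single_le_iff, Nat.one_le_iff_ne_zero]
      set m' := m - Finsupp.single i 1
      have hd : m'.degree + 1 = n := by
        rw [← h, e, map_add, Finsupp.degree_single]
      subst hd
      rw [e]
      rcases i with i | i
      · rw [← inl_mul_normal, add_comm]
        exact mul_mem_gr (incl_mem_gr _) (ih _ (by omega) _ rfl)
      · rw [← sub_eq_of_eq_add (B.inr_mul_normal i m')]
        refine sub_mem ?_ ?_
        · rw [add_comm]
          exact mul_mem_gr (incl_mem_gr _) (ih _ (by omega) _ rfl)
        · by_cases h1 : m' (Sum.inl i) = 0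
          · simp [h1]
          · have e1 : m' = (m' - Finsupp.single (Sum.inl i) 1) + Finsupp.single (Sum.inl i) 1 := by
              rw [tsub_add_cancel_of_le]
              rwa [Finsupp.single_le_iff, Nat.one_le_iff_ne_zero]
            have e2 := congrArg Finsupp.degree e1
            rw [map_add, Finsupp.degree_single] at e2
            have := mul_mem_gr (hbarD_mem_gr (ω := ω))
              (ih _ (by omega) (m' - Finsupp.single (Sum.inl i) 1) rfl)
            refine Submodule.smul_mem _ _ ?_
            convert this using 2
            omega

/-- The normally ordered element with a given symbol. -/
def ofSymbol : MvPolynomial (ι ⊕ ι) k →ₗ[k] Weyl ω :=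
  (basisMonomials (ι ⊕ ι) k).constr k fun m => toWeyl ω (B.normal m)

theorem ofSymbol_monomial (m : ι ⊕ ι →₀ ℕ) (t : k) :
    B.ofSymbol (monomial m t) = t • toWeyl ω (B.normal m) := by
  rw [← mul_one t, ← smul_eq_mul, ← smul_monomial, map_smul, ofSymbol]
  have := (basisMonomials (ι ⊕ ι) k).constr_basis k (fun m => toWeyl ω (B.normal m)) m
  rw [coe_basisMonomials] at this
  rw [this, smul_eq_mul, mul_one]

theorem symbol_ofSymbol (p : MvPolynomial (ι ⊕ ι) k) : B.symbol (B.ofSymbol p) = p := by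
  induction p using MvPolynomial.induction_on' with
  | monomial m t =>
    rw [ofSymbol_monomial, map_smul, symbol_normal, smul_monomial, smul_eq_mul, mul_one]
  | add p q hp hq => rw [map_add, map_add, hp, hq]

theorem ofSymbol_mem {d : ℕ} {p : MvPolynomial (ι ⊕ ι) k} (hp : p ∈ parityLE k (ι ⊕ ι) d) :
    B.ofSymbol p ∈ weylF ω d := by
  rw [p.as_sum, map_sum]
  refine sum_mem fun m hm => ?_
  obtain ⟨j, hj⟩ := hp m (mem_support_iff.1 hm)
  rw [ofSymbol_monomial]
  exact Submodule.smul_mem _ _ (weylF_le ⟨j, hj⟩ (toWeyl_mem (B.normal_mem_gr _ m rfl)))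

/-- The projection that sets the `x_i` to zero. -/
def setZero : MvPolynomial (ι ⊕ ι) k →ₐ[k] MvPolynomial (ι ⊕ ι) k :=
  aeval (Sum.elim (fun i => X (Sum.inl i)) 0)

theorem setZero_C (t : k) : setZero (ι := ι) (C t) = C t := by
  rw [setZero, aeval_C, algebraMap_eq]

theorem setZero_X_inl (i : ι) : setZero (k := k) (X (Sum.inl i)) = X (Sum.inl i) := by
  rw [setZero, aeval_X]; rfl

theorem setZero_X_inr (i : ι) : setZero (k := k) (X (Sum.inr i)) = 0 := by
  rw [setZero, aeval_X]; rfl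

theorem setZero_pderiv_inl (i : ι) (p : MvPolynomial (ι ⊕ ι) k) :
    setZero (pderiv (Sum.inl i) p) = pderiv (Sum.inl i) (setZero p) := by
  classical
  induction p using MvPolynomial.induction_on with
  | C t => rw [pderiv_C, map_zero, setZero_C, pderiv_C]
  | add p q hp hq => simp only [map_add, hp, hq]
  | mul_X p j hp =>
    rw [pderiv_mul, map_add, map_mul, map_mul, map_mul, pderiv_mul, hp]
    rcases j with j | j
    · rw [setZero_X_inl, pderiv_X]
      congr 2
      by_cases h : i = j
      · subst h; simp
      · rw [Pi.single_eq_of_ne (by simpa using Ne.symm h), map_zero]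
    · rw [setZero_X_inr, pderiv_X_of_ne (by simp), map_zero, map_zero]

theorem setZero_pderiv_inr (i : ι) (p : MvPolynomial (ι ⊕ ι) k) :
    pderiv (Sum.inr i) (setZero p) = 0 := by
  classical
  induction p using MvPolynomial.induction_on with
  | C t => rw [setZero_C, pderiv_C]
  | add p q hp hq => rw [map_add, map_add, hp, hq, add_zero]
  | mul_X p j hp =>
    rw [map_mul, pderiv_mul, hp, zero_mul, zero_add]
    rcases j with j | j
    · rw [setZero_X_inl, pderiv_X_of_ne (by simp), mul_zero]
    · rw [setZero_X_inr, map_zero, mul_zero]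

theorem setZero_setZero (p : MvPolynomial (ι ⊕ ι) k) : setZero (setZero p) = setZero p := by
  induction p using MvPolynomial.induction_on with
  | C t => rw [setZero_C, setZero_C]
  | add p q hp hq => rw [map_add, map_add, hp, hq]
  | mul_X p j hp =>
    rw [map_mul, map_mul, hp]
    rcases j with j | j
    · rw [setZero_X_inl, setZero_X_inl]
    · rw [setZero_X_inr, map_zero]

theorem coeff_zero_setZero (p : MvPolynomial (ι ⊕ ι) k) : coeff 0 (setZero p) = coeff 0 p := by
  induction p using MvPolynomial.induction_on with
  | C t => rw [setZero_C]
  | add p q hp hq => rw [map_add, coeff_add, coeff_add, hp, hq]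
  | mul_X p j hp =>
    rw [map_mul]
    simp only [← constantCoeff_eq, map_mul]
    rcases j with j | j
    · rw [setZero_X_inl]; simp
    · rw [setZero_X_inr]; simp

theorem setZero_mem {d : ℕ} {p : MvPolynomial (ι ⊕ ι) k} (hp : p ∈ parityLE k (ι ⊕ ι) d) :
    setZero p ∈ parityLE k (ι ⊕ ι) d := by
  classical
  rw [p.as_sum, map_sum]
  refine sum_mem fun m hm => ?_
  obtain ⟨j, hj⟩ := hp m (mem_support_iff.1 hm)
  generalize coeff m p = t
  by_cases h : ∃ i, m (Sum.inr i) ≠ 0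
  · obtain ⟨i, hi⟩ := h
    have e : m = Finsupp.single (Sum.inr i) 1 + (m - Finsupp.single (Sum.inr i) 1) := by
      rw [add_tsub_cancel_of_le]
      rwa [Finsupp.single_le_iff, Nat.one_le_iff_ne_zero]
    have e1 : monomial m t = X (Sum.inr i) * monomial (m - Finsupp.single (Sum.inr i) 1) t := by
      nth_rewrite 1 [e]
      rw [X, monomial_mul, one_mul]
    rw [e1, map_mul, setZero_X_inr, zero_mul]
    exact zero_mem _
  · have : setZero (monomial m t) = monomial m t := by
      push Not at h
      rw [setZero, aeval_monomial, monomial_eq, algebraMap_eq]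
      congr 1
      refine Finsupp.prod_congr fun i hi => ?_
      rcases i with i | i
      · rfl
      · exact absurd (h i) (Finsupp.mem_support_iff.1 hi)
    rw [this]
    exact parityLE_monomial hj t

variable [Fintype ι]

theorem toWeyl_hbarD_pow_mul (j : ℕ) (a : HWeyl ω) : toWeyl ω (hbarD ω ^ j * a) = toWeyl ω a := by
  rw [map_mul, map_pow, toWeyl_hbar, one_pow, one_mul]

theorem symbol_mem {d : ℕ} {w : Weyl ω} (hw : w ∈ weylF ω d) :
    B.symbol w ∈ parityLE k (ι ⊕ ι) d := by
  obtain ⟨a, ha, rfl⟩ := hw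
  have := B.gr_le_span_normal d ha
  clear ha
  induction this using Submodule.span_induction with
  | mem a h =>
    obtain ⟨j, m, h, rfl⟩ := h
    change B.symbol (toWeyl ω _) ∈ _
    rw [toWeyl_hbarD_pow_mul, symbol_normal]
    exact parityLE_monomial h 1
  | zero => rw [map_zero, map_zero]; exact zero_mem _
  | add x y _ _ hx hy => rw [map_add, map_add]; exact add_mem hx hy
  | smul t x _ hx => rw [map_smul, map_smul]; exact Submodule.smul_mem _ _ hx

theorem ofSymbol_symbol (w : Weyl ω) : B.ofSymbol (B.symbol w) = w := by
  have hw : w ∈ ⨆ d, weylF ω d := by rw [iSup_weylF]; trivial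
  have : (⨆ d, weylF ω d) ≤ LinearMap.ker (B.ofSymbol.comp B.symbol - LinearMap.id) := by
    refine iSup_le fun d => ?_
    rintro _ ⟨a, ha, rfl⟩
    rw [← Submodule.mem_comap]
    refine Submodule.span_le.2 ?_ (B.gr_le_span_normal d ha)
    rintro _ ⟨j, m, h, rfl⟩
    change B.ofSymbol (B.symbol (toWeyl ω _)) - toWeyl ω _ = 0
    rw [toWeyl_hbarD_pow_mul, symbol_normal, ofSymbol_monomial, one_smul, sub_self]
  exact sub_eq_zero.1 (this hw)

theorem symbol_injective : Function.Injective B.symbol :=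
  Function.LeftInverse.injective B.ofSymbol_symbol

theorem mem_weylF {d : ℕ} {w : Weyl ω} : w ∈ weylF ω d ↔ B.symbol w ∈ parityLE k (ι ⊕ ι) d :=
  ⟨B.symbol_mem, fun h => B.ofSymbol_symbol w ▸ B.ofSymbol_mem h⟩

/-- The specialization `ħ = 1` is injective on each homogeneous component. -/
theorem eq_zero_of_toWeyl_eq_zero (B : Darboux ω 𝔵 ι) {d : ℕ} {a : HWeyl ω} (ha : a ∈ gr ω d)
    (h : toWeyl ω a = 0) : a = 0 := by
  let f : MvPolynomial (ι ⊕ ι) k →ₗ[k] HWeyl ω := (basisMonomials (ι ⊕ ι) k).constr k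
    fun m => hbarD ω ^ ((d - m.degree) / 2) * B.normal m
  have hf : ∀ m, f (monomial m 1) = hbarD ω ^ ((d - m.degree) / 2) * B.normal m := fun m => by
    have := (basisMonomials (ι ⊕ ι) k).constr_basis k
      (fun m => hbarD ω ^ ((d - m.degree) / 2) * B.normal m) m
    rwa [coe_basisMonomials] at this
  suffices f (B.symbol (toWeyl ω a)) = a by rw [← this, h, map_zero, map_zero]
  have := B.gr_le_span_normal d ha
  clear h ha
  induction this using Submodule.span_induction with
  | mem a h =>
    obtain ⟨j, m, h, rfl⟩ := h
    rw [toWeyl_hbarD_pow_mul, symbol_normal, hf]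
    congr 2
    omega
  | zero => simp
  | add x y _ _ hx hy => rw [map_add, map_add, map_add, hx, hy]
  | smul t x _ hx => rw [map_smul, map_smul, map_smul, hx]

end Darboux

/-! ### Commutators and the left ideal of the Weyl algebra -/

namespace Darboux

open MvPolynomial

variable {k V ι : Type*} [Field k] [AddCommGroup V] [Module k V] {ω : SymplecticForm k V}
  {𝔵 : Submodule k V} (B : Darboux ω 𝔵 ι)

/-- The partial derivatives on the Weyl algebra, as commutators. -/
theorem symbol_comm_eq (w : Weyl ω) (i : ι ⊕ ι) :
    pderiv i (B.symbol w) = B.symbol (Sum.elim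
      (fun i => weylV ω (B.basis (Sum.inr i)) * w - w * weylV ω (B.basis (Sum.inr i)))
      (fun i => w * weylV ω (B.basis (Sum.inl i)) - weylV ω (B.basis (Sum.inl i)) * w) i) := by
  rcases i with i | i
  · exact (B.symbol_comm_inr w i).symm
  · exact (B.symbol_comm_inl w i).symm

theorem symbol_algebraMap (t : k) : B.symbol (algebraMap k _ t) = C t := by
  rw [Algebra.algebraMap_eq_smul_one, map_smul, symbol_one, smul_eq_C_mul, mul_one]

theorem inr_mem (i : ι) : B.basis (Sum.inr i) ∈ 𝔵 := by
  have h : B.basis (Sum.inr i) ∈ Submodule.span k (Set.range fun i => B.basis (Sum.inr i)) :=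
    Submodule.subset_span ⟨i, rfl⟩
  rwa [B.span_inr] at h

theorem weylV_mem_weylIdeal {x : V} (hx : x ∈ 𝔵) : weylV ω x ∈ weylIdeal ω 𝔵 :=
  Ideal.subset_span ⟨x, hx, rfl⟩

theorem setZero_monomial_eq (m : ι ⊕ ι →₀ ℕ) (t : k) (h : ∀ i, m (Sum.inr i) = 0) :
    setZero (monomial m t) = monomial m t := by
  rw [setZero, aeval_monomial, monomial_eq, algebraMap_eq]
  congr 1
  refine Finsupp.prod_congr fun i hi => ?_
  rcases i with i | i
  · rfl
  · exact absurd (h i) (Finsupp.mem_support_iff.1 hi)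

theorem setZero_symbol_mul {a w : Weyl ω} (h : setZero (B.symbol w) = 0) :
    setZero (B.symbol (a * w)) = 0 := by
  induction a using B.basis_weyl_induction with
  | one => rwa [one_mul]
  | mul i a ih =>
    rw [mul_assoc, symbol_weylV_mul]
    rcases i with i | i
    · rw [op_inl, map_mul, ih, mul_zero]
    · rw [op_inr, map_add, map_mul, ih, mul_zero, setZero_pderiv_inl, ih, map_zero, add_zero]
  | add a b ha hb => rw [add_mul, map_add, map_add, ha, hb, add_zero]
  | smul t a ha => rw [smul_mul_assoc, map_smul, map_smul, ha, smul_zero]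

theorem setZero_symbol_of_mem {w : Weyl ω} (h : w ∈ weylIdeal ω 𝔵) :
    setZero (B.symbol w) = 0 := by
  induction h using Submodule.span_induction with
  | mem w h =>
    obtain ⟨x, hx, rfl⟩ := h
    rw [SetLike.mem_coe, ← B.span_inr] at hx
    induction hx using Submodule.span_induction with
    | mem x h =>
      obtain ⟨i, rfl⟩ := h
      rw [← one_mul (weylV ω _), symbol_mul_inr, map_mul, setZero_X_inr, zero_mul]
    | zero => simp
    | add x y _ _ hx hy => rw [map_add, map_add, map_add, hx, hy, add_zero]
    | smul t x _ hx => rw [map_smul, map_smul, map_smul, hx, smul_zero]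
  | zero => rw [map_zero, map_zero]
  | add x y _ _ hx hy => rw [map_add, map_add, hx, hy, add_zero]
  | smul a x _ hx => exact B.setZero_symbol_mul hx

variable [Fintype ι]

/-- `F_d 𝔵`, as the space of the sums `∑ a_i x_i` with `a_i ∈ F_d`. -/
def mulInr (S : Submodule k (Weyl ω)) : Submodule k (Weyl ω) where
  carrier := {w | ∃ a : ι → Weyl ω, (∀ i, a i ∈ S) ∧
    w = ∑ i, a i * weylV ω (B.basis (Sum.inr i))}
  add_mem' := by
    rintro _ _ ⟨a, ha, rfl⟩ ⟨b, hb, rfl⟩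
    exact ⟨a + b, fun i => add_mem (ha i) (hb i), by simp [add_mul, Finset.sum_add_distrib]⟩
  zero_mem' := ⟨0, fun _ => zero_mem _, by simp⟩
  smul_mem' := by
    rintro t _ ⟨a, ha, rfl⟩
    exact ⟨t • a, fun i => Submodule.smul_mem _ _ (ha i), by simp [Finset.smul_sum]⟩

theorem mul_mem_mulInr {S : Submodule k (Weyl ω)} {a : Weyl ω} (ha : a ∈ S) (i : ι) :
    a * weylV ω (B.basis (Sum.inr i)) ∈ B.mulInr S := by
  classical
  refine ⟨Pi.single i a, fun j => ?_, ?_⟩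
  · by_cases h : j = i
    · subst h; rwa [Pi.single_eq_same]
    · rw [Pi.single_eq_of_ne h]; exact zero_mem _
  · rw [Finset.sum_eq_single i]
    · rw [Pi.single_eq_same]
    · intro j _ h; rw [Pi.single_eq_of_ne h, zero_mul]
    · simp

theorem ofSymbol_X_inr_mul (i : ι) (p : MvPolynomial (ι ⊕ ι) k) :
    B.ofSymbol (X (Sum.inr i) * p) = B.ofSymbol p * weylV ω (B.basis (Sum.inr i)) := by
  apply B.symbol_injective
  rw [symbol_ofSymbol, symbol_mul_inr, symbol_ofSymbol]

theorem ofSymbol_sub_setZero_mem (S : Submodule k (MvPolynomial (ι ⊕ ι) k))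
    (p : MvPolynomial (ι ⊕ ι) k)
    (hS : ∀ i m, m ∈ p.support → m (Sum.inr i) ≠ 0 →
      monomial (m - Finsupp.single (Sum.inr i) 1) (1 : k) ∈ S) :
    B.ofSymbol (p - setZero p) ∈ B.mulInr (S.map B.ofSymbol) := by
  classical
  have : p - setZero p = ∑ m ∈ p.support,
      (monomial m (coeff m p) - setZero (monomial m (coeff m p))) := by
    rw [Finset.sum_sub_distrib, ← map_sum, ← p.as_sum]
  rw [this, map_sum]
  refine sum_mem fun m hm => ?_
  by_cases h : ∃ i, m (Sum.inr i) ≠ 0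
  · obtain ⟨i, hi⟩ := h
    have e : m = Finsupp.single (Sum.inr i) 1 + (m - Finsupp.single (Sum.inr i) 1) := by
      rw [add_tsub_cancel_of_le]
      rwa [Finsupp.single_le_iff, Nat.one_le_iff_ne_zero]
    have e1 : monomial m (coeff m p) =
        X (Sum.inr i) * (coeff m p • monomial (m - Finsupp.single (Sum.inr i) 1) 1) := by
      rw [smul_monomial, X, monomial_mul, one_mul, ← e, smul_eq_mul, mul_one]
    rw [e1, map_mul, setZero_X_inr, zero_mul, sub_zero, ofSymbol_X_inr_mul]
    exact B.mul_mem_mulInr (Submodule.mem_map_of_mem (Submodule.smul_mem S _ (hS i m hm hi))) i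
  · push Not at h
    rw [setZero_monomial_eq m _ h, sub_self, map_zero]
    exact zero_mem _

theorem mulInr_le (S : Submodule k (Weyl ω)) :
    B.mulInr S ≤ (weylIdeal ω 𝔵).restrictScalars k := by
  rintro _ ⟨a, _, rfl⟩
  exact sum_mem fun i _ => Ideal.mul_mem_left _ _ (weylV_mem_weylIdeal (B.inr_mem i))

theorem mem_weylIdeal (B : Darboux ω 𝔵 ι) {w : Weyl ω} : w ∈ weylIdeal ω 𝔵 ↔ setZero (B.symbol w) = 0 := by
  refine ⟨B.setZero_symbol_of_mem, fun h => ?_⟩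
  have := B.ofSymbol_sub_setZero_mem ⊤ (B.symbol w) (fun _ _ _ _ => trivial)
  rw [h, sub_zero, ofSymbol_symbol] at this
  exact B.mulInr_le _ this

/-- The elements of the left ideal in `F_{d+1}` are sums of products of elements of `F_d` and of
`𝔵`. -/
theorem exists_eq_sum_of_mem (B : Darboux ω 𝔵 ι) {d : ℕ} {w : Weyl ω} (h : w ∈ weylIdeal ω 𝔵)
    (hw : w ∈ weylF ω (d + 1)) : ∃ a : ι → Weyl ω, (∀ i, a i ∈ weylF ω d) ∧
      w = ∑ i, a i * weylV ω (B.basis (Sum.inr i)) := by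
  have := B.ofSymbol_sub_setZero_mem (parityLE k _ d) (B.symbol w) (fun i m hm hi => by
    obtain ⟨j, hj⟩ := B.symbol_mem hw m (mem_support_iff.1 hm)
    have e : m = Finsupp.single (Sum.inr i) 1 + (m - Finsupp.single (Sum.inr i) 1) := by
      rw [add_tsub_cancel_of_le]
      rwa [Finsupp.single_le_iff, Nat.one_le_iff_ne_zero]
    have e' := congrArg Finsupp.degree e
    rw [map_add, Finsupp.degree_single] at e'
    exact parityLE_monomial (j := j) (by omega) 1)
  rw [B.mem_weylIdeal.1 h, sub_zero, ofSymbol_symbol] at this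
  obtain ⟨a, ha, e⟩ := this
  refine ⟨a, fun i => ?_, e⟩
  obtain ⟨p, hp, e⟩ := ha i
  rw [← e]
  exact B.ofSymbol_mem hp

theorem eq_algebraMap_of_mem_weylF_zero (B : Darboux ω 𝔵 ι) {w : Weyl ω} (hw : w ∈ weylF ω 0) :
    ∃ t, w = algebraMap k _ t := by
  refine ⟨coeff 0 (B.symbol w), B.symbol_injective ?_⟩
  rw [symbol_algebraMap]
  exact eq_C_of_parityLE_zero (B.symbol_mem hw)

theorem algebraMap_mem_weylIdeal (B : Darboux ω 𝔵 ι) {t : k} (h : algebraMap k _ t ∈ weylIdeal ω 𝔵) : t = 0 := by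
  rw [B.mem_weylIdeal, symbol_algebraMap, setZero_C] at h
  simpa using h

theorem eq_zero_of_mem_weylF_zero (B : Darboux ω 𝔵 ι) {w : Weyl ω} (h : w ∈ weylIdeal ω 𝔵)
    (hw : w ∈ weylF ω 0) : w = 0 := by
  obtain ⟨t, rfl⟩ := B.eq_algebraMap_of_mem_weylF_zero hw
  rw [B.algebraMap_mem_weylIdeal h, map_zero]

theorem mem_weylF_sup (B : Darboux ω 𝔵 ι) {d : ℕ} {w : Weyl ω} :
    w ∈ weylF ω d ⊔ (weylIdeal ω 𝔵).restrictScalars k ↔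
      setZero (B.symbol w) ∈ parityLE k (ι ⊕ ι) d := by
  constructor
  · intro h
    obtain ⟨a, ha, b, hb, rfl⟩ := Submodule.mem_sup.1 h
    rw [map_add, map_add, B.mem_weylIdeal.1 hb, add_zero]
    exact setZero_mem (B.symbol_mem ha)
  · intro h
    refine Submodule.mem_sup.2 ⟨_, B.ofSymbol_mem h, w - _, ?_, add_sub_cancel _ _⟩
    rw [Submodule.restrictScalars_mem, B.mem_weylIdeal, map_sub, map_sub, symbol_ofSymbol,
      setZero_setZero, sub_self]

theorem algebraMap_mem_odd (B : Darboux ω 𝔵 ι) {d : ℕ} (hd : ¬ Even d) {t : k}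
    (h : algebraMap k _ t ∈ weylF ω d ⊔ (weylIdeal ω 𝔵).restrictScalars k) : t = 0 := by
  rw [B.mem_weylF_sup, symbol_algebraMap, setZero_C] at h
  by_contra ht
  obtain ⟨j, hj⟩ := h 0 (by rwa [coeff_zero_C])
  rw [map_zero, zero_add] at hj
  exact hd ⟨j, by omega⟩

variable [CharZero k]

theorem exists_sub_mem_weylF (B : Darboux ω 𝔵 ι) {d : ℕ} {w : Weyl ω}
    (h : ∀ v, w * weylV ω v - weylV ω v * w ∈ weylF ω d) :
    ∃ t, w - algebraMap k _ t ∈ weylF ω (d + 1) := by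
  refine ⟨coeff 0 (B.symbol w), ?_⟩
  rw [B.mem_weylF, map_sub, symbol_algebraMap]
  refine parityLE_of_pderiv (by simp) fun i => ?_
  rw [map_sub, pderiv_C, sub_zero, symbol_comm_eq]
  apply B.symbol_mem
  rcases i with i | i
  · rw [Sum.elim_inl, ← neg_sub]; exact neg_mem (h _)
  · exact h _

theorem exists_eq_algebraMap (B : Darboux ω 𝔵 ι) {w : Weyl ω} (h : ∀ v, w * weylV ω v = weylV ω v * w) :
    ∃ t, w = algebraMap k _ t := by
  refine ⟨coeff 0 (B.symbol w), B.symbol_injective ?_⟩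
  rw [symbol_algebraMap]
  refine eq_C_of_pderiv_eq_zero fun i => ?_
  rw [symbol_comm_eq, ← map_zero B.symbol]
  congr 1
  rcases i with i | i
  · exact sub_eq_zero.2 (h _).symm
  · exact sub_eq_zero.2 (h _)

theorem exists_sub_mem_weylF_sup (B : Darboux ω 𝔵 ι) {d : ℕ} {w : Weyl ω}
    (h : ∀ x ∈ 𝔵, weylV ω x * w ∈ weylF ω d ⊔ (weylIdeal ω 𝔵).restrictScalars k) :
    ∃ t, w - algebraMap k _ t ∈ weylF ω (d + 1) ⊔ (weylIdeal ω 𝔵).restrictScalars k := by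
  refine ⟨coeff 0 (B.symbol w), ?_⟩
  rw [B.mem_weylF_sup, map_sub, symbol_algebraMap, map_sub, setZero_C]
  refine parityLE_of_pderiv (by rw [coeff_sub, coeff_zero_setZero]; simp) fun i => ?_
  rw [map_sub, pderiv_C, sub_zero]
  rcases i with i | i
  · have := h _ (B.inr_mem i)
    rw [B.mem_weylF_sup, symbol_weylV_mul, op_inr, map_add, map_mul, setZero_X_inr, zero_mul,
      zero_add, setZero_pderiv_inl] at this
    exact this
  · rw [setZero_pderiv_inr]
    exact zero_mem _

theorem exists_sub_mem_weylIdeal (B : Darboux ω 𝔵 ι) {w : Weyl ω}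
    (h : ∀ x ∈ 𝔵, weylV ω x * w ∈ weylIdeal ω 𝔵) :
    ∃ t, w - algebraMap k _ t ∈ weylIdeal ω 𝔵 := by
  refine ⟨coeff 0 (B.symbol w), ?_⟩
  rw [B.mem_weylIdeal, map_sub, symbol_algebraMap, map_sub, setZero_C, sub_eq_zero,
    ← coeff_zero_setZero]
  refine eq_C_of_pderiv_eq_zero fun i => ?_
  rcases i with i | i
  · have := h _ (B.inr_mem i)
    rw [B.mem_weylIdeal, symbol_weylV_mul, op_inr, map_add, map_mul, setZero_X_inr, zero_mul,
      zero_add, setZero_pderiv_inl] at this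
    exact this
  · rw [setZero_pderiv_inr]

/-- The Poincaré lemma for the Weyl algebra: a closed linear map `c : V → W` is a commutator. -/
theorem exists_comm_eq (B : Darboux ω 𝔵 ι) (c : V →ₗ[k] Weyl ω)
    (hc : ∀ v w, c v * weylV ω w - weylV ω w * c v = c w * weylV ω v - weylV ω v * c w) :
    ∃ u, ∀ v, u * weylV ω v - weylV ω v * u = c v := by
  obtain ⟨p, -, hp⟩ := exists_pderiv_eq (k := k) (σ := ι ⊕ ι)
    (fun i => B.symbol (Sum.elim (fun i => - c (B.basis (Sum.inr i)))
      (fun i => c (B.basis (Sum.inl i))) i)) (fun i j => by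
    rw [symbol_comm_eq, symbol_comm_eq]
    congr 1
    rcases i with i | i <;> rcases j with j | j <;> simp only [Sum.elim_inl, Sum.elim_inr]
    · have := hc (B.basis (Sum.inr i)) (B.basis (Sum.inr j))
      rw [mul_neg, neg_mul, mul_neg, neg_mul, sub_neg_eq_add, sub_neg_eq_add, neg_add_eq_sub,
        neg_add_eq_sub, this]
    · have := hc (B.basis (Sum.inr i)) (B.basis (Sum.inl j))
      rw [mul_neg, neg_mul, sub_neg_eq_add, neg_add_eq_sub, ← neg_sub (c _ * _), ← this]
      abel
    · have := hc (B.basis (Sum.inl i)) (B.basis (Sum.inr j))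
      rw [mul_neg, neg_mul, sub_neg_eq_add, neg_add_eq_sub, ← neg_sub, ← this, neg_sub]
    · exact hc _ _)
  refine ⟨B.ofSymbol p, fun v => ?_⟩
  have key : ∀ i, B.ofSymbol p * weylV ω (B.basis i) - weylV ω (B.basis i) * B.ofSymbol p =
      c (B.basis i) := fun i => by
    apply B.symbol_injective
    rcases i with i | i
    · rw [symbol_comm_inl, symbol_ofSymbol, hp]; rfl
    · rw [← neg_sub, map_neg, symbol_comm_inr, symbol_ofSymbol, hp, ← map_neg, Sum.elim_inl,
        neg_neg]
  induction B.basis.mem_span v using Submodule.span_induction with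
  | mem v hv => obtain ⟨i, rfl⟩ := hv; exact key i
  | zero => simp
  | add x y _ _ hx hy => rw [map_add, map_add, mul_add, add_mul, ← hx, ← hy]; abel
  | smul t x _ hx => rw [map_smul, map_smul, mul_smul_comm, smul_mul_assoc, ← smul_sub, hx]

theorem exists_comm_eq_mem (B : Darboux ω 𝔵 ι) {d : ℕ} (c : V →ₗ[k] Weyl ω) (hd : ∀ v, c v ∈ weylF ω d)
    (hc : ∀ v w, c v * weylV ω w - weylV ω w * c v = c w * weylV ω v - weylV ω v * c w) :
    ∃ u ∈ weylF ω (d + 1), ∀ v, u * weylV ω v - weylV ω v * u = c v := by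
  obtain ⟨u, hu⟩ := B.exists_comm_eq c hc
  obtain ⟨t, ht⟩ := B.exists_sub_mem_weylF (d := d) (w := u) (fun v => by rw [hu]; exact hd v)
  refine ⟨_, ht, fun v => ?_⟩
  rw [sub_mul, mul_sub, Algebra.commutes, ← hu]
  abel

end Darboux

section Finite

variable {k V ι : Type*} [Field k] [AddCommGroup V] [Module k V] {ω : SymplecticForm k V}
  {𝔵 : Submodule k V}

theorem Darboux.finiteDimensional_gr [Fintype ι] (B : Darboux ω 𝔵 ι) (d : ℕ) :
    FiniteDimensional k (gr ω d) := by
  have hfin : {a | ∃ (j : ℕ) (m : ι ⊕ ι →₀ ℕ), m.degree + 2 * j = d ∧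
      a = hbarD ω ^ j * B.normal m}.Finite := by
    refine Set.Finite.subset (((Set.finite_Iic d).prod
      (Finsupp.finite_of_degree_le (σ := ι ⊕ ι) d)).image
        fun p => hbarD ω ^ p.1 * B.normal p.2) ?_
    rintro _ ⟨j, m, h, rfl⟩
    exact ⟨(j, m), ⟨Set.mem_Iic.2 (by omega), by change m.degree ≤ d; omega⟩, rfl⟩
  have := FiniteDimensional.span_of_finite k hfin
  exact Submodule.finiteDimensional_of_le (B.gr_le_span_normal d)

theorem Darboux.finiteDimensional_weylF [Fintype ι] (B : Darboux ω 𝔵 ι) (d : ℕ) :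
    FiniteDimensional k (weylF ω d) := by
  have := B.finiteDimensional_gr d
  exact inferInstanceAs (FiniteDimensional k ((gr ω d).map (toWeyl ω).toLinearMap))

end Finite

/-! ### Quadratic elements and the trace -/

section Quadratic

variable {k V : Type*} [Field k] [AddCommGroup V] [Module k V] {ω : SymplecticForm k V}

theorem gr_zero_le : gr ω 0 ≤ Submodule.span k {1} := by
  rw [gr, Submodule.span_le]
  intro a ha
  generalize hd : 0 = d at ha
  cases ha with
  | one => exact Submodule.subset_span rfl
  | incl_mul => omega
  | hbar_mul => omega

theorem gr_one_le : gr ω 1 ≤ LinearMap.range (incl ω) := by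
  rw [gr, Submodule.span_le]
  intro a ha
  generalize hd : 1 = d at ha
  cases ha with
  | one => omega
  | @incl_mul v d m hm =>
    have : d = 0 := by omega
    subst this
    obtain ⟨t, rfl⟩ := Submodule.mem_span_singleton.1 (gr_zero_le (Submodule.subset_span hm))
    exact ⟨t • v, by rw [map_smul, mul_smul_comm, mul_one]⟩
  | hbar_mul => omega

theorem gr_succ_le_span (d : ℕ) : gr ω (d + 1) ≤ Submodule.span k
    ({a | ∃ v, ∃ m ∈ gr ω d, a = incl ω v * m} ∪
      {a | ∃ e, e + 1 = d ∧ ∃ m ∈ gr ω e, a = hbarD ω * m}) := by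
  rw [gr, Submodule.span_le]
  intro a ha
  generalize hd : d + 1 = d' at ha
  refine Submodule.subset_span ?_
  cases ha with
  | one => omega
  | @incl_mul v d'' m hm =>
    have : d'' = d := by omega
    subst this
    exact Or.inl ⟨v, m, Submodule.subset_span hm, rfl⟩
  | @hbar_mul d'' m hm =>
    exact Or.inr ⟨d'', by omega, m, Submodule.subset_span hm, rfl⟩

theorem gr_two_le : gr ω 2 ≤ Submodule.span k
    ({a | ∃ v w, a = incl ω v * incl ω w} ∪ {hbarD ω}) := by
  refine (gr_succ_le_span 1).trans (Submodule.span_le.2 ?_)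
  rintro _ (⟨v, m, hm, rfl⟩ | ⟨e, he, m, hm, rfl⟩)
  · obtain ⟨w, rfl⟩ := gr_one_le hm
    exact Submodule.subset_span (Or.inl ⟨v, w, rfl⟩)
  · have : e = 0 := by omega
    subst this
    obtain ⟨t, rfl⟩ := Submodule.mem_span_singleton.1 (gr_zero_le hm)
    rw [mul_smul_comm, mul_one]
    exact Submodule.smul_mem _ _ (Submodule.subset_span (Or.inr rfl))

/-- The span of the `(1/ħ) [p, p']` with `p, p' ∈ D²`. -/
def commSpan (ω : SymplecticForm k V) : Submodule k (HWeyl ω) :=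
  Submodule.span k {w | w ∈ gr ω 2 ∧ ∃ p ∈ gr ω 2, ∃ p' ∈ gr ω 2, p * p' - p' * p = hbarD ω * w}

theorem commSpan_le : commSpan ω ≤ gr ω 2 := Submodule.span_le.2 fun _ h => h.1

theorem incl_mul_self_mem_commSpan [CharZero k] (v : V) :
    incl ω v * incl ω v ∈ commSpan ω := by
  by_cases hv : v = 0
  · subst hv; rw [map_zero, mul_zero]; exact zero_mem _
  · obtain ⟨z, hz⟩ : ∃ z, ω.form v z ≠ 0 := by
      by_contra h
      push Not at h
      exact hv (ω.nondegenerate v h)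
    have hz' : ω.form z v ≠ 0 := by rwa [form_neg, neg_ne_zero]
    have hvv : incl ω v * incl ω v ∈ gr ω 2 :=
      mul_mem_gr (i := 1) (j := 1) (incl_mem_gr v) (incl_mem_gr v)
    have key : incl ω v * incl ω z * (incl ω v * incl ω v) -
        incl ω v * incl ω v * (incl ω v * incl ω z) =
        hbarD ω * ((2 * ω.form z v) • (incl ω v * incl ω v)) := by
      have e := incl_comm ω z v
      have c := hbarD_comm_incl ω v
      have e1 : incl ω z * incl ω v = incl ω v * incl ω z + ω.form z v • hbarD ω := by
        rw [← e]; abel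
      have e2 : incl ω z * (incl ω v * incl ω v) =
          incl ω v * incl ω v * incl ω z + (2 * ω.form z v) • (hbarD ω * incl ω v) := by
        rw [← mul_assoc, e1, add_mul, mul_assoc, e1, mul_add, smul_mul_assoc, mul_smul_comm, c,
          two_mul, add_smul, ← mul_assoc, add_assoc]
      rw [mul_assoc, e2, mul_add, mul_smul_comm, mul_smul_comm, ← mul_assoc (incl ω v) (hbarD ω),
        ← c, ← mul_assoc (hbarD ω), mul_assoc (incl ω v) (incl ω v) (incl ω v * incl ω z),
        mul_assoc (incl ω v) (incl ω v) (incl ω z), add_sub_cancel_left]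
    have h2 : (2 * ω.form z v) • (incl ω v * incl ω v) ∈ commSpan ω :=
      Submodule.subset_span ⟨Submodule.smul_mem _ _ hvv, incl ω v * incl ω z,
        mul_mem_gr (i := 1) (j := 1) (incl_mem_gr v) (incl_mem_gr z), incl ω v * incl ω v, hvv, key⟩
    have := Submodule.smul_mem _ (2 * ω.form z v)⁻¹ h2
    rwa [smul_smul, inv_mul_cancel₀ (mul_ne_zero two_ne_zero hz'), one_smul] at this

/-- `D²` is spanned by `ħ` and by the commutators `(1/ħ) [p, p']`. -/
theorem exists_sub_mem_commSpan [CharZero k] {a : HWeyl ω} (ha : a ∈ gr ω 2) :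
    ∃ t : k, a - t • hbarD ω ∈ commSpan ω := by
  have h := gr_two_le ha
  clear ha
  induction h using Submodule.span_induction with
  | mem a h =>
    rcases h with ⟨v, w, rfl⟩ | rfl
    · refine ⟨2⁻¹ * ω.form v w, ?_⟩
      have h1 := sub_mem (sub_mem (incl_mul_self_mem_commSpan (ω := ω) (v + w))
        (incl_mul_self_mem_commSpan v)) (incl_mul_self_mem_commSpan w)
      have h2 := Submodule.smul_mem _ (2⁻¹ : k) h1
      convert h2 using 1
      rw [mul_smul, ← incl_comm, map_add]
      have : incl ω v * incl ω w = (2⁻¹ : k) • ((2 : k) • (incl ω v * incl ω w)) := by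
        rw [smul_smul, inv_mul_cancel₀ two_ne_zero, one_smul]
      nth_rewrite 1 [this]
      rw [← smul_sub, two_smul]
      congr 1
      noncomm_ring
    · exact ⟨1, by rw [one_smul, sub_self]; exact zero_mem _⟩
  | zero => exact ⟨0, by rw [zero_smul, sub_self]; exact zero_mem _⟩
  | add x y _ _ hx hy =>
    obtain ⟨s, hs⟩ := hx
    obtain ⟨t, ht⟩ := hy
    refine ⟨s + t, ?_⟩
    have := add_mem hs ht
    rwa [sub_add_sub_comm, ← add_smul] at this
  | smul c x _ hx =>
    obtain ⟨s, hs⟩ := hx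
    refine ⟨c * s, ?_⟩
    have := Submodule.smul_mem _ c hs
    rwa [smul_sub, smul_smul] at this

end Quadratic

namespace Darboux

open MvPolynomial

variable {k V ι : Type*} [Field k] [CharZero k] [AddCommGroup V] [Module k V]
  {ω : SymplecticForm k V} {𝔵 : Submodule k V} [Fintype ι] (B : Darboux ω 𝔵 ι)

/-- The contraction of the symbol with the Poisson bivector of the Darboux basis. -/
def contraction : Weyl ω →ₗ[k] k where
  toFun w := ∑ l, constantCoeff (pderiv (Sum.inl l) (pderiv (Sum.inr l) (B.symbol w)))
  map_add' a b := by simp only [map_add, Finset.sum_add_distrib]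
  map_smul' t a := by
    simp only [map_smul, Derivation.map_smul, RingHom.id_apply, Finset.smul_sum]
    refine Finset.sum_congr rfl fun l _ => ?_
    rw [smul_eq_C_mul, map_mul, constantCoeff_C, smul_eq_mul]

/-- The constant term of an element of the Weyl algebra in the Weyl ordering, for elements of
degree at most two. -/
def weylConst : Weyl ω →ₗ[k] k where
  toFun w := constantCoeff (B.symbol w) - 2⁻¹ * B.contraction w
  map_add' a b := by simp only [map_add]; ring
  map_smul' t a := by
    simp only [map_smul, RingHom.id_apply, smul_eq_mul]
    rw [smul_eq_C_mul, map_mul, constantCoeff_C]; ring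

theorem weylConst_mul (v w : V) : B.weylConst (weylV ω v * weylV ω w) = 2⁻¹ * ω.form v w := by
  classical
  have h : ∀ i j, B.weylConst (weylV ω (B.basis i) * weylV ω (B.basis j)) =
      2⁻¹ * ω.form (B.basis i) (B.basis j) := fun i j => by
    have hs : B.symbol (weylV ω (B.basis i) * weylV ω (B.basis j)) =
        B.op (B.basis i) (B.op (B.basis j) 1) := by
      rw [symbol_weylV_mul, ← mul_one (weylV ω _), symbol_weylV_mul, symbol_one]
    change constantCoeff (B.symbol _) - 2⁻¹ * ∑ l, constantCoeff (pderiv (Sum.inl l)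
      (pderiv (Sum.inr l) (B.symbol _))) = _
    rw [hs]
    rcases i with i | i <;> rcases j with j | j
    · simp [B.form_inl, op_inl, pderiv_X]
    · rw [form_neg, B.form_inr_inl]
      have e : ∀ l, constantCoeff (pderiv (Sum.inl l) (pderiv (Sum.inr l)
          (B.op (B.basis (Sum.inl i)) (B.op (B.basis (Sum.inr j)) 1)))) =
          if i = l then if j = l then 1 else 0 else 0 := fun l => by
        simp only [op_inl, op_inr, mul_one, pderiv_one, add_zero, Derivation.leibniz, pderiv_X,
          Pi.single_apply, Sum.inr.injEq, Sum.inl.injEq, reduceCtorEq, if_false, smul_zero,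
          smul_eq_mul]
        split_ifs <;> simp_all [pderiv_X, Pi.single_apply]
      simp only [e]
      simp [op_inl, op_inr]
    · rw [B.form_inr_inl]
      have e : ∀ l, constantCoeff (pderiv (Sum.inl l) (pderiv (Sum.inr l)
          (B.op (B.basis (Sum.inr i)) (B.op (B.basis (Sum.inl j)) 1)))) =
          if i = l then if j = l then 1 else 0 else 0 := fun l => by
        simp only [op_inl, op_inr, mul_one, map_add, Derivation.leibniz, pderiv_X,
          Pi.single_apply, Sum.inr.injEq, Sum.inl.injEq, reduceCtorEq, if_false, smul_zero,
          smul_eq_mul]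
        split_ifs <;> simp_all [pderiv_X, Pi.single_apply]
      simp only [e]
      simp [op_inl, op_inr, pderiv_X, Pi.single_apply]
      by_cases h : i = j
      · subst h; simp; norm_num
      · simp [h, Ne.symm h]
    · simp [B.form_inr, op_inr, pderiv_X]
  induction B.basis.mem_span v using Submodule.span_induction with
  | mem v hv =>
    obtain ⟨i, rfl⟩ := hv
    induction B.basis.mem_span w using Submodule.span_induction with
    | mem w hw => obtain ⟨j, rfl⟩ := hw; exact h i j
    | zero => simp
    | add x y _ _ hx hy => simp only [map_add, mul_add, hx, hy]
    | smul t x _ hx =>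
      simp only [map_smul, mul_smul_comm, hx, smul_eq_mul]; ring
  | zero => simp
  | add x y _ _ hx hy => simp only [map_add, LinearMap.add_apply, add_mul, mul_add, hx, hy]
  | smul t x _ hx =>
    simp only [map_smul, LinearMap.smul_apply, smul_mul_assoc, hx, smul_eq_mul]; ring

theorem weylConst_comm_mul (v w v' w' : V) :
    B.weylConst (weylV ω v * weylV ω w * (weylV ω v' * weylV ω w') -
      weylV ω v' * weylV ω w' * (weylV ω v * weylV ω w)) = 0 := by
  set f := weylV ω
  have c : ∀ a b, f a * f b = f b * f a + algebraMap k _ (ω.form a b) := fun a b => by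
    rw [← weylV_comm]; abel
  have e : f v * f w * (f v' * f w') - f v' * f w' * (f v * f w) =
      f v * (f w * f v' - f v' * f w) * f w' + f v' * f v * (f w * f w' - f w' * f w) +
      (f v * f v' - f v' * f v) * f w * f w' + f v' * (f v * f w' - f w' * f v) * f w +
      f v' * f v * f w' * f w - f v' * f v * f w' * f w := by noncomm_ring
  rw [e]
  simp only [f, weylV_comm, add_sub_cancel_right, Algebra.algebraMap_eq_smul_one, mul_smul_comm,
    smul_mul_assoc, mul_one, one_mul, map_add, map_smul, weylConst_mul, smul_eq_mul]
  rw [form_neg ω v' v, form_neg ω v' w]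
  ring

theorem weylConst_eq_zero {a : HWeyl ω} (ha : a ∈ commSpan ω) : B.weylConst (toWeyl ω a) = 0 := by
  have key : ∀ p ∈ gr ω 2, ∀ p' ∈ gr ω 2, B.weylConst (toWeyl ω p * toWeyl ω p' -
      toWeyl ω p' * toWeyl ω p) = 0 := by
    intro p hp p' hp'
    replace hp := gr_two_le hp
    replace hp' := gr_two_le hp'
    induction hp using Submodule.span_induction with
    | mem p h =>
      rcases h with ⟨v, w, rfl⟩ | rfl
      · induction hp' using Submodule.span_induction with
        | mem p' h =>
          rcases h with ⟨v', w', rfl⟩ | rfl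
          · rw [map_mul, map_mul]; exact B.weylConst_comm_mul v w v' w'
          · rw [toWeyl_hbar, mul_one, one_mul, sub_self, map_zero]
        | zero => simp
        | add x y _ _ hx hy =>
          rw [map_add, mul_add, add_mul, add_sub_add_comm, map_add, hx, hy, add_zero]
        | smul t x _ hx =>
          rw [map_smul, mul_smul_comm, smul_mul_assoc, ← smul_sub, map_smul, hx, smul_zero]
      · rw [toWeyl_hbar, mul_one, one_mul, sub_self, map_zero]
    | zero => simp
    | add x y _ _ hx hy =>
      rw [map_add, mul_add, add_mul, add_sub_add_comm, map_add, hx, hy, add_zero]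
    | smul t x _ hx =>
      rw [map_smul, mul_smul_comm, smul_mul_assoc, ← smul_sub, map_smul, hx, smul_zero]
  induction ha using Submodule.span_induction with
  | mem a h =>
    obtain ⟨_, p, hp, p', hp', e⟩ := h
    have := congrArg (toWeyl ω) e
    rw [map_sub, map_mul, map_mul, map_mul, toWeyl_hbar, one_mul] at this
    rw [← this]
    exact key p hp p' hp'
  | zero => simp
  | add x y _ _ hx hy => rw [map_add, map_add, hx, hy, add_zero]
  | smul t x _ hx => rw [map_smul, map_smul, hx, smul_zero]

/-- The scalar by which a quadratic element acts on the generator of `W / W𝔵` is half the trace of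
the corresponding endomorphism of `𝔵`, up to sign. -/
theorem eq_neg_half_trace {q : Weyl ω} {s : V →ₗ[k] V} {κ : k} (hq : B.weylConst q = 0)
    (hs : ∀ v, q * weylV ω v - weylV ω v * q = weylV ω (s v))
    (h𝔵 : ∀ v ∈ 𝔵, s v ∈ 𝔵) (hκ : q - algebraMap k _ κ ∈ weylIdeal ω 𝔵) :
    κ = -2⁻¹ * LinearMap.trace k 𝔵 (s.restrict h𝔵) := by
  classical
  have h1 : constantCoeff (B.symbol q) = κ := by
    rw [B.mem_weylIdeal, map_sub, symbol_algebraMap, map_sub, setZero_C, sub_eq_zero] at hκ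
    rw [constantCoeff_eq, ← coeff_zero_setZero, hκ, coeff_zero_C]
  have h2 : constantCoeff (B.symbol q) - 2⁻¹ * B.contraction q = 0 := hq
  have hli : LinearIndependent k fun i => (⟨B.basis (Sum.inr i), B.inr_mem i⟩ : 𝔵) := by
    have := B.basis.linearIndependent.comp Sum.inr Sum.inr_injective
    exact LinearIndependent.of_comp 𝔵.subtype this
  have hsp : ⊤ ≤ Submodule.span k
      (Set.range fun i => (⟨B.basis (Sum.inr i), B.inr_mem i⟩ : 𝔵)) := by
    rintro ⟨x, hx⟩ -
    have hx' : x ∈ Submodule.span k (Set.range fun i => B.basis (Sum.inr i)) := by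
      rwa [B.span_inr]
    have hm : x ∈ (Submodule.span k (Set.range fun i =>
        (⟨B.basis (Sum.inr i), B.inr_mem i⟩ : 𝔵))).map 𝔵.subtype := by
      rw [Submodule.map_span, ← Set.range_comp]
      exact hx'
    obtain ⟨y, hy, e⟩ := hm
    obtain rfl : y = ⟨x, hx⟩ := Subtype.ext e
    exact hy
  let b := Module.Basis.mk hli hsp
  have hb : ∀ i, (b i : V) = B.basis (Sum.inr i) := fun i => by
    rw [Module.Basis.mk_apply]
  have hrepr : ∀ (x : 𝔵) (i : ι), b.repr x i = B.basis.repr (x : V) (Sum.inr i) := fun x i => by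
    have h : x = ∑ j, b.repr x j • b j := (b.sum_repr x).symm
    have h' := congrArg (fun y : 𝔵 => B.basis.repr (y : V) (Sum.inr i)) h
    simp only [Submodule.coe_sum, Submodule.coe_smul, map_sum, map_smul, hb,
      Module.Basis.repr_self, Finsupp.coe_finsetSum, Finset.sum_apply, Finsupp.smul_apply,
      Finsupp.single_apply, smul_eq_mul, Sum.inr.injEq, mul_ite, mul_one, mul_zero,
      Finset.sum_ite_eq', Finset.mem_univ, if_true] at h'
    exact h'.symm
  have hcoord : ∀ (v : V) (l : ι), B.basis.repr v (Sum.inr l) =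
      constantCoeff (pderiv (Sum.inr l) (B.symbol (weylV ω v))) := fun v l => by
    induction B.basis.mem_span v using Submodule.span_induction with
    | mem v hv =>
      obtain ⟨i, rfl⟩ := hv
      rw [← mul_one (weylV ω _), symbol_weylV_mul, symbol_one, Module.Basis.repr_self]
      rcases i with i | i
      · rw [op_inl, mul_one, pderiv_X_of_ne (by simp)]; simp
      · rw [op_inr, mul_one, pderiv_one, add_zero, pderiv_X]
        by_cases h : i = l
        · subst h; simp
        · rw [Pi.single_eq_of_ne (by simpa using h), Finsupp.single_eq_of_ne (by simpa using Ne.symm h)]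
          simp
    | zero => simp
    | add x y _ _ hx hy => simp only [map_add, Finsupp.add_apply, hx, hy]
    | smul t x _ hx =>
      rw [map_smul, map_smul, map_smul, Derivation.map_smul, Finsupp.smul_apply, hx,
        smul_eq_C_mul, map_mul, constantCoeff_C, smul_eq_mul]
  have h3 : LinearMap.trace k 𝔵 (s.restrict h𝔵) = - B.contraction q := by
    rw [LinearMap.trace_eq_matrix_trace k b, Matrix.trace]
    change _ = - ∑ l, constantCoeff (pderiv (Sum.inl l) (pderiv (Sum.inr l) (B.symbol q)))
    rw [← Finset.sum_neg_distrib]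
    refine Finset.sum_congr rfl fun l _ => ?_
    rw [Matrix.diag_apply, LinearMap.toMatrix_apply, hrepr, LinearMap.coe_restrict_apply, hb,
      hcoord, ← hs, ← neg_sub, map_neg, symbol_comm_inr, map_neg, map_neg, pderiv_comm]
  rw [h3, ← h1]
  linear_combination h2

end Darboux

/-! ### The completed Weyl algebra -/

section Completed

variable {k V : Type*} [Field k] [AddCommGroup V] [Module k V] {ω : SymplecticForm k V}

open PowerSeries

theorem coeff_rho (x : FWeyl ω) (d : ℕ) : coeff d (rho x) = toWeyl ω (FWeyl.comp d x) := rfl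

theorem coeff_rho_mem (x : FWeyl ω) (d : ℕ) : coeff d (rho x) ∈ weylF ω d :=
  toWeyl_mem (FWeyl.comp_mem x d)

theorem comp_ofV (v : V) (d : ℕ) :
    FWeyl.comp d (FWeyl.ofV v : FWeyl ω) = if d = 1 then incl ω v else 0 :=
  FWeyl.comp_mk _ (fun i => by
    split_ifs with h
    · exact h ▸ incl_mem_gr v
    · exact zero_mem _) _

theorem rho_ofV (v : V) : rho (FWeyl.ofV v : FWeyl ω) = C (weylV ω v) * X := by
  ext d
  rw [coeff_rho, comp_ofV]
  rcases d with _ | d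
  · simp
  · rw [coeff_succ_mul_X, coeff_C]
    by_cases h : d = 0
    · subst h; rfl
    · rw [if_neg (by omega), if_neg h, map_zero]

theorem rho_ofV' (v : V) : rho (FWeyl.ofV v : FWeyl ω) = X * C (weylV ω v) := by
  rw [rho_ofV]; exact (commute_X _).eq

theorem rho_hbar : rho (FWeyl.hbar ω) = X ^ 2 := by
  ext d
  rw [coeff_rho, FWeyl.comp_hbar, coeff_X_pow]
  split_ifs
  · rw [toWeyl_hbar]
  · rw [map_zero]

theorem coeff_rho_algebraMap_even (c : k⟦X⟧) (m : ℕ) :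
    coeff (2 * m) (rho (algebraMap k⟦X⟧ (FWeyl ω) c)) = algebraMap k _ (coeff m c) := by
  rw [coeff_rho]
  change toWeyl ω (FWeyl.comp (2 * m) (FWeyl.ofKFun c)) = _
  rw [FWeyl.comp_ofKFun_even, map_smul, map_pow, toWeyl_hbar, one_pow,
    Algebra.algebraMap_eq_smul_one]

theorem coeff_rho_algebraMap_odd (c : k⟦X⟧) {d : ℕ} (h : ¬ Even d) :
    coeff d (rho (algebraMap k⟦X⟧ (FWeyl ω) c)) = 0 := by
  rw [coeff_rho]
  change toWeyl ω (FWeyl.comp d (FWeyl.ofKFun c)) = _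
  rw [FWeyl.comp_ofKFun_odd _ h, map_zero]

theorem rho_smul (t : k) (x : FWeyl ω) : rho (t • x) = t • rho x := by
  ext d
  rw [coeff_rho, map_smul, map_smul]; rfl

theorem exists_rho_eq (s : WSer ω) (h : ∀ d, coeff d s ∈ weylF ω d) : ∃ x : FWeyl ω, rho x = s := by
  choose a ha e using h
  refine ⟨FWeyl.mk a ha, PowerSeries.ext fun d => ?_⟩
  rw [coeff_rho, FWeyl.comp_mk]
  exact e d

/-- The elements of `W⟦t⟧` all of whose coefficients lie in the left ideal `W 𝔵`. -/
def serIdeal (ω : SymplecticForm k V) (𝔵 : Submodule k V) : Ideal (WSer ω) where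
  carrier := {s | ∀ d, coeff d s ∈ weylIdeal ω 𝔵}
  add_mem' h h' d := by rw [map_add]; exact add_mem (h d) (h' d)
  zero_mem' d := by rw [map_zero]; exact zero_mem _
  smul_mem' a s h d := by
    rw [smul_eq_mul, coeff_mul]
    exact sum_mem fun p _ => Ideal.mul_mem_left _ _ (h _)

theorem mem_serIdeal {𝔵 : Submodule k V} {s : WSer ω} :
    s ∈ serIdeal ω 𝔵 ↔ ∀ d, coeff d s ∈ weylIdeal ω 𝔵 := Iff.rfl

theorem mul_X_mem_serIdeal {𝔵 : Submodule k V} {s : WSer ω} (h : s ∈ serIdeal ω 𝔵) :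
    s * X ∈ serIdeal ω 𝔵 := by
  rw [(commute_X s).eq]; exact Ideal.mul_mem_left _ _ h

theorem C_mem_serIdeal {𝔵 : Submodule k V} {a : Weyl ω} (h : a ∈ weylIdeal ω 𝔵) :
    (C a : WSer ω) ∈ serIdeal ω 𝔵 := fun d => by
  rw [coeff_C]; split_ifs
  · exact h
  · exact zero_mem _

theorem rho_mem_serIdeal_of_mem {𝔵 : Submodule k V} {x : FWeyl ω} (h : x ∈ leftIdeal ω 𝔵) :
    rho x ∈ serIdeal ω 𝔵 := by
  have : leftIdeal ω 𝔵 ≤ (serIdeal ω 𝔵).comap rho := by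
    refine Ideal.span_le.2 ?_
    rintro _ ⟨v, hv, rfl⟩
    change rho _ ∈ serIdeal ω 𝔵
    rw [rho_ofV]
    exact mul_X_mem_serIdeal (C_mem_serIdeal (Ideal.subset_span ⟨v, hv, rfl⟩))
  exact this h

namespace FWeyl

theorem mul_mem_filt_add {i j : ℕ} {x y : FWeyl ω} (hx : x ∈ filt ω i) (hy : y ∈ filt ω j) :
    x * y ∈ filt ω (i + j) := fun d hd => by
  rw [comp_mul]
  refine Finset.sum_eq_zero fun p hp => ?_
  rw [Finset.HasAntidiagonal.mem_antidiagonal] at hp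
  by_cases h : p.1 < i
  · rw [hx _ h, zero_mul]
  · rw [hy p.2 (by omega), mul_zero]

theorem mul_mem_filt_right (a : FWeyl ω) {j : ℕ} {x : FWeyl ω} (hx : x ∈ filt ω j) :
    x * a ∈ filt ω j := by
  have := mul_mem_filt_add hx (show a ∈ filt ω 0 from fun i hi => absurd hi (by omega))
  rwa [add_zero] at this

theorem ofV_mem_filt (v : V) : (ofV v : FWeyl ω) ∈ filt ω 1 := fun i hi => by
  rw [comp_ofV, if_neg (by omega)]

theorem mem_filt_zero (x : FWeyl ω) : x ∈ filt ω 0 := fun i hi => absurd hi (by omega)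

theorem eq_zero_of_forall_mem_filt {x : FWeyl ω} (h : ∀ n, x ∈ filt ω n) : x = 0 :=
  ext fun i => by rw [h (i + 1) i (by omega), map_zero]

theorem exists_sub_mem_filt_one (x : FWeyl ω) : ∃ t : k, x - algebraMap k _ t ∈ filt ω 1 := by
  obtain ⟨t, ht⟩ := Submodule.mem_span_singleton.1 (gr_zero_le (comp_mem x 0))
  refine ⟨t, fun i hi => ?_⟩
  obtain rfl : i = 0 := by omega
  rw [map_sub, Algebra.algebraMap_eq_smul_one, map_smul, comp_one, if_pos rfl, ht, sub_self]

/-- An element of `𝒟` with nonzero constant term is a unit. -/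
theorem isUnit_of_not_mem_filt_one {x : FWeyl ω} (h : x ∉ filt ω 1) : IsUnit x := by
  obtain ⟨t, ht⟩ := exists_sub_mem_filt_one x
  have ht0 : t ≠ 0 := by rintro rfl; rw [map_zero, sub_zero] at ht; exact h ht
  set u : (HWeyl ω)ˣ := Units.map (algebraMap k (HWeyl ω)).toMonoidHom (Units.mk0 t ht0)
  have hu : PowerSeries.constantCoeff (toSeries x) = u := by
    have := ht 0 (by omega)
    rw [map_sub, sub_eq_zero, Algebra.algebraMap_eq_smul_one, map_smul, comp_one, if_pos rfl] at this
    rw [← PowerSeries.coeff_zero_eq_constantCoeff_apply]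
    exact this.trans (Algebra.algebraMap_eq_smul_one t).symm
  have hinv : ((u⁻¹ : (HWeyl ω)ˣ) : HWeyl ω) = algebraMap k _ t⁻¹ := rfl
  have hm : ∀ d, PowerSeries.coeff d (PowerSeries.invOfUnit (toSeries x) u) ∈ gr ω d := by
    intro d
    induction d using Nat.strong_induction_on with
    | _ d ih =>
      rw [PowerSeries.coeff_invOfUnit]
      split_ifs with hd
      · subst hd
        rw [hinv, Algebra.algebraMap_eq_smul_one]; exact Submodule.smul_mem _ _ one_mem_gr
      · rw [hinv, ← map_neg, ← Algebra.smul_def]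
        refine Submodule.smul_mem _ _ (sum_mem fun p hp => ?_)
        rw [Finset.HasAntidiagonal.mem_antidiagonal] at hp
        split_ifs with h2
        · rw [← hp]; exact mul_mem_gr (comp_mem x _) (ih _ h2)
        · exact zero_mem _
  let y : FWeyl ω := ⟨PowerSeries.invOfUnit (toSeries x) u, hm⟩
  exact ⟨⟨x, y, Subtype.ext (PowerSeries.mul_invOfUnit _ u hu),
    Subtype.ext (PowerSeries.invOfUnit_mul _ u hu)⟩, rfl⟩

end FWeyl

end Completed

namespace Darboux

open PowerSeries

variable {k V ι : Type*} [Field k] [AddCommGroup V] [Module k V]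
  {ω : SymplecticForm k V} {𝔵 : Submodule k V} [Fintype ι]

theorem rho_injective (B : Darboux ω 𝔵 ι) : Function.Injective (rho (ω := ω)) := by
  rw [injective_iff_map_eq_zero]
  intro x hx
  refine FWeyl.ext fun d => ?_
  rw [map_zero]
  refine B.eq_zero_of_toWeyl_eq_zero (FWeyl.comp_mem x d) ?_
  rw [← coeff_rho, hx, map_zero]

theorem exists_eq_sum_of_mem_gr_succ (B : Darboux ω 𝔵 ι) [Nonempty ι] {d : ℕ} {a : HWeyl ω}
    (ha : a ∈ gr ω (d + 1)) : ∃ y : ι ⊕ ι → HWeyl ω, (∀ i, y i ∈ gr ω d) ∧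
      a = ∑ i, incl ω (B.basis i) * y i := by
  let S : Submodule k (HWeyl ω) :=
    { carrier := {a | ∃ y : ι ⊕ ι → HWeyl ω, (∀ i, y i ∈ gr ω d) ∧
        a = ∑ i, incl ω (B.basis i) * y i}
      add_mem' := by
        rintro _ _ ⟨y, hy, rfl⟩ ⟨z, hz, rfl⟩
        exact ⟨y + z, fun i => add_mem (hy i) (hz i), by
          rw [← Finset.sum_add_distrib]; simp only [Pi.add_apply, mul_add]⟩
      zero_mem' := ⟨0, fun _ => zero_mem _, by simp⟩
      smul_mem' := by
        rintro t _ ⟨y, hy, rfl⟩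
        exact ⟨t • y, fun i => Submodule.smul_mem _ _ (hy i), by
          rw [Finset.smul_sum]; simp only [Pi.smul_apply, mul_smul_comm]⟩ }
  have hS : ∀ {a}, a ∈ S ↔ ∃ y : ι ⊕ ι → HWeyl ω, (∀ i, y i ∈ gr ω d) ∧
      a = ∑ i, incl ω (B.basis i) * y i := Iff.rfl
  rw [← hS]
  have key : ∀ v, ∀ m ∈ gr ω d, incl ω v * m ∈ S := by
    intro v m hm
    rw [hS]
    refine ⟨fun i => B.basis.repr v i • m, fun i => Submodule.smul_mem _ _ hm, ?_⟩
    conv_lhs => rw [← B.basis.sum_repr v]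
    rw [map_sum, Finset.sum_mul]
    refine Finset.sum_congr rfl fun i _ => ?_
    rw [map_smul, smul_mul_assoc, mul_smul_comm]
  refine Submodule.span_le.2 ?_ (gr_succ_le_span d ha)
  rintro _ (⟨v, m, hm, rfl⟩ | ⟨e, rfl, m, hm, rfl⟩)
  · exact key v m hm
  · obtain ⟨i⟩ := ‹Nonempty ι›
    classical
    have h := incl_comm ω (B.basis (Sum.inr i)) (B.basis (Sum.inl i))
    rw [B.form_inr_inl, if_pos rfl, one_smul] at h
    rw [← h, sub_mul, mul_assoc, mul_assoc]
    have h1 : ∀ v, incl ω v * m ∈ gr ω (e + 1) := fun v => by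
      rw [add_comm]; exact mul_mem_gr (incl_mem_gr v) hm
    exact sub_mem (key _ _ (h1 _)) (key _ _ (h1 _))

theorem exists_eq_sum_of_mem_filt (B : Darboux ω 𝔵 ι) [Nonempty ι] {j : ℕ} {x : FWeyl ω}
    (hx : x ∈ FWeyl.filt ω (j + 1)) : ∃ y : ι ⊕ ι → FWeyl ω, (∀ i, y i ∈ FWeyl.filt ω j) ∧
      x = ∑ i, FWeyl.ofV (B.basis i) * y i := by
  have h : ∀ d, ∃ y : ι ⊕ ι → HWeyl ω, (∀ i, y i ∈ gr ω d) ∧ (d < j → y = 0) ∧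
      FWeyl.comp (d + 1) x = ∑ i, incl ω (B.basis i) * y i := by
    intro d
    by_cases hd : d < j
    · exact ⟨0, fun _ => zero_mem _, fun _ => rfl, by simp [hx (d + 1) (by omega)]⟩
    · obtain ⟨y, hy, e⟩ := B.exists_eq_sum_of_mem_gr_succ (FWeyl.comp_mem x (d + 1))
      exact ⟨y, hy, fun h => absurd h hd, e⟩
  choose y hy hj e using h
  refine ⟨fun i => FWeyl.mk (fun d => y d i) fun d => hy d i, fun i d hd => ?_, ?_⟩
  · rw [FWeyl.comp_mk, hj d hd]; rfl
  · refine FWeyl.ext fun d => ?_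
    rw [map_sum]
    rcases d with _ | d
    · rw [hx 0 (by omega)]
      refine (Finset.sum_eq_zero fun i _ => ?_).symm
      exact FWeyl.mul_mem_filt_right _ (FWeyl.ofV_mem_filt _) 0 (by omega)
    · rw [e]
      refine Finset.sum_congr rfl fun i _ => ?_
      rw [FWeyl.comp_mul, Finset.sum_eq_single (1, d)]
      · rw [comp_ofV, if_pos rfl, FWeyl.comp_mk]
      · rintro ⟨a, b⟩ hp hne
        rw [Finset.HasAntidiagonal.mem_antidiagonal] at hp
        rw [comp_ofV, if_neg, zero_mul]
        rintro rfl
        exact hne (by ext <;> dsimp only at * ; omega)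
      · intro h; exact absurd (Finset.HasAntidiagonal.mem_antidiagonal.2 (by dsimp only; omega)) h

/-- Homomorphisms and derivations on `𝒟` are controlled by their values on `V`. -/
theorem eq_zero_of_forall_mul (B : Darboux ω 𝔵 ι) [Nonempty ι] {A : Type*} [Ring A] [Module k A]
    (F : ℕ → Submodule k A) (hF : ∀ a, (∀ n, a ∈ F n) → a = 0) (hF0 : ∀ a, a ∈ F 0)
    (hF1 : ∀ n, ∀ a ∈ F 1, ∀ b ∈ F n, a * b ∈ F (n + 1)) {φ : FWeyl ω → A}
    (h0 : ∀ t, φ (algebraMap k _ t) = 0) (hadd : ∀ x y, φ (x + y) = φ x + φ y)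
    (hmul : ∀ v x, ∃ a ∈ F 1, φ (FWeyl.ofV v * x) = a * φ x) (x : FWeyl ω) : φ x = 0 := by
  have key : ∀ n x, φ x ∈ F n := by
    intro n
    induction n with
    | zero => exact fun x => hF0 _
    | succ n ih =>
      intro x
      obtain ⟨t, ht⟩ := FWeyl.exists_sub_mem_filt_one x
      obtain ⟨y, -, e⟩ := B.exists_eq_sum_of_mem_filt ht
      have hs : ∀ s : Finset (ι ⊕ ι), φ (∑ i ∈ s, FWeyl.ofV (B.basis i) * y i) ∈ F (n + 1) := by
        intro s
        classical
        induction s using Finset.induction_on with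
        | empty => rw [Finset.sum_empty, ← map_zero (algebraMap k (FWeyl ω)), h0]; exact zero_mem _
        | insert i s hi ihs =>
          rw [Finset.sum_insert hi, hadd]
          refine add_mem ?_ ihs
          obtain ⟨a, ha, e⟩ := hmul (B.basis i) (y i)
          rw [e]
          exact hF1 n a ha _ (ih _)
      rw [show x = algebraMap k _ t + ∑ i, FWeyl.ofV (B.basis i) * y i by rw [← e]; abel, hadd, h0,
        zero_add]
      exact hs _
  exact hF _ fun n => key n x

theorem eq_zero_of_forall_mem_filt (B : Darboux ω 𝔵 ι) [Nonempty ι] {φ : FWeyl ω → FWeyl ω}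
    (h0 : ∀ t, φ (algebraMap k _ t) = 0) (hadd : ∀ x y, φ (x + y) = φ x + φ y)
    (hmul : ∀ v x, ∃ a ∈ FWeyl.filt ω 1, φ (FWeyl.ofV v * x) = a * φ x) (x : FWeyl ω) :
    φ x = 0 :=
  B.eq_zero_of_forall_mul (FWeyl.filt ω) (fun _ => FWeyl.eq_zero_of_forall_mem_filt)
    FWeyl.mem_filt_zero (fun n a ha b hb => by
      rw [add_comm]; exact FWeyl.mul_mem_filt_add ha hb) h0 hadd hmul x

theorem mem_leftIdeal (B : Darboux ω 𝔵 ι) {x : FWeyl ω} :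
    x ∈ leftIdeal ω 𝔵 ↔ rho x ∈ serIdeal ω 𝔵 := by
  refine ⟨rho_mem_serIdeal_of_mem, fun h => ?_⟩
  choose a ha e using fun d => B.exists_eq_sum_of_mem (h (d + 1)) (coeff_rho_mem x (d + 1))
  choose y hy using fun i => exists_rho_eq (ω := ω) (PowerSeries.mk fun d => a d i)
    (fun d => by rw [coeff_mk]; exact ha d i)
  have : x = ∑ i, y i * FWeyl.ofV (B.basis (Sum.inr i)) := by
    apply B.rho_injective
    rw [map_sum]
    refine PowerSeries.ext fun d => ?_
    rw [map_sum]
    simp only [map_mul, hy, rho_ofV, ← mul_assoc]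
    rcases d with _ | d
    · simp only [coeff_zero_mul_X, Finset.sum_const_zero]
      exact B.eq_zero_of_mem_weylF_zero (h 0) (coeff_rho_mem x 0)
    · simp only [coeff_succ_mul_X, coeff_mul_C, coeff_mk, e]
  rw [this]
  exact sum_mem fun i _ => Ideal.mul_mem_left _ _ (Ideal.subset_span ⟨_, B.inr_mem i, rfl⟩)

end Darboux

section JIdeal

open PowerSeries

variable {k V : Type*} [Field k] [AddCommGroup V] [Module k V] {ω : SymplecticForm k V}
  {𝔵 : Submodule k V}

theorem mk_eq_mk {x y : FWeyl ω} :
    (Submodule.Quotient.mk x : FMod ω 𝔵) = Submodule.Quotient.mk y ↔ x - y ∈ leftIdeal ω 𝔵 :=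
  Submodule.Quotient.eq _

theorem smul_mk (a x : FWeyl ω) :
    a • (Submodule.Quotient.mk x : FMod ω 𝔵) = Submodule.Quotient.mk (a * x) := rfl

theorem algebraMap_smul_mk (c : k⟦X⟧) (x : FWeyl ω) :
    c • (Submodule.Quotient.mk x : FMod ω 𝔵) =
      Submodule.Quotient.mk (algebraMap _ (FWeyl ω) c * x) := rfl

theorem mem_JIdeal_iff {x : FWeyl ω} :
    x ∈ JIdeal ω 𝔵 ↔ ∃ y, x - FWeyl.hbar ω * y ∈ leftIdeal ω 𝔵 := by
  rw [JIdeal, Submodule.mem_sup]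
  constructor
  · rintro ⟨a, ha, b, hb, rfl⟩
    obtain ⟨c, rfl⟩ := Ideal.mem_span_singleton'.1 hb
    refine ⟨c, ?_⟩
    rwa [FWeyl.hbar, Algebra.commutes, add_sub_cancel_right]
  · rintro ⟨y, hy⟩
    refine ⟨_, hy, FWeyl.hbar ω * y, ?_, sub_add_cancel _ _⟩
    rw [FWeyl.hbar, Algebra.commutes]
    exact Ideal.mul_mem_left _ _ (Ideal.subset_span rfl)

theorem hbar_mul_mem_JIdeal (y : FWeyl ω) : FWeyl.hbar ω * y ∈ JIdeal ω 𝔵 :=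
  mem_JIdeal_iff.2 ⟨y, by rw [sub_self]; exact zero_mem _⟩

theorem ofV_mem_leftIdeal {v : V} (hv : v ∈ 𝔵) : (FWeyl.ofV v : FWeyl ω) ∈ leftIdeal ω 𝔵 :=
  Ideal.subset_span ⟨v, hv, rfl⟩

theorem leftIdeal_le_JIdeal : leftIdeal ω 𝔵 ≤ JIdeal ω 𝔵 := le_sup_left

theorem JIdeal_mul_mem {x : FWeyl ω} (hx : x ∈ JIdeal ω 𝔵) (y : FWeyl ω) :
    x * y ∈ JIdeal ω 𝔵 := by
  obtain ⟨w, hw⟩ := FWeyl.exists_comm_eq x y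
  rw [sub_eq_iff_eq_add.1 hw]
  exact add_mem (hbar_mul_mem_JIdeal _) (Ideal.mul_mem_left _ _ hx)

theorem JIdeal_smul_mem {x : FWeyl ω} (hx : x ∈ JIdeal ω 𝔵) (m : FMod ω 𝔵) :
    ∃ m', x • m = FWeyl.hbar ω • m' := by
  obtain ⟨y, rfl⟩ := Submodule.Quotient.mk_surjective _ m
  obtain ⟨w, hw⟩ := mem_JIdeal_iff.1 (JIdeal_mul_mem hx y)
  exact ⟨Submodule.Quotient.mk w, (Submodule.Quotient.eq _).2 hw⟩

theorem mem_JIdeal_of_smul {x : FWeyl ω}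
    (h : ∃ m' : FMod ω 𝔵, x • (Submodule.Quotient.mk 1 : FMod ω 𝔵) = FWeyl.hbar ω • m') :
    x ∈ JIdeal ω 𝔵 := by
  obtain ⟨m', h⟩ := h
  obtain ⟨y, rfl⟩ := Submodule.Quotient.mk_surjective _ m'
  rw [mem_JIdeal_iff]
  refine ⟨y, ?_⟩
  rwa [smul_mk, smul_mk, mk_eq_mk, mul_one] at h

/-- The part of weight `d` of the image of `𝒥` in the Weyl algebra. -/
def weylJ (ω : SymplecticForm k V) (𝔵 : Submodule k V) (d : ℕ) : Submodule k (Weyl ω) :=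
  (if d < 2 then ⊥ else weylF ω (d - 2)) ⊔ (weylIdeal ω 𝔵).restrictScalars k

variable {ι : Type*} [Fintype ι]

theorem Darboux.mem_JIdeal (B : Darboux ω 𝔵 ι) {x : FWeyl ω} :
    x ∈ JIdeal ω 𝔵 ↔ ∀ d, coeff d (rho x) ∈ weylJ ω 𝔵 d := by
  rw [mem_JIdeal_iff]
  constructor
  · rintro ⟨y, hy⟩ d
    have h := rho_mem_serIdeal_of_mem hy d
    rw [map_sub, map_mul, rho_hbar, map_sub, coeff_X_pow_mul'] at h
    refine Submodule.mem_sup.2 ⟨_, ?_, _, h, add_sub_cancel _ _⟩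
    by_cases hd : 2 ≤ d
    · rw [if_pos hd, if_neg (by omega)]; exact coeff_rho_mem _ _
    · rw [if_neg hd]; exact zero_mem _
  · intro h
    choose a ha b hb e using fun d => Submodule.mem_sup.1 (h d)
    obtain ⟨y, hy⟩ := exists_rho_eq (ω := ω) (PowerSeries.mk fun d => a (d + 2)) (fun d => by
      have := ha (d + 2)
      rw [if_neg (by omega), Nat.add_sub_cancel] at this
      rwa [coeff_mk])
    refine ⟨y, B.mem_leftIdeal.2 fun d => ?_⟩
    rw [map_sub, map_mul, rho_hbar, map_sub, coeff_X_pow_mul', hy]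
    have : (if 2 ≤ d then coeff (d - 2) (PowerSeries.mk fun d => a (d + 2)) else 0) = a d := by
      by_cases hd : 2 ≤ d
      · rw [if_pos hd, coeff_mk, Nat.sub_add_cancel hd]
      · have := ha d
        rw [if_pos (by omega), Submodule.mem_bot] at this
        rw [if_neg hd, this]
    rw [this, ← e d, add_sub_cancel_left]
    exact hb d

end JIdeal

namespace Darboux

open PowerSeries

variable {k V ι : Type*} [Field k] [AddCommGroup V] [Module k V]
  {ω : SymplecticForm k V} {𝔵 : Submodule k V} [Fintype ι]

theorem hbar_mul_cancel (B : Darboux ω 𝔵 ι) {x y : FWeyl ω}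
    (h : FWeyl.hbar ω * x = FWeyl.hbar ω * y) : x = y := by
  apply B.rho_injective
  have := congrArg rho h
  rw [map_mul, map_mul, rho_hbar] at this
  refine PowerSeries.ext fun d => ?_
  rw [← coeff_X_pow_mul (rho x) 2 d, this, coeff_X_pow_mul]

theorem hbar_smul_cancel (B : Darboux ω 𝔵 ι) {m m' : FMod ω 𝔵}
    (h : FWeyl.hbar ω • m = FWeyl.hbar ω • m') : m = m' := by
  obtain ⟨x, rfl⟩ := Submodule.Quotient.mk_surjective _ m
  obtain ⟨y, rfl⟩ := Submodule.Quotient.mk_surjective _ m'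
  rw [smul_mk, smul_mk, mk_eq_mk, ← mul_sub, B.mem_leftIdeal] at h
  rw [mk_eq_mk, B.mem_leftIdeal]
  intro d
  have := h (d + 2)
  rwa [map_mul, rho_hbar, coeff_X_pow_mul] at this

theorem mk_mem_filtMod (B : Darboux ω 𝔵 ι) {x : FWeyl ω} {j : ℕ} :
    (Submodule.Quotient.mk x : FMod ω 𝔵) ∈ filtMod ω 𝔵 j ↔
      ∀ d < j, coeff d (rho x) ∈ weylIdeal ω 𝔵 := by
  constructor
  · rintro ⟨y, hy, e⟩ d hd
    have h := rho_mem_serIdeal_of_mem ((Submodule.Quotient.eq _).1 e) d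
    rw [map_sub, map_sub, coeff_rho, hy d hd, map_zero, zero_sub] at h
    exact neg_mem_iff.1 h
  · intro h
    obtain ⟨y, hy⟩ := exists_rho_eq (ω := ω) (PowerSeries.mk fun d => if d < j then 0 else
      coeff d (rho x)) (fun d => by
        rw [coeff_mk]; split_ifs
        · exact zero_mem _
        · exact coeff_rho_mem _ _)
    refine ⟨y, fun i hi => ?_, (Submodule.Quotient.eq _).2 (B.mem_leftIdeal.2 fun d => ?_)⟩
    · refine B.eq_zero_of_toWeyl_eq_zero (FWeyl.comp_mem y i) ?_
      rw [← coeff_rho, hy, coeff_mk, if_pos hi]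
    · rw [map_sub, hy, map_sub, coeff_mk]
      split_ifs with hd
      · rw [zero_sub]; exact neg_mem (h d hd)
      · rw [sub_self]; exact zero_mem _

theorem exists_coeff_algebraMap (c : ℕ → k) (hc : ∀ d, ¬ Even d → c d = 0) :
    ∃ a : k⟦X⟧, ∀ d, coeff d (rho (algebraMap k⟦X⟧ (FWeyl ω) a)) = algebraMap k _ (c d) := by
  refine ⟨PowerSeries.mk fun m => c (2 * m), fun d => ?_⟩
  rcases Nat.even_or_odd' d with ⟨m, rfl | rfl⟩
  · rw [coeff_rho_algebraMap_even, coeff_mk]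
  · rw [coeff_rho_algebraMap_odd _ (by simp), hc _ (by simp), map_zero]

theorem eq_smul_mk_one_of_forall [CharZero k] (B : Darboux ω 𝔵 ι) {m : FMod ω 𝔵}
    (h : ∀ v ∈ 𝔵, (FWeyl.ofV v : FWeyl ω) • m = 0) :
    ∃ c : k⟦X⟧, m = c • Submodule.Quotient.mk 1 := by
  obtain ⟨x, rfl⟩ := Submodule.Quotient.mk_surjective _ m
  have h' : ∀ d, ∀ v ∈ 𝔵, weylV ω v * coeff d (rho x) ∈ weylIdeal ω 𝔵 := fun d v hv => by
    have : FWeyl.ofV v * x ∈ leftIdeal ω 𝔵 := (Submodule.Quotient.mk_eq_zero _).1 (h v hv)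
    rw [B.mem_leftIdeal, map_mul, rho_ofV', mul_assoc] at this
    have := this (d + 1)
    rwa [coeff_succ_X_mul, coeff_C_mul] at this
  choose t ht using fun d => B.exists_sub_mem_weylIdeal (h' d)
  obtain ⟨c, hc⟩ := exists_coeff_algebraMap (ω := ω) t (fun d hd => by
    refine B.algebraMap_mem_odd hd (Submodule.mem_sup.2
      ⟨_, coeff_rho_mem x d, _, neg_mem (ht d), ?_⟩)
    abel)
  refine ⟨c, ?_⟩
  rw [algebraMap_smul_mk, mul_one, mk_eq_mk, B.mem_leftIdeal]
  intro d
  rw [map_sub, map_sub, hc]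
  exact ht d

theorem smul_mk_one_injective (B : Darboux ω 𝔵 ι) {c c' : k⟦X⟧}
    (h : c • (Submodule.Quotient.mk 1 : FMod ω 𝔵) = c' • Submodule.Quotient.mk 1) : c = c' := by
  rw [algebraMap_smul_mk, algebraMap_smul_mk, mk_eq_mk, B.mem_leftIdeal, mul_one, mul_one,
    ← map_sub] at h
  ext m
  have := h (2 * m)
  rw [coeff_rho_algebraMap_even, map_sub] at this
  exact sub_eq_zero.1 (B.algebraMap_mem_weylIdeal this)

end Darboux

/-! ### The localization of `𝒟` -/

namespace Darboux

variable {k V ι : Type*} [Field k] [AddCommGroup V] [Module k V]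
  {ω : SymplecticForm k V} {𝔵 : Submodule k V} [Fintype ι]

theorem X_pow_smul_cancel (B : Darboux ω 𝔵 ι) (n : ℕ) {x y : FWeyl ω}
    (h : (PowerSeries.X ^ n : k⟦X⟧) • x = (PowerSeries.X ^ n : k⟦X⟧) • y) : x = y := by
  induction n with
  | zero => simpa using h
  | succ n ih =>
    rw [pow_succ', mul_smul, mul_smul] at h
    exact ih (B.hbar_mul_cancel h)

theorem isTorsionFree (B : Darboux ω 𝔵 ι) : Module.IsTorsionFree k⟦X⟧ (FWeyl ω) := by
  refine ⟨fun c hc x y h => ?_⟩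
  have hc0 : c ≠ 0 := hc.ne_zero
  have e : (PowerSeries.Unit_of_divided_by_X_pow_order c : k⟦X⟧) * PowerSeries.X ^ c.order.toNat = c := by
    rw [PowerSeries.Unit_of_divided_by_X_pow_order_nonzero hc0, mul_comm,
      PowerSeries.X_pow_order_mul_divXPowOrder]
  refine B.X_pow_smul_cancel c.order.toNat ?_
  have h' : c • x = c • y := h
  rw [← e, mul_smul, mul_smul] at h'
  have h2 := congrArg (fun z => (((PowerSeries.Unit_of_divided_by_X_pow_order c)⁻¹ : k⟦X⟧ˣ) : k⟦X⟧) • z) h'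
  simpa only [smul_smul, Units.inv_mul_cancel_left] using h2

theorem toLoc_injective (B : Darboux ω 𝔵 ι) : Function.Injective (toLoc (ω := ω)) := by
  have := B.isTorsionFree
  have hf : Module.Flat k⟦X⟧ (FWeyl ω) := inferInstance
  exact Algebra.TensorProduct.includeRight_injective
    (IsFractionRing.injective k⟦X⟧ k⸨X⸩)

theorem X_smul_overHbar (x : FWeyl ω) :
    (PowerSeries.X : k⟦X⟧) • overHbar x = toLoc x := by
  change (PowerSeries.X : k⟦X⟧) • (HahnSeries.single (-1) (1 : k) : k⸨X⸩) ⊗ₜ[k⟦X⟧] x =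
    (1 : k⸨X⸩) ⊗ₜ[k⟦X⟧] x
  rw [TensorProduct.smul_tmul', X_smul_single]
  rfl

theorem overHbar_injective (B : Darboux ω 𝔵 ι) : Function.Injective (overHbar (ω := ω)) :=
  fun x y h => B.toLoc_injective (by rw [← X_smul_overHbar, h, X_smul_overHbar])

theorem lie_overHbar_toLoc_iff (B : Darboux ω 𝔵 ι) {u x y : FWeyl ω} :
    ⁅overHbar u, toLoc x⁆ = (toLoc y : Loc ω) ↔ u * x - x * u = FWeyl.hbar ω * y := by
  refine ⟨fun h => ?_, fun h => lie_overHbar_toLoc h⟩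
  obtain ⟨w, hw⟩ := FWeyl.exists_comm_eq u x
  rw [lie_overHbar_toLoc hw] at h
  rw [hw, B.toLoc_injective h]

theorem cls_eq_zero_iff (B : Darboux ω 𝔵 ι) {u : FWeyl ω} :
    cls u = 0 ↔ ∃ t : k, u = algebraMap k _ t := by
  change (LieSubmodule.Quotient.mk (divHbar u) : 𝔊 ω) = 0 ↔ _
  rw [show (LieSubmodule.Quotient.mk (divHbar u) : 𝔊 ω) = 0 ↔ divHbar u ∈ (invHbark ω).toSubmodule from
    Submodule.Quotient.mk_eq_zero _]
  change divHbar u ∈ Submodule.span k {divHbar 1} ↔ _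
  rw [Submodule.mem_span_singleton]
  refine exists_congr fun t => ?_
  rw [← map_smul, Algebra.algebraMap_eq_smul_one]
  constructor
  · intro h
    exact (B.overHbar_injective (congrArg Subtype.val h)).symm
  · intro h; rw [h]

theorem cls_eq_cls_iff (B : Darboux ω 𝔵 ι) {u u' : FWeyl ω} :
    cls u = cls u' ↔ ∃ t : k, u = u' + algebraMap k _ t := by
  rw [← sub_eq_zero, ← map_sub, B.cls_eq_zero_iff]
  exact exists_congr fun t => sub_eq_iff_eq_add'

end Darboux

/-! ### Automorphisms and derivations of `𝒟` -/

namespace Darboux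

variable {k V ι : Type*} [Field k] [AddCommGroup V] [Module k V]
  {ω : SymplecticForm k V} {𝔵 : Submodule k V} [Fintype ι]

theorem aut_ofV_mem_filt (f : AutD ω) (v : V) : f (FWeyl.ofV v) ∈ FWeyl.filt ω 1 := by
  by_contra h
  have hu : IsUnit (FWeyl.ofV v : FWeyl ω) := by
    have := (FWeyl.isUnit_of_not_mem_filt_one h).map f.symm
    rwa [f.symm_apply_apply] at this
  obtain ⟨y, hy⟩ := hu.exists_right_inv
  have := FWeyl.mul_mem_filt_right y (FWeyl.ofV_mem_filt (ω := ω) v) 0 (by omega)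
  rw [hy, FWeyl.comp_one, if_pos rfl] at this
  have h1 : (1 : FWeyl ω) = 0 := FWeyl.ext fun i => by
    rw [FWeyl.comp_one, this, ite_self, map_zero]
  apply h
  rw [← mul_one (f _), h1, mul_zero]
  exact zero_mem _

theorem aut_mem_filt (B : Darboux ω 𝔵 ι) [Nonempty ι] (f : AutD ω) {j : ℕ} {x : FWeyl ω}
    (hx : x ∈ FWeyl.filt ω j) : f x ∈ FWeyl.filt ω j := by
  induction j generalizing x with
  | zero => exact FWeyl.mem_filt_zero _
  | succ j ih =>
    obtain ⟨y, hy, rfl⟩ := B.exists_eq_sum_of_mem_filt hx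
    rw [map_sum]
    refine sum_mem fun i _ => ?_
    rw [map_mul, add_comm]
    exact FWeyl.mul_mem_filt_add (aut_ofV_mem_filt f _) (ih (hy i))

theorem derivation_mem_filt (B : Darboux ω 𝔵 ι) [Nonempty ι] {δ : FWeyl ω → FWeyl ω}
    (hadd : ∀ x y, δ (x + y) = δ x + δ y) (hmul : ∀ x y, δ (x * y) = δ x * y + x * δ y)
    {j : ℕ} {x : FWeyl ω} (hx : x ∈ FWeyl.filt ω (j + 1)) : δ x ∈ FWeyl.filt ω j := by
  induction j generalizing x with
  | zero => exact FWeyl.mem_filt_zero _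
  | succ j ih =>
    obtain ⟨y, hy, rfl⟩ := B.exists_eq_sum_of_mem_filt hx
    rw [show δ (∑ i, FWeyl.ofV (B.basis i) * y i) = ∑ i, δ (FWeyl.ofV (B.basis i) * y i) from
      map_sum (AddMonoidHom.mk' δ hadd) _ _]
    refine sum_mem fun i _ => ?_
    rw [hmul]
    refine add_mem (FWeyl.mul_mem_filt _ (hy i)) ?_
    rw [add_comm]
    exact FWeyl.mul_mem_filt_add (FWeyl.ofV_mem_filt _) (ih (hy i))

theorem isContD_of_derivation (B : Darboux ω 𝔵 ι) [Nonempty ι] {δ : FWeyl ω → FWeyl ω}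
    (hadd : ∀ x y, δ (x + y) = δ x + δ y) (hmul : ∀ x y, δ (x * y) = δ x * y + x * δ y) :
    IsContD δ := fun i => ⟨i + 1, fun _ hx => B.derivation_mem_filt hadd hmul hx⟩

theorem derivation_ext (B : Darboux ω 𝔵 ι) [Nonempty ι] {δ δ' : Module.End k⟦X⟧ (FWeyl ω)}
    (hδ : ∀ x y, δ (x * y) = δ x * y + x * δ y) (hδ' : ∀ x y, δ' (x * y) = δ' x * y + x * δ' y)
    (h : ∀ v, δ (FWeyl.ofV v) = δ' (FWeyl.ofV v)) : δ = δ' := by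
  have h1 : ∀ (ε : Module.End k⟦X⟧ (FWeyl ω)), (∀ x y, ε (x * y) = ε x * y + x * ε y) →
      ∀ t, ε (algebraMap k _ t) = 0 := fun ε hε t => by
    have h1 := hε 1 1
    rw [mul_one, one_mul, mul_one, left_eq_add] at h1
    rw [IsScalarTower.algebraMap_apply k k⟦X⟧, Algebra.algebraMap_eq_smul_one, map_smul, h1,
      smul_zero]
  refine LinearMap.ext fun x => sub_eq_zero.1 ?_
  refine B.eq_zero_of_forall_mem_filt (φ := fun x => δ x - δ' x) (fun t => ?_) (fun x y => ?_)
    (fun v x => ⟨_, FWeyl.ofV_mem_filt v, ?_⟩) x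
  · rw [h1 δ hδ, h1 δ' hδ', sub_self]
  · rw [map_add, map_add]; abel
  · rw [hδ, hδ', h, mul_sub]; abel

end Darboux

/-! ### Exponentials -/

section TruncatedExp

variable {k A : Type*} [Field k] [Ring A] [Algebra k A]

/-- Truncated exponential series. -/
def truncExp (k : Type*) {A : Type*} [Field k] [Ring A] [Algebra k A] (N : ℕ) (a : A) : A :=
  ∑ n ∈ Finset.range N, ((n.factorial : k)⁻¹) • a ^ n

theorem truncExp_mul_eq_sum (N : ℕ) (a b : A) : truncExp k N a * truncExp k N b =
    ∑ p ∈ Finset.range N ×ˢ Finset.range N,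
      ((p.1.factorial : k)⁻¹ * (p.2.factorial : k)⁻¹) • (a ^ p.1 * b ^ p.2) := by
  rw [truncExp, truncExp, Finset.sum_mul_sum, Finset.sum_product]
  refine Finset.sum_congr rfl fun i _ => Finset.sum_congr rfl fun j _ => ?_
  rw [smul_mul_assoc, mul_smul_comm, smul_smul]

theorem truncExp_mul [CharZero k] {a b : A} (h : Commute a b) (N : ℕ) : truncExp k N a * truncExp k N b =
    truncExp k N (a + b) + ∑ p ∈ Finset.range N ×ˢ Finset.range N with N ≤ p.1 + p.2,
      ((p.1.factorial : k)⁻¹ * (p.2.factorial : k)⁻¹) • (a ^ p.1 * b ^ p.2) := by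
  rw [truncExp_mul_eq_sum, ← Finset.sum_filter_add_sum_filter_not _ (fun p => p.1 + p.2 < N)]
  simp only [not_lt]
  congr 1
  have e : {p ∈ Finset.range N ×ˢ Finset.range N | p.1 + p.2 < N} =
      (Finset.range N).biUnion fun n => Finset.HasAntidiagonal.antidiagonal n := by
    ext ⟨i, j⟩
    simp only [Finset.mem_filter, Finset.mem_product, Finset.mem_range, Finset.mem_biUnion,
      Finset.HasAntidiagonal.mem_antidiagonal]
    constructor
    · rintro ⟨-, h⟩; exact ⟨_, h, rfl⟩
    · rintro ⟨n, h, rfl⟩; omega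
  rw [e, Finset.sum_biUnion (fun i _ j _ hij => Finset.disjoint_left.2 fun p hp hp' => hij (by
    rw [Finset.HasAntidiagonal.mem_antidiagonal] at hp hp'; omega)), truncExp]
  refine Finset.sum_congr rfl fun n _ => ?_
  rw [h.add_pow', Finset.smul_sum]
  refine Finset.sum_congr rfl ?_
  rintro ⟨i, j⟩ hp
  rw [Finset.HasAntidiagonal.mem_antidiagonal] at hp
  subst hp
  rw [← Nat.cast_smul_eq_nsmul k, smul_smul]
  congr 1
  have hc := Nat.add_choose_mul_factorial_mul_factorial i j
  have hc' : ((i + j).choose j : k) * i.factorial * j.factorial = (i + j).factorial := by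
    exact_mod_cast hc
  have hi : (i.factorial : k) ≠ 0 := Nat.cast_ne_zero.2 i.factorial_ne_zero
  have hj : (j.factorial : k) ≠ 0 := Nat.cast_ne_zero.2 j.factorial_ne_zero
  have hij : ((i + j).factorial : k) ≠ 0 := Nat.cast_ne_zero.2 (i + j).factorial_ne_zero
  rw [← Nat.choose_symm_add] at hc'
  field_simp
  linear_combination -hc'

end TruncatedExp

section SerFilt

open PowerSeries

variable {k V : Type*} [Field k] [AddCommGroup V] [Module k V] {ω : SymplecticForm k V}

/-- The series without terms of degree less than `m`. -/
def serFilt (ω : SymplecticForm k V) (m : ℕ) : Submodule k (WSer ω) where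
  carrier := {s | ∀ i < m, coeff i s = 0}
  add_mem' h h' i hi := by rw [map_add, h i hi, h' i hi, add_zero]
  zero_mem' i _ := map_zero _
  smul_mem' t s h i hi := by
    change t • coeff i s = 0
    rw [h i hi, smul_zero]

theorem mem_serFilt {m : ℕ} {s : WSer ω} : s ∈ serFilt ω m ↔ ∀ i < m, coeff i s = 0 := Iff.rfl

theorem mem_serFilt_zero (s : WSer ω) : s ∈ serFilt ω 0 := fun i hi => absurd hi (by omega)

theorem serFilt_anti {i j : ℕ} (h : i ≤ j) : serFilt ω j ≤ serFilt ω i :=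
  fun _ hx l hl => hx l (hl.trans_le h)

theorem mul_mem_serFilt {i j : ℕ} {a b : WSer ω} (ha : a ∈ serFilt ω i) (hb : b ∈ serFilt ω j) :
    a * b ∈ serFilt ω (i + j) := fun d hd => by
  rw [coeff_mul]
  refine Finset.sum_eq_zero fun p hp => ?_
  rw [Finset.HasAntidiagonal.mem_antidiagonal] at hp
  by_cases h : p.1 < i
  · rw [ha _ h, zero_mul]
  · rw [hb p.2 (by omega), mul_zero]

theorem mul_mem_serFilt_left (a : WSer ω) {j : ℕ} {b : WSer ω} (hb : b ∈ serFilt ω j) :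
    a * b ∈ serFilt ω j := by
  have := mul_mem_serFilt (mem_serFilt_zero a) hb; rwa [zero_add] at this

theorem mul_mem_serFilt_right (a : WSer ω) {j : ℕ} {b : WSer ω} (hb : b ∈ serFilt ω j) :
    b * a ∈ serFilt ω j := by
  have := mul_mem_serFilt hb (mem_serFilt_zero a); rwa [add_zero] at this

theorem coeff_mul_of_mem {a b : WSer ω} {i j : ℕ} (ha : a ∈ serFilt ω i) (hb : b ∈ serFilt ω j) :
    coeff (i + j) (a * b) = coeff i a * coeff j b := by
  rw [coeff_mul, Finset.sum_eq_single (i, j)]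
  · rintro ⟨i', j'⟩ hp hne
    rw [Finset.HasAntidiagonal.mem_antidiagonal] at hp
    dsimp only at hp ⊢
    by_cases h : i' < i
    · rw [ha i' h, zero_mul]
    · rw [hb j' (by by_contra h'; exact hne (by ext <;> dsimp only <;> omega)), mul_zero]
  · intro h; exact absurd (Finset.HasAntidiagonal.mem_antidiagonal.2 (by simp)) h

theorem coeff_mul_of_mem_left {a b : WSer ω} {d : ℕ} (ha : a ∈ serFilt ω d) :
    coeff d (a * b) = coeff d a * coeff 0 b := by
  have := coeff_mul_of_mem ha (mem_serFilt_zero b)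
  rwa [add_zero] at this

theorem coeff_mul_of_mem_right {a b : WSer ω} {d : ℕ} (hb : b ∈ serFilt ω d) :
    coeff d (a * b) = coeff 0 a * coeff d b := by
  have := coeff_mul_of_mem (mem_serFilt_zero a) hb
  rwa [zero_add] at this

theorem pow_mem_serFilt {a : WSer ω} (ha : a ∈ serFilt ω 1) (n : ℕ) : a ^ n ∈ serFilt ω n := by
  induction n with
  | zero => exact mem_serFilt_zero _
  | succ n ih => rw [pow_succ]; exact mul_mem_serFilt ih ha

/-- A limit of successive approximations. -/
theorem exists_limit {R : Type*} [Semiring R] {P : ℕ → R⟦X⟧ → Prop} {s₀ : R⟦X⟧} (h₀ : P 0 s₀)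
    (step : ∀ d s, P d s → ∃ s', P (d + 1) s' ∧ ∀ i < d, coeff i s' = coeff i s) :
    ∃ s, ∀ d, ∃ s', P d s' ∧ ∀ i < d, coeff i s = coeff i s' := by
  choose! next h1 h2 using step
  let q : ℕ → R⟦X⟧ := fun n => Nat.rec s₀ next n
  have hq : ∀ n, P n (q n) := fun n => by
    induction n with
    | zero => exact h₀
    | succ n ih => exact h1 n _ ih
  have hc : ∀ m n i, i < m → coeff i (q (m + n)) = coeff i (q m) := fun m n i hi => by
    induction n with
    | zero => rfl
    | succ n ih => rw [← add_assoc]; exact (h2 _ _ (hq _) i (by omega)).trans ih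
  refine ⟨PowerSeries.mk fun i => coeff i (q (i + 1)), fun d => ⟨q d, hq d, fun i hi => ?_⟩⟩
  rw [coeff_mk]
  obtain ⟨n, rfl⟩ := Nat.exists_eq_add_of_le (Nat.succ_le_of_lt hi)
  exact (hc (i + 1) n i (by omega)).symm

theorem coeff_expS {a : WSer ω} (ha : a ∈ serFilt ω 1) {d N : ℕ} (h : d < N) :
    coeff d (expS a) = coeff d (truncExp k N a) := by
  rw [expS, coeff_mk, truncExp, map_sum]
  have := Finset.sum_subset (Finset.range_mono (show d + 1 ≤ N by omega))
    (f := fun n => (n.factorial : k)⁻¹ • coeff d (a ^ n)) (fun n _ hn => by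
      rw [Finset.mem_range] at hn
      rw [pow_mem_serFilt ha n d (by omega), smul_zero])
  rw [this]
  rfl

theorem expS_sub_truncExp_mem {a : WSer ω} (ha : a ∈ serFilt ω 1) (N : ℕ) :
    expS a - truncExp k N a ∈ serFilt ω N := fun i hi => by
  rw [map_sub, coeff_expS ha hi, sub_self]

theorem expS_zero : expS (0 : WSer ω) = 1 := by
  ext d
  rw [coeff_expS (zero_mem _) (Nat.lt_succ_self d), truncExp, Finset.sum_eq_single 0]
  · simp
  · intro n _ hn; rw [zero_pow hn, smul_zero]
  · intro h; simp at h

theorem expS_add_of_commute [CharZero k] {a b : WSer ω} (ha : a ∈ serFilt ω 1) (hb : b ∈ serFilt ω 1)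
    (h : Commute a b) : expS (a + b) = expS a * expS b := by
  ext d
  have e1 : expS a * expS b - truncExp k (d + 1) a * truncExp k (d + 1) b ∈ serFilt ω (d + 1) := by
    have : expS a * expS b - truncExp k (d + 1) a * truncExp k (d + 1) b =
        (expS a - truncExp k (d + 1) a) * expS b +
          truncExp k (d + 1) a * (expS b - truncExp k (d + 1) b) := by noncomm_ring
    rw [this]
    exact add_mem (mul_mem_serFilt_right _ (expS_sub_truncExp_mem ha _))
      (mul_mem_serFilt_left _ (expS_sub_truncExp_mem hb _))
  have e2 := e1 d (Nat.lt_succ_self d)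
  rw [map_sub, sub_eq_zero] at e2
  rw [coeff_expS (add_mem ha hb) (Nat.lt_succ_self d), e2, truncExp_mul h, map_add, left_eq_add]
  have : (∑ p ∈ Finset.range (d + 1) ×ˢ Finset.range (d + 1) with d + 1 ≤ p.1 + p.2,
      ((p.1.factorial : k)⁻¹ * (p.2.factorial : k)⁻¹) • (a ^ p.1 * b ^ p.2)) ∈
      serFilt ω (d + 1) := by
    refine sum_mem fun p hp => Submodule.smul_mem _ _ ?_
    exact serFilt_anti (Finset.mem_filter.1 hp).2
      (mul_mem_serFilt (pow_mem_serFilt ha _) (pow_mem_serFilt hb _))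
  exact this d (Nat.lt_succ_self d)

theorem expS_mul_expS_neg [CharZero k] {a : WSer ω} (ha : a ∈ serFilt ω 1) : expS a * expS (-a) = 1 := by
  rw [← expS_add_of_commute ha (neg_mem ha) (Commute.refl a).neg_right, add_neg_cancel, expS_zero]

/-- The unit `exp a`. -/
def expU [CharZero k] (a : WSer ω) (ha : a ∈ serFilt ω 1) : (WSer ω)ˣ where
  val := expS a
  inv := expS (-a)
  val_inv := expS_mul_expS_neg ha
  inv_val := by
    have := expS_mul_expS_neg (neg_mem ha)
    rwa [neg_neg] at this

/-- Conjugation by `exp b` is the exponential of `[b, -]`. -/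
theorem exists_expS_mul_eq [CharZero k] {b : WSer ω} (hb : b ∈ serFilt ω 1) (S : Submodule k (WSer ω))
    (hS : ∀ x ∈ S, b * x - x * b ∈ S) {x : WSer ω} (hx : x ∈ S) :
    ∃ y, expS b * x = y * expS b ∧ ∀ d, ∃ z ∈ S, coeff d y = coeff d z := by
  let R : Module.End k (WSer ω) := LinearMap.mulRight k b
  let L : Module.End k (WSer ω) := LinearMap.mulLeft k b
  let D : Module.End k (WSer ω) := L - R
  have hR : ∀ n z, (R ^ n) z = z * b ^ n := fun n z => by
    rw [LinearMap.pow_mulRight, LinearMap.mulRight_apply]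
  have hL : ∀ n z, (L ^ n) z = b ^ n * z := fun n z => by
    rw [LinearMap.pow_mulLeft, LinearMap.mulLeft_apply]
  have hLR : Commute L R := LinearMap.commute_mulLeft_right (R := k) b b
  have hRD : Commute R D := (hLR.symm).sub_right (Commute.refl R)
  have hD : ∀ n j z, z ∈ serFilt ω j → (D ^ n) z ∈ serFilt ω (j + n) := fun n => by
    induction n with
    | zero => exact fun j z hz => hz
    | succ n ih =>
      intro j z hz
      rw [pow_succ', Module.End.mul_apply, ← add_assoc]
      have := ih j z hz
      exact sub_mem (by rw [add_comm]; exact mul_mem_serFilt hb this) (mul_mem_serFilt this hb)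
  have hDS : ∀ n, (D ^ n) x ∈ S := fun n => by
    induction n with
    | zero => exact hx
    | succ n ih => rw [pow_succ', Module.End.mul_apply]; exact hS _ ih
  have happ : ∀ (N : ℕ) (E : Module.End k (WSer ω)) z, (truncExp k N E) z =
      ∑ n ∈ Finset.range N, (n.factorial : k)⁻¹ • (E ^ n) z := fun N E z => by
    rw [truncExp, LinearMap.sum_apply]; rfl
  let y : WSer ω := PowerSeries.mk fun d => coeff d ((truncExp k (d + 1) D) x)
  have hy : ∀ N, y - (truncExp k N D) x ∈ serFilt ω N := fun N i hi => by
    rw [map_sub, coeff_mk, sub_eq_zero, happ, happ, map_sum, map_sum]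
    refine Finset.sum_subset (Finset.range_mono (show i + 1 ≤ N by omega)) fun n _ hn => ?_
    rw [Finset.mem_range] at hn
    have := hD n 0 x (mem_serFilt_zero x) i (by omega)
    change (n.factorial : k)⁻¹ • coeff i ((D ^ n) x) = 0
    rw [this, smul_zero]
  refine ⟨y, ?_, fun d => ⟨(truncExp k (d + 1) D) x, ?_, by rw [coeff_mk]⟩⟩
  · ext d
    set N := d + 1
    have e1 : expS b * x - truncExp k N b * x ∈ serFilt ω N := by
      rw [← sub_mul]; exact mul_mem_serFilt_right _ (expS_sub_truncExp_mem hb _)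
    have e2 : y * expS b - (truncExp k N D) x * truncExp k N b ∈ serFilt ω N := by
      have : y * expS b - (truncExp k N D) x * truncExp k N b =
        (y - (truncExp k N D) x) * expS b +
          (truncExp k N D) x * (expS b - truncExp k N b) := by noncomm_ring
      rw [this]
      exact add_mem (mul_mem_serFilt_right _ (hy N))
        (mul_mem_serFilt_left _ (expS_sub_truncExp_mem hb _))
    have e3 : truncExp k N b * x = (truncExp k N L) x := by
      rw [happ, truncExp, Finset.sum_mul]
      refine Finset.sum_congr rfl fun n _ => ?_
      rw [hL, smul_mul_assoc]
    have e4 : (truncExp k N D) x * truncExp k N b = (truncExp k N R * truncExp k N D) x := by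
      rw [Module.End.mul_apply, happ N R, truncExp.eq_1 k N b, Finset.mul_sum]
      refine Finset.sum_congr rfl fun n _ => ?_
      rw [hR, mul_smul_comm]
    have e5 := congrArg (fun E : Module.End k (WSer ω) => E x) (truncExp_mul (k := k) hRD N)
    have e6 : R + D = L := add_sub_cancel _ _
    rw [e6] at e5
    rw [LinearMap.add_apply, ← e3, ← e4, LinearMap.sum_apply] at e5
    have e7 : (∑ p ∈ Finset.range N ×ˢ Finset.range N with N ≤ p.1 + p.2,
      (((p.1.factorial : k)⁻¹ * (p.2.factorial : k)⁻¹) • (R ^ p.1 * D ^ p.2)) x) ∈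
      serFilt ω N := by
      refine sum_mem fun p hp => Submodule.smul_mem _ _ ?_
      refine serFilt_anti (Finset.mem_filter.1 hp).2 ?_
      rw [Module.End.mul_apply, hR, add_comm]
      have := hD p.2 0 x (mem_serFilt_zero x)
      rw [zero_add] at this
      exact mul_mem_serFilt this (pow_mem_serFilt hb _)
    have e8 : expS b * x - y * expS b ∈ serFilt ω N := by
      have := sub_mem (sub_mem e1 e2) e7
      rw [show expS b * x - y * expS b = expS b * x - truncExp k N b * x -
        (y * expS b - (truncExp k N D) x * truncExp k N b) - _ from ?_]
      · exact this
      · rw [e5]; abel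
    have := e8 d (Nat.lt_succ_self d)
    rwa [map_sub, sub_eq_zero] at this
  · rw [happ]
    exact sum_mem fun n _ => Submodule.smul_mem _ _ (hDS n)

theorem pow_sub_pow_mem {a b : WSer ω} (ha : a ∈ serFilt ω 1) (hb : b ∈ serFilt ω 1) {d : ℕ}
    (h : a - b ∈ serFilt ω d) (n : ℕ) : a ^ (n + 2) - b ^ (n + 2) ∈ serFilt ω (d + 1) := by
  have key : ∀ n, a ^ (n + 1) - b ^ (n + 1) ∈ serFilt ω (d + n) := fun n => by
    induction n with
    | zero => simpa using h
    | succ n ih =>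
      have : a ^ (n + 1 + 1) - b ^ (n + 1 + 1) =
          a * (a ^ (n + 1) - b ^ (n + 1)) + (a - b) * b ^ (n + 1) := by
        rw [pow_succ' a, pow_succ' b]; noncomm_ring
      rw [this]
      refine add_mem ?_ (mul_mem_serFilt h (pow_mem_serFilt hb _))
      have := mul_mem_serFilt ha ih
      rwa [add_comm 1, add_assoc] at this
  exact serFilt_anti (by omega) (key (n + 1))

theorem expS_sub_expS_sub_mem {a b : WSer ω} (ha : a ∈ serFilt ω 1) (hb : b ∈ serFilt ω 1) {d : ℕ}
    (h : a - b ∈ serFilt ω d) : expS a - expS b - (a - b) ∈ serFilt ω (d + 1) := by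
  have e : truncExp k (d + 2) a - truncExp k (d + 2) b - (a - b) ∈ serFilt ω (d + 1) := by
    rw [truncExp, truncExp, Finset.sum_range_succ', Finset.sum_range_succ',
      Finset.sum_range_succ', Finset.sum_range_succ']
    have : ∑ n ∈ Finset.range d, (((n + 2).factorial : k)⁻¹) • (a ^ (n + 2) - b ^ (n + 2)) ∈
        serFilt ω (d + 1) :=
      sum_mem fun n _ => Submodule.smul_mem _ _ (pow_sub_pow_mem ha hb h n)
    convert this using 1
    simp only [smul_sub, Finset.sum_sub_distrib]
    simp
    abel
  have := add_mem (sub_mem (expS_sub_truncExp_mem ha (d + 2)) (expS_sub_truncExp_mem hb (d + 2)))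
    (show (0 : WSer ω) ∈ _ from zero_mem _)
  have := add_mem (serFilt_anti (Nat.le_succ _) this) e
  convert this using 1
  abel

end SerFilt

/-! ### The group `𝒢^{≥ 1}` -/

section Prounipotent

open PowerSeries

variable {k V : Type*} [Field k] [AddCommGroup V] [Module k V] {ω : SymplecticForm k V}

/-- The image of `𝒟` in `W⟦t⟧`. -/
def rhoRange (ω : SymplecticForm k V) : Subalgebra k (WSer ω) where
  carrier := {s | ∀ d, coeff d s ∈ weylF ω d}
  mul_mem' {f g} hf hg i := by
    rw [coeff_mul]
    refine sum_mem fun p hp => ?_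
    rw [← Finset.HasAntidiagonal.mem_antidiagonal.mp hp]
    exact mul_mem_weylF (hf _) (hg _)
  add_mem' {f g} hf hg i := by rw [map_add]; exact add_mem (hf i) (hg i)
  algebraMap_mem' t i := by
    rw [PowerSeries.algebraMap_apply, coeff_C]
    split_ifs with h
    · subst h; exact algebraMap_mem_weylF t
    · exact zero_mem _

theorem rho_mem_rhoRange (x : FWeyl ω) : rho x ∈ rhoRange ω := fun d => coeff_rho_mem x d

theorem mem_rhoRange_iff {s : WSer ω} : s ∈ rhoRange ω ↔ ∃ x, rho x = s :=
  ⟨fun h => exists_rho_eq s h, by rintro ⟨x, rfl⟩; exact rho_mem_rhoRange x⟩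

/-- The series whose coefficient of degree `d` has order at most `3 d`. -/
def tripleRange (ω : SymplecticForm k V) : Subalgebra k (WSer ω) where
  carrier := {s | ∀ d, coeff d s ∈ weylF ω (3 * d)}
  mul_mem' {f g} hf hg i := by
    rw [coeff_mul]
    refine sum_mem fun p hp => ?_
    rw [← Finset.HasAntidiagonal.mem_antidiagonal.mp hp, mul_add]
    exact mul_mem_weylF (hf _) (hg _)
  add_mem' {f g} hf hg i := by rw [map_add]; exact add_mem (hf i) (hg i)
  algebraMap_mem' t i := by
    rw [PowerSeries.algebraMap_apply, coeff_C]
    split_ifs with h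
    · subst h; exact algebraMap_mem_weylF t
    · exact zero_mem _

theorem mem_tripleRange {s : WSer ω} : s ∈ tripleRange ω ↔ ∀ d, coeff d s ∈ weylF ω (3 * d) :=
  Iff.rfl

theorem coeff_zero_mul_ser (a b : WSer ω) : coeff 0 (a * b) = coeff 0 a * coeff 0 b := by
  rw [coeff_mul]; simp

theorem inv_mem_tripleRange {u : (WSer ω)ˣ} (h0 : coeff 0 (u : WSer ω) = 1)
    (hu : (u : WSer ω) ∈ tripleRange ω) : ((u⁻¹ : (WSer ω)ˣ) : WSer ω) ∈ tripleRange ω := by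
  intro d
  induction d using Nat.strong_induction_on with
  | _ d ih =>
    have h := congrArg (coeff d) u.mul_inv
    rw [coeff_mul, Finset.Nat.sum_antidiagonal_eq_sum_range_succ_mk, Nat.succ_eq_add_one,
      Finset.sum_range_succ'] at h
    simp only [Nat.sub_zero, h0, one_mul] at h
    rw [eq_sub_of_add_eq' h]
    refine sub_mem ?_ (sum_mem fun i hi => ?_)
    · rw [coeff_one]; split_ifs with hd
      · subst hd; exact one_mem_weylF
      · exact zero_mem _
    · rw [Finset.mem_range] at hi
      have := mul_mem_weylF (hu (i + 1)) (ih (d - (i + 1)) (by omega))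
      rwa [← mul_add, Nat.add_sub_cancel' (by omega)] at this

theorem inv_coeff_zero {u : (WSer ω)ˣ} (h0 : coeff 0 (u : WSer ω) = 1) :
    coeff 0 ((u⁻¹ : (WSer ω)ˣ) : WSer ω) = 1 := by
  have h := congrArg (coeff 0) u.mul_inv
  rwa [coeff_zero_mul_ser, h0, one_mul, coeff_zero_one] at h

variable (ω) in
/-- The units with constant term `1` whose coefficients are bounded in order and for which
conjugation preserves `𝒟`. -/
def uniGroup : Subgroup (WSer ω)ˣ where
  carrier := {u | coeff 0 (u : WSer ω) = 1 ∧ (u : WSer ω) ∈ tripleRange ω ∧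
    (∀ x ∈ rhoRange ω, (u : WSer ω) * x * (u⁻¹ : (WSer ω)ˣ) ∈ rhoRange ω) ∧
    ∀ x ∈ rhoRange ω, ((u⁻¹ : (WSer ω)ˣ) : WSer ω) * x * u ∈ rhoRange ω}
  mul_mem' {u v} hu hv := by
    refine ⟨?_, mul_mem hu.2.1 hv.2.1, fun x hx => ?_, fun x hx => ?_⟩
    · rw [Units.val_mul, coeff_zero_mul_ser, hu.1, hv.1, one_mul]
    · have := hu.2.2.1 _ (hv.2.2.1 x hx)
      rw [mul_inv_rev, Units.val_mul, Units.val_mul]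
      simpa only [mul_assoc] using this
    · have := hv.2.2.2 _ (hu.2.2.2 x hx)
      rw [mul_inv_rev, Units.val_mul, Units.val_mul]
      simpa only [mul_assoc] using this
  one_mem' := ⟨by simp, one_mem _, fun x hx => by simpa using hx, fun x hx => by simpa using hx⟩
  inv_mem' {u} hu := ⟨inv_coeff_zero hu.1, inv_mem_tripleRange hu.1 hu.2.1,
    fun x hx => by rw [inv_inv]; exact hu.2.2.2 x hx,
    fun x hx => by rw [inv_inv]; exact hu.2.2.1 x hx⟩

theorem overS_mem {a : FWeyl ω} (ha : a ∈ FWeyl.filt ω 3) : overS a ∈ serFilt ω 1 := fun i hi => by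
  rw [overS, coeff_mk, ha _ (by omega), map_zero]

theorem X_sq_mul_overS {a : FWeyl ω} (ha : a ∈ FWeyl.filt ω 2) : X ^ 2 * overS a = rho a := by
  ext d
  rw [coeff_X_pow_mul', coeff_rho]
  split_ifs with h
  · rw [overS, coeff_mk, Nat.sub_add_cancel h]
  · rw [ha d (by omega), map_zero]

theorem X_sq_mul_cancel {s t : WSer ω} (h : X ^ 2 * s = X ^ 2 * t) : s = t := by
  ext d
  rw [← coeff_X_pow_mul s 2 d, h, coeff_X_pow_mul]

theorem overS_comm_mem {a : FWeyl ω} (ha : a ∈ FWeyl.filt ω 2) {x : WSer ω}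
    (hx : x ∈ rhoRange ω) : overS a * x - x * overS a ∈ rhoRange ω := by
  obtain ⟨x, rfl⟩ := mem_rhoRange_iff.1 hx
  obtain ⟨w, hw⟩ := FWeyl.exists_comm_eq a x
  rw [mem_rhoRange_iff]
  refine ⟨w, X_sq_mul_cancel ?_⟩
  have h := congrArg rho hw
  rw [map_sub, map_mul, map_mul, map_mul, rho_hbar, ← X_sq_mul_overS ha] at h
  rw [← h, mul_sub, ← mul_assoc, ← mul_assoc, ← mul_assoc, (commute_X_pow (rho x) 2).eq]

theorem overS_mem_tripleRange {a : FWeyl ω} (ha : a ∈ FWeyl.filt ω 3) :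
    overS a ∈ tripleRange ω := fun d => by
  rw [overS, coeff_mk]
  rcases d with _ | d
  · rw [ha _ (by omega), map_zero]; exact zero_mem _
  · exact weylF_le ⟨d, by ring⟩ (toWeyl_mem (FWeyl.comp_mem a _))

theorem expS_mem_tripleRange {b : WSer ω} (hb : b ∈ tripleRange ω) :
    expS b ∈ tripleRange ω := fun d => by
  rw [expS, coeff_mk]
  exact sum_mem fun n _ => Submodule.smul_mem _ _ (pow_mem hb n d)

theorem overS_neg (a : FWeyl ω) : overS (-a) = -overS a := by
  ext d
  rw [overS, coeff_mk, map_neg, map_neg, map_neg, overS, coeff_mk]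

theorem coeff_zero_expS (b : WSer ω) : coeff 0 (expS b) = 1 := by
  rw [expS, coeff_mk]; simp

theorem conj_expS_mem [CharZero k] {a : FWeyl ω} (ha : a ∈ FWeyl.filt ω 3) {x : WSer ω}
    (hx : x ∈ rhoRange ω) : expS (overS a) * x * expS (-overS a) ∈ rhoRange ω := by
  obtain ⟨y, hy, h⟩ := exists_expS_mul_eq (overS_mem ha) (Subalgebra.toSubmodule (rhoRange ω))
    (fun x hx => overS_comm_mem (FWeyl.filt_anti (by omega) ha) hx) hx
  rw [hy, mul_assoc, expS_mul_expS_neg (overS_mem ha), mul_one]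
  intro d
  obtain ⟨z, hz, e⟩ := h d
  rw [e]
  exact hz d

theorem expU_mem_uniGroup [CharZero k] {a : FWeyl ω} (ha : a ∈ FWeyl.filt ω 3) :
    expU (overS a) (overS_mem ha) ∈ uniGroup ω := by
  refine ⟨coeff_zero_expS _, expS_mem_tripleRange (overS_mem_tripleRange ha),
    fun x hx => conj_expS_mem ha hx, fun x hx => ?_⟩
  have := conj_expS_mem (neg_mem ha) hx
  rwa [overS_neg, neg_neg] at this

theorem expSet_subset_uniGroup [CharZero k] : expSet ω ⊆ (uniGroup ω : Set (WSer ω)ˣ) := by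
  rintro u ⟨a, ha, hu⟩
  obtain rfl : u = expU (overS a) (overS_mem ha) := Units.ext hu
  exact expU_mem_uniGroup ha

theorem exists_overS_eq {b : WSer ω} (hb : ∀ i, coeff i b ∈ weylF ω (i + 2)) (h0 : coeff 0 b = 0) :
    ∃ a ∈ FWeyl.filt ω 3, overS a = b := by
  choose a ha e using hb
  refine ⟨FWeyl.mk (fun i => if 3 ≤ i then a (i - 2) else 0) fun i => ?_, fun i hi => ?_, ?_⟩
  · split_ifs with h
    · have := ha (i - 2)
      rwa [Nat.sub_add_cancel (by omega)] at this
    · exact zero_mem _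
  · rw [FWeyl.comp_mk, if_neg (by omega)]
  · ext d
    rw [overS, coeff_mk, FWeyl.comp_mk]
    split_ifs with h
    · exact e d
    · obtain rfl : d = 0 := by omega
      rw [map_zero, h0]

end Prounipotent

namespace Darboux

open PowerSeries

variable {k V ι : Type*} [Field k] [CharZero k] [AddCommGroup V] [Module k V]
  {ω : SymplecticForm k V} {𝔵 : Submodule k V} [Fintype ι]

/-- The leading coefficient of an element of `𝒢^{≥ 1}` has order `d + 2`. -/
theorem leading_mem_weylF (B : Darboux ω 𝔵 ι) {u : (WSer ω)ˣ} (hu : u ∈ uniGroup ω) {d : ℕ}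
    (h : (u : WSer ω) - 1 ∈ serFilt ω (d + 1)) :
    coeff (d + 1) (u : WSer ω) ∈ weylF ω (d + 3) := by
  set w := coeff (d + 1) (u : WSer ω)
  have hw : coeff (d + 1) ((u : WSer ω) - 1) = w := by
    rw [map_sub, coeff_one, if_neg (by omega), sub_zero]
  have h1 : ∀ v, w * weylV ω v - weylV ω v * w ∈ weylF ω (d + 2) := fun v => by
    have h2 := hu.2.2.1 _ (rho_mem_rhoRange (FWeyl.ofV v)) (d + 2)
    have e : (u : WSer ω) * rho (FWeyl.ofV v) * ((u⁻¹ : (WSer ω)ˣ) : WSer ω) = rho (FWeyl.ofV v) +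
        (((u : WSer ω) - 1) * C (weylV ω v) - C (weylV ω v) * ((u : WSer ω) - 1)) *
          ((u⁻¹ : (WSer ω)ˣ) : WSer ω) * X := by
      have e1 : ((u : WSer ω) - 1) * C (weylV ω v) - C (weylV ω v) * ((u : WSer ω) - 1) =
          (u : WSer ω) * C (weylV ω v) - C (weylV ω v) * u := by noncomm_ring
      rw [e1, rho_ofV, sub_mul, mul_assoc (C (weylV ω v)) (u : WSer ω), Units.mul_inv, mul_one,
        sub_mul, add_sub_cancel, ← mul_assoc, mul_assoc _ X, mul_assoc _ _ X,
        (commute_X ((u⁻¹ : (WSer ω)ˣ) : WSer ω)).eq]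
    have hm : ((u : WSer ω) - 1) * C (weylV ω v) - C (weylV ω v) * ((u : WSer ω) - 1) ∈
        serFilt ω (d + 1) :=
      sub_mem (mul_mem_serFilt_right _ h) (mul_mem_serFilt_left _ h)
    rw [e, map_add, coeff_succ_mul_X, coeff_mul_of_mem_left hm, inv_coeff_zero hu.1, mul_one,
      map_sub, coeff_mul_C, coeff_C_mul, hw] at h2
    have h3 : coeff (d + 2) (rho (FWeyl.ofV v : FWeyl ω)) = 0 := by
      rw [rho_ofV, coeff_succ_mul_X, coeff_C, if_neg (by omega)]
    rwa [h3, zero_add] at h2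
  obtain ⟨t, ht⟩ := B.exists_sub_mem_weylF h1
  have ht' : algebraMap k _ t ∈ weylF ω (d + 3) := by
    by_cases hd : Even (d + 3)
    · obtain ⟨m, hm⟩ := hd
      exact weylF_le ⟨m, by omega⟩ (algebraMap_mem_weylF t)
    · have h4 : algebraMap k _ t ∈ weylF ω (3 * (d + 1)) := by
        have := sub_mem (hu.2.1 (d + 1)) (weylF_le (e := 3 * (d + 1)) ⟨d, by ring⟩ ht)
        rwa [sub_sub_cancel] at this
      have hd' : ¬ Even (3 * (d + 1)) := by
        rw [Nat.even_mul]; rw [Nat.even_iff] at hd ⊢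
        rw [Nat.even_iff]; omega
      rw [B.algebraMap_mem_odd hd' (Submodule.mem_sup_left h4), map_zero]; exact zero_mem _
  have := add_mem ht ht'
  rwa [sub_add_cancel] at this

theorem uniGroup_subset_expSet (B : Darboux ω 𝔵 ι) : (uniGroup ω : Set (WSer ω)ˣ) ⊆ expSet ω := by
  intro u hu
  let P : ℕ → WSer ω → Prop := fun d b => (∀ i, coeff i b ∈ weylF ω (i + 2)) ∧ coeff 0 b = 0 ∧
    (u : WSer ω) - expS b ∈ serFilt ω (d + 1)
  have h0 : P 0 0 := by
    refine ⟨fun i => zero_mem _, map_zero _, fun i hi => ?_⟩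
    obtain rfl : i = 0 := by omega
    rw [map_sub, hu.1, coeff_zero_expS, sub_self]
  have step : ∀ d b, P d b → ∃ b', P (d + 1) b' ∧ ∀ i < d, coeff i b' = coeff i b := by
    rintro d b ⟨hb, hb0, h⟩
    obtain ⟨a, ha, rfl⟩ := exists_overS_eq hb hb0
    set e := expU (overS a) (overS_mem ha) with he
    have h1 : ((u * e⁻¹ : (WSer ω)ˣ) : WSer ω) - 1 = ((u : WSer ω) - expS (overS a)) *
        (e⁻¹ : (WSer ω)ˣ) := by
      rw [sub_mul, Units.val_mul]; congr 1; exact e.mul_inv.symm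
    have h2 : ((u * e⁻¹ : (WSer ω)ˣ) : WSer ω) - 1 ∈ serFilt ω (d + 1) := by
      rw [h1]; exact mul_mem_serFilt_right _ h
    have h3 := B.leading_mem_weylF (mul_mem hu (inv_mem (expU_mem_uniGroup ha))) h2
    set w := coeff (d + 1) ((u * e⁻¹ : (WSer ω)ˣ) : WSer ω) with hw
    have h4 : w = coeff (d + 1) ((u : WSer ω) - expS (overS a)) := by
      have := congrArg (coeff (d + 1)) h1
      rwa [map_sub, coeff_one, if_neg (by omega), sub_zero, coeff_mul_of_mem_left h,
        inv_coeff_zero (expU_mem_uniGroup ha).1, mul_one] at this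
    have hm : (monomial (d + 1) w : WSer ω) ∈ serFilt ω (d + 1) := fun i hi => by
      rw [coeff_monomial, if_neg (by omega)]
    have hb1 : overS a + monomial (d + 1) w ∈ serFilt ω 1 :=
      add_mem (overS_mem ha) (serFilt_anti (by omega) hm)
    have hdiff : overS a + monomial (d + 1) w - overS a = monomial (d + 1) w :=
      add_sub_cancel_left _ _
    have h5 := expS_sub_expS_sub_mem hb1 (overS_mem ha) (d := d + 1) (by rwa [hdiff])
    rw [hdiff] at h5
    refine ⟨overS a + monomial (d + 1) w, ⟨fun i => ?_, ?_, ?_⟩, fun i hi => ?_⟩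
    · rw [map_add, coeff_monomial]
      refine add_mem (hb i) ?_
      split_ifs with hi
      · subst hi; exact h3
      · exact zero_mem _
    · rw [map_add, hb0, coeff_monomial, if_neg (by omega), zero_add]
    · intro i hi
      by_cases hid : i < d + 1
      · have e1 := h i hid
        have e2 := h5 i (by omega)
        rw [map_sub, map_sub, hm i hid, sub_zero] at e2
        rw [map_sub] at e1 ⊢
        rw [sub_eq_zero.1 e1, sub_eq_zero.1 e2, sub_self]
      · obtain rfl : i = d + 1 := by omega
        have e2 := h5 (d + 1) (by omega)
        rw [map_sub] at h4
        rw [map_sub, map_sub, coeff_monomial_same, sub_eq_zero] at e2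
        rw [map_sub, sub_eq_zero]
        exact (sub_left_injective (b := coeff (d + 1) (expS (overS a))) (e2.trans h4)).symm
    · rw [map_add, hm i (by omega), add_zero]
  obtain ⟨b, hb⟩ := exists_limit h0 step
  have hb2 : ∀ i, coeff i b ∈ weylF ω (i + 2) := fun i => by
    obtain ⟨b', h', e⟩ := hb (i + 1)
    rw [e i (by omega)]; exact h'.1 i
  have hb0 : coeff 0 b = 0 := by
    obtain ⟨b', h', e⟩ := hb 1
    rw [e 0 (by omega)]; exact h'.2.1
  obtain ⟨a, ha, rfl⟩ := exists_overS_eq hb2 hb0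
  refine ⟨a, ha, PowerSeries.ext fun d => ?_⟩
  obtain ⟨b', h', e⟩ := hb (d + 1)
  have hb1 : b' ∈ serFilt ω 1 := fun i hi => by
    obtain rfl : i = 0 := by omega
    exact h'.2.1
  have h1 : overS a - b' ∈ serFilt ω (d + 1) := fun i hi => by rw [map_sub, e i hi, sub_self]
  have h2 := expS_sub_expS_sub_mem (overS_mem ha) hb1 h1
  have h3 := h2 d (by omega)
  rw [map_sub, h1 d (by omega), sub_zero, map_sub, sub_eq_zero] at h3
  have h4 := h'.2.2 d (by omega)
  rw [map_sub, sub_eq_zero] at h4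
  rw [h4, h3]

theorem G1_eq_uniGroup (B : Darboux ω 𝔵 ι) : G1 ω = uniGroup ω :=
  le_antisymm ((Subgroup.closure_le _).2 expSet_subset_uniGroup)
    (B.uniGroup_subset_expSet.trans Subgroup.subset_closure)

end Darboux

/-! ### The homomorphism `Φ_𝒟 : 𝒢 → Aut(𝒟)` -/

section Adj

open PowerSeries

variable {k V : Type*} [Field k] [AddCommGroup V] [Module k V] {ω : SymplecticForm k V}

theorem thetaS_rho (s : Sp ω) (x : FWeyl ω) : thetaS s (rho x) = rho (thetaF s x) := by
  ext d
  rw [coeff_thetaS, coeff_rho, coeff_rho, thetaW_toWeyl, thetaF, FWeyl.comp_mk]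

theorem thetaF_ofV (s : Sp ω) (v : V) :
    thetaF s (FWeyl.ofV v) = (FWeyl.ofV (s.1 v) : FWeyl ω) := by
  refine FWeyl.ext fun d => ?_
  rw [thetaF, FWeyl.comp_mk, comp_ofV, comp_ofV]
  split_ifs
  · rw [thetaD_incl]
  · rw [map_zero]

theorem ofV_add (v w : V) : (FWeyl.ofV (v + w) : FWeyl ω) = FWeyl.ofV v + FWeyl.ofV w := by
  refine FWeyl.ext fun d => ?_
  rw [map_add, comp_ofV, comp_ofV, comp_ofV]
  split_ifs
  · rw [map_add]
  · rw [add_zero]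

theorem ofV_smul (t : k) (v : V) : (FWeyl.ofV (t • v) : FWeyl ω) = t • FWeyl.ofV v := by
  refine FWeyl.ext fun d => ?_
  rw [map_smul, comp_ofV, comp_ofV]
  split_ifs
  · rw [map_smul]
  · rw [smul_zero]

theorem coeff_rho_algebraMap (c : k⟦X⟧) (d : ℕ) :
    ∃ t : k, coeff d (rho (algebraMap k⟦X⟧ (FWeyl ω) c)) = algebraMap k _ t := by
  rcases Nat.even_or_odd' d with ⟨m, rfl | rfl⟩
  · exact ⟨_, coeff_rho_algebraMap_even c m⟩
  · exact ⟨0, by rw [coeff_rho_algebraMap_odd _ (by simp), map_zero]⟩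

theorem commute_of_scalar {a : WSer ω} (ha : ∀ d, ∃ t : k, coeff d a = algebraMap k _ t)
    (b : WSer ω) : Commute a b := by
  ext d
  rw [coeff_mul, coeff_mul, ← Finset.Nat.sum_antidiagonal_swap]
  refine Finset.sum_congr rfl fun p _ => ?_
  obtain ⟨t, ht⟩ := ha p.2
  dsimp only [Prod.fst_swap, Prod.snd_swap]
  rw [ht, Algebra.commutes]

theorem commute_rho_algebraMap (c : k⟦X⟧) (b : WSer ω) :
    Commute (rho (algebraMap k⟦X⟧ (FWeyl ω) c)) b :=
  commute_of_scalar (coeff_rho_algebraMap c) b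

theorem thetaS_of_scalar {a : WSer ω} (ha : ∀ d, ∃ t : k, coeff d a = algebraMap k _ t)
    (s : Sp ω) : thetaS s a = a := by
  ext d
  obtain ⟨t, ht⟩ := ha d
  rw [coeff_thetaS, ht, AlgHom.commutes]

theorem adj_rho_algebraMap (g : 𝒢 ω) (c : k⟦X⟧) :
    adj g (rho (algebraMap k⟦X⟧ (FWeyl ω) c)) = rho (algebraMap k⟦X⟧ (FWeyl ω) c) := by
  rw [adj_apply, thetaS_of_scalar (coeff_rho_algebraMap c),
    ← (commute_rho_algebraMap c ((g.2.left : (WSer ω)ˣ) : WSer ω)).eq, mul_assoc, Units.mul_inv,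
    mul_one]

end Adj

namespace Darboux

open PowerSeries

variable {k V ι : Type*} [Field k] [CharZero k] [AddCommGroup V] [Module k V]
  {ω : SymplecticForm k V} {𝔵 : Submodule k V} [Fintype ι]

theorem left_mem_uniGroup (B : Darboux ω 𝔵 ι) (u : G1 ω) : (u : (WSer ω)ˣ) ∈ uniGroup ω := by
  rw [← B.G1_eq_uniGroup]; exact u.2

theorem exists_adj_rho_eq (B : Darboux ω 𝔵 ι) (g : 𝒢 ω) (x : FWeyl ω) :
    ∃ y, rho y = adj g (rho x) := by
  rw [adj_apply, thetaS_rho]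
  exact mem_rhoRange_iff.1 ((B.left_mem_uniGroup g.2.left).2.2.1 _ (rho_mem_rhoRange _))

/-- The action of an element of `𝒢` on `𝒟`. -/
def adjHom (B : Darboux ω 𝔵 ι) (g : 𝒢 ω) : FWeyl ω →ₐ[k⟦X⟧] FWeyl ω :=
  let h := B.exists_adj_rho_eq g
  { toFun := fun x => (h x).choose
    map_one' := B.rho_injective (by rw [(h 1).choose_spec, map_one, map_one])
    map_mul' := fun x y => B.rho_injective (by
      rw [(h (x * y)).choose_spec, map_mul, map_mul, map_mul, (h x).choose_spec,
        (h y).choose_spec])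
    map_zero' := B.rho_injective (by rw [(h 0).choose_spec, map_zero, map_zero])
    map_add' := fun x y => B.rho_injective (by
      rw [(h (x + y)).choose_spec, map_add, map_add, map_add, (h x).choose_spec,
        (h y).choose_spec])
    commutes' := fun c => B.rho_injective (by
      rw [(h (algebraMap _ _ c)).choose_spec, adj_rho_algebraMap]) }

theorem rho_adjHom (B : Darboux ω 𝔵 ι) (g : 𝒢 ω) (x : FWeyl ω) :
    rho (B.adjHom g x) = adj g (rho x) := (B.exists_adj_rho_eq g x).choose_spec

/-- The homomorphism `Φ_𝒟`. -/
def Phi (B : Darboux ω 𝔵 ι) : 𝒢 ω →* AutD ω where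
  toFun g := AlgEquiv.ofAlgHom (B.adjHom g) (B.adjHom g⁻¹)
    (AlgHom.ext fun x => B.rho_injective (by
      rw [AlgHom.comp_apply, rho_adjHom, rho_adjHom, ← RingAut.mul_apply, ← map_mul,
        mul_inv_cancel, map_one]; rfl))
    (AlgHom.ext fun x => B.rho_injective (by
      rw [AlgHom.comp_apply, rho_adjHom, rho_adjHom, ← RingAut.mul_apply, ← map_mul,
        inv_mul_cancel, map_one]; rfl))
  map_one' := AlgEquiv.ext fun x => B.rho_injective (by
    change rho (B.adjHom 1 x) = rho x
    rw [rho_adjHom, map_one]; rfl)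
  map_mul' g h := AlgEquiv.ext fun x => B.rho_injective (by
    change rho (B.adjHom (g * h) x) = rho (B.adjHom g (B.adjHom h x))
    rw [rho_adjHom, rho_adjHom, rho_adjHom, map_mul]; rfl)

theorem rho_Phi (B : Darboux ω 𝔵 ι) (g : 𝒢 ω) (x : FWeyl ω) :
    rho (B.Phi g x) = adj g (rho x) := B.rho_adjHom g x

theorem Phi_inr (B : Darboux ω 𝔵 ι) (t : kˣ) (s : Sp ω) (x : FWeyl ω) :
    B.Phi (t, SemidirectProduct.inr s) x = thetaF s x := B.rho_injective (by
  rw [rho_Phi, adj_apply, ← thetaS_rho]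
  change ((1 : (WSer ω)ˣ) : WSer ω) * thetaS s (rho x) * ((1⁻¹ : (WSer ω)ˣ) : WSer ω) = _
  rw [inv_one, Units.val_one, one_mul, mul_one])

theorem mem_GJ_iff (B : Darboux ω 𝔵 ι) {g : 𝒢 ω} : g ∈ GJ ω 𝔵 ↔ B.Phi g ∈ AutJ ω 𝔵 := by
  change adj g '' (rho '' (JIdeal ω 𝔵 : Set (FWeyl ω))) =
    rho '' (JIdeal ω 𝔵 : Set (FWeyl ω)) ↔ _
  have e : adj g '' (rho '' (JIdeal ω 𝔵 : Set (FWeyl ω))) =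
      rho '' (B.Phi g '' (JIdeal ω 𝔵 : Set (FWeyl ω))) := by
    rw [Set.image_image, Set.image_image]
    simp only [rho_Phi]
  rw [e, B.rho_injective.image_injective.eq_iff]
  constructor
  · intro h x
    constructor
    · intro hx
      have hx' : B.Phi g x ∈ (JIdeal ω 𝔵 : Set (FWeyl ω)) := hx
      rw [← h] at hx'
      obtain ⟨y, hy, e⟩ := hx'
      rwa [(B.Phi g).injective e] at hy
    · intro hx
      have : B.Phi g x ∈ (JIdeal ω 𝔵 : Set (FWeyl ω)) := by rw [← h]; exact ⟨x, hx, rfl⟩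
      exact this
  · intro h
    ext y
    constructor
    · rintro ⟨x, hx, rfl⟩; exact (h x).2 hx
    · intro hy
      refine ⟨(B.Phi g).symm y, (h _).1 ?_, (B.Phi g).apply_symm_apply y⟩
      rwa [(B.Phi g).apply_symm_apply]

end Darboux

/-! ### Surjectivity and kernel of `Φ_𝒟` -/

namespace Darboux

open PowerSeries

variable {k V ι : Type*} [Field k] [AddCommGroup V] [Module k V]
  {ω : SymplecticForm k V} {𝔵 : Submodule k V} [Fintype ι]

theorem algebraMap_weyl_injective (B : Darboux ω 𝔵 ι) :
    Function.Injective (algebraMap k (Weyl ω)) := fun s t h => by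
  have := congrArg B.symbol h
  rw [symbol_algebraMap, symbol_algebraMap] at this
  exact MvPolynomial.C_injective _ _ this

theorem weylV_injective (B : Darboux ω 𝔵 ι) : Function.Injective (weylV ω) := by
  rw [injective_iff_map_eq_zero]
  intro v hv
  refine ω.nondegenerate v fun w => B.algebraMap_weyl_injective ?_
  rw [← weylV_comm, hv, zero_mul, mul_zero, sub_zero, map_zero]

theorem rho_ofV_comm (v w : V) :
    rho (FWeyl.ofV v) * rho (FWeyl.ofV w) - rho (FWeyl.ofV w) * rho (FWeyl.ofV v) =
      (ω.form v w • X ^ 2 : WSer ω) := by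
  have h : ∀ v w, (rho (FWeyl.ofV v) * rho (FWeyl.ofV w) : WSer ω) =
      C (weylV ω v * weylV ω w) * X ^ 2 := fun v w => by
    rw [rho_ofV v, rho_ofV' w, mul_assoc, ← mul_assoc X, ← pow_two, (commute_X_pow _ 2).symm.eq,
      ← mul_assoc, map_mul]
  rw [h, h, ← sub_mul, ← map_sub, weylV_comm]
  ext d
  rw [coeff_C_mul, ← Algebra.smul_def]
  rfl

theorem ofV_comm (B : Darboux ω 𝔵 ι) (v w : V) :
    (FWeyl.ofV v * FWeyl.ofV w - FWeyl.ofV w * FWeyl.ofV v : FWeyl ω) =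
      ω.form v w • FWeyl.hbar ω := B.rho_injective (by
  rw [map_sub, map_mul, map_mul, rho_ofV_comm, rho_smul, rho_hbar])

theorem aut_smul (f : AutD ω) (t : k) (x : FWeyl ω) : f (t • x) = t • f x :=
  f.toLinearMap.map_smul_of_tower t x

/-- `[f(v), f(w)] = ω(v, w) ħ` for an automorphism `f`. -/
theorem rho_aut_comm (B : Darboux ω 𝔵 ι) (f : AutD ω) (v w : V) :
    rho (f (FWeyl.ofV v)) * rho (f (FWeyl.ofV w)) - rho (f (FWeyl.ofV w)) * rho (f (FWeyl.ofV v)) =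
      (ω.form v w • X ^ 2 : WSer ω) := by
  have h := congrArg (fun x => rho (f x)) (B.ofV_comm v w)
  simp only [map_sub, map_mul] at h
  rw [h, aut_smul, show f (FWeyl.hbar ω) = FWeyl.hbar ω from f.commutes _, rho_smul, rho_hbar]

theorem rho_mem_serFilt {x : FWeyl ω} {j : ℕ} (hx : x ∈ FWeyl.filt ω j) :
    rho x ∈ serFilt ω j := fun i hi => by rw [coeff_rho, hx i hi, map_zero]

theorem mem_filt_of_rho (B : Darboux ω 𝔵 ι) {x : FWeyl ω} {j : ℕ} (hx : rho x ∈ serFilt ω j) :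
    x ∈ FWeyl.filt ω j := fun i hi =>
  B.eq_zero_of_toWeyl_eq_zero (FWeyl.comp_mem x i) (hx i hi)

/-- One step in the construction of a series that implements a unipotent automorphism. -/
theorem exists_implement_step [CharZero k] (B : Darboux ω 𝔵 ι) (f : AutD ω)
    (hf : ∀ v, f (FWeyl.ofV v) - FWeyl.ofV v ∈ FWeyl.filt ω 2) {d : ℕ} {U : WSer ω}
    (hU : U ∈ tripleRange ω)
    (hR : ∀ v, rho (f (FWeyl.ofV v)) * U - U * rho (FWeyl.ofV v) ∈ serFilt ω (d + 2)) :
    ∃ u ∈ weylF ω (3 * (d + 1)), ∀ v, u * weylV ω v - weylV ω v * u =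
      coeff (d + 2) (rho (f (FWeyl.ofV v)) * U - U * rho (FWeyl.ofV v)) := by
  let R : V → WSer ω := fun v => rho (f (FWeyl.ofV v)) * U - U * rho (FWeyl.ofV v)
  have hadd : ∀ v w, R (v + w) = R v + R w := fun v w => by
    simp only [R, ofV_add, map_add]; noncomm_ring
  have hsmul : ∀ (t : k) v, R (t • v) = t • R v := fun t v => by
    simp only [R, ofV_smul, aut_smul, rho_smul, smul_mul_assoc, mul_smul_comm, smul_sub]
  let c : V →ₗ[k] Weyl ω :=
    { toFun := fun v => coeff (d + 2) (R v)
      map_add' := fun v w => by rw [hadd, map_add]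
      map_smul' := fun t v => by rw [hsmul]; rfl }
  have hlin : ∀ v, coeff 1 (rho (f (FWeyl.ofV v))) = weylV ω v := fun v => by
    have h := rho_mem_serFilt (hf v) 1 (by omega)
    rw [map_sub, map_sub, sub_eq_zero] at h
    rw [h, rho_ofV, coeff_succ_mul_X, coeff_zero_C]
  have hf1 : ∀ v, rho (f (FWeyl.ofV v)) ∈ serFilt ω 1 := fun v =>
    rho_mem_serFilt (aut_ofV_mem_filt f v)
  have hv1 : ∀ v, (rho (FWeyl.ofV v) : WSer ω) ∈ serFilt ω 1 := fun v =>
    rho_mem_serFilt (FWeyl.ofV_mem_filt v)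
  have hvc : ∀ v, coeff 1 (rho (FWeyl.ofV v) : WSer ω) = weylV ω v := fun v => by
    rw [rho_ofV, coeff_succ_mul_X, coeff_zero_C]
  have key : ∀ v w, rho (f (FWeyl.ofV w)) * R v - R v * rho (FWeyl.ofV w) =
      rho (f (FWeyl.ofV v)) * R w - R w * rho (FWeyl.ofV v) := fun v w => by
    have e1 := B.rho_aut_comm f v w
    have e2 := rho_ofV_comm (ω := ω) v w
    have e3 : (rho (f (FWeyl.ofV v)) * rho (f (FWeyl.ofV w)) -
        rho (f (FWeyl.ofV w)) * rho (f (FWeyl.ofV v))) * U = U *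
        (rho (FWeyl.ofV v) * rho (FWeyl.ofV w) - rho (FWeyl.ofV w) * rho (FWeyl.ofV v)) := by
      rw [e1, e2, smul_mul_assoc, mul_smul_comm, (commute_X_pow U 2).symm.eq]
    rw [← sub_eq_zero] at e3 ⊢
    rw [← neg_eq_zero, ← e3]
    simp only [R]
    noncomm_ring
  have hcoef : ∀ v w, coeff (1 + (d + 2)) (rho (f (FWeyl.ofV w)) * R v - R v * rho (FWeyl.ofV w)) =
      weylV ω w * c v - c v * weylV ω w := fun v w => by
    rw [map_sub, coeff_mul_of_mem (hf1 w) (hR v), hlin, add_comm 1,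
      coeff_mul_of_mem (hR v) (hv1 w), hvc]
    rfl
  have hclosed : ∀ v w, c v * weylV ω w - weylV ω w * c v = c w * weylV ω v - weylV ω v * c w :=
    fun v w => by
      have h := congrArg (coeff (1 + (d + 2))) (key v w)
      rw [hcoef, hcoef] at h
      rw [← neg_sub, h, neg_sub]
  have hc : ∀ v, c v ∈ weylF ω (3 * d + 2) := fun v => by
    have e : R v = rho (FWeyl.ofV v) * U - U * rho (FWeyl.ofV v) +
        rho (f (FWeyl.ofV v) - FWeyl.ofV v) * U := by
      simp only [R, map_sub]; noncomm_ring
    change coeff (d + 2) (R v) ∈ _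
    rw [e, map_add, map_sub]
    refine add_mem ?_ ?_
    · rw [rho_ofV' v, mul_assoc, coeff_succ_X_mul, coeff_C_mul, ← rho_ofV', rho_ofV, ← mul_assoc,
        coeff_succ_mul_X, coeff_mul_C]
      exact comm_mem_weylF (by ring) (weylV_mem_weylF v) (hU (d + 1))
    · rw [coeff_mul]
      refine sum_mem fun p hp => ?_
      rw [Finset.HasAntidiagonal.mem_antidiagonal] at hp
      by_cases h : p.1 < 2
      · rw [rho_mem_serFilt (hf v) _ h, zero_mul]; exact zero_mem _
      · exact weylF_le ⟨p.1 - 2, by omega⟩ (mul_mem_weylF (coeff_rho_mem _ p.1) (hU p.2))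
  obtain ⟨u, hu, h⟩ := B.exists_comm_eq_mem c hc hclosed
  exact ⟨u, hu, h⟩

/-- A unipotent automorphism of `𝒟` is conjugation by a series. -/
theorem exists_implement [CharZero k] (B : Darboux ω 𝔵 ι) (f : AutD ω)
    (hf : ∀ v, f (FWeyl.ofV v) - FWeyl.ofV v ∈ FWeyl.filt ω 2) :
    ∃ s ∈ tripleRange ω, coeff 0 s = 1 ∧
      ∀ v, rho (f (FWeyl.ofV v)) * s = s * rho (FWeyl.ofV v) := by
  let P : ℕ → WSer ω → Prop := fun d U => U ∈ tripleRange ω ∧ coeff 0 U = 1 ∧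
    ∀ v, rho (f (FWeyl.ofV v)) * U - U * rho (FWeyl.ofV v) ∈ serFilt ω (d + 2)
  have h0 : P 0 1 := ⟨one_mem _, coeff_zero_one, fun v => by
    rw [mul_one, one_mul, ← map_sub]; exact rho_mem_serFilt (hf v)⟩
  have step : ∀ d U, P d U → ∃ U', P (d + 1) U' ∧ ∀ i < d, coeff i U' = coeff i U := by
    rintro d U ⟨hU, hU0, hR⟩
    obtain ⟨u, hu, h⟩ := B.exists_implement_step f hf hU hR
    have hm : (monomial (d + 1) u : WSer ω) ∈ serFilt ω (d + 1) := fun i hi => by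
      rw [coeff_monomial, if_neg (by omega)]
    refine ⟨U + monomial (d + 1) u, ⟨fun i => ?_, ?_, fun v => ?_⟩, fun i hi => ?_⟩
    · rw [map_add, coeff_monomial]
      refine add_mem (hU i) ?_
      split_ifs with hi
      · subst hi; exact hu
      · exact zero_mem _
    · rw [map_add, hU0, hm 0 (by omega), add_zero]
    · have e : rho (f (FWeyl.ofV v)) * (U + monomial (d + 1) u) -
          (U + monomial (d + 1) u) * rho (FWeyl.ofV v) =
          (rho (f (FWeyl.ofV v)) * U - U * rho (FWeyl.ofV v)) +
          (rho (FWeyl.ofV v) * monomial (d + 1) u - monomial (d + 1) u * rho (FWeyl.ofV v)) +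
          rho (f (FWeyl.ofV v) - FWeyl.ofV v) * monomial (d + 1) u := by
        rw [map_sub]; noncomm_ring
      rw [e]
      refine add_mem ?_ (serFilt_anti (by omega) (mul_mem_serFilt (rho_mem_serFilt (hf v)) hm))
      have hv := rho_mem_serFilt (FWeyl.ofV_mem_filt (ω := ω) v)
      intro i hi
      by_cases hid : i < d + 2
      · rw [map_add, hR v i hid, zero_add]
        exact sub_mem (serFilt_anti (by omega) (mul_mem_serFilt hv hm))
          (mul_mem_serFilt hm hv) i hid
      · obtain rfl : i = d + 2 := by omega
        rw [map_add, ← h v, map_sub, rho_ofV' v, mul_assoc, coeff_succ_X_mul, coeff_C_mul,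
          ← rho_ofV', rho_ofV, ← mul_assoc, coeff_succ_mul_X, coeff_mul_C, coeff_monomial_same]
        abel
    · rw [map_add, hm i (by omega), add_zero]
  obtain ⟨s, hs⟩ := exists_limit h0 step
  refine ⟨s, fun i => ?_, ?_, fun v => ?_⟩
  · obtain ⟨U, h, e⟩ := hs (i + 1)
    rw [e i (by omega)]; exact h.1 i
  · obtain ⟨U, h, e⟩ := hs 1
    rw [e 0 (by omega)]; exact h.2.1
  · rw [← sub_eq_zero]
    ext i
    obtain ⟨U, h, e⟩ := hs (i + 1)
    have hsU : s - U ∈ serFilt ω (i + 1) := fun j hj => by rw [map_sub, e j hj, sub_self]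
    have e' : rho (f (FWeyl.ofV v)) * s - s * rho (FWeyl.ofV v) =
        (rho (f (FWeyl.ofV v)) * U - U * rho (FWeyl.ofV v)) +
        (rho (f (FWeyl.ofV v)) * (s - U) - (s - U) * rho (FWeyl.ofV v)) := by noncomm_ring
    rw [e', map_zero]
    exact add_mem (serFilt_anti (by omega) (h.2.2 v))
      (sub_mem (mul_mem_serFilt_left _ hsU) (mul_mem_serFilt_right _ hsU)) i (Nat.lt_succ_self i)

theorem exists_conj_eq [CharZero k] (B : Darboux ω 𝔵 ι) [Nonempty ι] (f : AutD ω)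
    (hf : ∀ v, f (FWeyl.ofV v) - FWeyl.ofV v ∈ FWeyl.filt ω 2) :
    ∃ u ∈ uniGroup ω, ∀ x, rho (f x) = (u : WSer ω) * rho x * ((u⁻¹ : (WSer ω)ˣ) : WSer ω) := by
  obtain ⟨s, hs, hs0, h⟩ := B.exists_implement f hf
  have h0 : constantCoeff s = ((1 : (Weyl ω)ˣ) : Weyl ω) := by
    rw [← coeff_zero_eq_constantCoeff_apply, hs0, Units.val_one]
  let u : (WSer ω)ˣ := ⟨s, invOfUnit s 1, mul_invOfUnit s 1 h0, invOfUnit_mul s 1 h0⟩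
  have hx : ∀ x, rho (f x) * s = s * rho x := fun x => sub_eq_zero.1 <|
    B.eq_zero_of_forall_mul (serFilt ω) (fun a ha => PowerSeries.ext fun i => by
      rw [ha (i + 1) i (by omega), map_zero]) mem_serFilt_zero
      (fun n a ha b hb => by rw [add_comm]; exact mul_mem_serFilt ha hb)
      (φ := fun x => rho (f x) * s - s * rho x)
      (fun t => by
        rw [IsScalarTower.algebraMap_apply k k⟦X⟧, f.commutes, sub_eq_zero]
        exact (commute_rho_algebraMap _ s).eq)
      (fun x y => by simp only [map_add]; noncomm_ring)
      (fun v x => ⟨rho (f (FWeyl.ofV v)), rho_mem_serFilt (aut_ofV_mem_filt f v), by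
        simp only [map_mul]
        rw [mul_assoc, ← mul_assoc s, ← h, mul_sub]; noncomm_ring⟩) x
  have hx' : ∀ x, rho (f x) = (u : WSer ω) * rho x * ((u⁻¹ : (WSer ω)ˣ) : WSer ω) := fun x => by
    rw [show (u : WSer ω) * rho x = rho (f x) * (u : WSer ω) from (hx x).symm, mul_assoc,
      Units.mul_inv, mul_one]
  refine ⟨u, ⟨hs0, hs, fun x hx => ?_, fun x hx => ?_⟩, hx'⟩
  · obtain ⟨x, rfl⟩ := mem_rhoRange_iff.1 hx
    rw [← hx']; exact rho_mem_rhoRange _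
  · obtain ⟨x, rfl⟩ := mem_rhoRange_iff.1 hx
    have := hx' (f.symm x)
    rw [f.apply_symm_apply] at this
    rw [this, mul_assoc, mul_assoc, Units.inv_mul, mul_one, ← mul_assoc, Units.inv_mul, one_mul]
    exact rho_mem_rhoRange _

theorem exists_sub_ofV_mem_filt {x : FWeyl ω} (hx : x ∈ FWeyl.filt ω 1) :
    ∃ v, x - FWeyl.ofV v ∈ FWeyl.filt ω 2 := by
  obtain ⟨v, hv⟩ := gr_one_le (FWeyl.comp_mem x 1)
  refine ⟨v, fun i hi => ?_⟩
  rw [map_sub, comp_ofV]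
  rcases (by omega : i = 0 ∨ i = 1) with rfl | rfl
  · rw [hx 0 (by omega), if_neg (by omega), sub_zero]
  · rw [if_pos rfl, hv, sub_self]

theorem eq_of_sub_ofV_mem (B : Darboux ω 𝔵 ι) {v w : V}
    (h : (FWeyl.ofV v - FWeyl.ofV w : FWeyl ω) ∈ FWeyl.filt ω 2) : v = w := by
  apply B.weylV_injective
  have := rho_mem_serFilt h 1 (by omega)
  rwa [map_sub, map_sub, rho_ofV, rho_ofV, coeff_succ_mul_X, coeff_succ_mul_X, coeff_zero_C,
    coeff_zero_C, sub_eq_zero] at this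

theorem exists_linear_part (B : Darboux ω 𝔵 ι) [Nonempty ι] (f : AutD ω) :
    ∃ s : Sp ω, ∀ v, f (FWeyl.ofV v) - FWeyl.ofV (s.1 v) ∈ FWeyl.filt ω 2 := by
  choose s hs using fun v => exists_sub_ofV_mem_filt (aut_ofV_mem_filt f v)
  choose s' hs' using fun v => exists_sub_ofV_mem_filt (aut_ofV_mem_filt f.symm v)
  have hinv : ∀ (f : AutD ω) (s s' : V → V),
      (∀ v, f (FWeyl.ofV v) - FWeyl.ofV (s v) ∈ FWeyl.filt ω 2) →
      (∀ v, f.symm (FWeyl.ofV v) - FWeyl.ofV (s' v) ∈ FWeyl.filt ω 2) → ∀ v, s (s' v) = v := by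
    intro f s s' hs hs' v
    refine (B.eq_of_sub_ofV_mem ?_).symm
    have h := add_mem (B.aut_mem_filt f (hs' v)) (hs (s' v))
    rwa [map_sub, f.apply_symm_apply, sub_add_sub_cancel] at h
  let e : V ≃ₗ[k] V :=
    { toFun := s
      invFun := s'
      map_add' := fun v w => B.eq_of_sub_ofV_mem (by
        have h := sub_mem (add_mem (hs v) (hs w)) (hs (v + w))
        rw [ofV_add, map_add] at h
        rw [ofV_add (s v)]
        convert h using 1
        abel)
      map_smul' := fun t v => B.eq_of_sub_ofV_mem (by
        have h := sub_mem (Submodule.smul_mem _ t (hs v)) (hs (t • v))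
        rw [ofV_smul, aut_smul, smul_sub] at h
        rw [RingHom.id_apply, ofV_smul t (s v)]
        convert h using 1
        abel)
      left_inv := hinv f.symm s' s hs' (by rwa [f.symm_symm])
      right_inv := hinv f s s' hs hs' }
  refine ⟨⟨e, fun v w => B.algebraMap_weyl_injective ?_⟩, hs⟩
  have hc : ∀ v, coeff 1 (rho (f (FWeyl.ofV v))) = weylV ω (s v) := fun v => by
    have h := rho_mem_serFilt (hs v) 1 (by omega)
    rw [map_sub, map_sub, sub_eq_zero] at h
    rw [h, rho_ofV, coeff_succ_mul_X, coeff_zero_C]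
  have h1 : ∀ v, rho (f (FWeyl.ofV v)) ∈ serFilt ω 1 := fun v =>
    rho_mem_serFilt (aut_ofV_mem_filt f v)
  have h := congrArg (coeff (1 + 1)) (B.rho_aut_comm f v w)
  rw [map_sub, coeff_mul_of_mem (h1 v) (h1 w), coeff_mul_of_mem (h1 w) (h1 v), hc, hc,
    weylV_comm] at h
  rw [Algebra.algebraMap_eq_smul_one (ω.form v w)]
  refine h.trans ?_
  change ω.form v w • coeff 2 (X ^ 2 : WSer ω) = _
  rw [coeff_X_pow_self]

theorem Phi_surjective [CharZero k] (B : Darboux ω 𝔵 ι) [Nonempty ι] :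
    Function.Surjective B.Phi := by
  intro f
  obtain ⟨s, hs⟩ := B.exists_linear_part f
  let g : 𝒢 ω := (1, SemidirectProduct.inr s)
  have hg : ∀ v, (f * (B.Phi g)⁻¹) (FWeyl.ofV (s.1 v)) = f (FWeyl.ofV v) := fun v => by
    rw [AlgEquiv.mul_apply]
    congr 1
    apply (B.Phi g).injective
    rw [← AlgEquiv.mul_apply, mul_inv_cancel, AlgEquiv.one_apply]
    exact ((B.Phi_inr 1 s _).trans (thetaF_ofV s v)).symm
  obtain ⟨u, hu, h⟩ := B.exists_conj_eq (f * (B.Phi g)⁻¹) (fun v => by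
    have := hs (s.1.symm v)
    rwa [← hg, s.1.apply_symm_apply] at this)
  refine ⟨(1, SemidirectProduct.inl ⟨u, by rwa [B.G1_eq_uniGroup]⟩) * g, ?_⟩
  rw [map_mul, ← _root_.eq_mul_inv_iff_mul_eq]
  refine AlgEquiv.ext fun x => B.rho_injective ?_
  rw [h, rho_Phi, adj_apply]
  congr 2
  change thetaS 1 (rho x) = rho x
  rw [map_one]; rfl

/-- The kernel of `Φ_𝒟` is `K^×`. -/
theorem exists_of_Phi_eq_one [CharZero k] (B : Darboux ω 𝔵 ι) {g : 𝒢 ω} (hg : B.Phi g = 1) :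
    g.2.right = 1 ∧ ∃ c : k⟦X⟧, constantCoeff c = (g.1 : k) ∧
      (g.1 : k) • ((g.2.left : (WSer ω)ˣ) : WSer ω) = rho (algebraMap _ _ c) := by
  have hU := B.left_mem_uniGroup g.2.left
  set u : (WSer ω)ˣ := (g.2.left : (WSer ω)ˣ) with hu
  have h : ∀ v, (u : WSer ω) * rho (FWeyl.ofV (g.2.right.1 v)) = (rho (FWeyl.ofV v) : WSer ω) * (u : WSer ω) := fun v => by
    have := B.rho_Phi g (FWeyl.ofV v)
    rw [hg, AlgEquiv.one_apply, adj_apply, thetaS_rho, thetaF_ofV] at this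
    rw [this, mul_assoc, ← hu, Units.inv_mul, mul_one]
  have hd : ∀ v d, coeff d (u : WSer ω) * weylV ω (g.2.right.1 v) =
      weylV ω v * coeff d (u : WSer ω) := fun v d => by
    have := congrArg (coeff (d + 1)) (h v)
    rwa [rho_ofV, rho_ofV', ← mul_assoc, mul_assoc X, coeff_succ_mul_X, coeff_succ_X_mul,
      coeff_mul_C, coeff_C_mul] at this
  have hr : ∀ v, g.2.right.1 v = v := fun v => B.weylV_injective (by
    have := hd v 0
    rwa [hU.1, one_mul, mul_one] at this)
  choose t ht using fun d => B.exists_eq_algebraMap (w := coeff d (u : WSer ω)) (fun v => by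
    have := hd v d; rwa [hr] at this)
  obtain ⟨c, hc⟩ := exists_coeff_algebraMap (ω := ω) t (fun d hd => by
    have h3 : ¬ Even (3 * d) := by
      rw [Nat.even_mul]; rw [Nat.even_iff] at hd ⊢
      rw [Nat.even_iff]; omega
    refine B.algebraMap_mem_odd h3 (Submodule.mem_sup_left ?_)
    rw [← ht]; exact hU.2.1 d)
  have hc' : rho (algebraMap k⟦X⟧ (FWeyl ω) c) = u := by
    ext d; rw [hc, ← ht]
  refine ⟨Subtype.ext (LinearEquiv.ext hr), (g.1 : k) • c, ?_, ?_⟩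
  · have h0 := hc 0
    rw [hc', hU.1] at h0
    have h1 := coeff_rho_algebraMap_even (ω := ω) c 0
    rw [mul_zero, hc', hU.1] at h1
    have h2 : constantCoeff c = 1 := by
      rw [← coeff_zero_eq_constantCoeff_apply]
      exact B.algebraMap_weyl_injective (by rw [← h1, map_one])
    rw [← coeff_zero_eq_constantCoeff_apply, map_smul, coeff_zero_eq_constantCoeff_apply, h2,
      smul_eq_mul, mul_one]
  · rw [← hc', ← rho_smul, Algebra.algebraMap_eq_smul_one, Algebra.algebraMap_eq_smul_one,
      smul_assoc]

end Darboux

/-! ### The group `K^×` in `𝒢` -/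

section Central

open PowerSeries

variable {k V : Type*} [Field k] [AddCommGroup V] [Module k V] {ω : SymplecticForm k V}

/-- The projection of `K^×` to `1 + ħ K`. -/
def normalizeK (k : Type*) [Field k] : k⟦X⟧ˣ →* k⟦X⟧ˣ :=
  MonoidHom.id _ / (Units.map (C : k →+* k⟦X⟧).toMonoidHom).comp
    (Units.map (constantCoeff (R := k)).toMonoidHom)

theorem C_mul_normalizeK (c : k⟦X⟧ˣ) :
    C (constantCoeff (c : k⟦X⟧)) * (normalizeK k c : k⟦X⟧) = c := by
  have : Units.map (C : k →+* k⟦X⟧).toMonoidHom (Units.map (constantCoeff (R := k)).toMonoidHom c) *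
      normalizeK k c = c := by
    exact mul_div_cancel _ _
  exact congrArg Units.val this

theorem constantCoeff_normalizeK (c : k⟦X⟧ˣ) : constantCoeff (normalizeK k c : k⟦X⟧) = 1 := by
  have h := congrArg constantCoeff (C_mul_normalizeK c)
  rw [map_mul, constantCoeff_C] at h
  exact mul_left_cancel₀ (c.isUnit.map constantCoeff).ne_zero (h.trans (mul_one _).symm)

theorem rho_algebraMap_mem_tripleRange (c : k⟦X⟧) :
    rho (algebraMap k⟦X⟧ (FWeyl ω) c) ∈ tripleRange ω := fun d => by
  rcases Nat.even_or_odd' d with ⟨m, rfl | rfl⟩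
  · rw [coeff_rho_algebraMap_even]
    exact weylF_le ⟨3 * m, by ring⟩ (algebraMap_mem_weylF _)
  · rw [coeff_rho_algebraMap_odd _ (by simp)]; exact zero_mem _

/-- The units of `W⟦t⟧` that come from `K^×`. -/
def unitsK (ω : SymplecticForm k V) : k⟦X⟧ˣ →* (WSer ω)ˣ :=
  Units.map ((rho (ω := ω)).comp (algebraMap k⟦X⟧ (FWeyl ω))).toMonoidHom

theorem coe_unitsK (c : k⟦X⟧ˣ) :
    (unitsK ω c : WSer ω) = rho (algebraMap k⟦X⟧ (FWeyl ω) c) := rfl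

theorem unitsK_conj (c : k⟦X⟧ˣ) (x : WSer ω) :
    (unitsK ω c : WSer ω) * x * (((unitsK ω c)⁻¹ : (WSer ω)ˣ) : WSer ω) = x := by
  rw [coe_unitsK, (commute_rho_algebraMap _ x).eq, mul_assoc, ← coe_unitsK, Units.mul_inv, mul_one]

theorem unitsK_normalizeK_mem (c : k⟦X⟧ˣ) : unitsK ω (normalizeK k c) ∈ uniGroup ω := by
  refine ⟨?_, rho_algebraMap_mem_tripleRange _, fun x hx => by rwa [unitsK_conj], fun x hx => ?_⟩
  · have := coeff_rho_algebraMap_even (ω := ω) (normalizeK k c : k⟦X⟧) 0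
    rwa [mul_zero, coeff_zero_eq_constantCoeff_apply (normalizeK k c : k⟦X⟧),
      constantCoeff_normalizeK, map_one] at this
  · have := unitsK_conj (ω := ω) (normalizeK k c)⁻¹ x
    rw [map_inv, inv_inv] at this
    rwa [this]

variable [CharZero k] {𝔵 : Submodule k V} {ι : Type*} [Fintype ι]

/-- The embedding of `K^×` in `𝒢`. -/
def Darboux.centralHom (B : Darboux ω 𝔵 ι) : k⟦X⟧ˣ →* 𝒢 ω :=
  (Units.map (constantCoeff (R := k)).toMonoidHom).prod
    (SemidirectProduct.inl.comp (((unitsK ω).comp (normalizeK k)).codRestrict (G1 ω) fun c => by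
      rw [B.G1_eq_uniGroup]; exact unitsK_normalizeK_mem c))

theorem Darboux.centralHom_fst (B : Darboux ω 𝔵 ι) (c : k⟦X⟧ˣ) :
    ((B.centralHom c).1 : k) = constantCoeff (c : k⟦X⟧) := rfl

theorem Darboux.centralHom_right (B : Darboux ω 𝔵 ι) (c : k⟦X⟧ˣ) :
    (B.centralHom c).2.right = 1 := rfl

theorem Darboux.centralHom_left (B : Darboux ω 𝔵 ι) (c : k⟦X⟧ˣ) :
    ((B.centralHom c).2.left : (WSer ω)ˣ) = unitsK ω (normalizeK k c) := rfl

theorem Darboux.smul_centralHom_left (B : Darboux ω 𝔵 ι) (c : k⟦X⟧ˣ) :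
    constantCoeff (c : k⟦X⟧) • (((B.centralHom c).2.left : (WSer ω)ˣ) : WSer ω) =
      rho (algebraMap _ _ (c : k⟦X⟧)) := by
  rw [B.centralHom_left, coe_unitsK, ← rho_smul]
  congr 1
  conv_rhs => rw [← C_mul_normalizeK c, map_mul]
  rw [Algebra.smul_def, IsScalarTower.algebraMap_apply k k⟦X⟧]
  rfl

theorem Darboux.Phi_centralHom (B : Darboux ω 𝔵 ι) (c : k⟦X⟧ˣ) : B.Phi (B.centralHom c) = 1 :=
  AlgEquiv.ext fun x => B.rho_injective (by
    rw [B.rho_Phi, adj_apply, B.centralHom_right, map_one, B.centralHom_left, unitsK_conj]; rfl)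

theorem Darboux.rho_algebraMap_injective (B : Darboux ω 𝔵 ι) {c c' : k⟦X⟧}
    (h : rho (algebraMap k⟦X⟧ (FWeyl ω) c) = rho (algebraMap k⟦X⟧ (FWeyl ω) c')) : c = c' := by
  ext m
  have := congrArg (coeff (2 * m)) h
  rw [coeff_rho_algebraMap_even, coeff_rho_algebraMap_even] at this
  exact B.algebraMap_weyl_injective this

theorem Darboux.centralHom_injective (B : Darboux ω 𝔵 ι) : Function.Injective B.centralHom :=
  fun c c' h => Units.ext (B.rho_algebraMap_injective (by
    rw [← B.smul_centralHom_left, ← B.smul_centralHom_left, h, ← B.centralHom_fst, h,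
      B.centralHom_fst]))

theorem Darboux.exists_centralHom_eq (B : Darboux ω 𝔵 ι) {g : 𝒢 ω} (hg : B.Phi g = 1) :
    ∃ c, B.centralHom c = g := by
  obtain ⟨hr, c, hc0, hc⟩ := B.exists_of_Phi_eq_one hg
  have hu : IsUnit c := isUnit_iff_constantCoeff.2 (by rw [hc0]; exact g.1.isUnit)
  obtain ⟨c, rfl⟩ := hu
  refine ⟨c, Prod.ext (Units.ext ?_) (SemidirectProduct.ext (Subtype.ext (Units.ext ?_)) ?_)⟩
  · rw [B.centralHom_fst, hc0]
  · have h := B.smul_centralHom_left c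
    rw [← hc, hc0] at h
    have h' := congrArg (fun a => ((g.1⁻¹ : kˣ) : k) • a) h
    simpa only [smul_smul, Units.inv_mul, one_smul] using h'
  · rw [B.centralHom_right, hr]

theorem Darboux.centralHom_mem_GJ (B : Darboux ω 𝔵 ι) (c : k⟦X⟧ˣ) : B.centralHom c ∈ GJ ω 𝔵 := by
  rw [B.mem_GJ_iff, B.Phi_centralHom]; exact one_mem _

theorem Darboux.centralHom_comm (B : Darboux ω 𝔵 ι) (c : k⟦X⟧ˣ) (g : 𝒢 ω) :
    B.centralHom c * g = g * B.centralHom c := by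
  refine Prod.ext (mul_comm _ _) (SemidirectProduct.ext (Subtype.ext (Units.ext ?_)) ?_)
  · change (unitsK ω (normalizeK k c) : WSer ω) * thetaS 1 ((g.2.left : (WSer ω)ˣ) : WSer ω) =
      ((g.2.left : (WSer ω)ˣ) : WSer ω) * thetaS g.2.right (unitsK ω (normalizeK k c) : WSer ω)
    rw [coe_unitsK, thetaS_of_scalar (coeff_rho_algebraMap _), map_one,
      (commute_rho_algebraMap _ _).eq]
    rfl
  · change 1 * g.2.right = g.2.right * 1
    rw [one_mul, mul_one]

end Central

/-! ### The action of `𝒢_𝒥` on `𝓜` -/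

section ActMod

open PowerSeries

variable {k V : Type*} [Field k] [AddCommGroup V] [Module k V] {ω : SymplecticForm k V}
  {𝔵 : Submodule k V}

/-- The transformation `a ↦ c u s(a)` of `W⟦t⟧` given by `(c, u, s) ∈ 𝒢`. -/
def serMap (g : 𝒢 ω) (a : WSer ω) : WSer ω :=
  (g.1 : k) • (((g.2.left : (WSer ω)ˣ) : WSer ω) * thetaS g.2.right a)

theorem serMap_sub (g : 𝒢 ω) (a b : WSer ω) : serMap g (a - b) = serMap g a - serMap g b := by
  rw [serMap, map_sub, mul_sub, smul_sub]; rfl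

theorem thetaS_smul (s : Sp ω) (t : k) (a : WSer ω) : thetaS s (t • a) = t • thetaS s a := by
  ext d
  change thetaW s (t • coeff d a) = t • thetaW s (coeff d a)
  rw [map_smul]

theorem serMap_one (a : WSer ω) : serMap 1 a = a := by
  change ((1 : kˣ) : k) • (((1 : (WSer ω)ˣ) : WSer ω) * thetaS 1 a) = a
  rw [map_one, Units.val_one, Units.val_one, one_smul, one_mul]; rfl

theorem serMap_mul (g h : 𝒢 ω) (a : WSer ω) : serMap (g * h) a = serMap g (serMap h a) := by
  change ((g.1 : k) * (h.1 : k)) • ((((g.2.left : (WSer ω)ˣ) : WSer ω) *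
    thetaS g.2.right ((h.2.left : (WSer ω)ˣ) : WSer ω)) * thetaS (g.2.right * h.2.right) a) =
    (g.1 : k) • (_ * thetaS g.2.right ((h.1 : k) • (_ * thetaS h.2.right a)))
  rw [thetaS_smul, mul_smul_comm, smul_smul, map_mul, map_mul, mul_assoc]
  rfl

theorem serMap_mul_ser (g : 𝒢 ω) (a b : WSer ω) : serMap g (a * b) = adj g a * serMap g b := by
  rw [serMap, map_mul, adj_apply, serMap, mul_smul_comm]
  congr 1
  rw [mul_assoc (_ * _), Units.inv_mul_cancel_left, mul_assoc]

theorem thetaW_weylV (s : Sp ω) (v : V) : thetaW s (weylV ω v) = weylV ω (s.1 v) := by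
  change thetaW s (toWeyl ω (incl ω v)) = _
  rw [thetaW_toWeyl, thetaD_incl]; rfl

theorem thetaS_mem_serIdeal {s : Sp ω} (hs : ∀ x ∈ 𝔵, s.1 x ∈ 𝔵) {a : WSer ω}
    (ha : a ∈ serIdeal ω 𝔵) : thetaS s a ∈ serIdeal ω 𝔵 := fun d => by
  have h : weylIdeal ω 𝔵 ≤ (weylIdeal ω 𝔵).comap (thetaW s).toRingHom := by
    refine Ideal.span_le.2 ?_
    rintro _ ⟨x, hx, rfl⟩
    change thetaW s (weylV ω x) ∈ weylIdeal ω 𝔵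
    rw [thetaW_weylV]
    exact Ideal.subset_span ⟨_, hs x hx, rfl⟩
  exact h (ha d)

theorem smul_mem_serIdeal (t : k) {a : WSer ω} (ha : a ∈ serIdeal ω 𝔵) :
    t • a ∈ serIdeal ω 𝔵 := by
  rw [Algebra.smul_def]; exact Ideal.mul_mem_left _ _ ha

theorem serMap_mem_serIdeal {g : 𝒢 ω} (hs : ∀ x ∈ 𝔵, g.2.right.1 x ∈ 𝔵) {a : WSer ω}
    (ha : a ∈ serIdeal ω 𝔵) : serMap g a ∈ serIdeal ω 𝔵 :=
  smul_mem_serIdeal _ (Ideal.mul_mem_left _ _ (thetaS_mem_serIdeal hs ha))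

end ActMod

namespace Darboux

open PowerSeries

variable {k V ι : Type*} [Field k] [CharZero k] [AddCommGroup V] [Module k V]
  {ω : SymplecticForm k V} {𝔵 : Submodule k V} [Fintype ι]

theorem mem_of_weylV_mem_weylIdeal (B : Darboux ω 𝔵 ι) {v : V} (h : weylV ω v ∈ weylIdeal ω 𝔵) :
    v ∈ 𝔵 := by
  obtain ⟨a, ha, e⟩ := B.exists_eq_sum_of_mem (d := 0) h (weylV_mem_weylF v)
  choose t ht using fun i => B.eq_algebraMap_of_mem_weylF_zero (ha i)
  have : v = ∑ i, t i • B.basis (Sum.inr i) := B.weylV_injective (by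
    rw [e, map_sum]
    refine Finset.sum_congr rfl fun i _ => ?_
    rw [ht, map_smul, Algebra.smul_def])
  rw [this]
  exact sum_mem fun i _ => Submodule.smul_mem _ _ (B.inr_mem i)

theorem coeff_one_adj (B : Darboux ω 𝔵 ι) (g : 𝒢 ω) (v : V) :
    coeff 1 (adj g (rho (FWeyl.ofV v))) = weylV ω (g.2.right.1 v) := by
  have hU := B.left_mem_uniGroup g.2.left
  have h1 : (rho (FWeyl.ofV (g.2.right.1 v)) : WSer ω) ∈ serFilt ω 1 :=
    rho_mem_serFilt (FWeyl.ofV_mem_filt _)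
  rw [adj_apply, thetaS_rho, thetaF_ofV, coeff_mul_of_mem_left (mul_mem_serFilt_left _ h1),
    inv_coeff_zero hU.1, mul_one, coeff_mul_of_mem_right h1, hU.1, one_mul, rho_ofV,
    coeff_succ_mul_X, coeff_zero_C]

theorem right_mem_of_mem_GJ (B : Darboux ω 𝔵 ι) {g : 𝒢 ω} (hg : g ∈ GJ ω 𝔵) :
    ∀ x ∈ 𝔵, g.2.right.1 x ∈ 𝔵 := fun x hx => by
  have h := (B.mem_GJ_iff.1 hg (FWeyl.ofV x)).2 (leftIdeal_le_JIdeal (ofV_mem_leftIdeal hx))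
  have h1 := B.mem_JIdeal.1 h 1
  rw [B.rho_Phi, B.coeff_one_adj, weylJ, if_pos (by omega), bot_sup_eq] at h1
  exact B.mem_of_weylV_mem_weylIdeal h1

/-- The sum of `F^{d-1}` and `W 𝔵`, where `F^{-1} = 0`. -/
def weylG (ω : SymplecticForm k V) (𝔵 : Submodule k V) (d : ℕ) : Submodule k (Weyl ω) :=
  (if d = 0 then ⊥ else weylF ω (d - 1)) ⊔ (weylIdeal ω 𝔵).restrictScalars k

theorem weylG_succ (d : ℕ) :
    weylG ω 𝔵 (d + 1) = weylF ω d ⊔ (weylIdeal ω 𝔵).restrictScalars k := by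
  rw [weylG, if_neg (by omega), Nat.add_sub_cancel]

theorem mul_mem_weylG {i d : ℕ} {a w : Weyl ω} (ha : a ∈ weylF ω i) (hw : w ∈ weylG ω 𝔵 d) :
    a * w ∈ weylG ω 𝔵 (i + d) := by
  obtain ⟨x, hx, y, hy, rfl⟩ := Submodule.mem_sup.1 hw
  rw [mul_add]
  refine add_mem ?_ (Submodule.mem_sup_right (Ideal.mul_mem_left _ _ hy))
  refine Submodule.mem_sup_left ?_
  rcases d with _ | d
  · rw [if_pos rfl, Submodule.mem_bot] at hx
    rw [hx, mul_zero]; exact zero_mem _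
  · rw [if_neg (by omega)] at hx ⊢
    exact mul_mem_weylF ha hx

theorem mul_mem_weylG_of_mem_weylJ (B : Darboux ω 𝔵 ι) {j e : ℕ} {z w : Weyl ω}
    (hz : z ∈ weylF ω (j + 2)) (hzJ : z ∈ weylJ ω 𝔵 (j + 2)) (hw : w ∈ weylG ω 𝔵 (e + 1))
    (hx : ∀ x ∈ 𝔵, weylV ω x * w ∈ weylG ω 𝔵 e) : z * w ∈ weylG ω 𝔵 (j + 1 + e) := by
  obtain ⟨a, ha, b, hb, rfl⟩ := Submodule.mem_sup.1 hzJ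
  rw [if_neg (by omega), Nat.add_sub_cancel] at ha
  have hb' : b ∈ weylF ω (j + 1 + 1) := by
    have := sub_mem hz (weylF_le_add_two j ha)
    rwa [add_sub_cancel_left] at this
  obtain ⟨y, hy, rfl⟩ := B.exists_eq_sum_of_mem hb hb'
  rw [add_mul, Finset.sum_mul]
  refine add_mem ?_ (sum_mem fun i _ => ?_)
  · have := mul_mem_weylG ha hw
    rwa [← add_assoc, add_right_comm] at this
  · rw [mul_assoc]; exact mul_mem_weylG (hy i) (hx _ (B.inr_mem i))

/-- The elements of `𝒢_𝒥` agree with elements of `𝒟` modulo `𝔵`. -/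
theorem coeff_mem_weylG (B : Darboux ω 𝔵 ι) {g : 𝒢 ω} (hg : g ∈ GJ ω 𝔵) (d : ℕ) :
    coeff d ((g.2.left : (WSer ω)ˣ) : WSer ω) ∈ weylG ω 𝔵 (d + 1) ∧
      ∀ x ∈ 𝔵, weylV ω x * coeff d ((g.2.left : (WSer ω)ˣ) : WSer ω) ∈ weylG ω 𝔵 d := by
  have hU := B.left_mem_uniGroup g.2.left
  set u : (WSer ω)ˣ := (g.2.left : (WSer ω)ˣ) with hu
  induction d using Nat.strong_induction_on with
  | _ d ih =>
    have h2 : ∀ x ∈ 𝔵, weylV ω x * coeff d (u : WSer ω) ∈ weylG ω 𝔵 d := fun x hx => by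
      have hs : (g.2.right⁻¹).1 x ∈ 𝔵 := B.right_mem_of_mem_GJ (inv_mem hg) x hx
      set z := B.Phi g (FWeyl.ofV ((g.2.right⁻¹).1 x)) with hz
      have hzJ : z ∈ JIdeal ω 𝔵 :=
        (B.mem_GJ_iff.1 hg _).2 (leftIdeal_le_JIdeal (ofV_mem_leftIdeal hs))
      have hsx : g.2.right.1 ((g.2.right⁻¹).1 x) = x := g.2.right.1.apply_symm_apply x
      have hz1 : coeff 1 (rho z) = weylV ω x := by
        rw [hz, B.rho_Phi, B.coeff_one_adj, hsx]
      have hzu : rho z * (u : WSer ω) = (u : WSer ω) * rho (FWeyl.ofV x) := by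
        rw [hz, B.rho_Phi, adj_apply, thetaS_rho, thetaF_ofV, hsx, mul_assoc, Units.inv_mul,
          mul_one]
      have hz0 : coeff 0 (rho z) = 0 :=
        rho_mem_serFilt (aut_ofV_mem_filt (B.Phi g) _) 0 (by omega)
      have h := congrArg (coeff (d + 1)) hzu
      rw [rho_ofV, ← mul_assoc, coeff_succ_mul_X, coeff_mul_C, coeff_mul,
        Finset.Nat.sum_antidiagonal_eq_sum_range_succ_mk, Nat.succ_eq_add_one,
        Finset.sum_range_succ', Finset.sum_range_succ'] at h
      simp only [zero_add, hz0, zero_mul, add_zero, hz1, Nat.add_sub_cancel] at h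
      rw [← eq_sub_iff_add_eq'] at h
      rw [h]
      refine sub_mem (Submodule.mem_sup_right
        (Ideal.mul_mem_left _ _ (weylV_mem_weylIdeal hx))) (sum_mem fun j hj => ?_)
      rw [Finset.mem_range] at hj
      obtain ⟨i1, i2⟩ := ih (d + 1 - (j + 1 + 1)) (by omega)
      have := B.mul_mem_weylG_of_mem_weylJ (coeff_rho_mem z (j + 2)) (B.mem_JIdeal.1 hzJ (j + 2))
        i1 i2
      rwa [show j + 1 + (d + 1 - (j + 1 + 1)) = d by omega] at this
    refine ⟨?_, h2⟩
    rcases d with _ | d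
    · rw [hU.1, weylG_succ]
      exact Submodule.mem_sup_left one_mem_weylF
    · obtain ⟨t, ht⟩ := B.exists_sub_mem_weylF_sup (fun x hx => by
        rw [← weylG_succ]; exact h2 x hx)
      rw [weylG_succ]
      have ht' : algebraMap k _ t ∈ weylF ω (d + 1) ⊔ (weylIdeal ω 𝔵).restrictScalars k := by
        by_cases hd : Even (d + 1)
        · obtain ⟨m, hm⟩ := hd
          exact Submodule.mem_sup_left (weylF_le ⟨m, by omega⟩ (algebraMap_mem_weylF t))
        · have hd' : ¬ Even (3 * (d + 1)) := by
            rw [Nat.even_mul]; rw [Nat.even_iff] at hd ⊢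
            rw [Nat.even_iff]; omega
          have hle : weylF ω (d + 1) ⊔ (weylIdeal ω 𝔵).restrictScalars k ≤
              weylF ω (3 * (d + 1)) ⊔ (weylIdeal ω 𝔵).restrictScalars k :=
            sup_le_sup_right (weylF_le ⟨d + 1, by ring⟩) _
          have := sub_mem (Submodule.mem_sup_left (hU.2.1 (d + 1))) (hle ht)
          rw [sub_sub_cancel] at this
          rw [B.algebraMap_mem_odd hd' this, map_zero]; exact zero_mem _
      have := add_mem ht ht'
      rwa [sub_add_cancel] at this

theorem exists_rho_sub_mem (B : Darboux ω 𝔵 ι) (g : GJ ω 𝔵) :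
    ∃ e : FWeyl ω, rho e - serMap g.1 1 ∈ serIdeal ω 𝔵 := by
  choose a ha b hb e using fun d => Submodule.mem_sup.1
    (weylG_succ (ω := ω) (𝔵 := 𝔵) d ▸ (B.coeff_mem_weylG g.2 d).1)
  obtain ⟨x, hx⟩ := exists_rho_eq (ω := ω) (PowerSeries.mk a) (fun d => by
    rw [coeff_mk]; exact ha d)
  refine ⟨(g.1.1 : k) • x, ?_⟩
  rw [rho_smul, serMap, map_one, mul_one, ← smul_sub]
  refine smul_mem_serIdeal _ fun d => ?_
  rw [map_sub, hx, coeff_mk, ← e, sub_add_cancel_left]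
  exact neg_mem (hb d)

/-- The action of `𝒢_𝒥` on `𝓜`. -/
theorem exists_actMod (B : Darboux ω 𝔵 ι) (g : GJ ω 𝔵) : ∃ h : FMod ω 𝔵 →ₗ[k⟦X⟧] FMod ω 𝔵,
    ∃ e : FWeyl ω, rho e - serMap g.1 1 ∈ serIdeal ω 𝔵 ∧
      ∀ x, h (Submodule.Quotient.mk x) = Submodule.Quotient.mk (B.Phi g.1 x * e) := by
  obtain ⟨e, he⟩ := B.exists_rho_sub_mem g
  let p : FWeyl ω →ₗ[k⟦X⟧] FMod ω 𝔵 :=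
    ((leftIdeal ω 𝔵).mkQ.restrictScalars k⟦X⟧).comp
      ((LinearMap.mulRight k⟦X⟧ e).comp (B.Phi g.1).toLinearMap)
  have hp : (leftIdeal ω 𝔵).restrictScalars k⟦X⟧ ≤ LinearMap.ker p := fun x hx => by
    change (Submodule.Quotient.mk (B.Phi g.1 x * e) : FMod ω 𝔵) = 0
    rw [Submodule.Quotient.mk_eq_zero, B.mem_leftIdeal, map_mul, B.rho_Phi]
    have h1 := Ideal.mul_mem_left _ (adj g.1 (rho x)) he
    rw [mul_sub, ← serMap_mul_ser, mul_one] at h1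
    have h2 := add_mem h1
      (serMap_mem_serIdeal (B.right_mem_of_mem_GJ g.2) (rho_mem_serIdeal_of_mem hx))
    rwa [sub_add_cancel] at h2
  exact ⟨((leftIdeal ω 𝔵).restrictScalars k⟦X⟧).liftQ p hp, e, he, fun x => rfl⟩

/-- The action of `𝒢_𝒥` on `𝓜`. -/
def actMod (B : Darboux ω 𝔵 ι) (g : GJ ω 𝔵) : FMod ω 𝔵 →ₗ[k⟦X⟧] FMod ω 𝔵 := (B.exists_actMod g).choose

theorem actMod_mk_eq_iff (B : Darboux ω 𝔵 ι) (g : GJ ω 𝔵) {x y : FWeyl ω} :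
    B.actMod g (Submodule.Quotient.mk x) = Submodule.Quotient.mk y ↔
      rho y - serMap g.1 (rho x) ∈ serIdeal ω 𝔵 := by
  obtain ⟨e, he, h⟩ := (B.exists_actMod g).choose_spec
  have h1 : rho (B.Phi g.1 x * e) - serMap g.1 (rho x) ∈ serIdeal ω 𝔵 := by
    have h1 := Ideal.mul_mem_left _ (adj g.1 (rho x)) he
    rwa [mul_sub, ← serMap_mul_ser, mul_one, ← B.rho_Phi, ← map_mul] at h1
  rw [actMod, h, mk_eq_mk, B.mem_leftIdeal, map_sub]
  constructor
  · intro h2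
    have := sub_mem h1 h2
    rwa [sub_sub_sub_cancel_left] at this
  · intro h2
    have := sub_mem h1 h2
    rwa [sub_sub_sub_cancel_right] at this

theorem actMod_mul (B : Darboux ω 𝔵 ι) (g g' : GJ ω 𝔵) (m : FMod ω 𝔵) :
    B.actMod (g * g') m = B.actMod g (B.actMod g' m) := by
  obtain ⟨x, rfl⟩ := Submodule.Quotient.mk_surjective _ m
  obtain ⟨y, hy⟩ := Submodule.Quotient.mk_surjective _ (B.actMod g' (Submodule.Quotient.mk x))
  obtain ⟨z, hz⟩ := Submodule.Quotient.mk_surjective _ (B.actMod g (Submodule.Quotient.mk y))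
  rw [← hy, ← hz, B.actMod_mk_eq_iff]
  have h1 := (B.actMod_mk_eq_iff g').1 hy.symm
  have h2 := (B.actMod_mk_eq_iff g).1 hz.symm
  have h3 := serMap_mem_serIdeal (B.right_mem_of_mem_GJ g.2) h1
  rw [serMap_sub] at h3
  have h4 := add_mem h2 h3
  rw [sub_add_sub_cancel] at h4
  rw [show ((g * g' : GJ ω 𝔵) : 𝒢 ω) = g.1 * g'.1 from rfl, serMap_mul]
  exact h4

theorem actMod_one (B : Darboux ω 𝔵 ι) (m : FMod ω 𝔵) : B.actMod 1 m = m := by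
  obtain ⟨x, rfl⟩ := Submodule.Quotient.mk_surjective _ m
  rw [B.actMod_mk_eq_iff]
  rw [show ((1 : GJ ω 𝔵) : 𝒢 ω) = 1 from rfl, serMap_one, sub_self]
  exact zero_mem _

theorem actMod_smul (B : Darboux ω 𝔵 ι) (g : GJ ω 𝔵) (a : FWeyl ω) (m : FMod ω 𝔵) :
    B.actMod g (a • m) = B.Phi g.1 a • B.actMod g m := by
  obtain ⟨x, rfl⟩ := Submodule.Quotient.mk_surjective _ m
  obtain ⟨y, hy⟩ := Submodule.Quotient.mk_surjective _ (B.actMod g (Submodule.Quotient.mk x))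
  rw [← hy, smul_mk, smul_mk, B.actMod_mk_eq_iff, map_mul, map_mul, serMap_mul_ser, B.rho_Phi,
    ← mul_sub]
  exact Ideal.mul_mem_left _ _ ((B.actMod_mk_eq_iff g).1 hy.symm)

theorem actMod_mem_filtMod (B : Darboux ω 𝔵 ι) [Nonempty ι] (g : GJ ω 𝔵) {j : ℕ} {m : FMod ω 𝔵}
    (hm : m ∈ filtMod ω 𝔵 j) : B.actMod g m ∈ filtMod ω 𝔵 j := by
  obtain ⟨x, hx, rfl⟩ := hm
  obtain ⟨e, he, h⟩ := (B.exists_actMod g).choose_spec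
  refine ⟨B.Phi g.1 x * e, FWeyl.mul_mem_filt_right _ (B.aut_mem_filt _ hx), ?_⟩
  exact (h x).symm

/-- The action of `𝒢_𝒥` on the pair `(𝒟, 𝓜)`. -/
def actPair (B : Darboux ω 𝔵 ι) [Nonempty ι] : GJ ω 𝔵 →* AutDM ω 𝔵 where
  toFun g := ⟨(B.Phi g.1, LinearEquiv.ofLinearMap (B.actMod g) (B.actMod g⁻¹)
      (LinearMap.ext fun m => by
        rw [LinearMap.comp_apply, ← B.actMod_mul, mul_inv_cancel, B.actMod_one]; rfl)
      (LinearMap.ext fun m => by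
        rw [LinearMap.comp_apply, ← B.actMod_mul, inv_mul_cancel, B.actMod_one]; rfl)),
    fun a m => B.actMod_smul g a m, fun i => ⟨i, fun _ hm => B.actMod_mem_filtMod g hm⟩,
    fun i => ⟨i, fun _ hm => B.actMod_mem_filtMod g⁻¹ hm⟩⟩
  map_one' := Subtype.ext (Prod.ext (map_one B.Phi) (LinearEquiv.ext fun m => B.actMod_one m))
  map_mul' g h := Subtype.ext (Prod.ext (map_mul B.Phi _ _)
    (LinearEquiv.ext fun m => B.actMod_mul g h m))

/-- The embedding of `K^×` in `𝒢_𝒥`. -/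
def centralGJ (B : Darboux ω 𝔵 ι) : k⟦X⟧ˣ →* GJ ω 𝔵 :=
  B.centralHom.codRestrict (GJ ω 𝔵) B.centralHom_mem_GJ

theorem actPair_centralGJ (B : Darboux ω 𝔵 ι) [Nonempty ι] (c : k⟦X⟧ˣ) :
    B.actPair (B.centralGJ c) = epsAut ω 𝔵 c := by
  refine Subtype.ext (Prod.ext (B.Phi_centralHom c) (LinearEquiv.ext fun m => ?_))
  obtain ⟨x, rfl⟩ := Submodule.Quotient.mk_surjective _ m
  change B.actMod (B.centralGJ c) (Submodule.Quotient.mk x) = (c : k⟦X⟧) • Submodule.Quotient.mk x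
  rw [algebraMap_smul_mk, B.actMod_mk_eq_iff]
  have : serMap (B.centralHom c) (rho x) = rho (algebraMap k⟦X⟧ (FWeyl ω) c * x) := by
    rw [serMap, B.centralHom_right, map_one, ← smul_mul_assoc, B.centralHom_fst,
      B.smul_centralHom_left, map_mul]
    rfl
  change rho (algebraMap k⟦X⟧ (FWeyl ω) c * x) - serMap (B.centralHom c) (rho x) ∈ _
  rw [this, sub_self]
  exact zero_mem _

theorem mem_AutJ_of_mem_AutDM (h : AutDM ω 𝔵) : h.1.1 ∈ AutJ ω 𝔵 := by
  have key : ∀ (h : AutDM ω 𝔵) x, x ∈ JIdeal ω 𝔵 → h.1.1 x ∈ JIdeal ω 𝔵 := by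
    intro h x hx
    apply mem_JIdeal_of_smul
    set m : FMod ω 𝔵 := Submodule.Quotient.mk 1
    obtain ⟨m', hm'⟩ := JIdeal_smul_mem hx (h.1.2.symm m)
    refine ⟨h.1.2 m', ?_⟩
    have := congrArg h.1.2 hm'
    rw [h.2.1, h.2.1, h.1.2.apply_symm_apply] at this
    rw [this]
    congr 1
    exact h.1.1.commutes _
  intro x
  refine ⟨fun hx => ?_, key h x⟩
  have := key h⁻¹ _ hx
  rwa [show (h⁻¹).1.1 (h.1.1 x) = x from h.1.1.symm_apply_apply x] at this

theorem exists_epsAut_eq (B : Darboux ω 𝔵 ι) {h : AutDM ω 𝔵} (hh : h.1.1 = 1) :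
    ∃ c, epsAut ω 𝔵 c = h := by
  have key : ∀ h : AutDM ω 𝔵, h.1.1 = 1 → ∃ c : k⟦X⟧, ∀ m, h.1.2 m = c • m := by
    intro h hh
    have hl : ∀ (x : FWeyl ω) (m : FMod ω 𝔵), h.1.2 (x • m) = x • h.1.2 m := fun x m => by
      rw [h.2.1, hh]; rfl
    obtain ⟨c, hc⟩ := B.eq_smul_mk_one_of_forall (m := h.1.2 (Submodule.Quotient.mk 1))
      (fun v hv => by
        rw [← hl, smul_mk, mul_one, (Submodule.Quotient.mk_eq_zero _).2 (ofV_mem_leftIdeal hv),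
          map_zero])
    refine ⟨c, fun m => ?_⟩
    obtain ⟨x, rfl⟩ := Submodule.Quotient.mk_surjective _ m
    have : (Submodule.Quotient.mk x : FMod ω 𝔵) = x • Submodule.Quotient.mk 1 := by
      rw [smul_mk, mul_one]
    rw [this, hl, hc, smul_comm]
  obtain ⟨c, hc⟩ := key h hh
  obtain ⟨c', hc'⟩ := key h⁻¹ (by rw [show (h⁻¹).1.1 = (h.1.1)⁻¹ from rfl, hh, inv_one])
  have hcc : ∀ c c' : k⟦X⟧, (∀ m : FMod ω 𝔵, c • c' • m = m) → c * c' = 1 := fun c c' h =>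
    B.smul_mk_one_injective (by rw [mul_smul, h, one_smul])
  let u : k⟦X⟧ˣ := ⟨c, c', hcc c c' fun m => by
      rw [← hc, ← hc']; exact h.1.2.apply_symm_apply m,
    hcc c' c fun m => by rw [← hc, ← hc']; exact h.1.2.symm_apply_apply m⟩
  exact ⟨u, Subtype.ext (Prod.ext hh.symm (LinearEquiv.ext fun m => (hc m).symm))⟩

theorem actPair_bijective (B : Darboux ω 𝔵 ι) [Nonempty ι] : Function.Bijective B.actPair := by
  constructor
  · rw [injective_iff_map_eq_one]
    intro g hg
    obtain ⟨c, hc⟩ := B.exists_centralHom_eq (g := g.1) (congrArg (fun h => h.1.1) hg)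
    have hc' : B.centralGJ c = g := Subtype.ext hc
    rw [← hc', B.actPair_centralGJ] at hg
    have h1 : (c : k⟦X⟧) • (Submodule.Quotient.mk 1 : FMod ω 𝔵) =
        (1 : k⟦X⟧) • Submodule.Quotient.mk 1 := by
      rw [one_smul]
      exact congrArg (fun h : AutDM ω 𝔵 => h.1.2 (Submodule.Quotient.mk 1)) hg
    have : c = 1 := Units.ext (B.smul_mk_one_injective h1)
    rw [← hc', this, map_one]
  · intro h
    obtain ⟨g, hg⟩ := B.Phi_surjective h.1.1
    have hgJ : g ∈ GJ ω 𝔵 := by rw [B.mem_GJ_iff, hg]; exact mem_AutJ_of_mem_AutDM h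
    obtain ⟨c, hc⟩ := B.exists_epsAut_eq (h := (B.actPair ⟨g, hgJ⟩)⁻¹ * h) (by
      change (B.Phi g)⁻¹ * h.1.1 = 1
      rw [hg, inv_mul_cancel])
    refine ⟨⟨g, hgJ⟩ * B.centralGJ c, ?_⟩
    rw [map_mul, B.actPair_centralGJ, hc, mul_inv_cancel_left]

/-- The isomorphism `𝒢_𝒥 ≅ Aut(𝒟, 𝓜)` given by the action on the pair `(𝒟, 𝓜)`. -/
def actEquiv (B : Darboux ω 𝔵 ι) [Nonempty ι] : GJ ω 𝔵 ≃* AutDM ω 𝔵 :=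
  MulEquiv.ofBijective B.actPair B.actPair_bijective

end Darboux

section Inner

open PowerSeries

variable {k V : Type*} [Field k] [AddCommGroup V] [Module k V] {ω : SymplecticForm k V}
  {𝔵 : Submodule k V} {ι : Type*} [Fintype ι]

theorem hbar_mul_comm (x : FWeyl ω) : FWeyl.hbar ω * x = x * FWeyl.hbar ω :=
  Algebra.commutes _ _

theorem hbar_smul_eq (m : FMod ω 𝔵) : FWeyl.hbar ω • m = (X : k⟦X⟧) • m := by
  obtain ⟨x, rfl⟩ := Submodule.Quotient.mk_surjective _ m
  rw [smul_mk, algebraMap_smul_mk]; rfl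

theorem map_hbar_smul (h : Module.End k⟦X⟧ (FMod ω 𝔵)) (m : FMod ω 𝔵) :
    h (FWeyl.hbar ω • m) = FWeyl.hbar ω • h m := by
  rw [hbar_smul_eq, map_smul, hbar_smul_eq]

theorem smul_hbar_smul (x : FWeyl ω) (m : FMod ω 𝔵) :
    x • FWeyl.hbar ω • m = FWeyl.hbar ω • x • m := by
  rw [smul_smul, smul_smul, hbar_mul_comm]

namespace Darboux

theorem exists_adH (B : Darboux ω 𝔵 ι) (u : FWeyl ω) :
    ∃ δ : Module.End k⟦X⟧ (FWeyl ω), ∀ x, u * x - x * u = FWeyl.hbar ω * δ x := by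
  choose f hf using FWeyl.exists_comm_eq u
  refine ⟨⟨⟨f, fun x y => B.hbar_mul_cancel ?_⟩, fun c x => B.hbar_mul_cancel ?_⟩, hf⟩
  · rw [← hf, mul_add, mul_add, ← hf, ← hf]; noncomm_ring
  · rw [RingHom.id_apply, mul_smul_comm]
    change _ = c • (FWeyl.hbar ω * f x)
    rw [← hf, ← hf, mul_smul_comm, smul_mul_assoc, smul_sub]

/-- The derivation `[(1/ħ) u, -]` of `𝒟`. -/
def adH (B : Darboux ω 𝔵 ι) (u : FWeyl ω) : Module.End k⟦X⟧ (FWeyl ω) :=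
  (B.exists_adH u).choose

theorem hbar_mul_adH (B : Darboux ω 𝔵 ι) (u x : FWeyl ω) :
    FWeyl.hbar ω * B.adH u x = u * x - x * u := ((B.exists_adH u).choose_spec x).symm

theorem adH_eq (B : Darboux ω 𝔵 ι) {u x y : FWeyl ω} (h : u * x - x * u = FWeyl.hbar ω * y) :
    B.adH u x = y := B.hbar_mul_cancel (by rw [B.hbar_mul_adH, h])

theorem adH_mul (B : Darboux ω 𝔵 ι) (u x y : FWeyl ω) :
    B.adH u (x * y) = B.adH u x * y + x * B.adH u y := by
  refine B.adH_eq ?_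
  rw [mul_add, ← mul_assoc (FWeyl.hbar ω), B.hbar_mul_adH, ← mul_assoc (FWeyl.hbar ω),
    hbar_mul_comm x, mul_assoc x (FWeyl.hbar ω), B.hbar_mul_adH]
  noncomm_ring

theorem adH_add (B : Darboux ω 𝔵 ι) (u u' : FWeyl ω) : B.adH (u + u') = B.adH u + B.adH u' :=
  LinearMap.ext fun x => B.adH_eq (by
    rw [LinearMap.add_apply, mul_add (FWeyl.hbar ω), B.hbar_mul_adH, B.hbar_mul_adH]; noncomm_ring)

theorem adH_smul (B : Darboux ω 𝔵 ι) (t : k) (u : FWeyl ω) : B.adH (t • u) = t • B.adH u :=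
  LinearMap.ext fun x => B.adH_eq (by
    rw [LinearMap.smul_apply, mul_smul_comm t (FWeyl.hbar ω), B.hbar_mul_adH, smul_sub, smul_mul_assoc,
      mul_smul_comm])

theorem adH_algebraMap (B : Darboux ω 𝔵 ι) (c : k⟦X⟧) :
    B.adH (algebraMap k⟦X⟧ (FWeyl ω) c) = 0 :=
  LinearMap.ext fun x => B.adH_eq (by
    rw [Algebra.commutes, sub_self, LinearMap.zero_apply, mul_zero])

theorem adH_algebraMap' (B : Darboux ω 𝔵 ι) (t : k) : B.adH (algebraMap k (FWeyl ω) t) = 0 := by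
  rw [IsScalarTower.algebraMap_apply k k⟦X⟧ (FWeyl ω), B.adH_algebraMap]

theorem adH_lie (B : Darboux ω 𝔵 ι) {u u' w : FWeyl ω} (h : u * u' - u' * u = FWeyl.hbar ω * w) :
    B.adH w = ⁅B.adH u, B.adH u'⁆ := by
  refine LinearMap.ext fun x => B.adH_eq (B.hbar_mul_cancel ?_)
  rw [LieRing.of_associative_ring_bracket, LinearMap.sub_apply, Module.End.mul_apply,
    Module.End.mul_apply, mul_sub, mul_sub, mul_sub, ← mul_assoc, ← h, B.hbar_mul_adH,
    B.hbar_mul_adH, mul_sub, mul_sub, ← mul_assoc _ u, hbar_mul_comm u, mul_assoc u,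
    ← mul_assoc _ u', hbar_mul_comm u', mul_assoc u', ← mul_assoc _ _ u, ← mul_assoc _ _ u',
    B.hbar_mul_adH, B.hbar_mul_adH, ← mul_assoc _ x, hbar_mul_comm x, mul_assoc x, ← h]
  noncomm_ring

theorem lie_overHbar_toLoc_eq (B : Darboux ω 𝔵 ι) (u x : FWeyl ω) :
    ⁅overHbar u, toLoc x⁆ = (toLoc (B.adH u x) : Loc ω) :=
  B.lie_overHbar_toLoc_iff.2 (B.hbar_mul_adH u x).symm

theorem adH_eq_of_cls_eq (B : Darboux ω 𝔵 ι) {u u' : FWeyl ω} (h : cls u = cls u') :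
    B.adH u = B.adH u' := by
  obtain ⟨t, rfl⟩ := B.cls_eq_cls_iff.1 h
  rw [B.adH_add, B.adH_algebraMap', add_zero]

theorem cls_mem_𝔊J (B : Darboux ω 𝔵 ι) {u : FWeyl ω} :
    cls u ∈ 𝔊J ω 𝔵 ↔ ∀ x ∈ JIdeal ω 𝔵, B.adH u x ∈ JIdeal ω 𝔵 := by
  constructor
  · rintro ⟨u', h, hu'⟩ x hx
    obtain ⟨y, hy, e⟩ := hu' x hx
    rw [B.lie_overHbar_toLoc_eq] at e
    rwa [← B.adH_eq_of_cls_eq h, B.toLoc_injective e]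
  · intro h
    exact ⟨u, rfl, fun x hx => ⟨_, h x hx, B.lie_overHbar_toLoc_eq u x⟩⟩

theorem derivation_algebraMap {δ : Module.End k⟦X⟧ (FWeyl ω)}
    (hδ : ∀ x y, δ (x * y) = δ x * y + x * δ y) (c : k⟦X⟧) :
    δ (algebraMap _ _ c) = 0 := by
  have h := hδ 1 1
  rw [mul_one, mul_one, one_mul, left_eq_add] at h
  rw [Algebra.algebraMap_eq_smul_one, map_smul, h, smul_zero]

variable [CharZero k]

theorem exists_eq_algebraMap_of_adH (B : Darboux ω 𝔵 ι) {u : FWeyl ω} (h : B.adH u = 0) :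
    ∃ c : k⟦X⟧, u = algebraMap _ _ c := by
  have hc : ∀ d, ∃ t : k, coeff d (rho u) = algebraMap k _ t := fun d => by
    refine B.exists_eq_algebraMap fun v => ?_
    have e := B.hbar_mul_adH u (FWeyl.ofV v)
    rw [h, LinearMap.zero_apply, mul_zero] at e
    have e' := congrArg (fun x => coeff (d + 1) (rho x)) e
    simp only [map_zero, map_sub, map_mul] at e'
    rw [rho_ofV', ← mul_assoc, mul_assoc X, coeff_mul_C, coeff_succ_mul_X, coeff_succ_X_mul,
      coeff_C_mul] at e'
    exact sub_eq_zero.1 e'.symm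
  choose c hc using hc
  obtain ⟨a, ha⟩ := exists_coeff_algebraMap (ω := ω) c fun d hd =>
    B.algebraMap_mem_odd hd (Submodule.mem_sup_left (by rw [← hc]; exact coeff_rho_mem _ _))
  exact ⟨a, B.rho_injective (PowerSeries.ext fun d => by rw [hc, ha])⟩

theorem exists_adH_eq (B : Darboux ω 𝔵 ι) [Nonempty ι] {δ : Module.End k⟦X⟧ (FWeyl ω)}
    (hδ : ∀ x y, δ (x * y) = δ x * y + x * δ y) : ∃ u, B.adH u = δ := by
  let c : ℕ → V →ₗ[k] Weyl ω := fun d =>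
    { toFun := fun v => coeff d (rho (δ (FWeyl.ofV v)))
      map_add' := fun v w => by rw [ofV_add, map_add, map_add, map_add]
      map_smul' := fun t v => by
        rw [ofV_smul, LinearMap.map_smul_of_tower, rho_smul]; rfl }
  have key : ∀ d, ∃ u ∈ weylF ω (d + 1), ∀ v, u * weylV ω v - weylV ω v * u = c d v := fun d => by
    refine B.exists_comm_eq_mem (c d) (fun v => coeff_rho_mem _ _) fun v w => ?_
    have e := congrArg δ (B.ofV_comm v w)
    rw [LinearMap.map_smul_of_tower, FWeyl.hbar, derivation_algebraMap hδ, smul_zero, map_sub, hδ,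
      hδ] at e
    have e' := congrArg (fun x => coeff (d + 1) (rho x)) e
    simp only [map_zero, map_sub, map_mul, map_add] at e'
    rw [rho_ofV', rho_ofV'] at e'
    have h1 : ∀ (s : WSer ω) (a : Weyl ω), coeff (d + 1) (s * (X * C a)) = coeff d s * a :=
      fun s a => by rw [← mul_assoc, coeff_mul_C, coeff_succ_mul_X]
    have h2 : ∀ (s : WSer ω) (a : Weyl ω), coeff (d + 1) (X * C a * s) = a * coeff d s :=
      fun s a => by rw [mul_assoc, coeff_succ_X_mul, coeff_C_mul]
    rw [h1, h2, h1, h2] at e'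
    change coeff d (rho (δ (FWeyl.ofV v))) * _ - _ * coeff d (rho (δ (FWeyl.ofV v))) =
      coeff d (rho (δ (FWeyl.ofV w))) * _ - _ * coeff d (rho (δ (FWeyl.ofV w)))
    rw [← sub_eq_zero, ← e']
    abel
  choose u hu hc using key
  obtain ⟨x, hx⟩ := exists_rho_eq (ω := ω)
    (PowerSeries.mk fun d => Nat.casesOn d 0 u) fun d => by
      rw [coeff_mk]
      cases d with
      | zero => exact zero_mem _
      | succ d => exact hu d
  refine ⟨x, B.derivation_ext (B.adH_mul x) hδ fun v => B.adH_eq (B.rho_injective ?_)⟩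
  rw [map_sub, map_mul, map_mul, map_mul, rho_hbar, hx, rho_ofV', ← mul_assoc, mul_assoc X, sq,
    mul_assoc X]
  refine PowerSeries.ext fun d => ?_
  cases d with
  | zero => simp
  | succ d =>
    rw [map_sub, coeff_mul_C, coeff_succ_mul_X, coeff_succ_X_mul, coeff_succ_X_mul, coeff_C_mul,
      coeff_mk]
    cases d with
    | zero => simp
    | succ d => rw [coeff_succ_X_mul]; exact hc d v

theorem eq_zero_of_algebraMap_mem_JIdeal (B : Darboux ω 𝔵 ι) {t : k}
    (h : algebraMap k (FWeyl ω) t ∈ JIdeal ω 𝔵) : t = 0 := by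
  have := B.mem_JIdeal.1 h 0
  rw [IsScalarTower.algebraMap_apply k k⟦X⟧ (FWeyl ω)] at this
  have e := coeff_rho_algebraMap_even (ω := ω) (algebraMap k k⟦X⟧ t) 0
  rw [mul_zero] at e
  rw [e] at this
  exact B.algebraMap_mem_weylIdeal (by simpa [weylJ] using this)

theorem exists_sub_mem_JIdeal (B : Darboux ω 𝔵 ι) {u : FWeyl ω}
    (h : ∀ x ∈ JIdeal ω 𝔵, B.adH u x ∈ JIdeal ω 𝔵) :
    ∃ t : k, u - algebraMap k _ t ∈ JIdeal ω 𝔵 := by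
  have key : ∀ x ∈ 𝔵, ∃ z : FWeyl ω,
      FWeyl.ofV x * u + FWeyl.hbar ω * (FWeyl.hbar ω * z) ∈ leftIdeal ω 𝔵 := fun x hx => by
    obtain ⟨z, hz⟩ := mem_JIdeal_iff.1 (h _ (leftIdeal_le_JIdeal (ofV_mem_leftIdeal hx)))
    refine ⟨z, ?_⟩
    have e := B.hbar_mul_adH u (FWeyl.ofV x)
    have : FWeyl.ofV x * u + FWeyl.hbar ω * (FWeyl.hbar ω * z) =
        u * FWeyl.ofV x - FWeyl.hbar ω * (B.adH u (FWeyl.ofV x) - FWeyl.hbar ω * z) := by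
      rw [mul_sub, e]; abel
    rw [this]
    exact sub_mem (Ideal.mul_mem_left _ _ (ofV_mem_leftIdeal hx)) (Ideal.mul_mem_left _ _ hz)
  have low : ∀ d < 3, ∀ x ∈ 𝔵, weylV ω x * coeff d (rho u) ∈ weylIdeal ω 𝔵 := fun d hd x hx => by
    obtain ⟨z, hz⟩ := key x hx
    have := mem_serIdeal.1 (rho_mem_serIdeal_of_mem hz) (d + 1)
    rw [map_add, map_add, map_mul rho, map_mul rho, map_mul rho, rho_ofV', rho_hbar, ← mul_assoc, ← pow_add,
      coeff_X_pow_mul', if_neg (by omega), add_zero, mul_assoc, coeff_succ_X_mul,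
      coeff_C_mul] at this
    exact this
  have high : ∀ d, ∀ x ∈ 𝔵, weylV ω x * coeff (d + 3) (rho u) ∈
      weylF ω d ⊔ (weylIdeal ω 𝔵).restrictScalars k := fun d x hx => by
    obtain ⟨z, hz⟩ := key x hx
    have := mem_serIdeal.1 (rho_mem_serIdeal_of_mem hz) (d + 4)
    rw [map_add, map_add, map_mul rho, map_mul rho, map_mul rho, rho_ofV', rho_hbar, ← mul_assoc, ← pow_add,
      coeff_X_pow_mul, mul_assoc, coeff_succ_X_mul, coeff_C_mul] at this
    have e : weylV ω x * coeff (d + 3) (rho u) = -coeff d (rho z) +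
      (weylV ω x * coeff (d + 3) (rho u) + coeff d (rho z)) := by abel
    rw [e]
    exact Submodule.add_mem_sup (neg_mem (coeff_rho_mem _ _)) this
  obtain ⟨t, ht⟩ := B.eq_algebraMap_of_mem_weylF_zero (coeff_rho_mem u 0)
  refine ⟨t, B.mem_JIdeal.2 fun d => ?_⟩
  have hcst : ∀ d, coeff d (rho (algebraMap k (FWeyl ω) t)) =
      if d = 0 then algebraMap k _ t else 0 := fun d => by
    rw [Algebra.algebraMap_eq_smul_one, rho_smul, map_one, PowerSeries.coeff_smul, coeff_one,
      Algebra.algebraMap_eq_smul_one]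
    split_ifs <;> simp
  rw [map_sub, map_sub, hcst]
  match d with
  | 0 => rw [if_pos rfl, ht, sub_self]; exact zero_mem _
  | 1 =>
    rw [if_neg (by omega), sub_zero]
    obtain ⟨r, hr⟩ := B.exists_sub_mem_weylIdeal (low 1 (by omega))
    have : r = 0 := by
      refine B.algebraMap_mem_odd (d := 1) (by decide) ?_
      have e : algebraMap k (Weyl ω) r = coeff 1 (rho u) + -(coeff 1 (rho u) - algebraMap k _ r) :=
        by abel
      rw [e]
      exact Submodule.add_mem_sup (coeff_rho_mem _ _) (neg_mem hr)
    rw [this, map_zero, sub_zero] at hr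
    exact Submodule.mem_sup_right hr
  | 2 =>
    rw [if_neg (by omega), sub_zero]
    obtain ⟨r, hr⟩ := B.exists_sub_mem_weylIdeal (low 2 (by omega))
    have e : coeff 2 (rho u) = algebraMap k _ r + (coeff 2 (rho u) - algebraMap k _ r) := by abel
    have goal : coeff 2 (rho u) ∈ weylF ω 0 ⊔ (weylIdeal ω 𝔵).restrictScalars k := by
      rw [e]
      exact Submodule.add_mem_sup (algebraMap_mem_weylF r) hr
    exact goal
  | d + 3 =>
    rw [if_neg (by omega), sub_zero]
    obtain ⟨r, hr⟩ := B.exists_sub_mem_weylF_sup (high d)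
    have e : coeff (d + 3) (rho u) = algebraMap k _ r + (coeff (d + 3) (rho u) - algebraMap k _ r) :=
      by abel
    have goal : coeff (d + 3) (rho u) ∈ weylF ω (d + 1) ⊔ (weylIdeal ω 𝔵).restrictScalars k := by
      by_cases hd : Even (d + 3)
      · rw [e]
        obtain ⟨m, hm⟩ := hd
        exact add_mem (Submodule.mem_sup_left
          (weylF_le ⟨m - 1, by omega⟩ (algebraMap_mem_weylF r))) hr
      · have : r = 0 := by
          refine B.algebraMap_mem_odd hd ?_
          have e : algebraMap k (Weyl ω) r =
            coeff (d + 3) (rho u) + -(coeff (d + 3) (rho u) - algebraMap k _ r) := by abel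
          rw [e]
          exact add_mem (Submodule.mem_sup_left (coeff_rho_mem _ _))
            (neg_mem (sup_le_sup_right (weylF_le ⟨1, by omega⟩) _ hr))
        rwa [this, map_zero, sub_zero] at hr
    exact goal

theorem adH_mem_JIdeal (B : Darboux ω 𝔵 ι) {u : FWeyl ω} (hu : u ∈ JIdeal ω 𝔵) {x : FWeyl ω}
    (hx : x ∈ JIdeal ω 𝔵) : B.adH u x ∈ JIdeal ω 𝔵 := by
  obtain ⟨m, hm⟩ := JIdeal_smul_mem hx (Submodule.Quotient.mk 1)
  obtain ⟨m', hm'⟩ := JIdeal_smul_mem hu (Submodule.Quotient.mk 1)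
  obtain ⟨n, hn⟩ := JIdeal_smul_mem hu m
  obtain ⟨n', hn'⟩ := JIdeal_smul_mem hx m'
  refine mem_JIdeal_of_smul ⟨n - n', B.hbar_smul_cancel ?_⟩
  rw [← mul_smul, B.hbar_mul_adH, sub_smul, mul_smul, mul_smul, hm, hm', smul_hbar_smul,
    smul_hbar_smul, hn, hn', ← smul_sub, ← smul_sub]

end Darboux
end Inner

section LieIso

open PowerSeries

variable {k V : Type*} [Field k] [CharZero k] [AddCommGroup V] [Module k V]
  {ω : SymplecticForm k V} {𝔵 : Submodule k V} {ι : Type*} [Fintype ι]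

namespace Darboux

theorem exists_repJ (B : Darboux ω 𝔵 ι) (a : 𝔊J ω 𝔵) : ∃ u ∈ JIdeal ω 𝔵, cls u = a.1 := by
  obtain ⟨u, hu⟩ := cls_surjective a.1
  have h := a.2
  rw [← hu, B.cls_mem_𝔊J] at h
  obtain ⟨t, ht⟩ := B.exists_sub_mem_JIdeal h
  exact ⟨_, ht, by rw [← hu]; exact B.cls_eq_cls_iff.2 ⟨-t, by rw [map_neg, sub_eq_add_neg]⟩⟩

theorem eq_of_cls_eq (B : Darboux ω 𝔵 ι) {u u' : FWeyl ω} (hu : u ∈ JIdeal ω 𝔵)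
    (hu' : u' ∈ JIdeal ω 𝔵) (h : cls u = cls u') : u = u' := by
  obtain ⟨t, rfl⟩ := B.cls_eq_cls_iff.1 h
  have : algebraMap k (FWeyl ω) t ∈ JIdeal ω 𝔵 := by simpa using sub_mem hu hu'
  rw [B.eq_zero_of_algebraMap_mem_JIdeal this, map_zero, add_zero]

/-- The representative in `(1/ħ) 𝒥` of an element of `𝔊_𝒥`. -/
def repJ (B : Darboux ω 𝔵 ι) : 𝔊J ω 𝔵 →ₗ[k] FWeyl ω where
  toFun a := (B.exists_repJ a).choose
  map_add' a b := B.eq_of_cls_eq (B.exists_repJ _).choose_spec.1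
    (add_mem (B.exists_repJ a).choose_spec.1 (B.exists_repJ b).choose_spec.1) (by
      rw [map_add, (B.exists_repJ a).choose_spec.2, (B.exists_repJ b).choose_spec.2,
        (B.exists_repJ _).choose_spec.2]; rfl)
  map_smul' t a := B.eq_of_cls_eq (B.exists_repJ _).choose_spec.1
    (by
      rw [Algebra.smul_def]
      exact Ideal.mul_mem_left _ _ (B.exists_repJ a).choose_spec.1) (by
      rw [map_smul, (B.exists_repJ a).choose_spec.2, (B.exists_repJ _).choose_spec.2]; rfl)

theorem repJ_mem (B : Darboux ω 𝔵 ι) (a : 𝔊J ω 𝔵) : B.repJ a ∈ JIdeal ω 𝔵 :=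
  (B.exists_repJ a).choose_spec.1

theorem cls_repJ (B : Darboux ω 𝔵 ι) (a : 𝔊J ω 𝔵) : cls (B.repJ a) = a.1 :=
  (B.exists_repJ a).choose_spec.2

theorem repJ_eq (B : Darboux ω 𝔵 ι) {a : 𝔊J ω 𝔵} {u : FWeyl ω} (hu : u ∈ JIdeal ω 𝔵)
    (h : cls u = a.1) : B.repJ a = u :=
  B.eq_of_cls_eq (B.repJ_mem a) hu (by rw [B.cls_repJ, h])

theorem exists_eq_cls (B : Darboux ω 𝔵 ι) {u : FWeyl ω} (hu : u ∈ JIdeal ω 𝔵) :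
    ∃ a : 𝔊J ω 𝔵, B.repJ a = u :=
  ⟨⟨cls u, B.cls_mem_𝔊J.2 fun _ hx => B.adH_mem_JIdeal hu hx⟩, B.repJ_eq hu rfl⟩

theorem repJ_injective (B : Darboux ω 𝔵 ι) : Function.Injective B.repJ := fun a b h =>
  Subtype.ext (by rw [← B.cls_repJ, h, B.cls_repJ])

theorem repJ_lie (B : Darboux ω 𝔵 ι) (a b : 𝔊J ω 𝔵) :
    B.repJ a * B.repJ b - B.repJ b * B.repJ a = FWeyl.hbar ω * B.repJ ⁅a, b⁆ := by
  have h : B.repJ ⁅a, b⁆ = B.adH (B.repJ a) (B.repJ b) :=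
    B.repJ_eq (B.adH_mem_JIdeal (B.repJ_mem a) (B.repJ_mem b)) (by
      rw [← lie_cls (B.hbar_mul_adH _ _).symm, B.cls_repJ, B.cls_repJ]; rfl)
  rw [h, B.hbar_mul_adH]

theorem repJ_embK (B : Darboux ω 𝔵 ι) (c : k⟦X⟧) : B.repJ (embK ω 𝔵 c) = c • FWeyl.hbar ω :=
  B.repJ_eq (by
    have := hbar_mul_mem_JIdeal (ω := ω) (𝔵 := 𝔵) (algebraMap _ _ c)
    rwa [hbar_mul_comm, ← Algebra.smul_def] at this) rfl

theorem exists_actH (B : Darboux ω 𝔵 ι) {u : FWeyl ω} (hu : u ∈ JIdeal ω 𝔵) :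
    ∃ h : Module.End k⟦X⟧ (FMod ω 𝔵), ∀ m, FWeyl.hbar ω • h m = u • m := by
  choose f hf using fun m : FMod ω 𝔵 => JIdeal_smul_mem hu m
  refine ⟨⟨⟨f, fun m m' => B.hbar_smul_cancel ?_⟩, fun c m => B.hbar_smul_cancel ?_⟩,
    fun m => (hf m).symm⟩
  · rw [← hf, smul_add, smul_add, ← hf, ← hf]
  · rw [RingHom.id_apply, smul_comm (FWeyl.hbar ω) c]
    change _ = c • (FWeyl.hbar ω • f m)
    rw [← hf, ← hf, smul_comm]

/-- The action of `𝔊_𝒥 ≅ (1/ħ) 𝒥` on `𝓜`. -/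
def actH (B : Darboux ω 𝔵 ι) (a : 𝔊J ω 𝔵) : Module.End k⟦X⟧ (FMod ω 𝔵) :=
  (B.exists_actH (B.repJ_mem a)).choose

theorem hbar_smul_actH (B : Darboux ω 𝔵 ι) (a : 𝔊J ω 𝔵) (m : FMod ω 𝔵) :
    FWeyl.hbar ω • B.actH a m = B.repJ a • m := (B.exists_actH (B.repJ_mem a)).choose_spec m

theorem actH_smul (B : Darboux ω 𝔵 ι) (a : 𝔊J ω 𝔵) (x : FWeyl ω) (m : FMod ω 𝔵) :
    B.actH a (x • m) = B.adH (B.repJ a) x • m + x • B.actH a m := by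
  refine B.hbar_smul_cancel ?_
  rw [B.hbar_smul_actH, smul_add, ← smul_hbar_smul x, B.hbar_smul_actH, ← mul_smul (FWeyl.hbar ω) _ m,
    B.hbar_mul_adH, sub_smul, mul_smul, mul_smul, sub_add_cancel]

theorem actH_mem_filtMod (B : Darboux ω 𝔵 ι) (a : 𝔊J ω 𝔵) {j : ℕ} {m : FMod ω 𝔵}
    (hm : m ∈ filtMod ω 𝔵 (j + 2)) : B.actH a m ∈ filtMod ω 𝔵 j := by
  obtain ⟨x, hx, rfl⟩ := hm
  obtain ⟨y, hy⟩ := Submodule.Quotient.mk_surjective _ (B.actH a (Submodule.Quotient.mk x))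
  change B.actH a (Submodule.Quotient.mk x) ∈ _
  have e := B.hbar_smul_actH a (Submodule.Quotient.mk x)
  rw [← hy] at e ⊢
  rw [smul_mk, smul_mk, mk_eq_mk] at e
  refine B.mk_mem_filtMod.2 fun d hd => ?_
  have h := mem_serIdeal.1 (rho_mem_serIdeal_of_mem e) (d + 2)
  rwa [map_sub, map_sub, map_mul rho, rho_hbar, coeff_X_pow_mul,
    rho_mem_serFilt (FWeyl.mul_mem_filt _ hx) _ (by omega), sub_zero] at h

theorem lieDM_ext (B : Darboux ω 𝔵 ι) [Nonempty ι] {δ δ' : DerDM ω 𝔵} (h : δ.1.1 = δ'.1.1) :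
    ∃ c, δ = δ' + epsDer ω 𝔵 c := by
  have hl : ∀ (x : FWeyl ω) (m : FMod ω 𝔵),
      δ.1.2 (x • m) - δ'.1.2 (x • m) = x • (δ.1.2 m - δ'.1.2 m) := fun x m => by
    rw [δ.2.2.1, δ'.2.2.1, h, smul_sub]; abel
  obtain ⟨c, hc⟩ := B.eq_smul_mk_one_of_forall
    (m := δ.1.2 (Submodule.Quotient.mk 1) - δ'.1.2 (Submodule.Quotient.mk 1)) fun v hv => by
      have : (FWeyl.ofV v : FWeyl ω) • (Submodule.Quotient.mk 1 : FMod ω 𝔵) = 0 := by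
        rw [smul_mk, mul_one]
        exact (Submodule.Quotient.mk_eq_zero _).2 (ofV_mem_leftIdeal hv)
      rw [← hl, this, map_zero, map_zero, sub_zero]
  refine ⟨c, Subtype.ext (Prod.ext (by simp [h, epsDer]) (LinearMap.ext fun m => ?_))⟩
  obtain ⟨x, rfl⟩ := Submodule.Quotient.mk_surjective _ m
  have e : (Submodule.Quotient.mk x : FMod ω 𝔵) = x • Submodule.Quotient.mk 1 := by
    rw [smul_mk, mul_one]
  change δ.1.2 _ = δ'.1.2 _ + c • _
  rw [← sub_eq_iff_eq_add', e, hl, hc, smul_comm]; rfl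

/-- The isomorphism `φ_{𝒟,𝓜}` as a homomorphism. -/
def phiHom (B : Darboux ω 𝔵 ι) [Nonempty ι] : 𝔊J ω 𝔵 →ₗ⁅k⁆ DerDM ω 𝔵 where
  toFun a := ⟨(B.adH (B.repJ a), B.actH a), B.adH_mul _, B.actH_smul a,
    B.isContD_of_derivation (map_add _) (B.adH_mul _),
    fun i => ⟨i + 2, fun _ hm => B.actH_mem_filtMod a hm⟩⟩
  map_add' a b := Subtype.ext (Prod.ext (by
      change B.adH _ = B.adH _ + B.adH _
      rw [map_add, B.adH_add]) (LinearMap.ext fun m => B.hbar_smul_cancel (by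
      change _ = FWeyl.hbar ω • (B.actH a m + B.actH b m)
      rw [smul_add, B.hbar_smul_actH, B.hbar_smul_actH, B.hbar_smul_actH, map_add, add_smul])))
  map_smul' t a := Subtype.ext (Prod.ext (by
      change B.adH _ = t • B.adH _
      rw [map_smul, B.adH_smul]) (LinearMap.ext fun m => B.hbar_smul_cancel (by
      change FWeyl.hbar ω • B.actH (t • a) m = FWeyl.hbar ω • (t • B.actH a m)
      rw [B.hbar_smul_actH, smul_comm, B.hbar_smul_actH, map_smul, smul_assoc])))
  map_lie' {a b} := Subtype.ext (Prod.ext (by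
      change B.adH _ = B.adH _ * B.adH _ - B.adH _ * B.adH _
      rw [B.adH_lie (B.repJ_lie a b), LieRing.of_associative_ring_bracket])
      (LinearMap.ext fun m => B.hbar_smul_cancel (B.hbar_smul_cancel (by
        change FWeyl.hbar ω • FWeyl.hbar ω • B.actH ⁅a, b⁆ m =
          FWeyl.hbar ω • FWeyl.hbar ω • (B.actH a (B.actH b m) - B.actH b (B.actH a m))
        rw [B.hbar_smul_actH, ← mul_smul, ← B.repJ_lie, smul_sub, smul_sub, B.hbar_smul_actH,
          B.hbar_smul_actH, ← smul_hbar_smul, ← smul_hbar_smul, B.hbar_smul_actH,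
          B.hbar_smul_actH, sub_smul, mul_smul, mul_smul]))))

theorem phiHom_embK (B : Darboux ω 𝔵 ι) [Nonempty ι] (c : k⟦X⟧) :
    B.phiHom (embK ω 𝔵 c) = epsDer ω 𝔵 c :=
  Subtype.ext (Prod.ext (by
      change B.adH _ = 0
      rw [B.repJ_embK, Algebra.smul_def, FWeyl.hbar, ← map_mul, B.adH_algebraMap])
    (LinearMap.ext fun m => B.hbar_smul_cancel (by
      change FWeyl.hbar ω • B.actH _ m = FWeyl.hbar ω • c • m
      rw [B.hbar_smul_actH, B.repJ_embK, smul_assoc, smul_comm])))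

theorem epsDer_injective (B : Darboux ω 𝔵 ι) : Function.Injective (epsDer ω 𝔵) := fun c c' h =>
  B.smul_mk_one_injective (LinearMap.congr_fun (congrArg (fun δ => δ.1.2) h)
    (Submodule.Quotient.mk 1))

theorem mem_JIdeal_of_mem_DerDM (B : Darboux ω 𝔵 ι) (δ : DerDM ω 𝔵) {x : FWeyl ω}
    (hx : x ∈ JIdeal ω 𝔵) : δ.1.1 x ∈ JIdeal ω 𝔵 := by
  obtain ⟨m, hm⟩ := JIdeal_smul_mem hx (Submodule.Quotient.mk 1)
  obtain ⟨n, hn⟩ := JIdeal_smul_mem hx (δ.1.2 (Submodule.Quotient.mk 1))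
  have h := δ.2.2.1 x (Submodule.Quotient.mk 1)
  rw [hm, map_hbar_smul, hn, ← sub_eq_iff_eq_add, ← smul_sub] at h
  exact mem_JIdeal_of_smul ⟨_, h.symm⟩

theorem phiHom_bijective (B : Darboux ω 𝔵 ι) [Nonempty ι] : Function.Bijective B.phiHom := by
  constructor
  · refine (injective_iff_map_eq_zero B.phiHom).2 fun a ha => ?_
    have h1 : B.adH (B.repJ a) = 0 := congrArg (fun δ => δ.1.1) ha
    have h2 : B.actH a = 0 := congrArg (fun δ => δ.1.2) ha
    obtain ⟨c, hc⟩ := B.exists_eq_algebraMap_of_adH h1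
    have h3 := B.hbar_smul_actH a (Submodule.Quotient.mk 1)
    rw [h2, LinearMap.zero_apply, smul_zero, hc, smul_mk, ← algebraMap_smul_mk] at h3
    have h4 : c = 0 := B.smul_mk_one_injective (by rw [← h3, zero_smul])
    exact B.repJ_injective (by rw [hc, h4, map_zero, map_zero])
  · intro δ
    obtain ⟨u, hu⟩ := B.exists_adH_eq δ.2.1
    obtain ⟨t, ht⟩ := B.exists_sub_mem_JIdeal (u := u) fun x hx => by
      rw [hu]; exact B.mem_JIdeal_of_mem_DerDM δ hx
    obtain ⟨a, ha⟩ := B.exists_eq_cls ht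
    obtain ⟨c, hc⟩ := B.lieDM_ext (δ := δ) (δ' := B.phiHom a) (by
      change _ = B.adH (B.repJ a)
      rw [ha, sub_eq_add_neg, B.adH_add, ← map_neg, B.adH_algebraMap', add_zero, hu])
    exact ⟨a + embK ω 𝔵 c, by rw [map_add, B.phiHom_embK, hc]⟩

/-- The isomorphism `φ_{𝒟,𝓜}`. -/
def phiEquiv (B : Darboux ω 𝔵 ι) [Nonempty ι] : 𝔊J ω 𝔵 ≃ₗ⁅k⁆ DerDM ω 𝔵 :=
  LieEquiv.ofBijective B.phiHom B.phiHom_bijective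

theorem isPhiDM (B : Darboux ω 𝔵 ι) [Nonempty ι] : IsPhiDM B.phiEquiv := fun a =>
  ⟨B.repJ a, B.repJ_mem a, B.cls_repJ a, fun x => (B.lie_overHbar_toLoc_eq _ x).symm,
    B.hbar_smul_actH a⟩

/-- The map `F_Der`. -/
def forgetDer (B : Darboux ω 𝔵 ι) : DerDM ω 𝔵 →ₗ⁅k⁆ DerJ ω 𝔵 where
  toFun δ := ⟨δ.1.1, δ.2.1, δ.2.2.2.1, fun _ hx => B.mem_JIdeal_of_mem_DerDM δ hx⟩
  map_add' _ _ := rfl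
  map_smul' _ _ := rfl
  map_lie' := rfl

/-- The map `φ_𝒟`. -/
def phiD (B : Darboux ω 𝔵 ι) [Nonempty ι] : 𝔊J ω 𝔵 →ₗ⁅k⁆ DerJ ω 𝔵 :=
  B.forgetDer.comp B.phiHom

theorem phiD_spec (B : Darboux ω 𝔵 ι) [Nonempty ι] (a : 𝔊J ω 𝔵) (u : FWeyl ω)
    (hu : cls u = a.1) (x : FWeyl ω) :
    (toLoc ((B.phiD a).1 x) : Loc ω) = ⁅overHbar u, toLoc x⁆ := by
  rw [B.lie_overHbar_toLoc_eq, B.adH_eq_of_cls_eq (hu.trans (B.cls_repJ a).symm)]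
  rfl

theorem phiD_surjective (B : Darboux ω 𝔵 ι) [Nonempty ι] : Function.Surjective B.phiD := by
  intro δ
  obtain ⟨u, hu⟩ := B.exists_adH_eq δ.2.1
  obtain ⟨t, ht⟩ := B.exists_sub_mem_JIdeal (u := u) fun x hx => by
    rw [hu]; exact δ.2.2.2 x hx
  obtain ⟨a, ha⟩ := B.exists_eq_cls ht
  refine ⟨a, Subtype.ext ?_⟩
  change B.adH (B.repJ a) = _
  rw [ha, sub_eq_add_neg, B.adH_add, ← map_neg, B.adH_algebraMap', add_zero, hu]

theorem isExtension_epsDer (B : Darboux ω 𝔵 ι) [Nonempty ι] :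
    LieAlgebra.IsExtension (epsDer ω 𝔵) B.forgetDer where
  ker_eq_bot := (LieHom.ker_eq_bot _).2 B.epsDer_injective
  range_eq_top := (LieHom.range_eq_top _).2 fun δ => by
    obtain ⟨a, ha⟩ := B.phiD_surjective δ
    exact ⟨B.phiHom a, ha⟩
  exact := by
    ext δ
    constructor
    · rintro ⟨c, rfl⟩
      exact LieHom.mem_ker.2 rfl
    · intro h
      have h' : δ.1.1 = 0 := congrArg Subtype.val (LieHom.mem_ker.1 h)
      obtain ⟨c, hc⟩ := B.lieDM_ext (δ := δ) (δ' := 0) h'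
      exact ⟨c, by rw [hc, zero_add]; rfl⟩

theorem isExtension_embK (B : Darboux ω 𝔵 ι) [Nonempty ι] :
    LieAlgebra.IsExtension (embK ω 𝔵) B.phiD where
  ker_eq_bot := (LieHom.ker_eq_bot _).2 fun c c' h => B.epsDer_injective (by
    rw [← B.phiHom_embK, ← B.phiHom_embK, h])
  range_eq_top := (LieHom.range_eq_top _).2 B.phiD_surjective
  exact := by
    ext a
    constructor
    · rintro ⟨c, rfl⟩
      refine LieHom.mem_ker.2 ?_
      change B.forgetDer (B.phiHom (embK ω 𝔵 c)) = 0
      rw [B.phiHom_embK]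
      rfl
    · intro h
      obtain ⟨c, hc⟩ := B.lieDM_ext (δ := B.phiHom a) (δ' := 0)
        (congrArg Subtype.val (LieHom.mem_ker.1 h))
      exact ⟨c, B.phiHom_bijective.1 (by
        change B.phiHom (embK ω 𝔵 c) = _
        rw [B.phiHom_embK, hc, zero_add])⟩

theorem lie_embK (c : k⟦X⟧) (a : 𝔊J ω 𝔵) : ⁅embK ω 𝔵 c, a⁆ = (0 : 𝔊J ω 𝔵) := by
  obtain ⟨u, hu⟩ := cls_surjective a.1
  refine Subtype.ext ?_
  change ⁅cls (c • FWeyl.hbar ω), a.1⁆ = 0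
  rw [← hu, lie_cls (smul_hbar_comm ω c u), map_zero]

theorem lie_epsDer (B : Darboux ω 𝔵 ι) [Nonempty ι] (c : k⟦X⟧) (δ : DerDM ω 𝔵) :
    ⁅epsDer ω 𝔵 c, δ⁆ = (0 : DerDM ω 𝔵) := by
  obtain ⟨a, rfl⟩ := B.phiHom_bijective.2 δ
  rw [← B.phiHom_embK, ← LieHom.map_lie, lie_embK, map_zero]

end Darboux
end LieIso

section Derivative

variable {k G E E' E'' : Type*} [Field k] [AddCommGroup E] [Module k E]
  [AddCommGroup E'] [Module k E'] [AddCommGroup E''] [Module k E'']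
  {O : Subalgebra k (G → k)}

/-- The pairs of a vector valued regular function, that is, a finite sum of products of regular
functions and of vectors, and of its derivative in the direction of a tangent vector. -/
def derMod (T : O →ₗ[k] k) (E : Type*) [AddCommGroup E] [Module k E] :
    Submodule k ((G → E) × E) :=
  Submodule.span k {p | ∃ (f : O) (e : E), p = (fun g => f.1 g • e, T f • e)}

/-- The function `F` is regular, and its derivative in the direction of `T` is `e`. -/
def HasD (T : O →ₗ[k] k) (F : G → E) (e : E) : Prop := (F, e) ∈ derMod T E

theorem hasD_basic (T : O →ₗ[k] k) (f : O) (e : E) : HasD T (fun g => f.1 g • e) (T f • e) :=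
  Submodule.subset_span ⟨f, e, rfl⟩

theorem HasD.induction {T : O →ₗ[k] k} {motive : (F : G → E) → (e : E) → HasD T F e → Prop}
    (basic : ∀ (f : O) (e : E), motive _ _ (hasD_basic T f e))
    (zero : motive 0 0 (Submodule.zero_mem _))
    (add : ∀ F e F' e' (h : HasD T F e) (h' : HasD T F' e'), motive F e h → motive F' e' h' →
      motive (F + F') (e + e') (Submodule.add_mem _ h h'))
    (smul : ∀ (t : k) F e (h : HasD T F e), motive F e h →
      motive (t • F) (t • e) (Submodule.smul_mem _ t h)) {F : G → E} {e : E} (h : HasD T F e) :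
    motive F e h := by
  have : ∀ (q) (hq : q ∈ derMod T E), motive q.1 q.2 hq := fun q hq => by
    induction hq using Submodule.span_induction with
    | mem x hx => obtain ⟨f, e, rfl⟩ := hx; exact basic f e
    | zero => exact zero
    | add x y _ _ hx hy => exact add _ _ _ _ _ _ hx hy
    | smul t x _ hx => exact smul t _ _ _ hx
  exact this _ h

theorem hasD_scalar (T : O →ₗ[k] k) (f : O) : HasD T f.1 (T f) := by
  have := hasD_basic T f (1 : k)
  simpa using this

theorem HasD.add {T : O →ₗ[k] k} {F F' : G → E} {e e' : E} (h : HasD T F e) (h' : HasD T F' e') :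
    HasD T (fun g => F g + F' g) (e + e') := Submodule.add_mem _ h h'

theorem HasD.sub {T : O →ₗ[k] k} {F F' : G → E} {e e' : E} (h : HasD T F e) (h' : HasD T F' e') :
    HasD T (fun g => F g - F' g) (e - e') := Submodule.sub_mem _ h h'

theorem HasD.smul {T : O →ₗ[k] k} {F : G → E} {e : E} (t : k) (h : HasD T F e) :
    HasD T (fun g => t • F g) (t • e) := Submodule.smul_mem _ t h

theorem hasD_zero (T : O →ₗ[k] k) : HasD T (fun _ => (0 : E)) 0 := Submodule.zero_mem _

theorem hasD_sum {T : O →ₗ[k] k} {ι : Type*} (s : Finset ι) {F : ι → G → E} {e : ι → E}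
    (h : ∀ i ∈ s, HasD T (F i) (e i)) : HasD T (fun g => ∑ i ∈ s, F i g) (∑ i ∈ s, e i) := by
  classical
  induction s using Finset.induction_on with
  | empty => simpa using hasD_zero T
  | insert a s ha ih =>
    simp only [Finset.sum_insert ha]
    exact (h a (by simp)).add (ih fun i hi => h i (by simp [hi]))

theorem HasD.map {T : O →ₗ[k] k} (A : E →ₗ[k] E') {F : G → E} {e : E} (h : HasD T F e) :
    HasD T (fun g => A (F g)) (A e) := by
  induction h using HasD.induction with
  | basic f e => simpa only [map_smul] using hasD_basic T f (A e)
  | zero => simpa using hasD_zero T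
  | add F e F' e' _ _ h h' => simpa only [Pi.add_apply, map_add] using h.add h'
  | smul t F e _ h => simpa only [Pi.smul_apply, map_smul] using h.smul t

theorem HasD.exists_mem {T : O →ₗ[k] k} {F : G → k} {e : k} (h : HasD T F e) :
    ∃ f : O, f.1 = F ∧ T f = e := by
  induction h using HasD.induction with
  | basic f e =>
    refine ⟨e • f, ?_, by rw [map_smul, smul_eq_mul, smul_eq_mul, mul_comm]⟩
    ext g
    exact mul_comm _ _
  | zero => exact ⟨0, rfl, map_zero _⟩
  | add F e F' e' _ _ h h' =>
    obtain ⟨f, rfl, rfl⟩ := h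
    obtain ⟨f', rfl, rfl⟩ := h'
    exact ⟨f + f', rfl, map_add _ _ _⟩
  | smul t F e _ h =>
    obtain ⟨f, rfl, rfl⟩ := h
    exact ⟨t • f, rfl, map_smul _ _ _⟩

theorem HasD.mem {T : O →ₗ[k] k} {F : G → k} {e : k} (h : HasD T F e) : F ∈ O := by
  obtain ⟨f, rfl, -⟩ := h.exists_mem
  exact f.2

theorem HasD.apply_eq {T : O →ₗ[k] k} {F : G → k} {e : k} (h : HasD T F e) (f : O)
    (hf : ∀ g, f.1 g = F g) : T f = e := by
  obtain ⟨f', hf', rfl⟩ := h.exists_mem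
  exact congrArg T (Subtype.ext (by rw [hf']; exact funext hf))

theorem HasD.unique {T : O →ₗ[k] k} {F : G → E} {e e' : E} (h : HasD T F e) (h' : HasD T F e') :
    e = e' := by
  have h2 := h.sub h'
  refine sub_eq_zero.1 ((Module.forall_dual_apply_eq_zero_iff k (e - e')).1 fun l => ?_)
  obtain ⟨f, hf, hT⟩ := (h2.map l).exists_mem
  rw [← hT, show f = 0 from Subtype.ext (by rw [hf]; ext g; simp), map_zero]

theorem HasD.mem_of_forall {T : O →ₗ[k] k} {F : G → E} {e : E} (h : HasD T F e)
    (S : Submodule k E) (hS : ∀ g, F g ∈ S) : e ∈ S := by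
  have h1 := h.map S.mkQ
  have h2 : (fun g => S.mkQ (F g)) = fun _ => 0 :=
    funext fun g => (Submodule.Quotient.mk_eq_zero S).2 (hS g)
  rw [h2] at h1
  exact (Submodule.Quotient.mk_eq_zero S).1 (h1.unique (hasD_zero T))

theorem exists_hasD_of_finite (T : O →ₗ[k] k) (S : Submodule k E) [FiniteDimensional k S]
    {F : G → E} (hS : ∀ g, F g ∈ S) (hF : ∀ l : E →ₗ[k] k, (fun g => l (F g)) ∈ O) :
    ∃ e, HasD T F e := by
  let b := Module.finBasis k S
  have hl : ∀ i, ∃ l : E →ₗ[k] k, l ∘ₗ S.subtype = b.coord i := fun i =>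
    LinearMap.exists_extend _
  choose l hl using hl
  have h := hasD_sum Finset.univ fun i _ => hasD_basic T ⟨_, hF (l i)⟩ (b i : E)
  have e : (fun g => ∑ i, (⟨_, hF (l i)⟩ : O).1 g • (b i : E)) = F := by
    ext g
    have := congrArg (S.subtype) (b.sum_repr ⟨F g, hS g⟩)
    rw [map_sum] at this
    refine Eq.trans ?_ this
    refine Finset.sum_congr rfl fun i _ => ?_
    rw [map_smul]
    congr 1
    exact LinearMap.congr_fun (hl i) ⟨F g, hS g⟩
  rw [e] at h
  exact ⟨_, h⟩

theorem HasD.of_injective {T : O →ₗ[k] k} (A : E →ₗ[k] E') (hA : Function.Injective A)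
    {F : G → E} {e : E'} (h : HasD T (fun g => A (F g)) e) : ∃ e, HasD T F e := by
  obtain ⟨A', hA'⟩ := A.exists_leftInverse_of_injective (LinearMap.ker_eq_bot.2 hA)
  have := h.map A'
  simp only [← LinearMap.comp_apply, hA', LinearMap.id_apply] at this
  exact ⟨_, this⟩

theorem hasD_pi {T : O →ₗ[k] k} {ι : Type*} [Fintype ι] {F : G → ι → E} {e : ι → E}
    (h : ∀ i, HasD T (fun g => F g i) (e i)) : HasD T F e := by
  classical
  have := hasD_sum Finset.univ fun i _ => (h i).map (LinearMap.single k (fun _ : ι => E) i)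
  have e1 : ∀ x : ι → E, ∑ i, LinearMap.single k (fun _ : ι => E) i (x i) = x := fun x =>
    LinearMap.sum_single_apply _ x
  simpa only [e1] using this

theorem hasD_prod {T : O →ₗ[k] k} {F : G → E} {F' : G → E'} {e : E} {e' : E'}
    (h : HasD T F e) (h' : HasD T F' e') : HasD T (fun g => (F g, F' g)) (e, e') := by
  have := (h.map (LinearMap.inl k E E')).add (h'.map (LinearMap.inr k E E'))
  simpa using this

section Group

variable [Group G]

theorem IsTangent.map_one {T : O →ₗ[k] k} (hT : IsTangent O T) : T 1 = 0 := by
  have h := hT 1 1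
  have e : (1 : O).1 1 = (1 : k) := rfl
  rw [mul_one, e, one_mul, left_eq_add] at h
  exact h

theorem isTangent_zero : IsTangent O 0 := fun f f' => by simp

theorem hasD_const {T : O →ₗ[k] k} (hT : IsTangent O T) (e : E) :
    HasD T (fun _ => e) 0 := by
  have := hasD_basic T 1 e
  rw [hT.map_one, zero_smul] at this
  simpa using this

theorem HasD.bilin {T : O →ₗ[k] k} (hT : IsTangent O T) (β : E →ₗ[k] E' →ₗ[k] E'')
    {F : G → E} {F' : G → E'} {e : E} {e' : E'} (h : HasD T F e) (h' : HasD T F' e') :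
    HasD T (fun g => β (F g) (F' g)) (β e (F' 1) + β (F 1) e') := by
  induction h using HasD.induction with
  | basic f a =>
    induction h' using HasD.induction with
    | basic f' a' =>
      have := hasD_basic T (f * f') (β a a')
      rw [hT] at this
      convert this using 2 with g
      · simp only [map_smul, LinearMap.smul_apply, smul_smul]
        rw [mul_comm]; rfl
      · simp only [map_smul, LinearMap.smul_apply, smul_smul, add_smul]
        rw [add_comm, mul_comm (T f') _]
    | zero => simpa using hasD_zero T
    | add F e F' e' _ _ h h' =>
      have := h.add h'
      simp only [Pi.add_apply, map_add] at this ⊢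
      convert this using 1
      abel
    | smul t F e _ h =>
      have := h.smul t
      simpa only [Pi.smul_apply, map_smul, smul_add] using this
  | zero => simpa using hasD_zero T
  | add F e F' e' _ _ h h' =>
    have := h.add h'
    simp only [Pi.add_apply, map_add, LinearMap.add_apply] at this ⊢
    convert this using 1
    abel
  | smul t F e _ h =>
    have := h.smul t
    simpa only [Pi.smul_apply, map_smul, smul_add, LinearMap.smul_apply] using this

theorem HasD.mul {A : Type*} [Ring A] [Algebra k A] {T : O →ₗ[k] k} (hT : IsTangent O T)
    {F F' : G → A} {e e' : A} (h : HasD T F e) (h' : HasD T F' e') :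
    HasD T (fun g => F g * F' g) (e * F' 1 + F 1 * e') :=
  h.bilin hT (LinearMap.mul k A) h'

theorem HasD.smul_fun {T : O →ₗ[k] k} (hT : IsTangent O T) {f : G → k} {F : G → E} {t : k} {e : E}
    (h : HasD T f t) (h' : HasD T F e) : HasD T (fun g => f g • F g) (t • F 1 + f 1 • e) :=
  h.bilin hT (LinearMap.lsmul k E) h'

/-- The derivative of a family of linear maps, applied to a vector valued function. -/
theorem HasD.eval {T : O →ₗ[k] k} (hT : IsTangent O T) {A : G → E →ₗ[k] E'} {A' : E →ₗ[k] E'}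
    (hA : ∀ v, HasD T (fun g => A g v) (A' v)) {F : G → E} {e : E} (h : HasD T F e) :
    HasD T (fun g => A g (F g)) (A' (F 1) + A 1 e) := by
  induction h using HasD.induction with
  | basic f e =>
    have := (hasD_scalar T f).smul_fun hT (hA e)
    simpa only [map_smul, add_comm] using this
  | zero => simpa using hasD_zero T
  | add F e F' e' _ _ h h' =>
    have := h.add h'
    simp only [Pi.add_apply, map_add] at this ⊢
    convert this using 1
    abel
  | smul t F e _ h =>
    have := h.smul t
    simpa only [Pi.smul_apply, map_smul, smul_add] using this

end Group

end Derivative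

section Weights

variable {k G : Type*} [Field k] [Group G]

/-- The regular functions of weight `n` with respect to a cocharacter `ζ`. -/
def wt (O : Subalgebra k (G → k)) (ζ : kˣ →* G) (n : ℤ) : Submodule k (G → k) where
  carrier := {F | F ∈ O ∧ ∀ t g, F (ζ t * g) = ((t ^ n : kˣ) : k) * F g}
  add_mem' {F F'} h h' := ⟨add_mem h.1 h'.1, fun t g => by
    rw [Pi.add_apply, Pi.add_apply, h.2, h'.2, mul_add]⟩
  zero_mem' := ⟨zero_mem _, fun t g => by simp⟩
  smul_mem' c F h := ⟨O.smul_mem h.1 c, fun t g => by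
    rw [Pi.smul_apply, Pi.smul_apply, h.2, smul_eq_mul, smul_eq_mul, mul_left_comm]⟩

variable {O : Subalgebra k (G → k)} {ζ : kˣ →* G}

theorem mul_mem_wt {n m : ℤ} {F F' : G → k} (h : F ∈ wt O ζ n) (h' : F' ∈ wt O ζ m) :
    F * F' ∈ wt O ζ (n + m) := ⟨mul_mem h.1 h'.1, fun t g => by
  rw [Pi.mul_apply, Pi.mul_apply, h.2, h'.2, zpow_add, Units.val_mul]; ring⟩

theorem one_mem_wt : (1 : G → k) ∈ wt O ζ 0 := ⟨one_mem _, fun t g => by simp⟩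

theorem zpow_independent [CharZero k] :
    LinearIndependent k (fun (n : ℤ) (t : kˣ) => ((t ^ n : kˣ) : k)) := by
  have h := (linearIndependent_monoidHom kˣ k).comp
    (fun n : ℤ => (Units.coeHom k).comp (zpowGroupHom n)) fun n m h => by
      have h2 := DFunLike.congr_fun h (Units.mk0 (2 : k) two_ne_zero)
      change ((Units.mk0 (2 : k) two_ne_zero ^ n : kˣ) : k) = ((Units.mk0 2 two_ne_zero ^ m : kˣ) : k) at h2
      rw [Units.val_zpow_eq_zpow_val, Units.val_zpow_eq_zpow_val, Units.val_mk0] at h2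
      have h3 : ((2 : ℚ) ^ n) = 2 ^ m := by
        have : (((2 : ℚ) ^ n : ℚ) : k) = ((2 ^ m : ℚ) : k) := by push_cast; exact h2
        exact_mod_cast this
      exact zpow_right_injective₀ (by norm_num) (by norm_num) h3
  exact h

/-- The finitely supported families of functions of weights `n ∈ ℤ`. -/
def wtFam (O : Subalgebra k (G → k)) (ζ : kˣ →* G) : Submodule k (ℤ →₀ (G → k)) where
  carrier := {a | ∀ n, a n ∈ wt O ζ n}
  add_mem' h h' n := add_mem (h n) (h' n)
  zero_mem' n := zero_mem _
  smul_mem' c a h n := Submodule.smul_mem _ c (h n)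

theorem sum_wtFam_injective [CharZero k] {a : ℤ →₀ (G → k)} (ha : a ∈ wtFam O ζ)
    (h : (a.sum fun _ F => F) = 0) : a = 0 := by
  refine Finsupp.ext fun n => funext fun g => ?_
  by_cases hn : n ∈ a.support
  · refine linearIndependent_iff'.1 (zpow_independent (k := k)) a.support (fun n => a n g)
      (funext fun t => ?_) n hn
    have h1 := congrFun h (ζ t * g)
    rw [Finsupp.sum, Finset.sum_apply] at h1
    rw [Finset.sum_apply, Pi.zero_apply, ← show _ = (0 : k) from h1]
    refine Finset.sum_congr rfl fun m _ => ?_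
    rw [(ha m).2, Pi.smul_apply, smul_eq_mul, mul_comm]
  · rw [Finsupp.notMem_support_iff.1 hn]; rfl

theorem exists_wtFam (hO : Subalgebra.toSubmodule O ≤ ⨆ n, wt O ζ n) (F : O) :
    ∃ a ∈ wtFam O ζ, (a.sum fun _ F => F) = F.1 := by
  have h := hO F.2
  rw [Submodule.mem_iSup_iff_exists_finsupp] at h
  obtain ⟨a, ha, h⟩ := h
  exact ⟨a, ha, h⟩

theorem wtFam_sum_mem {a : ℤ →₀ (G → k)} (ha : a ∈ wtFam O ζ) :
    (a.sum fun _ F => F) ∈ O := sum_mem fun n _ => (ha n).1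

/-- The decomposition of a regular function into its components of weights `n ∈ ℤ`. -/
def wtEquiv [CharZero k] (hO : Subalgebra.toSubmodule O ≤ ⨆ n, wt O ζ n) :
    wtFam O ζ ≃ₗ[k] O :=
  LinearEquiv.ofBijective
    { toFun := fun a => ⟨a.1.sum fun _ F => F, wtFam_sum_mem a.2⟩
      map_add' := fun a b => Subtype.ext
        (Finsupp.sum_add_index' (f := a.1) (g := b.1) (h := fun _ F => F) (fun _ => rfl)
          fun _ _ _ => rfl)
      map_smul' := fun c a => Subtype.ext (by
        change ((c • a.1).sum fun _ F => F) = c • (a.1.sum fun _ F => F)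
        rw [Finsupp.sum_smul_index' (fun _ => rfl), Finsupp.smul_sum]) }
    ⟨(injective_iff_map_eq_zero _).2 fun a ha =>
        Subtype.ext (sum_wtFam_injective a.2 (congrArg Subtype.val ha)),
      fun F => by
        obtain ⟨a, ha, h⟩ := exists_wtFam hO F
        exact ⟨⟨a, ha⟩, Subtype.ext h⟩⟩

/-- The linear map whose restriction to the functions of weight `n` is `φ n`. -/
def wtMap [CharZero k] (hO : Subalgebra.toSubmodule O ≤ ⨆ n, wt O ζ n) {E : Type*}
    [AddCommGroup E] [Module k E] (φ : ℤ → (G → k) →ₗ[k] E) : O →ₗ[k] E :=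
  (Finsupp.lsum k φ ∘ₗ (wtFam O ζ).subtype) ∘ₗ (wtEquiv hO).symm.toLinearMap

theorem wtMap_apply [CharZero k] (hO : Subalgebra.toSubmodule O ≤ ⨆ n, wt O ζ n) {E : Type*}
    [AddCommGroup E] [Module k E] (φ : ℤ → (G → k) →ₗ[k] E) {n : ℤ} (F : O)
    (hF : F.1 ∈ wt O ζ n) : wtMap hO φ F = φ n F.1 := by
  let a : wtFam O ζ := ⟨Finsupp.single n F.1, fun m => by
    rw [Finsupp.single_apply]
    split_ifs with h
    · exact h ▸ hF
    · exact zero_mem _⟩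
  have h : wtEquiv hO a = F := Subtype.ext
    (Finsupp.sum_single_index (h := fun _ F => F) rfl)
  rw [← h, wtMap, LinearMap.comp_apply, LinearEquiv.coe_coe, LinearEquiv.symm_apply_apply, h]
  change Finsupp.lsum k φ (Finsupp.single n F.1) = _
  rw [Finsupp.lsum_single]

theorem wt_induction (hO : Subalgebra.toSubmodule O ≤ ⨆ n, wt O ζ n) {p : O → Prop}
    (mem : ∀ (n : ℤ) (F : O), F.1 ∈ wt O ζ n → p F) (add : ∀ F F', p F → p F' → p (F + F'))
    (F : O) : p F := by
  have : ∀ (F' : G → k), F' ∈ ⨆ n, wt O ζ n → ∃ h : F' ∈ O, p ⟨F', h⟩ := fun F' h => by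
    refine Submodule.iSup_induction _ (motive := fun F' => ∃ h : F' ∈ O, p ⟨F', h⟩) h
      (fun n x hx => ⟨hx.1, mem n ⟨x, hx.1⟩ hx⟩) ⟨zero_mem _, mem 0 ⟨0, zero_mem _⟩ (zero_mem _)⟩ ?_
    rintro x y ⟨hx, hx'⟩ ⟨hy, hy'⟩
    exact ⟨add_mem hx hy, add _ _ hx' hy'⟩
  exact (this F.1 (hO F.2)).2

end Weights

section Regular

variable {k G E : Type*} [Field k] [AddCommGroup E] [Module k E]

/-- Regularity of a vector valued function. -/
abbrev Reg (O : Subalgebra k (G → k)) (F : G → E) : Prop := HasD (0 : O →ₗ[k] k) F 0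

variable {O : Subalgebra k (G → k)}

theorem HasD.reg {T : O →ₗ[k] k} {F : G → E} {e : E} (h : HasD T F e) : Reg O F := by
  induction h using HasD.induction with
  | basic f e =>
    have := hasD_basic (0 : O →ₗ[k] k) f e
    rwa [LinearMap.zero_apply, zero_smul] at this
  | zero => exact Submodule.zero_mem _
  | add F e F' e' _ _ h h' =>
    have := HasD.add h h'
    rwa [add_zero] at this
  | smul t F e _ h =>
    have := HasD.smul t h
    rwa [smul_zero] at this

theorem HasD.exists_hasD {T : O →ₗ[k] k} {F : G → E} {e : E} (h : HasD T F e)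
    (T' : O →ₗ[k] k) : ∃ e, HasD T' F e := by
  induction h using HasD.induction with
  | basic f e => exact ⟨_, hasD_basic T' f e⟩
  | zero => exact ⟨0, Submodule.zero_mem _⟩
  | add F e F' e' _ _ h h' =>
    obtain ⟨a, h⟩ := h
    obtain ⟨a', h'⟩ := h'
    exact ⟨_, h.add h'⟩
  | smul t F e _ h =>
    obtain ⟨a, h⟩ := h
    exact ⟨_, h.smul t⟩

theorem reg_of_mem {F : G → k} (h : F ∈ O) : Reg O F := (hasD_scalar 0 ⟨F, h⟩).reg

theorem reg_const [Group G] (e : E) : Reg O (fun _ : G => e) := hasD_const isTangent_zero e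

end Regular

section Series

open PowerSeries

variable {k V G : Type*} [Field k] [AddCommGroup V] [Module k V] {ω : SymplecticForm k V}
  {O : Subalgebra k (G → k)}

/-- The derivative of a series valued function, coefficient by coefficient. -/
def HasDS (T : O →ₗ[k] k) (F : G → WSer ω) (e : WSer ω) : Prop :=
  ∀ d, HasD T (fun g => coeff d (F g)) (coeff d e)

theorem HasDS.unique {T : O →ₗ[k] k} {F : G → WSer ω} {e e' : WSer ω} (h : HasDS T F e)
    (h' : HasDS T F e') : e = e' := PowerSeries.ext fun d => (h d).unique (h' d)

theorem hasDS_of_reg {F : G → WSer ω} (T : O →ₗ[k] k)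
    (h : ∀ d, Reg O (fun g => coeff d (F g))) : ∃ e, HasDS T F e := by
  choose e he using fun d => (h d).exists_hasD T
  exact ⟨PowerSeries.mk e, fun d => by rw [coeff_mk]; exact he d⟩

variable [Group G]

theorem hasDS_const {T : O →ₗ[k] k} (hT : IsTangent O T) (a : WSer ω) :
    HasDS T (fun _ => a) 0 := fun d => by
  simpa only [map_zero] using hasD_const hT (coeff d a)

theorem HasDS.mul {T : O →ₗ[k] k} (hT : IsTangent O T) {F F' : G → WSer ω} {e e' : WSer ω}
    (h : HasDS T F e) (h' : HasDS T F' e') :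
    HasDS T (fun g => F g * F' g) (e * F' 1 + F 1 * e') := fun d => by
  simp only [map_add, coeff_mul, ← Finset.sum_add_distrib]
  exact hasD_sum _ fun p _ => (h p.1).mul hT (h' p.2)

theorem HasDS.smul_fun {T : O →ₗ[k] k} (hT : IsTangent O T) {f : G → k} {F : G → WSer ω} {t : k}
    {e : WSer ω} (h : HasD T f t) (h' : HasDS T F e) :
    HasDS T (fun g => f g • F g) (t • F 1 + f 1 • e) := fun d => by
  simp only [map_add, PowerSeries.coeff_smul]
  exact h.smul_fun hT (h' d)

theorem reg_coeff_mul {F F' : G → WSer ω} (h : ∀ d, Reg O (fun g => coeff d (F g)))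
    (h' : ∀ d, Reg O (fun g => coeff d (F' g))) (d : ℕ) :
    Reg O (fun g => coeff d (F g * F' g)) := by
  simp only [coeff_mul]
  exact (hasD_sum _ fun p _ => (h p.1).mul isTangent_zero (h' p.2)).reg

theorem reg_coeff_inv {u : G → (WSer ω)ˣ} (h0 : ∀ g, coeff 0 (u g : WSer ω) = 1)
    (h : ∀ d, Reg O (fun g => coeff d (u g : WSer ω))) (d : ℕ) :
    Reg O (fun g => coeff d (((u g)⁻¹ : (WSer ω)ˣ) : WSer ω)) := by
  induction d using Nat.strong_induction_on with
  | _ d ih =>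
    have e : ∀ g, coeff d (((u g)⁻¹ : (WSer ω)ˣ) : WSer ω) = coeff d (1 : WSer ω) -
        ∑ p ∈ Finset.range d, coeff (d - p) (u g : WSer ω) *
          coeff p (((u g)⁻¹ : (WSer ω)ˣ) : WSer ω) := fun g => by
      rw [← (u g).mul_inv, coeff_mul, Finset.Nat.sum_antidiagonal_eq_sum_range_succ_mk,
        ← Finset.sum_range_reflect, Finset.sum_range_succ]
      have h1 : d + 1 - 1 - d = 0 := by omega
      have h2 : d - (d + 1 - 1 - d) = d := by omega
      dsimp only
      rw [h2, h1, h0, one_mul, eq_sub_iff_add_eq, add_comm]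
      congr 1
      refine Finset.sum_congr rfl fun p hp => ?_
      rw [Finset.mem_range] at hp
      rw [show d + 1 - 1 - p = d - p by omega, show d - (d - p) = p by omega]
    simp only [e]
    exact ((reg_const _).sub (hasD_sum _ fun p hp =>
      (h _).mul isTangent_zero (ih p (Finset.mem_range.1 hp)))).reg

end Series

section Jets

open PowerSeries

variable {k V : Type*} [Field k] [AddCommGroup V] [Module k V] {ω : SymplecticForm k V}
  {𝔵 : Submodule k V}

variable (ω) in
/-- The `d`-th coefficient of an element of `𝒟`. -/
def jetD (d : ℕ) : FWeyl ω →ₗ[k] Weyl ω where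
  toFun x := coeff d (rho x)
  map_add' x y := by rw [map_add, map_add]
  map_smul' t x := by rw [rho_smul]; rfl

variable (ω 𝔵) in
/-- The quotient of the Weyl algebra by the left ideal generated by `𝔵`. -/
abbrev WeylMod : Type _ := Weyl ω ⧸ (weylIdeal ω 𝔵).restrictScalars k

variable (ω 𝔵) in
/-- The `d`-th coefficient of an element of `𝓜`. -/
def jetM (d : ℕ) : FMod ω 𝔵 →ₗ[k] WeylMod ω 𝔵 :=
  (((leftIdeal ω 𝔵).restrictScalars k).liftQ
      (((weylIdeal ω 𝔵).restrictScalars k).mkQ ∘ₗ jetD ω d) fun x hx =>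
        (Submodule.Quotient.mk_eq_zero _).2 (mem_serIdeal.1 (rho_mem_serIdeal_of_mem hx) d)) ∘ₗ
    (Submodule.Quotient.restrictScalarsEquiv k (leftIdeal ω 𝔵)).symm.toLinearMap

theorem jetM_mk (d : ℕ) (x : FWeyl ω) :
    jetM ω 𝔵 d (Submodule.Quotient.mk x) = Submodule.Quotient.mk (coeff d (rho x)) := rfl

theorem exists_factor {E E' : Type*} [AddCommGroup E] [Module k E] [AddCommGroup E'] [Module k E']
    (A : E →ₗ[k] E') (l : E →ₗ[k] k) (h : ∀ x, A x = 0 → l x = 0) :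
    ∃ l' : E' →ₗ[k] k, ∀ x, l x = l' (A x) := by
  have : l ∈ (LinearMap.ker A).dualAnnihilator :=
    (Submodule.mem_dualAnnihilator _).2 fun x hx => h x hx
  rw [← LinearMap.range_dualMap_eq_dualAnnihilator_ker] at this
  obtain ⟨l', rfl⟩ := this
  exact ⟨l', fun x => rfl⟩

variable {ι : Type*} [Fintype ι] {G : Type*} {O : Subalgebra k (G → k)}

theorem Darboux.hasD_contFunD (B : Darboux ω 𝔵 ι) {T : O →ₗ[k] k} {F : G → FWeyl ω} {y : FWeyl ω}
    (h : HasDS T (fun g => rho (F g)) (rho y)) {l : FWeyl ω →ₗ[k] k} (hl : IsContFunD ω l) :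
    HasD T (fun g => l (F g)) (l y) := by
  obtain ⟨j, hj⟩ := hl
  obtain ⟨l', hl'⟩ := exists_factor (LinearMap.pi fun d : Fin j => jetD ω d) l fun x hx =>
    hj x (B.mem_filt_of_rho fun d hd => congrFun hx ⟨d, hd⟩)
  simp only [hl']
  exact HasD.map l' (hasD_pi fun d => h d)

theorem Darboux.hasD_contFunM (B : Darboux ω 𝔵 ι) {T : O →ₗ[k] k} {F : G → FMod ω 𝔵}
    {y : FMod ω 𝔵} (h : ∀ d, HasD T (fun g => jetM ω 𝔵 d (F g)) (jetM ω 𝔵 d y))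
    {l : FMod ω 𝔵 →ₗ[k] k} (hl : IsContFunM ω 𝔵 l) : HasD T (fun g => l (F g)) (l y) := by
  obtain ⟨j, hj⟩ := hl
  obtain ⟨l', hl'⟩ := exists_factor (LinearMap.pi fun d : Fin j => jetM ω 𝔵 d) l fun x hx => by
    obtain ⟨x, rfl⟩ := Submodule.Quotient.mk_surjective _ x
    exact hj _ (B.mk_mem_filtMod.2 fun d hd =>
      (Submodule.Quotient.mk_eq_zero _).1 (congrFun hx ⟨d, hd⟩))
  simp only [hl']
  exact HasD.map l' (hasD_pi fun d => h d)

theorem isContFunD_jetD (l : Weyl ω →ₗ[k] k) (d : ℕ) : IsContFunD ω (l ∘ₗ jetD ω d) :=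
  ⟨d + 1, fun x hx => by
    rw [LinearMap.comp_apply, show jetD ω d x = 0 from Darboux.rho_mem_serFilt hx d (by omega), map_zero]⟩

theorem isContFunM_jetM (l : WeylMod ω 𝔵 →ₗ[k] k) (d : ℕ) : IsContFunM ω 𝔵 (l ∘ₗ jetM ω 𝔵 d) :=
  ⟨d + 1, fun m hm => by
    obtain ⟨x, hx, rfl⟩ := hm
    have h : jetD ω d x = 0 := Darboux.rho_mem_serFilt hx d (by omega)
    rw [LinearMap.comp_apply]
    change l (Submodule.Quotient.mk (jetD ω d x)) = 0
    rw [h]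
    exact map_zero l⟩

end Jets

section Velocity

open PowerSeries

variable {k V : Type*} [Field k] [CharZero k] [AddCommGroup V] [Module k V]
  {ω : SymplecticForm k V} {𝔵 : Submodule k V} {ι : Type*} [Fintype ι]

/-- The components of a tangent vector of `𝒢_𝒥`. -/
structure IsVelocity (T : OGJ ω 𝔵 →ₗ[k] k) (c : k) (s : V →ₗ[k] V) (w : WSer ω) : Prop where
  scal : HasD T (fun g => (g.1.1 : k)) c
  right : ∀ v, HasD T (fun g => g.1.2.right.1 v) (s v)
  left : HasDS T (fun g => ((g.1.2.left : (WSer ω)ˣ) : WSer ω)) w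

theorem scal_mem_OGJ : (fun g : GJ ω 𝔵 => (g.1.1 : k)) ∈ OGJ ω 𝔵 :=
  Algebra.subset_adjoin (Or.inl (Or.inl (Or.inl rfl)))

theorem scal_inv_mem_OGJ : (fun g : GJ ω 𝔵 => ((g.1.1⁻¹ : kˣ) : k)) ∈ OGJ ω 𝔵 :=
  Algebra.subset_adjoin (Or.inl (Or.inl (Or.inr rfl)))

theorem right_mem_OGJ (l : V →ₗ[k] k) (v : V) :
    (fun g : GJ ω 𝔵 => l (g.1.2.right.1 v)) ∈ OGJ ω 𝔵 :=
  Algebra.subset_adjoin (Or.inl (Or.inr ⟨l, v, rfl⟩))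

theorem left_mem_OGJ (l : Weyl ω →ₗ[k] k) (d : ℕ) :
    (fun g : GJ ω 𝔵 => l (coeff d ((g.1.2.left : (WSer ω)ˣ) : WSer ω))) ∈ OGJ ω 𝔵 :=
  Algebra.subset_adjoin (Or.inr ⟨l, d, rfl⟩)

namespace Darboux

theorem finiteDimensional (B : Darboux ω 𝔵 ι) : FiniteDimensional k V :=
  Module.Finite.of_basis B.basis

theorem hasD_linear (B : Darboux ω 𝔵 ι) {G E : Type*} [AddCommGroup E] [Module k E]
    {O : Subalgebra k (G → k)} {T : O →ₗ[k] k} {A : G → V →ₗ[k] E} {A' : V →ₗ[k] E}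
    (h : ∀ i, HasD T (fun g => A g (B.basis i)) (A' (B.basis i))) (v : V) :
    HasD T (fun g => A g v) (A' v) := by
  have := hasD_sum Finset.univ fun i _ => (h i).smul (B.basis.repr v i)
  simpa only [← map_smul, ← map_sum, B.basis.sum_repr] using this

theorem coeff_left_mem (B : Darboux ω 𝔵 ι) (g : 𝒢 ω) (d : ℕ) :
    coeff d ((g.2.left : (WSer ω)ˣ) : WSer ω) ∈ weylF ω (3 * d) :=
  mem_tripleRange.1 (B.left_mem_uniGroup g.2.left).2.1 d

theorem coeff_zero_left (B : Darboux ω 𝔵 ι) (g : 𝒢 ω) :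
    coeff 0 ((g.2.left : (WSer ω)ˣ) : WSer ω) = 1 := (B.left_mem_uniGroup g.2.left).1

theorem exists_isVelocity (B : Darboux ω 𝔵 ι) (T : OGJ ω 𝔵 →ₗ[k] k) :
    ∃ c s w, IsVelocity T c s w := by
  have := B.finiteDimensional
  have h1 : ∀ i, ∃ e, HasD T (fun g => g.1.2.right.1 (B.basis i)) e := fun i =>
    exists_hasD_of_finite T ⊤ (fun _ => Submodule.mem_top) fun l => right_mem_OGJ l _
  choose e he using h1
  have h2 : ∀ d, ∃ e, HasD T
      (fun g => coeff d ((g.1.2.left : (WSer ω)ˣ) : WSer ω)) e := fun d => by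
    have := B.finiteDimensional_weylF (3 * d)
    exact exists_hasD_of_finite T (weylF ω (3 * d)) (fun g => B.coeff_left_mem g.1 d)
      fun l => left_mem_OGJ l d
  choose w hw using h2
  refine ⟨_, B.basis.constr k e, PowerSeries.mk w, hasD_scalar T ⟨_, scal_mem_OGJ⟩, fun v => ?_,
    fun d => by rw [coeff_mk]; exact hw d⟩
  exact B.hasD_linear (A := fun g : GJ ω 𝔵 => (g.1.2.right.1 : V →ₗ[k] V))
    (fun i => by rw [Module.Basis.constr_basis]; exact he i) v

theorem reg_right (B : Darboux ω 𝔵 ι) (v : V) :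
    Reg (OGJ ω 𝔵) (fun g : GJ ω 𝔵 => g.1.2.right.1 v) := by
  obtain ⟨c, s, w, h⟩ := B.exists_isVelocity (0 : OGJ ω 𝔵 →ₗ[k] k)
  exact (h.right v).reg

theorem reg_left (B : Darboux ω 𝔵 ι) (d : ℕ) :
    Reg (OGJ ω 𝔵) (fun g : GJ ω 𝔵 => coeff d ((g.1.2.left : (WSer ω)ˣ) : WSer ω)) := by
  obtain ⟨c, s, w, h⟩ := B.exists_isVelocity (0 : OGJ ω 𝔵 →ₗ[k] k)
  exact (h.left d).reg

theorem reg_right_inv (B : Darboux ω 𝔵 ι) (v : V) :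
    Reg (OGJ ω 𝔵) (fun g : GJ ω 𝔵 => (g.1.2.right⁻¹).1 v) := by
  have hA : Function.Injective (LinearMap.pi fun i => ω.form.flip (B.basis i) : V →ₗ[k] (ι ⊕ ι → k)) := by
    refine (injective_iff_map_eq_zero _).2 fun x hx => ω.nondegenerate x fun y => ?_
    have : ω.form x = 0 := B.basis.ext fun i => congrFun hx i
    rw [this, LinearMap.zero_apply]
  refine (HasD.of_injective (T := 0) _ hA (e := 0) (hasD_pi fun i => ?_)).choose_spec.reg
  have := HasD.map (ω.form v) (B.reg_right (B.basis i))
  rw [map_zero] at this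
  convert this using 2 with g
  change ω.form ((g.1.2.right⁻¹).1 v) (B.basis i) = _
  rw [← g.1.2.right.2]
  congr 1
  exact congrArg ω.form (g.1.2.right.1.apply_symm_apply v)
  rfl

theorem reg_left_inv (B : Darboux ω 𝔵 ι) (d : ℕ) :
    Reg (OGJ ω 𝔵) (fun g : GJ ω 𝔵 =>
      coeff d (((g.1.2.left : (WSer ω)ˣ)⁻¹ : (WSer ω)ˣ) : WSer ω)) :=
  reg_coeff_inv (u := fun g : GJ ω 𝔵 => (g.1.2.left : (WSer ω)ˣ))
    (fun g => B.coeff_zero_left g.1) B.reg_left d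

end Darboux

theorem hasD_thetaW {G : Type*} [Group G] {O : Subalgebra k (G → k)} {T : O →ₗ[k] k}
    (hT : IsTangent O T) {σ : G → Sp ω} (h1 : σ 1 = 1) {s : V →ₗ[k] V} {q : Weyl ω}
    (hσ : ∀ v, HasD T (fun g => (σ g).1 v) (s v))
    (hq : ∀ v, q * weylV ω v - weylV ω v * q = weylV ω (s v)) (a : Weyl ω) :
    HasD T (fun g => thetaW (σ g) a) (q * a - a * q) := by
  induction a using weyl_induction with
  | one => simpa only [map_one, mul_one, one_mul, sub_self] using hasD_const hT (1 : Weyl ω)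
  | mul v a ih =>
    have := ((hσ v).map (weylV ω)).mul hT ih
    rw [h1, map_one] at this
    simp only [map_mul, thetaW_weylV]
    convert this using 1
    rw [← hq]
    change _ = _ * a + weylV ω v * _
    noncomm_ring
  | add a b ha hb =>
    have := ha.add hb
    simp only [← map_add] at this
    convert this using 1
    noncomm_ring
  | smul t a ih =>
    have := ih.smul t
    simp only [← map_smul] at this
    convert this using 1
    rw [smul_sub, mul_smul_comm, smul_mul_assoc]

theorem hasDS_thetaS {G : Type*} [Group G] {O : Subalgebra k (G → k)} {T : O →ₗ[k] k}
    (hT : IsTangent O T) {σ : G → Sp ω} (h1 : σ 1 = 1) {s : V →ₗ[k] V} {q : Weyl ω}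
    (hσ : ∀ v, HasD T (fun g => (σ g).1 v) (s v))
    (hq : ∀ v, q * weylV ω v - weylV ω v * q = weylV ω (s v)) (a : WSer ω) :
    HasDS T (fun g => thetaS (σ g) a) (C q * a - a * C q) := fun d => by
  rw [map_sub, coeff_C_mul, coeff_mul_C]
  exact hasD_thetaW hT h1 hσ hq (coeff d a)

namespace IsVelocity

variable {T : OGJ ω 𝔵 →ₗ[k] k} {c : k} {s : V →ₗ[k] V} {w : WSer ω}

theorem left_inv (B : Darboux ω 𝔵 ι) (hT : IsTangent (OGJ ω 𝔵) T) (h : IsVelocity T c s w) :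
    HasDS T (fun g => (((g.1.2.left : (WSer ω)ˣ)⁻¹ : (WSer ω)ˣ) : WSer ω)) (-w) := by
  obtain ⟨e, he⟩ := hasDS_of_reg T B.reg_left_inv
  have h1 := HasDS.mul hT h.left he
  simp only [Units.mul_inv] at h1
  have h2 := h1.unique (hasDS_const hT 1)
  have h3 : w * ((((1 : GJ ω 𝔵).1.2.left : (WSer ω)ˣ)⁻¹ : (WSer ω)ˣ) : WSer ω) +
      (((1 : GJ ω 𝔵).1.2.left : (WSer ω)ˣ) : WSer ω) * e = w + e := by
    have e1 : (((1 : GJ ω 𝔵).1.2.left : G1 ω) : (WSer ω)ˣ) = 1 := rfl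
    rw [e1, inv_one, Units.val_one, mul_one, one_mul]
  rw [h3] at h2
  rwa [eq_neg_of_add_eq_zero_right h2] at he

theorem adj (B : Darboux ω 𝔵 ι) (hT : IsTangent (OGJ ω 𝔵) T) (h : IsVelocity T c s w)
    {q : Weyl ω} (hq : ∀ v, q * weylV ω v - weylV ω v * q = weylV ω (s v)) (a : WSer ω) :
    HasDS T (fun g => LabelExt.adj g.1 a) ((w + C q) * a - a * (w + C q)) := by
  have h1 := HasDS.mul hT (HasDS.mul hT h.left
    (hasDS_thetaS hT (σ := fun g : GJ ω 𝔵 => g.1.2.right) rfl h.right hq a)) (h.left_inv B hT)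
  have e1 : (((1 : GJ ω 𝔵).1.2.left : G1 ω) : (WSer ω)ˣ) = 1 := rfl
  have e2 : thetaS (1 : GJ ω 𝔵).1.2.right a = a := by
    change thetaS 1 a = a
    rw [map_one]; rfl
  simp only [e1, e2, inv_one, Units.val_one, mul_one, one_mul] at h1
  have h2 : HasDS T (fun g => LabelExt.adj g.1 a) _ := h1
  convert h2 using 1
  noncomm_ring

theorem serMap (hT : IsTangent (OGJ ω 𝔵) T) (h : IsVelocity T c s w)
    {q : Weyl ω} (hq : ∀ v, q * weylV ω v - weylV ω v * q = weylV ω (s v)) (a : WSer ω) :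
    HasDS T (fun g => LabelExt.serMap g.1 a) (c • a + ((w + C q) * a - a * C q)) := by
  have h1 := HasDS.smul_fun hT h.scal (HasDS.mul hT h.left
    (hasDS_thetaS hT (σ := fun g : GJ ω 𝔵 => g.1.2.right) rfl h.right hq a))
  have e1 : (((1 : GJ ω 𝔵).1.2.left : G1 ω) : (WSer ω)ˣ) = 1 := rfl
  have e2 : thetaS (1 : GJ ω 𝔵).1.2.right a = a := by
    change thetaS 1 a = a
    rw [map_one]; rfl
  have e3 : ((1 : GJ ω 𝔵).1.1 : k) = 1 := rfl
  simp only [e1, e2, e3, Units.val_one, one_mul, one_smul] at h1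
  have h2 : HasDS T (fun g => LabelExt.serMap g.1 a) _ := h1
  convert h2 using 1
  noncomm_ring

end IsVelocity

namespace Darboux

theorem isVelocity_zero (B : Darboux ω 𝔵 ι) : IsVelocity (0 : OGJ ω 𝔵 →ₗ[k] k) 0 0 0 := by
  obtain ⟨c, s, w, h⟩ := B.exists_isVelocity (0 : OGJ ω 𝔵 →ₗ[k] k)
  exact ⟨h.scal.reg, fun v => (h.right v).reg, fun d => (h.left d).reg⟩

theorem reg_adj (B : Darboux ω 𝔵 ι) (a : WSer ω) (d : ℕ) :
    Reg (OGJ ω 𝔵) (fun g : GJ ω 𝔵 => coeff d (adj g.1 a)) :=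
  (B.isVelocity_zero.adj B isTangent_zero (q := 0) (fun v => by simp) a d).reg

theorem reg_serMap (B : Darboux ω 𝔵 ι) (a : WSer ω) (d : ℕ) :
    Reg (OGJ ω 𝔵) (fun g : GJ ω 𝔵 => coeff d (serMap g.1 a)) :=
  (B.isVelocity_zero.serMap isTangent_zero (q := 0) (fun v => by simp) a d).reg

theorem inv_mem_OGJ (B : Darboux ω 𝔵 ι) {f : GJ ω 𝔵 → k} (hf : f ∈ OGJ ω 𝔵) :
    (fun g => f g⁻¹) ∈ OGJ ω 𝔵 := by
  induction hf using Algebra.adjoin_induction with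
  | mem f hf =>
    rcases hf with (hf | ⟨l, v, rfl⟩) | ⟨l, d, rfl⟩
    · rcases (show _ ∨ _ from hf) with rfl | rfl
      · exact scal_inv_mem_OGJ
      · simpa using scal_mem_OGJ
    · exact HasD.mem (HasD.map l (B.reg_right_inv v))
    · have := HasD.eval (T := (0 : OGJ ω 𝔵 →ₗ[k] k)) isTangent_zero
        (A := fun g => (thetaW g.1.2.right⁻¹).toLinearMap) (A' := 0)
        (fun a => (hasD_thetaW (T := (0 : OGJ ω 𝔵 →ₗ[k] k)) isTangent_zero
          (σ := fun g => g.1.2.right⁻¹) inv_one (s := 0) (q := 0) B.reg_right_inv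
          (fun v => by simp) a).reg) (B.reg_left_inv d)
      exact HasD.mem (HasD.map l this)
  | algebraMap t => exact (OGJ ω 𝔵).algebraMap_mem t
  | add f f' _ _ h h' => exact add_mem h h'
  | mul f f' _ _ h h' => exact mul_mem h h'

end Darboux
end Velocity

section Comparison

open PowerSeries

variable {k V : Type*} [Field k] [CharZero k] [AddCommGroup V] [Module k V]
  {ω : SymplecticForm k V} {𝔵 : Submodule k V} {ι : Type*} [Fintype ι]

namespace Darboux

theorem jetM_actMod (B : Darboux ω 𝔵 ι) (g : GJ ω 𝔵) (x : FWeyl ω) (d : ℕ) :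
    jetM ω 𝔵 d (B.actMod g (Submodule.Quotient.mk x)) =
      ((weylIdeal ω 𝔵).restrictScalars k).mkQ (coeff d (serMap g.1 (rho x))) := by
  obtain ⟨y, hy⟩ := Submodule.Quotient.mk_surjective _ (B.actMod g (Submodule.Quotient.mk x))
  rw [← hy, jetM_mk]
  have := mem_serIdeal.1 ((B.actMod_mk_eq_iff g).1 hy.symm) d
  rw [map_sub] at this
  exact (Submodule.Quotient.eq _).2 this

theorem actEquiv_fst (B : Darboux ω 𝔵 ι) [Nonempty ι] (g : GJ ω 𝔵) (x : FWeyl ω) :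
    (B.actEquiv g).1.1 x = B.Phi g.1 x := rfl

theorem actEquiv_fst_symm (B : Darboux ω 𝔵 ι) [Nonempty ι] (g : GJ ω 𝔵) (x : FWeyl ω) :
    (B.actEquiv g).1.1.symm x = B.Phi (g⁻¹ : GJ ω 𝔵).1 x := by
  rw [← B.actEquiv_fst, map_inv]; rfl

theorem actEquiv_snd (B : Darboux ω 𝔵 ι) [Nonempty ι] (g : GJ ω 𝔵) (m : FMod ω 𝔵) :
    (B.actEquiv g).1.2 m = B.actMod g m := rfl

theorem actEquiv_snd_symm (B : Darboux ω 𝔵 ι) [Nonempty ι] (g : GJ ω 𝔵) (m : FMod ω 𝔵) :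
    (B.actEquiv g).1.2.symm m = B.actMod g⁻¹ m := by
  rw [← B.actEquiv_snd, map_inv]; rfl

theorem Phi_mem_OGJ (B : Darboux ω 𝔵 ι) {l : FWeyl ω →ₗ[k] k} (hl : IsContFunD ω l)
    (x : FWeyl ω) : (fun g : GJ ω 𝔵 => l (B.Phi g.1 x)) ∈ OGJ ω 𝔵 :=
  HasD.mem (e := l 0) (B.hasD_contFunD (T := (0 : OGJ ω 𝔵 →ₗ[k] k)) (fun d => by
    simp only [B.rho_Phi, map_zero]; exact B.reg_adj _ d) hl)

theorem actMod_mem_OGJ (B : Darboux ω 𝔵 ι) {l : FMod ω 𝔵 →ₗ[k] k} (hl : IsContFunM ω 𝔵 l)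
    (m : FMod ω 𝔵) : (fun g : GJ ω 𝔵 => l (B.actMod g m)) ∈ OGJ ω 𝔵 := by
  obtain ⟨x, rfl⟩ := Submodule.Quotient.mk_surjective _ m
  refine HasD.mem (e := l 0) (B.hasD_contFunM (T := (0 : OGJ ω 𝔵 →ₗ[k] k)) (fun d => ?_) hl)
  simp only [B.jetM_actMod]
  have := HasD.map (((weylIdeal ω 𝔵).restrictScalars k).mkQ) (B.reg_serMap (𝔵 := 𝔵) (rho x) d)
  rwa [map_zero] at this ⊢

theorem comp_mem_OGJ (B : Darboux ω 𝔵 ι) [Nonempty ι] {f : AutDM ω 𝔵 → k}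
    (hf : f ∈ OAutDM ω 𝔵) : (fun g => f (B.actEquiv g)) ∈ OGJ ω 𝔵 := by
  induction hf using Algebra.adjoin_induction with
  | mem f hf =>
    rcases hf with ⟨l, x, hl, rfl | rfl⟩ | ⟨l, m, hl, rfl | rfl⟩
    · exact B.Phi_mem_OGJ hl x
    · simp only [B.actEquiv_fst_symm]
      exact B.inv_mem_OGJ (B.Phi_mem_OGJ hl x)
    · exact B.actMod_mem_OGJ hl m
    · simp only [B.actEquiv_snd_symm]
      exact B.inv_mem_OGJ (B.actMod_mem_OGJ hl m)
  | algebraMap t => exact (OGJ ω 𝔵).algebraMap_mem t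
  | add f f' _ _ h h' => exact add_mem h h'
  | mul f f' _ _ h h' => exact mul_mem h h'

/-- The coordinate ring of `Aut(𝒟, 𝓜)`, transported to `𝒢_𝒥`. -/
def OPull (B : Darboux ω 𝔵 ι) [Nonempty ι] : Subalgebra k (GJ ω 𝔵 → k) where
  carrier := {f | (fun h => f (B.actEquiv.symm h)) ∈ OAutDM ω 𝔵}
  mul_mem' h h' := (OAutDM ω 𝔵).mul_mem h h'
  add_mem' h h' := (OAutDM ω 𝔵).add_mem h h'
  algebraMap_mem' t := (OAutDM ω 𝔵).algebraMap_mem t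

theorem mem_OPull (B : Darboux ω 𝔵 ι) [Nonempty ι] {f : AutDM ω 𝔵 → k} (hf : f ∈ OAutDM ω 𝔵) :
    (fun g => f (B.actEquiv g)) ∈ B.OPull := by
  change (fun h => f (B.actEquiv (B.actEquiv.symm h))) ∈ OAutDM ω 𝔵
  simpa only [MulEquiv.apply_symm_apply] using hf

theorem Phi_mem_OPull (B : Darboux ω 𝔵 ι) [Nonempty ι] {l : FWeyl ω →ₗ[k] k}
    (hl : IsContFunD ω l) (x : FWeyl ω) : (fun g : GJ ω 𝔵 => l (B.Phi g.1 x)) ∈ B.OPull :=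
  B.mem_OPull (f := fun h => l (h.1.1 x))
    (Algebra.subset_adjoin (Or.inl ⟨l, x, hl, Or.inl rfl⟩))

theorem Phi_inv_mem_OPull (B : Darboux ω 𝔵 ι) [Nonempty ι] {l : FWeyl ω →ₗ[k] k}
    (hl : IsContFunD ω l) (x : FWeyl ω) :
    (fun g : GJ ω 𝔵 => l (B.Phi (g⁻¹ : GJ ω 𝔵).1 x)) ∈ B.OPull := by
  have := B.mem_OPull (f := fun h => l (h.1.1.symm x))
    (Algebra.subset_adjoin (Or.inl ⟨l, x, hl, Or.inr rfl⟩))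
  simpa only [B.actEquiv_fst_symm] using this

theorem actMod_mem_OPull (B : Darboux ω 𝔵 ι) [Nonempty ι] {l : FMod ω 𝔵 →ₗ[k] k}
    (hl : IsContFunM ω 𝔵 l) (m : FMod ω 𝔵) : (fun g : GJ ω 𝔵 => l (B.actMod g m)) ∈ B.OPull :=
  B.mem_OPull (f := fun h => l (h.1.2 m))
    (Algebra.subset_adjoin (Or.inr ⟨l, m, hl, Or.inl rfl⟩))

theorem actMod_inv_mem_OPull (B : Darboux ω 𝔵 ι) [Nonempty ι] {l : FMod ω 𝔵 →ₗ[k] k}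
    (hl : IsContFunM ω 𝔵 l) (m : FMod ω 𝔵) :
    (fun g : GJ ω 𝔵 => l (B.actMod g⁻¹ m)) ∈ B.OPull := by
  have := B.mem_OPull (f := fun h => l (h.1.2.symm m))
    (Algebra.subset_adjoin (Or.inr ⟨l, m, hl, Or.inr rfl⟩))
  simpa only [B.actEquiv_snd_symm] using this

theorem reg_adj_pull (B : Darboux ω 𝔵 ι) [Nonempty ι] (x : FWeyl ω) (d : ℕ) :
    Reg B.OPull (fun g : GJ ω 𝔵 => coeff d (adj g.1 (rho x))) := by
  have := B.finiteDimensional_weylF d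
  refine (exists_hasD_of_finite 0 (weylF ω d) (fun g => ?_) fun l => ?_).choose_spec.reg
  · rw [← B.rho_Phi]; exact coeff_rho_mem _ _
  · simp only [← B.rho_Phi]
    exact B.Phi_mem_OPull (isContFunD_jetD l d) x

theorem reg_adj_inv_pull (B : Darboux ω 𝔵 ι) [Nonempty ι] (x : FWeyl ω) (d : ℕ) :
    Reg B.OPull (fun g : GJ ω 𝔵 => coeff d (adj (g⁻¹ : GJ ω 𝔵).1 (rho x))) := by
  have := B.finiteDimensional_weylF d
  refine (exists_hasD_of_finite 0 (weylF ω d) (fun g => ?_) fun l => ?_).choose_spec.reg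
  · rw [← B.rho_Phi]; exact coeff_rho_mem _ _
  · simp only [← B.rho_Phi]
    exact B.Phi_inv_mem_OPull (isContFunD_jetD l d) x

theorem reg_actMod_pull (B : Darboux ω 𝔵 ι) [Nonempty ι] (m : FMod ω 𝔵) (d : ℕ) :
    Reg B.OPull (fun g : GJ ω 𝔵 => jetM ω 𝔵 d (B.actMod g m)) := by
  have := B.finiteDimensional_weylF d
  refine (exists_hasD_of_finite 0 ((weylF ω d).map ((weylIdeal ω 𝔵).restrictScalars k).mkQ)
    (fun g => ?_) fun l => ?_).choose_spec.reg
  · obtain ⟨y, hy⟩ := Submodule.Quotient.mk_surjective _ (B.actMod g m)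
    rw [← hy]
    exact ⟨_, coeff_rho_mem y d, rfl⟩
  · exact B.actMod_mem_OPull (isContFunM_jetM l d) m

theorem reg_right_pull (B : Darboux ω 𝔵 ι) [Nonempty ι] (v : V) :
    Reg B.OPull (fun g : GJ ω 𝔵 => g.1.2.right.1 v) := by
  have := B.reg_adj_pull (FWeyl.ofV v) 1
  simp only [B.coeff_one_adj] at this
  exact (this.of_injective _ B.weylV_injective).choose_spec.reg

theorem reg_right_inv_pull (B : Darboux ω 𝔵 ι) [Nonempty ι] (v : V) :
    Reg B.OPull (fun g : GJ ω 𝔵 => (g.1.2.right⁻¹).1 v) := by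
  have := B.reg_adj_inv_pull (FWeyl.ofV v) 1
  simp only [B.coeff_one_adj] at this
  exact (this.of_injective _ B.weylV_injective).choose_spec.reg

theorem exists_dual_one (B : Darboux ω 𝔵 ι) :
    ∃ l : WeylMod ω 𝔵 →ₗ[k] k,
      l (((weylIdeal ω 𝔵).restrictScalars k).mkQ 1) = 1 := by
  have h : ((weylIdeal ω 𝔵).restrictScalars k).mkQ 1 ≠ 0 := fun h => by
    have h1 : (1 : Weyl ω) ∈ weylIdeal ω 𝔵 := (Submodule.Quotient.mk_eq_zero _).1 h
    exact one_ne_zero (B.algebraMap_mem_weylIdeal (t := 1) (by rwa [map_one]))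
  rw [Ne, ← Module.forall_dual_apply_eq_zero_iff k, not_forall] at h
  obtain ⟨l, hl⟩ := h
  exact ⟨(l _)⁻¹ • l, by rw [LinearMap.smul_apply, smul_eq_mul, inv_mul_cancel₀ hl]⟩

theorem jetM_actMod_one (B : Darboux ω 𝔵 ι) (g : GJ ω 𝔵) (d : ℕ) :
    jetM ω 𝔵 d (B.actMod g (Submodule.Quotient.mk 1)) = (g.1.1 : k) •
      ((weylIdeal ω 𝔵).restrictScalars k).mkQ
        (coeff d ((g.1.2.left : (WSer ω)ˣ) : WSer ω)) := by
  rw [B.jetM_actMod, serMap, map_one, map_one, mul_one, PowerSeries.coeff_smul, map_smul]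

theorem scal_mem_OPull (B : Darboux ω 𝔵 ι) [Nonempty ι] :
    (fun g : GJ ω 𝔵 => (g.1.1 : k)) ∈ B.OPull := by
  obtain ⟨l, hl⟩ := B.exists_dual_one
  have := B.actMod_mem_OPull (isContFunM_jetM l 0) (Submodule.Quotient.mk 1)
  simpa only [LinearMap.comp_apply, B.jetM_actMod_one, B.coeff_zero_left, map_smul, hl, smul_eq_mul,
    mul_one] using this

theorem scal_inv_mem_OPull (B : Darboux ω 𝔵 ι) [Nonempty ι] :
    (fun g : GJ ω 𝔵 => ((g.1.1⁻¹ : kˣ) : k)) ∈ B.OPull := by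
  obtain ⟨l, hl⟩ := B.exists_dual_one
  have := B.actMod_inv_mem_OPull (isContFunM_jetM l 0) (Submodule.Quotient.mk 1)
  simp only [LinearMap.comp_apply, B.jetM_actMod_one, B.coeff_zero_left, map_smul, hl, smul_eq_mul,
    mul_one] at this
  exact this

theorem left_comm_eq (B : Darboux ω 𝔵 ι) (g : GJ ω 𝔵) (v : V) (d : ℕ) :
    coeff d ((g.1.2.left : (WSer ω)ˣ) : WSer ω) * weylV ω (g.1.2.right.1 v) -
      weylV ω (g.1.2.right.1 v) * coeff d ((g.1.2.left : (WSer ω)ˣ) : WSer ω) =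
    ∑ i ∈ Finset.range d, coeff (d + 1 - i) (adj g.1 (rho (FWeyl.ofV v))) *
      coeff i ((g.1.2.left : (WSer ω)ˣ) : WSer ω) := by
  have h : adj g.1 (rho (FWeyl.ofV v)) * ((g.1.2.left : (WSer ω)ˣ) : WSer ω) =
      ((g.1.2.left : (WSer ω)ˣ) : WSer ω) * (C (weylV ω (g.1.2.right.1 v)) * X) := by
    rw [adj_apply, mul_assoc, Units.inv_mul, mul_one, thetaS_rho, thetaF_ofV, rho_ofV]
  have h1 := congrArg (coeff (d + 1)) h
  have h0 : coeff 0 (adj g.1 (rho (FWeyl.ofV v))) = 0 := by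
    rw [← B.rho_Phi]
    exact rho_mem_serFilt (aut_ofV_mem_filt (B.Phi g.1) v) 0 one_pos
  rw [← mul_assoc, coeff_succ_mul_X, coeff_mul_C, coeff_mul,
    ← Finset.Nat.sum_antidiagonal_swap, Finset.Nat.sum_antidiagonal_eq_sum_range_succ_mk,
    Finset.sum_range_succ, Finset.sum_range_succ] at h1
  dsimp only [Prod.swap] at h1
  rw [show d + 1 - (d + 1) = 0 by omega, h0, zero_mul, add_zero,
    show d + 1 - d = 1 by omega, B.coeff_one_adj] at h1
  rw [← h1, add_sub_cancel_right]

theorem reg_left_pull (B : Darboux ω 𝔵 ι) [Nonempty ι] (d : ℕ) :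
    Reg B.OPull (fun g : GJ ω 𝔵 => coeff d ((g.1.2.left : (WSer ω)ˣ) : WSer ω)) := by
  induction d using Nat.strong_induction_on with
  | _ d ih =>
    have h1 : ∀ v, Reg B.OPull (fun g : GJ ω 𝔵 =>
        coeff d ((g.1.2.left : (WSer ω)ˣ) : WSer ω) * weylV ω (g.1.2.right.1 v) -
          weylV ω (g.1.2.right.1 v) * coeff d ((g.1.2.left : (WSer ω)ˣ) : WSer ω)) := fun v => by
      simp only [B.left_comm_eq]
      exact (hasD_sum _ fun i hi => HasD.mul isTangent_zero (B.reg_adj_pull _ _)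
        (ih i (Finset.mem_range.1 hi))).reg
    have h2 : ∀ v, Reg B.OPull (fun g : GJ ω 𝔵 =>
        coeff d ((g.1.2.left : (WSer ω)ˣ) : WSer ω) * weylV ω v -
          weylV ω v * coeff d ((g.1.2.left : (WSer ω)ˣ) : WSer ω)) := fun v => by
      have := HasD.eval (T := (0 : B.OPull →ₗ[k] k)) isTangent_zero
        (A := fun g : GJ ω 𝔵 => (LinearMap.mulLeft k (coeff d ((g.1.2.left : (WSer ω)ˣ) : WSer ω)) -
          LinearMap.mulRight k (coeff d ((g.1.2.left : (WSer ω)ˣ) : WSer ω))) ∘ₗ weylV ω ∘ₗ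
            (g.1.2.right.1 : V →ₗ[k] V)) (A' := 0) h1 (B.reg_right_inv_pull v)
      have e : ∀ g : GJ ω 𝔵, g.1.2.right.1 ((g.1.2.right⁻¹).1 v) = v := fun g =>
        g.1.2.right.1.apply_symm_apply v
      have := this.reg
      simpa only [LinearMap.comp_apply, LinearEquiv.coe_coe, e, LinearMap.sub_apply,
        LinearMap.mulLeft_apply, LinearMap.mulRight_apply] using this
    have h3 : Reg B.OPull (fun g : GJ ω 𝔵 => ((weylIdeal ω 𝔵).restrictScalars k).mkQ
        (coeff d ((g.1.2.left : (WSer ω)ˣ) : WSer ω))) := by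
      have := HasD.smul_fun isTangent_zero (reg_of_mem B.scal_inv_mem_OPull)
        (B.reg_actMod_pull (Submodule.Quotient.mk 1) d)
      simpa only [B.jetM_actMod_one, smul_smul, Units.inv_mul, one_smul] using this.reg
    let A : Weyl ω →ₗ[k] (ι ⊕ ι → Weyl ω) × WeylMod ω 𝔵 :=
      LinearMap.prod (LinearMap.pi fun i => LinearMap.mulRight k (weylV ω (B.basis i)) -
        LinearMap.mulLeft k (weylV ω (B.basis i))) ((weylIdeal ω 𝔵).restrictScalars k).mkQ
    have hA : Function.Injective A := by
      refine (injective_iff_map_eq_zero _).2 fun w hw => ?_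
      have hw1 : ∀ v, w * weylV ω v = weylV ω v * w := fun v => by
        have : (LinearMap.mulLeft k w - LinearMap.mulRight k w) ∘ₗ weylV ω = 0 :=
          B.basis.ext fun i => congrFun (congrArg Prod.fst hw) i
        exact sub_eq_zero.1 (LinearMap.congr_fun this v)
      obtain ⟨t, rfl⟩ := B.exists_eq_algebraMap hw1
      rw [B.algebraMap_mem_weylIdeal ((Submodule.Quotient.mk_eq_zero _).1
        (congrArg Prod.snd hw)), map_zero]
    have h4 : Reg B.OPull (fun g : GJ ω 𝔵 => A (coeff d ((g.1.2.left : (WSer ω)ˣ) : WSer ω))) :=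
      (hasD_prod (hasD_pi (e := 0) fun i => h2 (B.basis i)) h3).reg
    exact (h4.of_injective A hA).choose_spec.reg

theorem OGJ_le_OPull (B : Darboux ω 𝔵 ι) [Nonempty ι] : OGJ ω 𝔵 ≤ B.OPull := by
  refine Algebra.adjoin_le ?_
  rintro f ((hf | ⟨l, v, rfl⟩) | ⟨l, d, rfl⟩)
  · rcases (show _ ∨ _ from hf) with rfl | rfl
    · exact B.scal_mem_OPull
    · exact B.scal_inv_mem_OPull
  · exact HasD.mem (HasD.map l (B.reg_right_pull v))
  · exact HasD.mem (HasD.map l (B.reg_left_pull d))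

theorem comp_mem_OGJ_iff (B : Darboux ω 𝔵 ι) [Nonempty ι] {f : AutDM ω 𝔵 → k} :
    (fun g => f (B.actEquiv g)) ∈ OGJ ω 𝔵 ↔ f ∈ OAutDM ω 𝔵 := by
  refine ⟨fun h => ?_, B.comp_mem_OGJ⟩
  have := B.OGJ_le_OPull h
  change (fun h => f (B.actEquiv (B.actEquiv.symm h))) ∈ OAutDM ω 𝔵 at this
  simpa only [MulEquiv.apply_symm_apply] using this

end Darboux

/-- The cocharacter `k^× → 𝒢_𝒥`. -/
def scalGJ (ω : SymplecticForm k V) (𝔵 : Submodule k V) : kˣ →* GJ ω 𝔵 where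
  toFun t := ⟨(t, 1), by
    change adj (t, 1) '' _ = _
    rw [show adj ((t, 1) : 𝒢 ω) = 1 from (map_one adj : adj (1 : 𝒢 ω) = 1),
      show ⇑(1 : RingAut (WSer ω)) = id from rfl, Set.image_id]⟩
  map_one' := rfl
  map_mul' t t' := Subtype.ext (Prod.ext rfl (mul_one _).symm)

theorem scalGJ_neg_one : scalGJ ω 𝔵 (-1) = negGJ ω 𝔵 := rfl

theorem Darboux.scalGJ_eq (B : Darboux ω 𝔵 ι) (t : kˣ) :
    scalGJ ω 𝔵 t = B.centralGJ (Units.map (C : k →+* k⟦X⟧).toMonoidHom t) := by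
  have h0 : constantCoeff ((Units.map (C : k →+* k⟦X⟧).toMonoidHom t : k⟦X⟧ˣ) : k⟦X⟧) = t :=
    constantCoeff_C _
  refine Subtype.ext (Prod.ext (Units.ext ?_) (SemidirectProduct.ext (Subtype.ext (Units.ext ?_)) ?_))
  · change (t : k) = ((B.centralHom _).1 : k)
    rw [B.centralHom_fst, h0]
  · have h := B.smul_centralHom_left (Units.map (C : k →+* k⟦X⟧).toMonoidHom t)
    rw [h0] at h
    have h2 : rho (algebraMap k⟦X⟧ (FWeyl ω)
        ((Units.map (C : k →+* k⟦X⟧).toMonoidHom t : k⟦X⟧ˣ) : k⟦X⟧)) = (t : k) • (1 : WSer ω) := by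
      have : algebraMap k⟦X⟧ (FWeyl ω)
          ((Units.map (C : k →+* k⟦X⟧).toMonoidHom t : k⟦X⟧ˣ) : k⟦X⟧) = (t : k) • 1 := by
        rw [← Algebra.algebraMap_eq_smul_one, IsScalarTower.algebraMap_apply k k⟦X⟧ (FWeyl ω)]
        rfl
      rw [this, rho_smul, map_one]
    rw [h2] at h
    have h3 := congrArg (fun x => (t : k)⁻¹ • x) h
    simp only [smul_smul, inv_mul_cancel₀ t.ne_zero, one_smul] at h3
    exact h3.symm
  · exact (B.centralHom_right _).symm

theorem Darboux.actEquiv_negGJ (B : Darboux ω 𝔵 ι) [Nonempty ι] :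
    B.actEquiv (negGJ ω 𝔵) = epsAut ω 𝔵 (-1) := by
  rw [← scalGJ_neg_one, B.scalGJ_eq]
  refine (B.actPair_centralGJ _).trans ?_
  congr 1
  ext1
  change C (((-1 : kˣ) : k)) = _
  simp

end Comparison

section Comultiplication

variable {k G : Type*} [Field k] [Group G]

/-- The functions of weight `n` whose comultiplication is a sum of products of functions of
weight `n`. -/
def comulWt (O : Subalgebra k (G → k)) (ζ : kˣ →* G) (n : ℤ) : Submodule k (G → k) :=
  wt O ζ n ⊓ (Submodule.span k {H : G × G → k | ∃ a ∈ wt O ζ n, ∃ b ∈ wt O ζ n,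
    H = fun p => a p.1 * b p.2}).comap (LinearMap.funLeft k k fun p : G × G => p.1 * p.2)

variable {O : Subalgebra k (G → k)} {ζ : kˣ →* G}

theorem one_mem_comulWt : (1 : G → k) ∈ comulWt O ζ 0 :=
  ⟨one_mem_wt, Submodule.subset_span ⟨1, one_mem_wt, 1, one_mem_wt, funext fun _ => (mul_one _).symm⟩⟩

theorem mul_mem_comulWt {n m : ℤ} {F F' : G → k} (h : F ∈ comulWt O ζ n)
    (h' : F' ∈ comulWt O ζ m) : F * F' ∈ comulWt O ζ (n + m) := by
  refine ⟨mul_mem_wt h.1 h'.1, ?_⟩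
  have h1 := Submodule.mul_mem_mul (Submodule.mem_comap.1 h.2) (Submodule.mem_comap.1 h'.2)
  rw [Submodule.span_mul_span] at h1
  refine Submodule.span_mono ?_ h1
  rintro _ ⟨_, ⟨a, ha, b, hb, rfl⟩, _, ⟨a', ha', b', hb', rfl⟩, rfl⟩
  exact ⟨a * a', mul_mem_wt ha ha', b * b', mul_mem_wt hb hb',
    funext fun p => mul_mul_mul_comm _ _ _ _⟩

theorem adjoin_le_iSup_comulWt {S : Set (G → k)} (hS : ∀ f ∈ S, ∃ n, f ∈ comulWt O ζ n) :
    Subalgebra.toSubmodule (Algebra.adjoin k S) ≤ ⨆ n, comulWt O ζ n := by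
  have hmul : ∀ F F', F ∈ ⨆ n, comulWt O ζ n → F' ∈ ⨆ n, comulWt O ζ n →
      F * F' ∈ ⨆ n, comulWt O ζ n := fun F F' h h' => by
    refine Submodule.iSup_induction _ (motive := fun F => F * F' ∈ ⨆ n, comulWt O ζ n) h
      (fun n F hF => ?_) (by rw [zero_mul]; exact zero_mem _)
      fun x y hx hy => by rw [add_mul]; exact add_mem hx hy
    refine Submodule.iSup_induction _ (motive := fun F' => F * F' ∈ ⨆ n, comulWt O ζ n) h'
      (fun m F' hF' => ?_) (by rw [mul_zero]; exact zero_mem _)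
      fun x y hx hy => by rw [mul_add]; exact add_mem hx hy
    exact Submodule.mem_iSup_of_mem (n + m) (mul_mem_comulWt hF hF')
  intro F hF
  change F ∈ Algebra.adjoin k S at hF
  induction hF using Algebra.adjoin_induction with
  | mem f hf =>
    obtain ⟨n, hn⟩ := hS f hf
    exact Submodule.mem_iSup_of_mem n hn
  | algebraMap t =>
    rw [Algebra.algebraMap_eq_smul_one]
    exact Submodule.smul_mem _ _ (Submodule.mem_iSup_of_mem 0 one_mem_comulWt)
  | add f f' _ _ h h' => exact add_mem h h'
  | mul f f' _ _ h h' => exact hmul _ _ h h'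

theorem wt_le_comulWt [CharZero k] (hO : Subalgebra.toSubmodule O ≤ ⨆ n, comulWt O ζ n) (n : ℤ) :
    wt O ζ n ≤ comulWt O ζ n := by
  intro F hF
  have h := hO hF.1
  rw [Submodule.mem_iSup_iff_exists_finsupp] at h
  obtain ⟨a, ha, h⟩ := h
  have h1 : Finsupp.single n F - a ∈ wtFam O ζ := fun m => by
    rw [Finsupp.sub_apply, Finsupp.single_apply]
    refine sub_mem ?_ (ha m).1
    split_ifs with hm
    · exact hm ▸ hF
    · exact zero_mem _
  have h2 : ((Finsupp.single n F - a).sum fun _ F => F) = 0 := by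
    rw [Finsupp.sum_sub_index fun _ _ _ => rfl, Finsupp.sum_single_index rfl]
    exact sub_eq_zero.2 h.symm
  have h3 := sum_wtFam_injective h1 h2
  have h4 := DFunLike.congr_fun h3 n
  rw [Finsupp.sub_apply, Finsupp.single_eq_same, Finsupp.zero_apply, sub_eq_zero] at h4
  rw [h4]
  exact ha n

end Comultiplication

section Twist

variable {k G : Type*} [Field k] [CharZero k] [Group G] {O : Subalgebra k (G → k)} {ζ : kˣ →* G}

theorem mem_invariants_of_wt {m : ℤ} {F : G → k} (hF : F ∈ wt O ζ (2 * m)) :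
    F ∈ invariants O (ζ (-1)) := ⟨hF.1, fun g => by
  rw [hF.2, zpow_mul, zpow_ofNat, neg_one_sq, one_zpow, Units.val_one, one_mul]⟩

theorem invariants_induction (hO : Subalgebra.toSubmodule O ≤ ⨆ n, wt O ζ n)
    {motive : invariants O (ζ (-1)) → Prop}
    (mem : ∀ (m : ℤ) (F : invariants O (ζ (-1))), F.1 ∈ wt O ζ (2 * m) → motive F)
    (add : ∀ F F', motive F → motive F' → motive (F + F'))
    (F : invariants O (ζ (-1))) : motive F := by
  have key : ∀ F : O, ∃ F' : invariants O (ζ (-1)),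
      (F'.1 = fun g => (2 : k)⁻¹ * (F.1 g + F.1 (ζ (-1) * g))) ∧ motive F' := by
    refine wt_induction hO (fun n F hF => ?_) ?_
    · have e : ∀ g, F.1 (ζ (-1) * g) = (((-1 : kˣ) ^ n : kˣ) : k) * F.1 g := hF.2 (-1)
      rcases Int.even_or_odd' n with ⟨m, rfl | rfl⟩
      · refine ⟨⟨F.1, mem_invariants_of_wt hF⟩, funext fun g => ?_, mem m _ hF⟩
        rw [e, zpow_mul, zpow_ofNat, neg_one_sq, one_zpow, Units.val_one, one_mul, ← two_mul,
          inv_mul_cancel_left₀ two_ne_zero]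
      · refine ⟨0, funext fun g => ?_, mem 0 _ (zero_mem _)⟩
        rw [e, zpow_add, zpow_mul, zpow_ofNat, neg_one_sq, one_zpow, one_mul, zpow_one,
          Units.val_neg, Units.val_one, neg_one_mul, add_neg_cancel, mul_zero]; rfl
    · rintro F F' ⟨G, hG, h⟩ ⟨G', hG', h'⟩
      refine ⟨G + G', ?_, add _ _ h h'⟩
      change G.1 + G'.1 = _
      rw [hG, hG']
      funext g
      change _ = (2 : k)⁻¹ * (F.1 g + F'.1 g + (F.1 (ζ (-1) * g) + F'.1 (ζ (-1) * g)))
      simp only [Pi.add_apply]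
      ring
  obtain ⟨F', h, h'⟩ := key ⟨F.1, F.2.1⟩
  have e : F' = F := Subtype.ext (by
    rw [h]; funext g
    rw [F.2.2, ← two_mul, inv_mul_cancel_left₀ two_ne_zero])
  rwa [e] at h'

/-- The integral powers of a character, as functions. -/
def charPow (χ : G →* kˣ) (n : ℤ) : G → k := fun g => ((χ g ^ n : kˣ) : k)

theorem charPow_add (χ : G →* kˣ) (n m : ℤ) : charPow χ (n + m) = charPow χ n * charPow χ m :=
  funext fun g => by simp [charPow, zpow_add]

theorem charPow_mul (χ : G →* kˣ) (n : ℤ) (g h : G) :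
    charPow χ n (g * h) = charPow χ n g * charPow χ n h := by
  simp [charPow, mul_zpow]

theorem charPow_inv_mul (χ : G →* kˣ) (n : ℤ) : charPow χ⁻¹ n * charPow χ n = 1 :=
  funext fun g => by
    simp only [charPow, Pi.mul_apply, ← Units.val_mul, MonoidHom.inv_apply, inv_zpow,
      inv_mul_cancel]
    rfl

variable (hO : Subalgebra.toSubmodule O ≤ ⨆ n, wt O ζ n) {χ : G →* kˣ}

/-- Multiplication of the functions of weight `2 m` by `χ ^ m`. -/
def twistFun (χ : G →* kˣ) : O →ₗ[k] G → k :=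
  wtMap hO fun n => LinearMap.mulLeft k (charPow χ (n / 2))

theorem twistFun_apply {m : ℤ} (F : O) (hF : F.1 ∈ wt O ζ (2 * m)) :
    twistFun hO χ F = charPow χ m * F.1 := by
  rw [twistFun, wtMap_apply hO _ F hF, Int.mul_ediv_cancel_left _ two_ne_zero]; rfl

theorem twistFun_mem (hχ : ∀ n, charPow χ n ∈ wt O ζ 0) (F : invariants O (ζ (-1))) :
    twistFun hO χ ⟨F.1, F.2.1⟩ ∈ invariants O (ζ (-1)) := by
  induction F using invariants_induction hO with
  | mem m F hF =>
    rw [twistFun_apply hO ⟨F.1, F.2.1⟩ hF]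
    refine mem_invariants_of_wt (m := m) ?_
    have := mul_mem_wt (hχ m) hF
    rwa [zero_add] at this
  | add F F' ih ih' =>
    have := add_mem ih ih'
    rwa [← map_add] at this

/-- The restriction of a linear map to the ring of invariants. -/
def restrictInvariants {z : G} (T : O →ₗ[k] G → k)
    (hT : ∀ F : invariants O z, T ⟨F.1, F.2.1⟩ ∈ invariants O z) :
    invariants O z →ₗ[k] invariants O z where
  toFun F := ⟨T ⟨F.1, F.2.1⟩, hT F⟩
  map_add' F F' := Subtype.ext (map_add T ⟨F.1, F.2.1⟩ ⟨F'.1, F'.2.1⟩)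
  map_smul' t F := Subtype.ext (map_smul T t ⟨F.1, F.2.1⟩)

/-- The linear endomorphism of the ring of invariants that multiplies the functions of weight
`2 m` by `χ ^ m`. -/
def twistLin (hχ : ∀ n, charPow χ n ∈ wt O ζ 0) :
    invariants O (ζ (-1)) →ₗ[k] invariants O (ζ (-1)) :=
  restrictInvariants (twistFun hO χ) (twistFun_mem hO hχ)

theorem twistLin_apply (hχ : ∀ n, charPow χ n ∈ wt O ζ 0) {m : ℤ} (F : invariants O (ζ (-1)))
    (hF : F.1 ∈ wt O ζ (2 * m)) : (twistLin hO hχ F).1 = charPow χ m * F.1 :=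
  twistFun_apply hO ⟨F.1, F.2.1⟩ hF

theorem twistLin_one (hχ : ∀ n, charPow χ n ∈ wt O ζ 0) : twistLin hO hχ 1 = 1 := by
  refine Subtype.ext ((twistLin_apply hO hχ (m := 0) 1 ?_).trans ?_)
  · rw [mul_zero]; exact one_mem_wt
  · funext g
    change charPow χ 0 g * 1 = 1
    simp [charPow]

theorem twistLin_mul (hχ : ∀ n, charPow χ n ∈ wt O ζ 0) (F F' : invariants O (ζ (-1))) :
    twistLin hO hχ (F * F') = twistLin hO hχ F * twistLin hO hχ F' := by
  induction F using invariants_induction hO with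
  | mem m F hF =>
    induction F' using invariants_induction hO with
    | mem m' F' hF' =>
      have h := mul_mem_wt hF hF'
      rw [← mul_add] at h
      refine Subtype.ext ((twistLin_apply hO hχ (F * F') h).trans ?_)
      change _ = (twistLin hO hχ F).1 * (twistLin hO hχ F').1
      rw [twistLin_apply hO hχ F hF, twistLin_apply hO hχ F' hF', charPow_add]
      exact mul_mul_mul_comm _ _ _ _
    | add G G' ih ih' => rw [mul_add, map_add, map_add, ih, ih', mul_add]
  | add G G' ih ih' => rw [add_mul, map_add, map_add, ih, ih', add_mul]

theorem twistLin_comp (hχ : ∀ n, charPow χ n ∈ wt O ζ 0) {χ' : G →* kˣ}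
    (hχ' : ∀ n, charPow χ' n ∈ wt O ζ 0) (h : ∀ n, charPow χ' n * charPow χ n = 1)
    (F : invariants O (ζ (-1))) : twistLin hO hχ' (twistLin hO hχ F) = F := by
  induction F using invariants_induction hO with
  | mem m F hF =>
    have e := twistLin_apply hO hχ F hF
    have h' := mul_mem_wt (hχ m) hF
    rw [zero_add, ← e] at h'
    exact Subtype.ext ((twistLin_apply hO hχ' _ h').trans (by rw [e, ← mul_assoc, h, one_mul]))
  | add F F' ih ih' => rw [map_add, map_add, ih, ih']

theorem charPow_inv_mem (hχ : ∀ n, charPow χ n ∈ wt O ζ 0) (n : ℤ) :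
    charPow χ⁻¹ n ∈ wt O ζ 0 := by
  have e : charPow χ⁻¹ n = charPow χ (-n) := funext fun g => by simp [charPow]
  exact e ▸ hχ (-n)

/-- The automorphism of the ring of invariants that multiplies the functions of weight `2 m`
by `χ ^ m`. -/
def twistEquiv (hχ : ∀ n, charPow χ n ∈ wt O ζ 0) :
    invariants O (ζ (-1)) ≃ₐ[k] invariants O (ζ (-1)) :=
  AlgEquiv.ofLinearEquiv
    (LinearEquiv.ofLinearMap (twistLin hO hχ) (twistLin hO (charPow_inv_mem hχ))
      (LinearMap.ext fun F => twistLin_comp hO (charPow_inv_mem hχ) hχ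
        (fun n => by rw [mul_comm]; exact charPow_inv_mul χ n) F)
      (LinearMap.ext fun F => twistLin_comp hO hχ (charPow_inv_mem hχ) (charPow_inv_mul χ) F))
    (twistLin_one hO hχ) (twistLin_mul hO hχ)

theorem twistEquiv_apply (hχ : ∀ n, charPow χ n ∈ wt O ζ 0) {m : ℤ} (F : invariants O (ζ (-1)))
    (hF : F.1 ∈ wt O ζ (2 * m)) : (twistEquiv hO hχ F).1 = charPow χ m * F.1 :=
  twistLin_apply hO hχ F hF

theorem twistEquiv_eq_of_sq (hχ : ∀ n, charPow χ n ∈ wt O ζ 0) (F : invariants O (ζ (-1)))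
    {g : G} {r : kˣ} (hr : r ^ 2 = χ g) : (twistEquiv hO hχ F).1 g = F.1 (ζ r * g) := by
  induction F using invariants_induction hO with
  | mem m F hF =>
    rw [twistEquiv_apply hO hχ F hF, hF.2, zpow_mul, zpow_ofNat, hr]; rfl
  | add F F' ih ih' =>
    rw [map_add]
    exact congrArg₂ (· + ·) ih ih'

theorem twistEquiv_eq_self (hχ : ∀ n, charPow χ n ∈ wt O ζ 0) (F : invariants O (ζ (-1)))
    (hF : F.1 ∈ wt O ζ 0) : twistEquiv hO hχ F = F := Subtype.ext (by
  rw [twistEquiv_apply hO hχ (m := 0) F (by rwa [mul_zero])]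
  ext g
  simp [charPow])

theorem exists_comul_twist (hO' : Subalgebra.toSubmodule O ≤ ⨆ n, comulWt O ζ n)
    (hχ : ∀ n, charPow χ n ∈ wt O ζ 0) (F : invariants O (ζ (-1))) :
    ∃ (r : ℕ) (f₁ f₂ : Fin r → invariants O (ζ (-1))),
      (∀ g g' : G, F.1 (g * g') = ∑ i, (f₁ i).1 g * (f₂ i).1 g') ∧
      ∀ g g' : G, (twistEquiv hO hχ F).1 (g * g') =
        ∑ i, (twistEquiv hO hχ (f₁ i)).1 g * (twistEquiv hO hχ (f₂ i)).1 g' := by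
  let S : Set ((G × G → k) × (G × G → k)) := {H | ∃ a b : invariants O (ζ (-1)),
    H = (fun p => a.1 p.1 * b.1 p.2,
      fun p => (twistEquiv hO hχ a).1 p.1 * (twistEquiv hO hχ b).1 p.2)}
  have key : ((fun p : G × G => F.1 (p.1 * p.2)),
      fun p : G × G => (twistEquiv hO hχ F).1 (p.1 * p.2)) ∈ Submodule.span k S := by
    induction F using invariants_induction hO with
    | mem m F hF =>
      rw [twistEquiv_apply hO hχ F hF]
      have h1 := (wt_le_comulWt hO' _ hF).2
      have h2 : ∀ H ∈ Submodule.span k {H : G × G → k | ∃ a ∈ wt O ζ (2 * m),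
          ∃ b ∈ wt O ζ (2 * m), H = fun p => a p.1 * b p.2},
          (H, fun p : G × G => charPow χ m (p.1 * p.2) * H p) ∈ Submodule.span k S :=
          fun H hH => by
        induction hH using Submodule.span_induction with
        | mem H hH =>
          obtain ⟨a, ha, b, hb, rfl⟩ := hH
          refine Submodule.subset_span ⟨⟨a, mem_invariants_of_wt ha⟩,
            ⟨b, mem_invariants_of_wt hb⟩, Prod.ext rfl (funext fun p => ?_)⟩
          rw [twistEquiv_apply hO hχ ⟨a, mem_invariants_of_wt ha⟩ ha,
            twistEquiv_apply hO hχ ⟨b, mem_invariants_of_wt hb⟩ hb]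
          dsimp only [Pi.mul_apply]
          rw [charPow_mul, mul_mul_mul_comm]
        | zero =>
          have e : ((0 : G × G → k), fun p : G × G =>
              charPow χ m (p.1 * p.2) * (0 : G × G → k) p) = 0 :=
            Prod.ext rfl (funext fun p => mul_zero _)
          rw [e]; exact zero_mem _
        | add H H' _ _ h h' =>
          have := add_mem h h'
          convert this using 1
          exact Prod.ext rfl (funext fun p => mul_add _ _ _)
        | smul t H _ h =>
          have := Submodule.smul_mem _ t h
          convert this using 1
          exact Prod.ext rfl (funext fun p => mul_left_comm _ _ _)
      exact h2 _ h1
    | add F F' ih ih' =>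
      rw [map_add]
      exact add_mem ih ih'
  obtain ⟨r, c, H, h⟩ := Submodule.mem_span_set'.1 key
  choose a b hab using fun i => (H i).2
  refine ⟨r, fun i => c i • a i, b, fun g g' => ?_, fun g g' => ?_⟩
  · have := congrFun (congrArg Prod.fst h) (g, g')
    refine this.symm.trans ?_
    rw [Prod.fst_sum, Finset.sum_apply]
    refine Finset.sum_congr rfl fun i _ => ?_
    rw [hab]
    exact (mul_assoc _ _ _).symm
  · have := congrFun (congrArg Prod.snd h) (g, g')
    refine this.symm.trans ?_
    rw [Prod.snd_sum, Finset.sum_apply]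
    refine Finset.sum_congr rfl fun i _ => ?_
    rw [hab, map_smul]
    exact (mul_assoc _ _ _).symm

/-- The derivative along the cocharacter `ζ` at the identity. -/
def wtDeriv : O →ₗ[k] k := wtMap hO fun n => (n : k) • LinearMap.proj 1

theorem wtDeriv_apply {n : ℤ} (F : O) (hF : F.1 ∈ wt O ζ n) : wtDeriv hO F = n * F.1 1 :=
  wtMap_apply hO _ F hF

theorem isTangent_wtDeriv : IsTangent O (wtDeriv hO) := by
  intro F F'
  induction F using wt_induction hO with
  | mem n F hF =>
    induction F' using wt_induction hO with
    | mem m F' hF' =>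
      rw [wtDeriv_apply hO F hF, wtDeriv_apply hO F' hF',
        wtDeriv_apply hO (F * F') (mul_mem_wt hF hF')]
      change ((n + m : ℤ) : k) * (F.1 1 * F'.1 1) = _
      push_cast
      ring
    | add G G' h h' =>
      rw [mul_add, map_add, map_add, h, h']
      change _ = _ + (G.1 1 + G'.1 1) * _
      ring
  | add G G' h h' =>
    rw [add_mul, map_add, map_add, h, h']
    change _ = (G.1 1 + G'.1 1) * _ + _
    ring

theorem IsTangent.add_smul {T T' : O →ₗ[k] k} (h : IsTangent O T) (h' : IsTangent O T') (κ : k) :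
    IsTangent O (T + κ • T') := fun f f' => by
  simp only [LinearMap.add_apply, LinearMap.smul_apply, h f f', h' f f', smul_eq_mul]
  ring

theorem tangent_charPow {T : O →ₗ[k] k} (hT : IsTangent O T) (hχ : ∀ n, charPow χ n ∈ O) (m : ℤ) :
    T ⟨charPow χ m, hχ m⟩ = m * T ⟨charPow χ 1, hχ 1⟩ := by
  have h1 : ∀ n, charPow χ n 1 = 1 := fun n => by simp [charPow]
  have hs : ∀ n m, T ⟨charPow χ (n + m), hχ _⟩ = T ⟨charPow χ n, hχ n⟩ + T ⟨charPow χ m, hχ m⟩ :=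
    fun n m => by
      have e : (⟨charPow χ (n + m), hχ _⟩ : O) = ⟨charPow χ n, hχ n⟩ * ⟨charPow χ m, hχ m⟩ :=
        Subtype.ext (charPow_add χ n m)
      rw [e, hT]
      change charPow χ n 1 * _ + charPow χ m 1 * _ = _
      rw [h1, h1, one_mul, one_mul, add_comm]
  let φ : ℤ →+ k := AddMonoidHom.mk' (fun n => T ⟨charPow χ n, hχ n⟩) hs
  have := map_zsmul φ m 1
  rw [smul_eq_mul, mul_one, zsmul_eq_mul] at this
  exact this

/-- The derivative of the twist by `χ` is the sum of the identity and of a multiple of the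
derivative along `ζ`. -/
theorem tangent_twist {T : O →ₗ[k] k} (hT : IsTangent O T) (hχ : ∀ n, charPow χ n ∈ wt O ζ 0)
    (F : invariants O (ζ (-1))) :
    T ⟨(twistEquiv hO hχ F).1, (twistEquiv hO hχ F).2.1⟩ =
      (T + (2⁻¹ * T ⟨charPow χ 1, (hχ 1).1⟩) • wtDeriv hO) ⟨F.1, F.2.1⟩ := by
  induction F using invariants_induction hO with
  | mem m F hF =>
    have e : (⟨(twistEquiv hO hχ F).1, (twistEquiv hO hχ F).2.1⟩ : O) =
        ⟨charPow χ m, (hχ m).1⟩ * ⟨F.1, F.2.1⟩ :=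
      Subtype.ext (twistEquiv_apply hO hχ F hF)
    have h1 : charPow χ m 1 = 1 := by simp [charPow]
    rw [e, hT, tangent_charPow hT fun n => (hχ n).1, LinearMap.add_apply,
      LinearMap.smul_apply, wtDeriv_apply hO ⟨F.1, F.2.1⟩ hF, smul_eq_mul]
    change charPow χ m 1 * _ + F.1 1 * _ = _ + _ * (_ * F.1 1)
    rw [h1]
    push_cast
    field_simp
  | add F F' ih ih' =>
    have e : (⟨(twistEquiv hO hχ (F + F')).1, (twistEquiv hO hχ (F + F')).2.1⟩ : O) =
        ⟨(twistEquiv hO hχ F).1, (twistEquiv hO hχ F).2.1⟩ +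
        ⟨(twistEquiv hO hχ F').1, (twistEquiv hO hχ F').2.1⟩ :=
      Subtype.ext (by rw [map_add]; rfl)
    have e2 : (⟨(F + F').1, (F + F').2.1⟩ : O) = ⟨F.1, F.2.1⟩ + ⟨F'.1, F'.2.1⟩ := rfl
    rw [e, e2, map_add, map_add, ih, ih']

end Twist

section Outer

variable {k G : Type*} [Field k] [Group G]

/-- The algebra of the functions of weight zero. -/
def wtZero (O : Subalgebra k (G → k)) (ζ : kˣ →* G) : Subalgebra k (G → k) where
  carrier := {F | F ∈ wt O ζ 0}
  mul_mem' h h' := by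
    have := mul_mem_wt h h'
    rwa [add_zero] at this
  add_mem' h h' := (wt O ζ 0).add_mem h h'
  algebraMap_mem' t := by
    rw [Algebra.algebraMap_eq_smul_one]
    exact Submodule.smul_mem (wt O ζ 0) _ one_mem_wt

/-- The functions on `G × G` that are sums of products of functions in `A` of the two variables. -/
def outer (A : Subalgebra k (G → k)) : Subalgebra k (G × G → k) where
  carrier := {H | H ∈ Submodule.span k {H : G × G → k | ∃ a ∈ A, ∃ b ∈ A,
    H = fun p => a p.1 * b p.2}}
  mul_mem' h h' := by
    have h1 := Submodule.mul_mem_mul (Set.mem_setOf.1 h) (Set.mem_setOf.1 h')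
    rw [Submodule.span_mul_span] at h1
    refine Submodule.span_mono ?_ h1
    rintro _ ⟨_, ⟨a, ha, b, hb, rfl⟩, _, ⟨a', ha', b', hb', rfl⟩, rfl⟩
    exact ⟨a * a', mul_mem ha ha', b * b', mul_mem hb hb',
      funext fun p => mul_mul_mul_comm _ _ _ _⟩
  add_mem' h h' := Submodule.add_mem _ (Set.mem_setOf.1 h) h'
  algebraMap_mem' t := Submodule.subset_span ⟨algebraMap k _ t, A.algebraMap_mem t, 1, one_mem _,
    funext fun _ => (mul_one t).symm⟩

variable {A : Subalgebra k (G → k)}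

theorem fst_mem_outer {a : G → k} (ha : a ∈ A) : (fun p : G × G => a p.1) ∈ outer A := by
  refine Submodule.subset_span (Set.mem_setOf.2 ⟨a, ha, 1, one_mem _, funext fun _ => (mul_one _).symm⟩)

theorem snd_mem_outer {a : G → k} (ha : a ∈ A) : (fun p : G × G => a p.2) ∈ outer A := by
  refine Submodule.subset_span (Set.mem_setOf.2 ⟨1, one_mem _, a, ha, funext fun _ => (one_mul _).symm⟩)

theorem mem_comulWt_zero {O : Subalgebra k (G → k)} {ζ : kˣ →* G} {F : G → k} (hF : F ∈ wt O ζ 0)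
    (h : (fun p : G × G => F (p.1 * p.2)) ∈ outer (wtZero O ζ)) : F ∈ comulWt O ζ 0 := ⟨hF, h⟩

/-- The ring homomorphism to the dual numbers given by a tangent vector. -/
def tangentHom {T : A →ₗ[k] k} (hT : IsTangent A T) : A →+* DualNumber k where
  toFun f := (f.1 1, T f)
  map_one' := Prod.ext rfl hT.map_one
  map_zero' := Prod.ext rfl (map_zero T)
  map_add' f f' := Prod.ext rfl (map_add T f f')
  map_mul' f f' := Prod.ext rfl (by
    rw [hT f f']
    exact congrArg₂ (· + ·) rfl (mul_comm _ _))

theorem IsTangent.det {T : A →ₗ[k] k} (hT : IsTangent A T) {n : Type*} [Fintype n] [DecidableEq n]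
    (M : Matrix n n A) (h1 : ∀ i j, (M i j).1 1 = (1 : Matrix n n k) i j) :
    T M.det = Matrix.trace (Matrix.of fun i j => T (M i j)) := by
  let S : Matrix n n k := Matrix.of fun i j => T (M i j)
  have hψ : (tangentHom hT).mapMatrix M = 1 + (DualNumber.eps : DualNumber k) •
      S.map (algebraMap k (DualNumber k)) := by
    refine Matrix.ext fun i j => TrivSqZeroExt.ext ?_ ?_
    · refine (h1 i j).trans ?_
      rw [Matrix.add_apply, TrivSqZeroExt.fst_add, Matrix.smul_apply, smul_eq_mul,
        TrivSqZeroExt.fst_mul, DualNumber.fst_eps, zero_mul, add_zero, Matrix.one_apply,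
        Matrix.one_apply]
      split_ifs <;> simp
    · change T (M i j) = _
      rw [Matrix.add_apply, TrivSqZeroExt.snd_add, Matrix.one_apply]
      split_ifs <;> simp [S, Matrix.smul_apply] <;> rfl
  have h2 : TrivSqZeroExt.snd (tangentHom hT M.det) = T M.det := rfl
  rw [← h2, RingHom.map_det, hψ, Matrix.det_one_add_smul, pow_two, DualNumber.eps_mul_eps,
    mul_zero, add_zero, TrivSqZeroExt.snd_add, TrivSqZeroExt.snd_one, zero_add]
  have h3 : (S.map (algebraMap k (DualNumber k))).trace = algebraMap k (DualNumber k) S.trace :=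
    (AddMonoidHom.map_trace (algebraMap k (DualNumber k)).toAddMonoidHom S).symm
  rw [h3, TrivSqZeroExt.snd_mul]
  simp [S]
  rfl

end Outer

section Character

open PowerSeries

variable {k V : Type*} [Field k] [CharZero k] [AddCommGroup V] [Module k V]
  {ω : SymplecticForm k V} {𝔵 : Submodule k V} {ι : Type*} [Fintype ι]

theorem scalGJ_mul_snd (t : kˣ) (g : GJ ω 𝔵) : (scalGJ ω 𝔵 t * g).1.2 = g.1.2 := one_mul _

theorem mem_wt_zero_of_snd {φ : G1 ω ⋊[spAct] Sp ω → k}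
    (h : (fun g : GJ ω 𝔵 => φ g.1.2) ∈ OGJ ω 𝔵) :
    (fun g : GJ ω 𝔵 => φ g.1.2) ∈ wt (OGJ ω 𝔵) (scalGJ ω 𝔵) 0 :=
  ⟨h, fun t g => by dsimp only; rw [scalGJ_mul_snd, zpow_zero, Units.val_one, one_mul]⟩

namespace Darboux

theorem reg_outer_right (B : Darboux ω 𝔵 ι) (v : V) :
    Reg (outer (wtZero (OGJ ω 𝔵) (scalGJ ω 𝔵)))
      (fun p : GJ ω 𝔵 × GJ ω 𝔵 => (p.1 * p.2).1.2.right.1 v) := by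
  have := B.finiteDimensional
  have hm : ∀ (l : V →ₗ[k] k) (v : V), (fun g : GJ ω 𝔵 => l (g.1.2.right.1 v)) ∈
      wtZero (OGJ ω 𝔵) (scalGJ ω 𝔵) := fun l v => mem_wt_zero_of_snd
    (φ := fun x : G1 ω ⋊[spAct] Sp ω => l (x.right.1 v)) (right_mem_OGJ l v)
  have h1 : ∀ v, Reg (outer (wtZero (OGJ ω 𝔵) (scalGJ ω 𝔵)))
      (fun p : GJ ω 𝔵 × GJ ω 𝔵 => p.1.1.2.right.1 v) := fun v =>
    (exists_hasD_of_finite 0 ⊤ (fun _ => Submodule.mem_top)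
      fun l => fst_mem_outer (a := fun g : GJ ω 𝔵 => l (g.1.2.right.1 v)) (hm l v)).choose_spec.reg
  have h2 : Reg (outer (wtZero (OGJ ω 𝔵) (scalGJ ω 𝔵)))
      (fun p : GJ ω 𝔵 × GJ ω 𝔵 => p.2.1.2.right.1 v) :=
    (exists_hasD_of_finite 0 ⊤ (fun _ => Submodule.mem_top)
      fun l => snd_mem_outer (a := fun g : GJ ω 𝔵 => l (g.1.2.right.1 v)) (hm l v)).choose_spec.reg
  exact (HasD.eval isTangent_zero (A := fun p : GJ ω 𝔵 × GJ ω 𝔵 =>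
    (p.1.1.2.right.1 : V →ₗ[k] V)) (A' := 0) h1 h2).reg

theorem reg_outer_left (B : Darboux ω 𝔵 ι) (d : ℕ) :
    Reg (outer (wtZero (OGJ ω 𝔵) (scalGJ ω 𝔵)))
      (fun p : GJ ω 𝔵 × GJ ω 𝔵 => coeff d (((p.1 * p.2).1.2.left : (WSer ω)ˣ) : WSer ω)) := by
  have := B.finiteDimensional
  have hm : ∀ (l : Weyl ω →ₗ[k] k) (d : ℕ), (fun g : GJ ω 𝔵 => l (coeff d ((g.1.2.left : (WSer ω)ˣ) : WSer ω))) ∈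
      wtZero (OGJ ω 𝔵) (scalGJ ω 𝔵) := fun l d =>
    mem_wt_zero_of_snd (φ := fun x : G1 ω ⋊[spAct] Sp ω => l (coeff d ((x.left : (WSer ω)ˣ) : WSer ω)))
      (left_mem_OGJ l d)
  have h0 : ∀ v, Reg (outer (wtZero (OGJ ω 𝔵) (scalGJ ω 𝔵)))
      (fun p : GJ ω 𝔵 × GJ ω 𝔵 => p.1.1.2.right.1 v) := fun v =>
    (exists_hasD_of_finite 0 ⊤ (fun _ => Submodule.mem_top) fun l => fst_mem_outer
      (a := fun g : GJ ω 𝔵 => l (g.1.2.right.1 v)) (mem_wt_zero_of_snd (φ := fun x : G1 ω ⋊[spAct] Sp ω => l (x.right.1 v)) (right_mem_OGJ l v))).choose_spec.reg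
  have h1 : ∀ d, Reg (outer (wtZero (OGJ ω 𝔵) (scalGJ ω 𝔵)))
      (fun p : GJ ω 𝔵 × GJ ω 𝔵 => coeff d ((p.1.1.2.left : (WSer ω)ˣ) : WSer ω)) := fun d => by
    have := B.finiteDimensional_weylF (3 * d)
    exact (exists_hasD_of_finite 0 (weylF ω (3 * d)) (fun p : GJ ω 𝔵 × GJ ω 𝔵 => B.coeff_left_mem p.1.1 d)
      fun l => fst_mem_outer
        (a := fun g : GJ ω 𝔵 => l (coeff d ((g.1.2.left : (WSer ω)ˣ) : WSer ω))) (hm l d)).choose_spec.reg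
  have h2 : ∀ d, Reg (outer (wtZero (OGJ ω 𝔵) (scalGJ ω 𝔵)))
      (fun p : GJ ω 𝔵 × GJ ω 𝔵 => coeff d ((p.2.1.2.left : (WSer ω)ˣ) : WSer ω)) := fun d => by
    have := B.finiteDimensional_weylF (3 * d)
    exact (exists_hasD_of_finite 0 (weylF ω (3 * d)) (fun p : GJ ω 𝔵 × GJ ω 𝔵 => B.coeff_left_mem p.2.1 d)
      fun l => snd_mem_outer
        (a := fun g : GJ ω 𝔵 => l (coeff d ((g.1.2.left : (WSer ω)ˣ) : WSer ω))) (hm l d)).choose_spec.reg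
  refine reg_coeff_mul (F := fun p : GJ ω 𝔵 × GJ ω 𝔵 => ((p.1.1.2.left : (WSer ω)ˣ) : WSer ω))
    (F' := fun p : GJ ω 𝔵 × GJ ω 𝔵 =>
      thetaS p.1.1.2.right ((p.2.1.2.left : (WSer ω)ˣ) : WSer ω)) h1 (fun d => ?_) d
  exact (HasD.eval isTangent_zero (A := fun p : GJ ω 𝔵 × GJ ω 𝔵 =>
    (thetaW p.1.1.2.right).toLinearMap) (A' := 0)
    (fun a => (hasD_thetaW isTangent_zero (σ := fun p : GJ ω 𝔵 × GJ ω 𝔵 => p.1.1.2.right) rfl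
      (s := 0) (q := 0) h0 (fun v => by simp) a).reg) (h2 d)).reg

theorem OGJ_le_comulWt (B : Darboux ω 𝔵 ι) :
    Subalgebra.toSubmodule (OGJ ω 𝔵) ≤ ⨆ n, comulWt (OGJ ω 𝔵) (scalGJ ω 𝔵) n := by
  refine adjoin_le_iSup_comulWt fun f hf => ?_
  rcases hf with (hf | ⟨l, v, rfl⟩) | ⟨l, d, rfl⟩
  · rcases (show _ ∨ _ from hf) with rfl | rfl
    · have h : (fun g : GJ ω 𝔵 => (g.1.1 : k)) ∈ wt (OGJ ω 𝔵) (scalGJ ω 𝔵) 1 :=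
        ⟨scal_mem_OGJ, fun t g => by rw [zpow_one]; rfl⟩
      exact ⟨1, h, Submodule.subset_span ⟨_, h, _, h, rfl⟩⟩
    · have h : (fun g : GJ ω 𝔵 => ((g.1.1⁻¹ : kˣ) : k)) ∈ wt (OGJ ω 𝔵) (scalGJ ω 𝔵) (-1) :=
        ⟨scal_inv_mem_OGJ, fun t g => by
          rw [zpow_neg_one, ← Units.val_mul, ← mul_inv]; rfl⟩
      exact ⟨-1, h, Submodule.subset_span ⟨_, h, _, h, funext fun p => by
        rw [← Units.val_mul, ← mul_inv]; rfl⟩⟩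
  · exact ⟨0, mem_comulWt_zero (mem_wt_zero_of_snd
      (φ := fun x : G1 ω ⋊[spAct] Sp ω => l (x.right.1 v)) (right_mem_OGJ l v))
      (HasD.mem (HasD.map l (B.reg_outer_right v)))⟩
  · exact ⟨0, mem_comulWt_zero (mem_wt_zero_of_snd
      (φ := fun x : G1 ω ⋊[spAct] Sp ω => l (coeff d ((x.left : (WSer ω)ˣ) : WSer ω)))
      (left_mem_OGJ l d)) (HasD.mem (HasD.map l (B.reg_outer_left d)))⟩

theorem OGJ_le_wt (B : Darboux ω 𝔵 ι) :
    Subalgebra.toSubmodule (OGJ ω 𝔵) ≤ ⨆ n, wt (OGJ ω 𝔵) (scalGJ ω 𝔵) n :=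
  B.OGJ_le_comulWt.trans (iSup_mono fun _ => inf_le_left)

/-- The action of `𝒢_𝒥` on `𝔵`. -/
def resX (B : Darboux ω 𝔵 ι) : GJ ω 𝔵 →* Module.End k 𝔵 where
  toFun g := (g.1.2.right.1 : V →ₗ[k] V).restrict (B.right_mem_of_mem_GJ g.2)
  map_one' := rfl
  map_mul' _ _ := rfl

/-- The inverse of the determinant of the action on `𝔵`. -/
def chi (B : Darboux ω 𝔵 ι) : GJ ω 𝔵 →* kˣ :=
  ((LinearMap.det (M := 𝔵)).comp B.resX).toHomUnits⁻¹

theorem charPow_chi_neg_one (B : Darboux ω 𝔵 ι) :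
    charPow B.chi (-1) = fun g => LinearMap.det (B.resX g) := funext fun g => by
  simp [charPow, chi]

theorem charPow_chi_one (B : Darboux ω 𝔵 ι) :
    charPow B.chi 1 = fun g => LinearMap.det (B.resX g⁻¹) := funext fun g => by
  rw [← congrFun B.charPow_chi_neg_one g⁻¹]
  simp [charPow]

/-- A matrix of regular functions that describes the action on `𝔵`. -/
theorem exists_matrix (B : Darboux ω 𝔵 ι) : ∃ (n : ℕ) (b : Module.Basis (Fin n) k 𝔵)
    (M : Matrix (Fin n) (Fin n) (OGJ ω 𝔵)) (l : Fin n → V →ₗ[k] k),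
    (∀ i (x : 𝔵), l i x = b.repr x i) ∧
    (∀ i j, (M i j).1 = fun g => l i (g.1.2.right.1 (b j))) ∧
    M.det.1 = fun g => LinearMap.det (B.resX g) := by
  have := B.finiteDimensional
  let b := Module.finBasis k 𝔵
  choose l hl using fun i => LinearMap.exists_extend (b.coord i)
  have hl' : ∀ i (x : 𝔵), l i x = b.repr x i := fun i x => LinearMap.congr_fun (hl i) x
  refine ⟨_, b, Matrix.of fun i j => ⟨_, right_mem_OGJ (l i) (b j)⟩, l, hl', fun i j => rfl,
    funext fun g => ?_⟩
  let ev : OGJ ω 𝔵 →+* k := (Pi.evalRingHom (fun _ => k) g).comp (OGJ ω 𝔵).val.toRingHom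
  change ev _ = _
  rw [RingHom.map_det, ← LinearMap.det_toMatrix b]
  congr 1
  ext i j
  rw [LinearMap.toMatrix_apply]
  exact hl' i (B.resX g (b j))

theorem charPow_chi_mem (B : Darboux ω 𝔵 ι) (n : ℤ) :
    charPow B.chi n ∈ wt (OGJ ω 𝔵) (scalGJ ω 𝔵) 0 := by
  have h1 : charPow B.chi (-1) ∈ wt (OGJ ω 𝔵) (scalGJ ω 𝔵) 0 := by
    obtain ⟨n, b, M, l, -, -, h⟩ := B.exists_matrix
    rw [charPow_chi_neg_one, ← h]
    refine ⟨M.det.2, fun t g => ?_⟩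
    rw [h, zpow_zero, Units.val_one, one_mul]
    rfl
  have h2 : charPow B.chi 1 ∈ wt (OGJ ω 𝔵) (scalGJ ω 𝔵) 0 := by
    rw [charPow_chi_one]
    rw [charPow_chi_neg_one] at h1
    refine ⟨B.inv_mem_OGJ h1.1, fun t g => ?_⟩
    dsimp only
    rw [mul_inv_rev, zpow_zero, Units.val_one, one_mul, map_mul, ← map_inv]
    exact congrArg LinearMap.det (mul_one (B.resX g⁻¹))
  have h3 : ∀ {n m}, charPow B.chi n ∈ wt (OGJ ω 𝔵) (scalGJ ω 𝔵) 0 →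
      charPow B.chi m ∈ wt (OGJ ω 𝔵) (scalGJ ω 𝔵) 0 →
      charPow B.chi (n + m) ∈ wt (OGJ ω 𝔵) (scalGJ ω 𝔵) 0 := fun h h' => by
    rw [charPow_add]
    have := mul_mem_wt h h'
    rwa [add_zero] at this
  induction n using Int.induction_on with
  | zero =>
    have : charPow B.chi 0 = 1 := funext fun g => by simp [charPow]
    rw [this]; exact one_mem_wt
  | succ n ih => exact h3 ih h2
  | pred n ih => exact h3 ih h1

theorem right_velocity_mem (B : Darboux ω 𝔵 ι) {T : OGJ ω 𝔵 →ₗ[k] k} {c : k} {s : V →ₗ[k] V}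
    {w : WSer ω} (h : IsVelocity T c s w) : ∀ v ∈ 𝔵, s v ∈ 𝔵 := fun v hv =>
  (h.right v).mem_of_forall 𝔵 fun g => B.right_mem_of_mem_GJ g.2 v hv

/-- The derivative of the determinant is the trace. -/
theorem tangent_chi (B : Darboux ω 𝔵 ι) {T : OGJ ω 𝔵 →ₗ[k] k} (hT : IsTangent (OGJ ω 𝔵) T) {c : k}
    {s : V →ₗ[k] V} {w : WSer ω} (h : IsVelocity T c s w) :
    T ⟨charPow B.chi 1, (B.charPow_chi_mem 1).1⟩ =
      -LinearMap.trace k 𝔵 (s.restrict (B.right_velocity_mem h)) := by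
  have h1 := tangent_charPow hT (fun n => (B.charPow_chi_mem n).1) (-1)
  rw [Int.cast_neg, Int.cast_one, neg_one_mul] at h1
  rw [← neg_eq_iff_eq_neg, ← h1]
  obtain ⟨n, b, M, l, hl, hM, hdet⟩ := B.exists_matrix
  have e : (⟨charPow B.chi (-1), (B.charPow_chi_mem (-1)).1⟩ : OGJ ω 𝔵) = M.det :=
    Subtype.ext (B.charPow_chi_neg_one.trans hdet.symm)
  rw [e]
  rw [hT.det M fun i j => by
    rw [hM]
    refine (hl i (b j)).trans ?_
    rw [Module.Basis.repr_self, Finsupp.single_apply, Matrix.one_apply]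
    exact if_congr eq_comm rfl rfl, LinearMap.trace_eq_matrix_trace k b]
  congr 1
  ext i j
  rw [LinearMap.toMatrix_apply, Matrix.of_apply,
    (HasD.map (l i) (h.right (b j))).apply_eq (M i j) fun g => congrFun (hM i j) g]
  exact hl i (s.restrict (B.right_velocity_mem h) (b j))

end Darboux
end Character

section Rows

open PowerSeries

variable {k V : Type*} [Field k] [CharZero k] [AddCommGroup V] [Module k V]
  {ω : SymplecticForm k V} {𝔵 : Submodule k V} {ι : Type*} [Fintype ι]

namespace Darboux

/-- The isomorphism of the coordinate rings given by the action on `𝒟` and `𝓜`. -/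
def pullEquiv (B : Darboux ω 𝔵 ι) [Nonempty ι] : OAutDMpm ω 𝔵 ≃ₐ[k] OGJpm ω 𝔵 where
  toFun f := ⟨fun g => f.1 (B.actEquiv g), B.comp_mem_OGJ f.2.1, fun g => by
    dsimp only
    rw [map_mul, B.actEquiv_negGJ, f.2.2]⟩
  invFun f := ⟨fun h => f.1 (B.actEquiv.symm h), B.comp_mem_OGJ_iff.1 (by
    simpa only [MulEquiv.symm_apply_apply] using f.2.1), fun h => by
      dsimp only
      rw [map_mul, ← B.actEquiv_negGJ, MulEquiv.symm_apply_apply, f.2.2]⟩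
  left_inv f := Subtype.ext (funext fun h => congrArg f.1 (B.actEquiv.apply_symm_apply h))
  right_inv f := Subtype.ext (funext fun g => congrArg f.1 (B.actEquiv.symm_apply_apply g))
  map_mul' _ _ := rfl
  map_add' _ _ := rfl
  commutes' _ := rfl

/-- The comorphism of `Φ_{𝒟,𝓜}`: the composition of the action on `𝒟` and `𝓜` with the twist by a
square root of the determinant. -/
def pullPhi (B : Darboux ω 𝔵 ι) [Nonempty ι] : OAutDMpm ω 𝔵 ≃ₐ[k] OGJpm ω 𝔵 :=
  B.pullEquiv.trans (twistEquiv B.OGJ_le_wt B.charPow_chi_mem)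

theorem pullPhi_eq_of_sq (B : Darboux ω 𝔵 ι) [Nonempty ι] (f : OAutDMpm ω 𝔵) {g : GJ ω 𝔵} {r : kˣ}
    (hr : r ^ 2 = B.chi g) : (B.pullPhi f).1 g = f.1 (B.actEquiv (scalGJ ω 𝔵 r * g)) :=
  twistEquiv_eq_of_sq B.OGJ_le_wt B.charPow_chi_mem (B.pullEquiv f) hr

theorem pullPhi_eq_self (B : Darboux ω 𝔵 ι) [Nonempty ι] (f : OAutDMpm ω 𝔵)
    (hf : ∀ t g, f.1 (B.actEquiv (scalGJ ω 𝔵 t * g)) = f.1 (B.actEquiv g)) (g : GJ ω 𝔵) :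
    (B.pullPhi f).1 g = f.1 (B.actEquiv g) :=
  congrFun (congrArg Subtype.val (twistEquiv_eq_self B.OGJ_le_wt B.charPow_chi_mem (B.pullEquiv f)
    ⟨(B.pullEquiv f).2.1, fun t g => by
      rw [zpow_zero, Units.val_one, one_mul]; exact hf t g⟩)) g

/-- The isomorphism `Φ_{𝒟,𝓜}`. -/
def PhiDM (B : Darboux ω 𝔵 ι) [Nonempty ι] : ProalgIso (OGJpm ω 𝔵) (OAutDMpm ω 𝔵) where
  pull := B.pullPhi
  comul f := by
    obtain ⟨r, f₁, f₂, h1, h2⟩ := exists_comul_twist B.OGJ_le_wt B.OGJ_le_comulWt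
      B.charPow_chi_mem (B.pullEquiv f)
    refine ⟨r, fun i => B.pullEquiv.symm (f₁ i), fun i => B.pullEquiv.symm (f₂ i),
      fun h h' => ?_, fun g g' => ?_⟩
    · have := h1 (B.actEquiv.symm h) (B.actEquiv.symm h')
      rw [← map_mul] at this
      exact (congrArg f.1 (B.actEquiv.apply_symm_apply (h * h'))).symm.trans this
    · refine (h2 g g').trans (Finset.sum_congr rfl fun i _ => ?_)
      have e := fun F => congrArg (twistEquiv B.OGJ_le_wt B.charPow_chi_mem)
        (B.pullEquiv.apply_symm_apply F)
      exact congrArg₂ (· * ·) (congrFun (congrArg Subtype.val (e (f₁ i))) g).symm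
        (congrFun (congrArg Subtype.val (e (f₂ i))) g').symm

theorem centralGJ_right (B : Darboux ω 𝔵 ι) (c : k⟦X⟧ˣ) : (B.centralGJ c).1.2.right = 1 :=
  B.centralHom_right c

theorem centralGJ_left (B : Darboux ω 𝔵 ι) (c : k⟦X⟧ˣ) :
    (((B.centralGJ c).1.2.left : (WSer ω)ˣ) : WSer ω) =
      constantCoeff ((c⁻¹ : k⟦X⟧ˣ) : k⟦X⟧) • rho (algebraMap _ _ (c : k⟦X⟧)) := by
  have h1 : constantCoeff ((c⁻¹ : k⟦X⟧ˣ) : k⟦X⟧) * constantCoeff (c : k⟦X⟧) = 1 := by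
    rw [← map_mul, Units.inv_mul, map_one]
  rw [← B.smul_centralHom_left c, smul_smul, h1, one_smul]
  rfl

theorem coeff_mem_OK (i : ℕ) : (fun c : k⟦X⟧ˣ => coeff i (c : k⟦X⟧)) ∈ OK k :=
  Algebra.subset_adjoin (Or.inl ⟨i, rfl⟩)

theorem inv_mem_OK : (fun c : k⟦X⟧ˣ => constantCoeff ((c⁻¹ : k⟦X⟧ˣ) : k⟦X⟧)) ∈ OK k :=
  Algebra.subset_adjoin (Or.inr rfl)

theorem comp_centralGJ_mem (B : Darboux ω 𝔵 ι) {f : GJ ω 𝔵 → k} (hf : f ∈ OGJ ω 𝔵) :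
    (fun c => f (B.centralGJ c)) ∈ OK k := by
  induction hf using Algebra.adjoin_induction with
  | mem f hf =>
    rcases hf with (hf | ⟨l, v, rfl⟩) | ⟨l, d, rfl⟩
    · rcases (show _ ∨ _ from hf) with rfl | rfl
      · have : (fun c => (((B.centralGJ c).1.1 : kˣ) : k)) = fun c : k⟦X⟧ˣ => coeff 0 (c : k⟦X⟧) :=
          funext fun c => (B.centralHom_fst c).trans (coeff_zero_eq_constantCoeff_apply _).symm
        rw [this]
        exact coeff_mem_OK 0
      · have : (fun c => ((((B.centralGJ c).1.1)⁻¹ : kˣ) : k)) =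
            fun c => constantCoeff ((c⁻¹ : k⟦X⟧ˣ) : k⟦X⟧) := funext fun c => by
          rw [← B.centralHom_fst c⁻¹, map_inv]; rfl
        rw [this]
        exact inv_mem_OK
    · simp only [centralGJ_right]
      exact (OK k).algebraMap_mem (l v)
    · simp only [centralGJ_left, map_smul, smul_eq_mul, coeff_smul]
      refine mul_mem inv_mem_OK ?_
      rcases Nat.even_or_odd' d with ⟨m, rfl | rfl⟩
      · simp only [coeff_rho_algebraMap_even]
        simp only [Algebra.algebraMap_eq_smul_one, map_smul, smul_eq_mul]
        exact mul_mem (coeff_mem_OK m) ((OK k).algebraMap_mem (l 1))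
      · have h := fun c : k⟦X⟧ => coeff_rho_algebraMap_odd (ω := ω) c (d := 2 * m + 1) (by simp)
        simp only [h, map_zero]
        exact zero_mem _
  | algebraMap t => exact (OK k).algebraMap_mem t
  | add f f' _ _ h h' => exact add_mem h h'
  | mul f f' _ _ h h' => exact mul_mem h h'

theorem exists_comp_centralGJ (B : Darboux ω 𝔵 ι) {f : k⟦X⟧ˣ → k} (hf : f ∈ OK k) :
    ∃ f' ∈ OGJ ω 𝔵, f = fun c => f' (B.centralGJ c) := by
  induction hf using Algebra.adjoin_induction with
  | mem f hf =>
    rcases hf with ⟨i, rfl⟩ | rfl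
    · obtain ⟨l, hl⟩ := B.exists_dual_one
      refine ⟨_, mul_mem scal_mem_OGJ (left_mem_OGJ
        (l ∘ₗ ((weylIdeal ω 𝔵).restrictScalars k).mkQ) (2 * i)), funext fun c => ?_⟩
      have h1 : constantCoeff (c : k⟦X⟧) * constantCoeff ((c⁻¹ : k⟦X⟧ˣ) : k⟦X⟧) = 1 := by
        rw [← map_mul, Units.mul_inv, map_one]
      change _ = ((B.centralHom c).1 : k) * l (((weylIdeal ω 𝔵).restrictScalars k).mkQ (coeff (2 * i)
        (((B.centralGJ c).1.2.left : (WSer ω)ˣ) : WSer ω)))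
      rw [B.centralHom_fst, centralGJ_left, coeff_smul, coeff_rho_algebraMap_even,
        Algebra.algebraMap_eq_smul_one, map_smul, map_smul, map_smul, map_smul, hl, smul_eq_mul,
        smul_eq_mul, mul_one, ← mul_assoc, h1, one_mul]
    · refine ⟨_, scal_inv_mem_OGJ, funext fun c => ?_⟩
      rw [← B.centralHom_fst c⁻¹, map_inv]; rfl
  | algebraMap t => exact ⟨_, (OGJ ω 𝔵).algebraMap_mem t, rfl⟩
  | add f f' _ _ h h' =>
    obtain ⟨F, hF, rfl⟩ := h
    obtain ⟨F', hF', rfl⟩ := h'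
    exact ⟨F + F', add_mem hF hF', rfl⟩
  | mul f f' _ _ h h' =>
    obtain ⟨F, hF, rfl⟩ := h
    obtain ⟨F', hF', rfl⟩ := h'
    exact ⟨F * F', mul_mem hF hF', rfl⟩

/-- The upper row of the diagram. -/
def upperRow (B : Darboux ω 𝔵 ι) [Nonempty ι] : UpperRow ω 𝔵 where
  grp :=
    { inl := B.centralGJ
      rightHom :=
        { toFun := fun g => ⟨B.Phi g.1, B.mem_GJ_iff.1 g.2⟩
          map_one' := Subtype.ext (map_one B.Phi)
          map_mul' := fun g g' => Subtype.ext (map_mul B.Phi g.1 g'.1) }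
      inl_injective := fun c c' h => B.centralHom_injective (congrArg Subtype.val h)
      range_inl_eq_ker_rightHom := by
        ext g
        rw [MonoidHom.mem_range, MonoidHom.mem_ker]
        constructor
        · rintro ⟨c, rfl⟩
          exact Subtype.ext (B.Phi_centralHom c)
        · intro h
          obtain ⟨c, hc⟩ := B.exists_centralHom_eq (congrArg Subtype.val h)
          exact ⟨c, Subtype.ext hc⟩
      rightHom_surjective := fun f => by
        obtain ⟨g, hg⟩ := B.Phi_surjective f.1
        exact ⟨⟨g, B.mem_GJ_iff.2 (hg ▸ f.2)⟩, Subtype.ext hg⟩ }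
  phi := B.phiD
  inl_spec c := ⟨B.centralHom_fst c, B.centralHom_right c, B.smul_centralHom_left c⟩
  Phi_spec g x := B.rho_Phi g.1 x
  phi_spec := B.phiD_spec
  inl_regular _ hf := B.comp_centralGJ_mem hf
  inl_closed _ hf := B.exists_comp_centralGJ hf
  Phi_regular f hf := by
    induction hf using Algebra.adjoin_induction with
    | mem f hf =>
      obtain ⟨l, x, hl, hf⟩ := hf
      rcases hf with rfl | rfl
      · exact B.Phi_mem_OGJ hl x
      · have := B.inv_mem_OGJ (B.Phi_mem_OGJ (𝔵 := 𝔵) hl x)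
        convert this using 2 with g
        exact congrArg l (DFunLike.congr_fun (map_inv B.Phi g.1).symm x)
    | algebraMap t => exact (OGJ ω 𝔵).algebraMap_mem t
    | add f f' _ _ h h' => exact add_mem h h'
    | mul f f' _ _ h h' => exact mul_mem h h'
  grp_central c := Subgroup.mem_center_iff.2 fun g =>
    Subtype.ext (B.centralHom_comm c g.1).symm
  lie_exact := B.isExtension_embK
  lie_central := lie_embK

theorem actEquiv_centralGJ (B : Darboux ω 𝔵 ι) [Nonempty ι] (c : k⟦X⟧ˣ) :
    B.actEquiv (B.centralGJ c) = epsAut ω 𝔵 c := B.actPair_centralGJ c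

/-- The lower row of the diagram. -/
def lowerRow (B : Darboux ω 𝔵 ι) [Nonempty ι] : LowerRow ω 𝔵 where
  grp :=
    { inl := epsAut ω 𝔵
      rightHom :=
        { toFun := fun h => ⟨h.1.1, mem_AutJ_of_mem_AutDM h⟩
          map_one' := rfl
          map_mul' := fun _ _ => rfl }
      inl_injective := fun c c' h => by
        rw [← B.actEquiv_centralGJ, ← B.actEquiv_centralGJ] at h
        exact B.centralHom_injective (congrArg Subtype.val (B.actEquiv.injective h))
      range_inl_eq_ker_rightHom := by
        ext h
        rw [MonoidHom.mem_range, MonoidHom.mem_ker]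
        constructor
        · rintro ⟨c, rfl⟩
          rfl
        · intro hh
          exact B.exists_epsAut_eq (congrArg Subtype.val hh)
      rightHom_surjective := fun f => by
        obtain ⟨g, hg⟩ := B.upperRow.grp.rightHom_surjective f
        refine ⟨B.actEquiv g, hg ▸ Subtype.ext (AlgEquiv.ext fun x => ?_)⟩
        exact B.actEquiv_fst g x }
  f := B.forgetDer
  inl_spec := rfl
  F_spec _ := rfl
  f_spec _ := rfl
  inl_regular f hf := by
    have := B.comp_centralGJ_mem (B.comp_mem_OGJ hf)
    simpa only [B.actEquiv_centralGJ] using this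
  inl_closed f hf := by
    obtain ⟨F, hF, rfl⟩ := B.exists_comp_centralGJ hf
    refine ⟨fun h => F (B.actEquiv.symm h), B.comp_mem_OGJ_iff.1 (by
      simpa only [MulEquiv.symm_apply_apply] using hF), funext fun c => congrArg F ?_⟩
    exact (B.actEquiv.symm_apply_eq.2 (B.actEquiv_centralGJ c).symm).symm
  F_regular f hf := by
    induction hf using Algebra.adjoin_induction with
    | mem f hf =>
      obtain ⟨l, x, hl, hf⟩ := hf
      rcases hf with rfl | rfl
      · exact Algebra.subset_adjoin (Or.inl ⟨l, x, hl, Or.inl rfl⟩)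
      · exact Algebra.subset_adjoin (Or.inl ⟨l, x, hl, Or.inr rfl⟩)
    | algebraMap t => exact (OAutDM ω 𝔵).algebraMap_mem t
    | add f f' _ _ h h' => exact add_mem h h'
    | mul f f' _ _ h h' => exact mul_mem h h'
  grp_central c := Subgroup.mem_center_iff.2 fun h => by
    rw [← B.actEquiv_centralGJ, ← B.actEquiv.apply_symm_apply h, ← map_mul, ← map_mul]
    exact congrArg B.actEquiv (Subtype.ext (B.centralHom_comm c _).symm)
  lie_exact := B.isExtension_epsDer
  lie_central := B.lie_epsDer

end Darboux
end Rows

section Sigma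

open PowerSeries

variable {k V : Type*} [Field k] [AddCommGroup V] [Module k V]
  {ω : SymplecticForm k V} {𝔵 : Submodule k V} {ι : Type*} [Fintype ι]

theorem rho_homog {d : ℕ} {a : HWeyl ω} (ha : a ∈ gr ω d) :
    rho (FWeyl.homog a ha) = X ^ d * C (toWeyl ω a) := by
  ext i
  rw [coeff_rho, FWeyl.homog, FWeyl.comp_mk, coeff_X_pow_mul', coeff_C]
  rcases lt_trichotomy i d with h | rfl | h
  · rw [if_neg h.ne, if_neg h.not_ge, map_zero]
  · rw [if_pos rfl, if_pos le_rfl, if_pos (Nat.sub_self i)]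
  · rw [if_neg h.ne', if_pos h.le, if_neg (by omega), map_zero]

theorem X_sq_mul_mul_X_sq (a b : WSer ω) : X ^ 2 * a * (X ^ 2 * b) = X ^ 2 * (X ^ 2 * (a * b)) := by
  rw [mul_assoc, ← mul_assoc a, (commute_X_pow a 2).eq, mul_assoc]

theorem smul_X_sq_mul_C (t : k) (a : Weyl ω) : t • (X ^ 2 * C a : WSer ω) = X ^ 2 * C (t • a) := by
  rw [← mul_smul_comm]
  congr 1
  ext d
  rw [coeff_smul, coeff_C, coeff_C, smul_ite, smul_zero]

theorem C_comm_rho_ofV (q : Weyl ω) (v : V) :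
    C q * rho (FWeyl.ofV v) - rho (FWeyl.ofV v) * C q =
      C (q * weylV ω v - weylV ω v * q) * X := by
  rw [rho_ofV, mul_assoc (C (weylV ω v)), ← (commute_X (C q)).eq, ← mul_assoc, ← mul_assoc,
    ← sub_mul, ← map_mul, ← map_mul, ← map_sub]

namespace Darboux

theorem homog_comm (B : Darboux ω 𝔵 ι) {p p' w : HWeyl ω} (hp : p ∈ gr ω 2) (hp' : p' ∈ gr ω 2)
    (hw : w ∈ gr ω 2) (h : p * p' - p' * p = hbarD ω * w) :
    FWeyl.homog p hp * FWeyl.homog p' hp' - FWeyl.homog p' hp' * FWeyl.homog p hp =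
      FWeyl.hbar ω * FWeyl.homog w hw := by
  apply B.rho_injective
  have h1 := congrArg (toWeyl ω) h
  rw [map_sub, map_mul, map_mul, map_mul, toWeyl_hbar, one_mul] at h1
  rw [map_sub rho, map_mul rho, map_mul rho, map_mul rho, rho_homog, rho_homog, rho_homog,
    rho_hbar, X_sq_mul_mul_X_sq, X_sq_mul_mul_X_sq, ← mul_sub, ← mul_sub, ← h1,
    map_sub C, map_mul C, map_mul C]

theorem rho_adH_of (B : Darboux ω 𝔵 ι) {u : FWeyl ω} {z : WSer ω} (h : rho u = X ^ 2 * z)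
    (x : FWeyl ω) : rho (B.adH u x) = z * rho x - rho x * z := by
  apply X_sq_mul_cancel
  have h1 := congrArg rho (B.hbar_mul_adH u x)
  rw [map_mul rho, rho_hbar, map_sub rho, map_mul rho, map_mul rho, h] at h1
  rw [mul_sub, h1, mul_assoc, ← mul_assoc (rho x), (commute_X_pow (rho x) 2).eq, mul_assoc]

theorem lie_overHbar_ofV_iff (B : Darboux ω 𝔵 ι) {q : FWeyl ω} {a : Weyl ω}
    (h : rho q = X ^ 2 * C a) (v w : V) :
    ⁅overHbar q, toLoc (FWeyl.ofV v : FWeyl ω)⁆ = (toLoc (FWeyl.ofV w : FWeyl ω) : Loc ω) ↔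
      a * weylV ω v - weylV ω v * a = weylV ω w := by
  rw [B.lie_overHbar_toLoc_eq, B.toLoc_injective.eq_iff, ← B.rho_injective.eq_iff,
    B.rho_adH_of h, C_comm_rho_ofV, rho_ofV]
  refine ⟨fun h => ?_, fun h => by rw [h]⟩
  have := congrArg (coeff 1) h
  rwa [show (1 : ℕ) = 0 + 1 from rfl, coeff_succ_mul_X, coeff_succ_mul_X, coeff_zero_C,
    coeff_zero_C] at this

theorem isSigma_homog (B : Darboux ω 𝔵 ι) {s : V →ₗ[k] V} {a : HWeyl ω} (ha : a ∈ commSpan ω)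
    (hs : ∀ v, toWeyl ω a * weylV ω v - weylV ω v * toWeyl ω a = weylV ω (s v)) :
    IsSigma ω s (FWeyl.homog a (commSpan_le ha)) := by
  refine ⟨?_, fun v => (B.lie_overHbar_ofV_iff (rho_homog _) v _).2 (hs v)⟩
  have key : ∀ b ∈ commSpan ω, ∃ x : FWeyl ω, rho x = X ^ 2 * C (toWeyl ω b) ∧
      overHbar x ∈ Submodule.span k {a : Loc ω | ∃ (p p' : HWeyl ω) (hp : p ∈ gr ω 2)
        (hp' : p' ∈ gr ω 2),
        a = ⁅(overHbar (FWeyl.homog p hp) : Loc ω), overHbar (FWeyl.homog p' hp')⁆} := by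
    intro b hb
    induction hb using Submodule.span_induction with
    | mem w hw =>
      obtain ⟨hw, p, hp, p', hp', h⟩ := hw
      exact ⟨FWeyl.homog w hw, rho_homog hw, Submodule.subset_span ⟨p, p', hp, hp',
        (lie_overHbar (B.homog_comm hp hp' hw h)).symm⟩⟩
    | zero => exact ⟨0, by rw [map_zero, map_zero, map_zero, mul_zero], by
        rw [map_zero]; exact zero_mem _⟩
    | add b b' _ _ h h' =>
      obtain ⟨x, hx, h⟩ := h
      obtain ⟨x', hx', h'⟩ := h'
      exact ⟨x + x', by rw [map_add, hx, hx', map_add, map_add, mul_add], by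
        rw [map_add]; exact add_mem h h'⟩
    | smul t b _ h =>
      obtain ⟨x, hx, h⟩ := h
      refine ⟨t • x, ?_, ?_⟩
      · rw [rho_smul, hx, map_smul, smul_X_sq_mul_C]
      · rw [show overHbar (t • x) = t • overHbar x from
          map_smul ((overHbar (ω := ω)).restrictScalars k) t x]
        exact Submodule.smul_mem _ t h
  obtain ⟨x, hx, h⟩ := key a ha
  rwa [B.rho_injective (hx.trans (rho_homog (commSpan_le ha)).symm)] at h

theorem exists_commSpan_of_isSigma (B : Darboux ω 𝔵 ι) {s : V →ₗ[k] V} {q : FWeyl ω}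
    (h : IsSigma ω s q) : ∃ a ∈ commSpan ω, rho q = X ^ 2 * C (toWeyl ω a) ∧
      ∀ v, toWeyl ω a * weylV ω v - weylV ω v * toWeyl ω a = weylV ω (s v) := by
  have key : ∀ y ∈ Submodule.span k {a : Loc ω | ∃ (p p' : HWeyl ω) (hp : p ∈ gr ω 2)
      (hp' : p' ∈ gr ω 2),
      a = ⁅(overHbar (FWeyl.homog p hp) : Loc ω), overHbar (FWeyl.homog p' hp')⁆},
      ∃ a, ∃ ha : a ∈ commSpan ω, y = overHbar (FWeyl.homog a (commSpan_le ha)) := by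
    intro y hy
    induction hy using Submodule.span_induction with
    | mem y hy =>
      obtain ⟨p, p', hp, hp', rfl⟩ := hy
      obtain ⟨w, hw, h⟩ := hbarGr_exists (d := 2) (gr_comm hp hp')
      exact ⟨w, Submodule.subset_span ⟨hw, p, hp, p', hp', h⟩,
        lie_overHbar (B.homog_comm hp hp' hw h)⟩
    | zero =>
      refine ⟨0, zero_mem _, ?_⟩
      rw [← map_zero overHbar]
      congr 1
      apply B.rho_injective
      rw [rho_homog, map_zero, map_zero, map_zero, mul_zero]
    | add y y' _ _ h h' =>
      obtain ⟨a, ha, rfl⟩ := h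
      obtain ⟨a', ha', rfl⟩ := h'
      refine ⟨a + a', add_mem ha ha', ?_⟩
      rw [← map_add]
      congr 1
      apply B.rho_injective
      rw [map_add, rho_homog, rho_homog, rho_homog, map_add, map_add, mul_add]
    | smul t y _ h =>
      obtain ⟨a, ha, rfl⟩ := h
      refine ⟨t • a, Submodule.smul_mem _ t ha, ?_⟩
      refine (map_smul ((overHbar (ω := ω)).restrictScalars k) t _).symm.trans ?_
      refine congrArg overHbar (B.rho_injective ?_)
      rw [rho_smul, rho_homog, rho_homog, map_smul, smul_X_sq_mul_C]
  obtain ⟨a, ha, h1⟩ := key _ h.1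
  have h2 : rho q = X ^ 2 * C (toWeyl ω a) := by
    rw [B.overHbar_injective h1, rho_homog]
  exact ⟨a, ha, h2, fun v => (B.lie_overHbar_ofV_iff h2 v _).1 (h.2 v)⟩

theorem rho_velocity {c : k} {q b : FWeyl ω} {a : Weyl ω} (hq : rho q = X ^ 2 * C a)
    (hb : b ∈ FWeyl.filt ω 3) :
    rho (c • FWeyl.hbar ω + q + b) = X ^ 2 * (c • 1 + (overS b + C a)) := by
  rw [map_add, map_add, rho_smul, rho_hbar, hq, ← X_sq_mul_overS (FWeyl.filt_anti (by omega) hb),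
    mul_add, mul_add, mul_smul_comm, mul_one]
  abel

theorem rho_adH_velocity (B : Darboux ω 𝔵 ι) {c : k} {q b : FWeyl ω} {a : Weyl ω}
    (hq : rho q = X ^ 2 * C a) (hb : b ∈ FWeyl.filt ω 3) (x : FWeyl ω) :
    rho (B.adH (c • FWeyl.hbar ω + q + b) x) =
      (overS b + C a) * rho x - rho x * (overS b + C a) := by
  rw [B.rho_adH_of (rho_velocity hq hb), add_mul, mul_add, smul_mul_assoc, mul_smul_comm, one_mul,
    mul_one, add_sub_add_left_eq_sub]

variable [CharZero k]

theorem exists_commSpan_of_sp (B : Darboux ω 𝔵 ι) {s : V →ₗ[k] V}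
    (hs : ∀ v w, ω.form (s v) w + ω.form v (s w) = 0) : ∃ a ∈ commSpan ω,
      ∀ v, toWeyl ω a * weylV ω v - weylV ω v * toWeyl ω a = weylV ω (s v) := by
  obtain ⟨u, hu, h⟩ := B.exists_comm_eq_mem (d := 1) (weylV ω ∘ₗ s)
    (fun v => weylV_mem_weylF (s v)) fun v w => by
      rw [LinearMap.comp_apply, LinearMap.comp_apply, weylV_comm, weylV_comm]
      congr 1
      rw [form_neg ω (s w), ← add_eq_zero_iff_eq_neg]
      exact hs v w
  obtain ⟨a, ha, rfl⟩ := hu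
  obtain ⟨t, ht⟩ := exists_sub_mem_commSpan ha
  refine ⟨_, ht, fun v => ?_⟩
  rw [← LinearMap.comp_apply, ← h v, map_sub, map_smul, toWeyl_hbar, sub_mul, mul_sub,
    smul_mul_assoc, mul_smul_comm, one_mul, mul_one, sub_sub_sub_cancel_right]
  rfl

end Darboux
end Sigma

theorem add_smul_wtDeriv_apply {k G : Type*} [Field k] [CharZero k] [Group G]
    {O : Subalgebra k (G → k)} {ζ : kˣ →* G} (hO : ∀ F ∈ O, F ∈ ⨆ n, wt O ζ n) (T : O →ₗ[k] k)
    (κ : k) {n : ℤ} (F : O) (hF : F.1 ∈ wt O ζ n) :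
    (T + κ • wtDeriv hO) F = T F + κ * (n * F.1 1) := by
  rw [LinearMap.add_apply, LinearMap.smul_apply, wtDeriv_apply hO F hF, smul_eq_mul]

section Differential

open PowerSeries

variable {k V : Type*} [Field k] [CharZero k] [AddCommGroup V] [Module k V]
  {ω : SymplecticForm k V} {𝔵 : Submodule k V} {ι : Type*} [Fintype ι]

namespace IsVelocity

variable {T : OGJ ω 𝔵 →ₗ[k] k} {c : k} {s : V →ₗ[k] V} {w : WSer ω}

theorem of_apply (B : Darboux ω 𝔵 ι) (hc : T ⟨_, scal_mem_OGJ⟩ = c)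
    (hs : ∀ l v, T ⟨_, right_mem_OGJ l v⟩ = l (s v))
    (hw : ∀ l d, T ⟨_, left_mem_OGJ l d⟩ = l (coeff d w)) : IsVelocity T c s w := by
  obtain ⟨c', s', w', h⟩ := B.exists_isVelocity T
  obtain rfl : c' = c := (hasD_scalar T ⟨_, scal_mem_OGJ⟩ |>.unique h.scal).symm.trans hc
  obtain rfl : s' = s := LinearMap.ext fun v =>
    sub_eq_zero.1 ((Module.forall_dual_apply_eq_zero_iff k _).1 fun l => by
      rw [map_sub, ← hs, ((h.right v).map l).apply_eq ⟨_, right_mem_OGJ l v⟩ fun g => rfl,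
        sub_self])
  obtain rfl : w' = w := PowerSeries.ext fun d =>
    sub_eq_zero.1 ((Module.forall_dual_apply_eq_zero_iff k _).1 fun l => by
      rw [map_sub, ← hw, ((h.left d).map l).apply_eq ⟨_, left_mem_OGJ l d⟩ fun g => rfl,
        sub_self])
  exact h

theorem form (hT : IsTangent (OGJ ω 𝔵) T) (h : IsVelocity T c s w) (v v' : V) :
    ω.form (s v) v' + ω.form v (s v') = 0 := by
  have h1 := HasD.bilin hT ω.form (h.right v) (h.right v')
  have e : (fun g : GJ ω 𝔵 => ω.form (g.1.2.right.1 v) (g.1.2.right.1 v')) =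
      fun _ => ω.form v v' := funext fun g => g.1.2.right.2 v v'
  rw [e] at h1
  exact h1.unique (hasD_const hT _)

theorem exists_overS_eq (B : Darboux ω 𝔵 ι) (hT : IsTangent (OGJ ω 𝔵) T)
    (h : IsVelocity T c s w) {a : Weyl ω}
    (ha : ∀ v, a * weylV ω v - weylV ω v * a = weylV ω (s v)) :
    ∃ b ∈ FWeyl.filt ω 3, overS b = w := by
  have h0 : coeff 0 w = 0 := by
    have h1 := h.left 0
    have e : (fun g : GJ ω 𝔵 => coeff 0 ((g.1.2.left : (WSer ω)ˣ) : WSer ω)) = fun _ => 1 :=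
      funext fun g => B.coeff_zero_left g.1
    rw [e] at h1
    exact h1.unique (hasD_const hT _)
  refine LabelExt.exists_overS_eq (fun d => ?_) h0
  rcases d with _ | d
  · rw [h0]; exact zero_mem _
  obtain ⟨t, ht⟩ := B.exists_sub_mem_weylF (d := d + 2) (w := coeff (d + 1) w) fun v => by
    have h1 := (h.adj B hT ha (rho (FWeyl.ofV v)) (d + 2)).mem_of_forall (weylF ω (d + 2))
      fun g => by dsimp only; rw [← B.rho_Phi]; exact coeff_rho_mem _ _
    have e : (w + C a) * rho (FWeyl.ofV v) - rho (FWeyl.ofV v) * (w + C a) =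
        (w * C (weylV ω v) - C (weylV ω v) * w) * X + C (weylV ω (s v)) * X := by
      rw [← ha v, ← C_comm_rho_ofV, add_mul, mul_add, add_sub_add_comm, sub_mul, rho_ofV,
        mul_assoc _ X w, ← (commute_X w).eq, mul_assoc w, mul_assoc _ w]
    rw [e, map_add, coeff_succ_mul_X, coeff_succ_mul_X, coeff_C, if_neg (by omega), add_zero,
      map_sub, coeff_mul_C, coeff_C_mul] at h1
    exact h1
  rcases Nat.even_or_odd (d + 1) with he | ho
  · have h1 : algebraMap k _ t ∈ weylF ω (d + 1 + 2) := by
      obtain ⟨j, hj⟩ := he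
      exact weylF_le ⟨j + 1, by omega⟩ (algebraMap_mem_weylF t)
    simpa using add_mem ht h1
  · have h1 : coeff (d + 1) w ∈ weylF ω (3 * (d + 1)) :=
      (h.left (d + 1)).mem_of_forall _ fun g => B.coeff_left_mem g.1 (d + 1)
    have h2 : coeff (d + 1) w - algebraMap k _ t ∈ weylF ω (3 * (d + 1)) :=
      weylF_le ⟨d, by omega⟩ ht
    have h3 : algebraMap k (Weyl ω) t ∈ weylF ω (3 * (d + 1)) := by
      simpa using sub_mem h1 h2
    have h4 := B.algebraMap_mem_odd (d := 3 * (d + 1)) (𝔵 := 𝔵) (by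
      obtain ⟨j, hj⟩ := ho
      rw [Nat.not_even_iff_odd]
      exact ⟨3 * j + 1, by omega⟩) (Submodule.mem_sup_left h3)
    rwa [h4, map_zero, sub_zero] at ht

theorem adH (B : Darboux ω 𝔵 ι) (hT : IsTangent (OGJ ω 𝔵) T) {q b : FWeyl ω} {a : Weyl ω}
    (h : IsVelocity T c s (overS b)) (ha : ∀ v, a * weylV ω v - weylV ω v * a = weylV ω (s v))
    (hq : rho q = X ^ 2 * C a) (hb : b ∈ FWeyl.filt ω 3) (t : k) (x : FWeyl ω) :
    HasDS T (fun g => rho (B.Phi g.1 x)) (rho (B.adH (t • FWeyl.hbar ω + q + b) x)) := by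
  have h1 := h.adj B hT ha (rho x)
  rw [← B.rho_adH_velocity (c := t) hq hb] at h1
  simpa only [B.rho_Phi] using h1

end IsVelocity

namespace Darboux

theorem exists_lieGJ (B : Darboux ω 𝔵 ι) {T : OGJ ω 𝔵 →ₗ[k] k} (hT : IsTangent (OGJ ω 𝔵) T) :
    ∃ a, LieGJ ω 𝔵 T a := by
  obtain ⟨c, s, w, h⟩ := B.exists_isVelocity T
  obtain ⟨a, ha, hs⟩ := B.exists_commSpan_of_sp (h.form hT)
  obtain ⟨b, hb, rfl⟩ := h.exists_overS_eq B hT hs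
  have hq := rho_homog (commSpan_le ha)
  refine ⟨⟨cls (c • FWeyl.hbar ω + FWeyl.homog a (commSpan_le ha) + b),
    B.cls_mem_𝔊J.2 fun x hx => B.mem_JIdeal.2 fun d => ?_⟩, c, s, _, b, B.isSigma_homog ha hs, hb,
    rfl, fun f hf => h.scal.apply_eq f hf, fun f l v hf => ((h.right v).map l).apply_eq f hf,
    fun f l d hf => ((h.left d).map l).apply_eq f hf⟩
  exact (h.adH B hT hs hq hb c x d).mem_of_forall _ fun g =>
    B.mem_JIdeal.1 ((B.mem_GJ_iff.1 g.2 x).2 hx) d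

theorem isVelocity_of_lieGJ (B : Darboux ω 𝔵 ι) {T : OGJ ω 𝔵 →ₗ[k] k} {a : 𝔊J ω 𝔵}
    (h : LieGJ ω 𝔵 T a) : ∃ (c : k) (s : V →ₗ[k] V) (q b : FWeyl ω), IsSigma ω s q ∧
      b ∈ FWeyl.filt ω 3 ∧ a.1 = cls (c • FWeyl.hbar ω + q + b) ∧ IsVelocity T c s (overS b) := by
  obtain ⟨c, s, q, b, hs, hb, ha, h1, h2, h3⟩ := h
  exact ⟨c, s, q, b, hs, hb, ha, IsVelocity.of_apply B (h1 _ fun _ => rfl)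
    (fun l v => h2 _ l v fun _ => rfl) fun l d => h3 _ l d fun _ => rfl⟩

theorem isVelocity_add_wtDeriv (B : Darboux ω 𝔵 ι) {T : OGJ ω 𝔵 →ₗ[k] k} {c : k} {s : V →ₗ[k] V}
    {w : WSer ω} (h : IsVelocity T c s w) (κ : k) :
    IsVelocity (T + κ • wtDeriv B.OGJ_le_wt) (c + κ) s w := by
  have key (F : OGJ ω 𝔵) (hF : F.1 ∈ wt (OGJ ω 𝔵) (scalGJ ω 𝔵) 0) :
      (T + κ • wtDeriv B.OGJ_le_wt) F = T F :=
    (add_smul_wtDeriv_apply B.OGJ_le_wt T κ F hF).trans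
      (by rw [Int.cast_zero, zero_mul, mul_zero, add_zero])
  refine IsVelocity.of_apply B ?_ (fun l v => ?_) fun l d => ?_
  · have h1 := h.scal.apply_eq ⟨_, scal_mem_OGJ⟩ fun _ => rfl
    refine (add_smul_wtDeriv_apply B.OGJ_le_wt T κ (n := 1) ⟨_, scal_mem_OGJ⟩
      ⟨scal_mem_OGJ, fun t g => by rw [zpow_one]; rfl⟩).trans ?_
    rw [h1, Int.cast_one, one_mul]
    exact congrArg (c + ·) (mul_one κ)
  · exact (key _ (mem_wt_zero_of_snd (φ := fun x : G1 ω ⋊[spAct] Sp ω => l (x.right.1 v))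
      (right_mem_OGJ l v))).trans
      (((h.right v).map l).apply_eq ⟨_, right_mem_OGJ l v⟩ fun _ => rfl)
  · exact (key _ (mem_wt_zero_of_snd (φ := fun x : G1 ω ⋊[spAct] Sp ω =>
      l (coeff d ((x.left : (WSer ω)ˣ) : WSer ω))) (left_mem_OGJ l d))).trans
      (((h.left d).map l).apply_eq ⟨_, left_mem_OGJ l d⟩ fun _ => rfl)

/-- The representative in `𝒥` of a velocity, and its component of degree two. -/
theorem repJ_velocity (B : Darboux ω 𝔵 ι) {c : k} {q b : FWeyl ω} {Q : Weyl ω} {a : 𝔊J ω 𝔵}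
    (hq : rho q = X ^ 2 * C Q) (hb : b ∈ FWeyl.filt ω 3)
    (ha : a.1 = cls (c • FWeyl.hbar ω + q + b)) :
    B.repJ a = c • FWeyl.hbar ω + q + b ∧ ∃ κ, Q - algebraMap k _ κ ∈ weylIdeal ω 𝔵 := by
  have hu := rho_velocity (c := c) hq hb
  set u := c • FWeyl.hbar ω + q + b
  obtain ⟨t, ht⟩ := B.exists_sub_mem_JIdeal (B.cls_mem_𝔊J.1 (ha ▸ a.2 : cls u ∈ 𝔊J ω 𝔵))
  have h0 : t = 0 := by
    have h1 := B.mem_JIdeal.1 ht 0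
    have e := coeff_rho_algebraMap_even (ω := ω) (algebraMap k k⟦X⟧ t) 0
    rw [mul_zero, ← IsScalarTower.algebraMap_apply k k⟦X⟧ (FWeyl ω)] at e
    rw [map_sub rho, map_sub, e, hu, coeff_X_pow_mul', if_neg (by omega), zero_sub] at h1
    exact B.algebraMap_mem_weylIdeal (𝔵 := 𝔵) (by simpa [weylJ] using h1)
  rw [h0, map_zero, sub_zero] at ht
  refine ⟨B.repJ_eq ht ha.symm, ?_⟩
  have h2 := B.mem_JIdeal.1 ht 2
  rw [hu, coeff_X_pow_mul', if_pos le_rfl, Nat.sub_self, map_add, map_add, coeff_smul,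
    (mem_serFilt.1 (overS_mem hb)) 0 one_pos, zero_add, coeff_zero_C, coeff_zero_one] at h2
  obtain ⟨y, hy, z, hz, h2⟩ := Submodule.mem_sup.1 h2
  rw [if_neg (by omega)] at hy
  obtain ⟨t', rfl⟩ := B.eq_algebraMap_of_mem_weylF_zero hy
  refine ⟨t' - c, ?_⟩
  have e : Q - algebraMap k _ (t' - c) = z := by
    rw [eq_sub_of_add_eq' h2, map_sub, Algebra.algebraMap_eq_smul_one c]
    abel
  rw [e]; exact hz

/-- The restriction of functions along the action on `𝒟` and `𝓜`. -/
def pullLin (B : Darboux ω 𝔵 ι) [Nonempty ι] : OAutDM ω 𝔵 →ₗ[k] OGJ ω 𝔵 where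
  toFun f := ⟨fun g => f.1 (B.actEquiv g), B.comp_mem_OGJ f.2⟩
  map_add' _ _ := rfl
  map_smul' _ _ := rfl

theorem isTangent_pullLin (B : Darboux ω 𝔵 ι) [Nonempty ι] {T : OGJ ω 𝔵 →ₗ[k] k}
    (hT : IsTangent (OGJ ω 𝔵) T) : IsTangent (OAutDM ω 𝔵) (T ∘ₗ B.pullLin) := fun f f' => by
  have h := hT (B.pullLin f) (B.pullLin f')
  change T (B.pullLin f * B.pullLin f') = f.1 1 * _ + f'.1 1 * _
  rw [h]
  change f.1 (B.actEquiv 1) * _ + f'.1 (B.actEquiv 1) * _ = _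
  rw [map_one]
  rfl

theorem actMod_velocity (B : Darboux ω 𝔵 ι) {T : OGJ ω 𝔵 →ₗ[k] k} (hT : IsTangent (OGJ ω 𝔵) T)
    {c κ : k} {s : V →ₗ[k] V} {q b : FWeyl ω} {Q : Weyl ω} {a : 𝔊J ω 𝔵}
    (h : IsVelocity T (c + κ) s (overS b)) (hQ : ∀ v, Q * weylV ω v - weylV ω v * Q = weylV ω (s v))
    (hq : rho q = X ^ 2 * C Q) (hb : b ∈ FWeyl.filt ω 3)
    (ha : B.repJ a = c • FWeyl.hbar ω + q + b) (hκ : Q - algebraMap k _ κ ∈ weylIdeal ω 𝔵)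
    (m : FMod ω 𝔵) (d : ℕ) :
    HasD T (fun g => jetM ω 𝔵 d (B.actMod g m)) (jetM ω 𝔵 d (B.actH a m)) := by
  obtain ⟨x, rfl⟩ := Submodule.Quotient.mk_surjective _ m
  obtain ⟨y, hy⟩ := Submodule.Quotient.mk_surjective _ (B.actH a (Submodule.Quotient.mk x))
  have h1 := (h.serMap hT hQ (rho x) d).map ((weylIdeal ω 𝔵).restrictScalars k).mkQ
  simp only [B.jetM_actMod]
  convert h1 using 1
  have h2 := B.hbar_smul_actH a (Submodule.Quotient.mk x)
  rw [← hy, smul_mk, smul_mk, mk_eq_mk, B.mem_leftIdeal, map_sub rho, map_mul rho, map_mul rho,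
    rho_hbar, ha, rho_velocity hq hb, mul_assoc, ← mul_sub] at h2
  have h3 : rho y - (c • 1 + (overS b + C Q)) * rho x ∈ serIdeal ω 𝔵 := fun d => by
    have := h2 (d + 2)
    rwa [coeff_X_pow_mul] at this
  have h4 : rho x * (C Q - κ • 1) ∈ serIdeal ω 𝔵 := Ideal.mul_mem_left _ _ (by
    have := C_mem_serIdeal hκ
    rwa [map_sub, show (C (algebraMap k (Weyl ω) κ) : WSer ω) = κ • 1 by
      rw [Algebra.algebraMap_eq_smul_one]
      ext d
      rw [coeff_smul, coeff_C, coeff_one, smul_ite, smul_zero]] at this)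
  rw [← hy, jetM_mk]
  refine (Submodule.Quotient.eq _).2 ?_
  have h5 := add_mem h3 h4 d
  rw [← map_sub]
  refine (congrArg (· ∈ weylIdeal ω 𝔵) (congrArg (coeff d) ?_)).mpr h5
  rw [mul_sub (rho x), mul_smul_comm, mul_one, add_mul (c • (1 : WSer ω)), add_mul (overS b),
    add_smul, smul_mul_assoc, one_mul]
  abel

theorem lieAutDM_pullLin (B : Darboux ω 𝔵 ι) [Nonempty ι] {T : OGJ ω 𝔵 →ₗ[k] k}
    (hT : IsTangent (OGJ ω 𝔵) T) {c κ : k} {s : V →ₗ[k] V} {q b : FWeyl ω} {Q : Weyl ω}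
    {a : 𝔊J ω 𝔵} (h : IsVelocity T (c + κ) s (overS b))
    (hQ : ∀ v, Q * weylV ω v - weylV ω v * Q = weylV ω (s v)) (hq : rho q = X ^ 2 * C Q)
    (hb : b ∈ FWeyl.filt ω 3) (ha : B.repJ a = c • FWeyl.hbar ω + q + b)
    (hκ : Q - algebraMap k _ κ ∈ weylIdeal ω 𝔵) :
    LieAutDM ω 𝔵 (T ∘ₗ B.pullLin) (B.phiEquiv a) := by
  refine ⟨fun f l x hl hf => ?_, fun f l m hl hf => ?_⟩
  · have h1 := h.adH B hT hQ hq hb c x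
    rw [← ha] at h1
    have h2 := B.hasD_contFunD h1 hl
    exact h2.apply_eq (B.pullLin f) fun g => (hf _).trans (congrArg l (B.actEquiv_fst g x))
  · have h2 := B.hasD_contFunM (F := fun g => B.actMod g m)
      (fun d => B.actMod_velocity hT h hQ hq hb ha hκ m d) hl
    exact h2.apply_eq (B.pullLin f) fun g => (hf _).trans (congrArg l (B.actEquiv_snd g m))

theorem tangent_pullPhi (B : Darboux ω 𝔵 ι) [Nonempty ι] {T : OGJ ω 𝔵 →ₗ[k] k}
    (hT : IsTangent (OGJ ω 𝔵) T) {κ : k}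
    (hκ : κ = 2⁻¹ * T ⟨charPow B.chi 1, (B.charPow_chi_mem 1).1⟩) (f : OAutDMpm ω 𝔵) :
    ((T + κ • wtDeriv B.OGJ_le_wt) ∘ₗ B.pullLin) ⟨f.1, f.2.1⟩ =
      T ⟨(B.pullPhi f).1, (B.pullPhi f).2.1⟩ := by
  subst hκ
  exact (tangent_twist B.OGJ_le_wt hT B.charPow_chi_mem (B.pullEquiv f)).symm

theorem differentialEq (B : Darboux ω 𝔵 ι) [Nonempty ι] : DifferentialEq B.PhiDM B.phiEquiv := by
  refine fun T hT => ⟨B.exists_lieGJ hT, fun a ha => ?_⟩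
  obtain ⟨c, s, q, b, hs, hb, ha, h⟩ := B.isVelocity_of_lieGJ ha
  obtain ⟨Q, hQ, hq, hQs⟩ := B.exists_commSpan_of_isSigma hs
  obtain ⟨hu, κ, hκ⟩ := B.repJ_velocity hq hb ha
  have hκ' : κ = 2⁻¹ * T ⟨charPow B.chi 1, (B.charPow_chi_mem 1).1⟩ := by
    rw [B.tangent_chi hT h, B.eq_neg_half_trace (B.weylConst_eq_zero hQ) hQs
      (B.right_velocity_mem h) hκ, mul_neg, neg_mul]
  have hT1 := hT.add_smul (isTangent_wtDeriv B.OGJ_le_wt) κ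
  have h1 := B.isVelocity_add_wtDeriv h κ
  refine ⟨(T + κ • wtDeriv B.OGJ_le_wt) ∘ₗ B.pullLin, B.isTangent_pullLin hT1,
    B.lieAutDM_pullLin hT1 h1 hQs hq hb hu hκ, B.tangent_pullPhi hT hκ'⟩

end Darboux
end Differential

section Equivariance

open PowerSeries

variable {k V : Type*} [Field k] [CharZero k] [AddCommGroup V] [Module k V]
  {ω : SymplecticForm k V} {𝔵 : Submodule k V} {ι : Type*} [Fintype ι]

namespace Darboux

theorem exists_Ad (B : Darboux ω 𝔵 ι) (g : GJ ω 𝔵) (a : 𝔊J ω 𝔵) :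
    ∃ a' : 𝔊J ω 𝔵, B.repJ a' = B.Phi g.1 (B.repJ a) :=
  B.exists_eq_cls ((B.mem_GJ_iff.1 g.2 _).2 (B.repJ_mem a))

/-- The adjoint action of `𝒢_𝒥`. -/
def Ad (B : Darboux ω 𝔵 ι) (g : GJ ω 𝔵) (a : 𝔊J ω 𝔵) : 𝔊J ω 𝔵 := (B.exists_Ad g a).choose

theorem repJ_Ad (B : Darboux ω 𝔵 ι) (g : GJ ω 𝔵) (a : 𝔊J ω 𝔵) :
    B.repJ (B.Ad g a) = B.Phi g.1 (B.repJ a) := (B.exists_Ad g a).choose_spec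

theorem Ad_val (B : Darboux ω 𝔵 ι) (g : GJ ω 𝔵) {a : 𝔊J ω 𝔵} {u : FWeyl ω} (hu : cls u = a.1) :
    (B.Ad g a).1 = cls (B.Phi g.1 u) := by
  rw [← B.cls_repJ, B.repJ_Ad, B.cls_eq_cls_iff]
  obtain ⟨t, ht⟩ := B.cls_eq_cls_iff.1 ((B.cls_repJ a).trans hu.symm)
  refine ⟨t, ?_⟩
  rw [ht, map_add, IsScalarTower.algebraMap_apply k k⟦X⟧ (FWeyl ω), AlgEquiv.commutes]

theorem Phi_scalGJ_mul (B : Darboux ω 𝔵 ι) (t : kˣ) (g : GJ ω 𝔵) (x : FWeyl ω) :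
    B.Phi (scalGJ ω 𝔵 t * g).1 x = B.Phi g.1 x := B.rho_injective (by
  rw [B.rho_Phi, B.rho_Phi, adj_apply, adj_apply, scalGJ_mul_snd])

theorem Ad_scalGJ_mul (B : Darboux ω 𝔵 ι) (t : kˣ) (g : GJ ω 𝔵) (a : 𝔊J ω 𝔵) :
    B.Ad (scalGJ ω 𝔵 t * g) a = B.Ad g a := B.repJ_injective (by
  rw [B.repJ_Ad, B.repJ_Ad, B.Phi_scalGJ_mul])

theorem Phi_adH_Phi_inv (B : Darboux ω 𝔵 ι) (g : GJ ω 𝔵) (u x : FWeyl ω) :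
    B.Phi g.1 (B.adH u (B.Phi (g⁻¹ : GJ ω 𝔵).1 x)) = B.adH (B.Phi g.1 u) x := by
  have e : B.Phi g.1 (B.Phi (g⁻¹ : GJ ω 𝔵).1 x) = x := by
    change B.Phi g.1 (B.Phi (g.1)⁻¹ x) = x
    rw [map_inv B.Phi]
    exact (B.Phi g.1).apply_symm_apply x
  refine (B.adH_eq ?_).symm
  have h := congrArg (B.Phi g.1) (B.hbar_mul_adH u (B.Phi (g⁻¹ : GJ ω 𝔵).1 x))
  rw [map_sub, map_mul (B.Phi g.1), map_mul (B.Phi g.1), map_mul (B.Phi g.1), e] at h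
  rw [← h, FWeyl.hbar, AlgEquiv.commutes]

theorem actMod_actH_actMod_inv (B : Darboux ω 𝔵 ι) [Nonempty ι] (g : GJ ω 𝔵) (a : 𝔊J ω 𝔵)
    (m : FMod ω 𝔵) : B.actMod g (B.actH a (B.actMod g⁻¹ m)) = B.actH (B.Ad g a) m := by
  have e : B.actMod g (B.actMod g⁻¹ m) = m := by
    rw [← B.actEquiv_snd, ← B.actEquiv_snd_symm]
    exact (B.actEquiv g).1.2.apply_symm_apply m
  refine B.hbar_smul_cancel ?_
  have h := congrArg (B.actMod g) (B.hbar_smul_actH a (B.actMod g⁻¹ m))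
  rw [B.actMod_smul, B.actMod_smul, e, ← B.repJ_Ad, FWeyl.hbar, AlgEquiv.commutes] at h
  rw [B.hbar_smul_actH, ← h, FWeyl.hbar]

theorem adH_mem_filt (B : Darboux ω 𝔵 ι) {u : FWeyl ω} {j : ℕ} (hu : u ∈ FWeyl.filt ω (j + 2))
    (x : FWeyl ω) : B.adH u x ∈ FWeyl.filt ω j := B.mem_filt_of_rho fun d hd => by
  have h := congrArg (fun y => coeff (d + 2) (rho y)) (B.hbar_mul_adH u x)
  rw [map_mul rho, rho_hbar, coeff_X_pow_mul] at h
  rw [h]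
  exact rho_mem_serFilt (sub_mem (FWeyl.mul_mem_filt_right _ hu) (FWeyl.mul_mem_filt _ hu)) _ (by omega)

theorem actH_mem_filtMod_of_repJ (B : Darboux ω 𝔵 ι) {a : 𝔊J ω 𝔵} {j : ℕ}
    (ha : B.repJ a ∈ FWeyl.filt ω (j + 2)) (m : FMod ω 𝔵) : B.actH a m ∈ filtMod ω 𝔵 j := by
  obtain ⟨x, rfl⟩ := Submodule.Quotient.mk_surjective _ m
  obtain ⟨y, hy⟩ := Submodule.Quotient.mk_surjective _ (B.actH a (Submodule.Quotient.mk x))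
  have e := B.hbar_smul_actH a (Submodule.Quotient.mk x)
  rw [← hy] at e ⊢
  rw [smul_mk, smul_mk, mk_eq_mk] at e
  refine B.mk_mem_filtMod.2 fun d hd => ?_
  have h := mem_serIdeal.1 (rho_mem_serIdeal_of_mem e) (d + 2)
  rwa [map_sub, map_sub, map_mul rho, rho_hbar, coeff_X_pow_mul,
    rho_mem_serFilt (FWeyl.mul_mem_filt_right _ ha) _ (by omega), sub_zero] at h

theorem Ad_mem_OGJ (B : Darboux ω 𝔵 ι) {P : 𝔊J ω 𝔵 →ₗ[k] k} {j : ℕ}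
    (hP : ∀ a, B.repJ a ∈ FWeyl.filt ω j → P a = 0) (a : 𝔊J ω 𝔵) :
    (fun g : GJ ω 𝔵 => P (B.Ad g a)) ∈ OGJ ω 𝔵 := by
  obtain ⟨l, hl⟩ := exists_factor ((LinearMap.pi fun d : Fin j => jetD ω d) ∘ₗ B.repJ) P fun a ha =>
    hP a (B.mem_filt_of_rho fun d hd => congrFun ha ⟨d, hd⟩)
  have h := B.Phi_mem_OGJ (𝔵 := 𝔵) (l := l ∘ₗ LinearMap.pi fun d : Fin j => jetD ω d)
    ⟨j, fun x hx => by
      rw [LinearMap.comp_apply, show (LinearMap.pi fun d : Fin j => jetD ω d) x = 0 from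
        funext fun d => rho_mem_serFilt hx d d.2, map_zero]⟩ (B.repJ a)
  convert h using 2 with g
  rw [hl, LinearMap.comp_apply, B.repJ_Ad]
  rfl

/-- The comorphism of `Φ_{𝒟,𝓜}` on the functions that are invariant under `k^×`. -/
theorem exists_invariant (B : Darboux ω 𝔵 ι) [Nonempty ι] {F : AutDM ω 𝔵 → k} (hF : F ∈ OAutDM ω 𝔵)
    (ht : ∀ t g, F (B.actEquiv (scalGJ ω 𝔵 t * g)) = F (B.actEquiv g)) :
    ∃ f : OAutDMpm ω 𝔵, (∀ h, f.1 h = F h) ∧ ∀ g, (B.PhiDM.pull f).1 g = F (B.actEquiv g) := by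
  refine ⟨⟨F, hF, fun h => ?_⟩, fun _ => rfl, fun g => B.pullPhi_eq_self _ ht g⟩
  obtain ⟨g, rfl⟩ := B.actEquiv.surjective h
  rw [← B.actEquiv_negGJ, ← map_mul]
  exact ht (-1) g

theorem exists_conj (B : Darboux ω 𝔵 ι) [Nonempty ι] {F : AutDM ω 𝔵 → k} {P : 𝔊J ω 𝔵 →ₗ[k] k} {j : ℕ}
    (hP : ∀ a, B.repJ a ∈ FWeyl.filt ω j → P a = 0) {a : 𝔊J ω 𝔵}
    (hF : ∀ g, F (B.actEquiv g) = P (B.Ad g a)) :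
    ∃ f : OAutDMpm ω 𝔵, (∀ h, f.1 h = F h) ∧ ∀ g, (B.PhiDM.pull f).1 g = P (B.Ad g a) := by
  obtain ⟨f, h1, h2⟩ := B.exists_invariant (F := F)
    (B.comp_mem_OGJ_iff.1 (by simpa only [hF] using B.Ad_mem_OGJ hP a))
    fun t g => by rw [hF, hF, B.Ad_scalGJ_mul]
  exact ⟨f, h1, fun g => (h2 g).trans (hF g)⟩

theorem equivariant (B : Darboux ω 𝔵 ι) [Nonempty ι] :
    Equivariant B.upperRow B.PhiDM B.phiEquiv := by
  refine fun g a u hu => ⟨B.Ad g a, B.Ad_val g hu, fun l x ⟨j, hl⟩ => ?_, fun l m ⟨j, hl⟩ => ?_⟩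
  · let P : 𝔊J ω 𝔵 →ₗ[k] k :=
      { toFun := fun a => l ((B.phiEquiv a).1.1 x)
        map_add' := fun a b => by rw [map_add]; exact map_add l _ _
        map_smul' := fun t a => by rw [map_smul]; exact map_smul l t _ }
    obtain ⟨f, h1, h2⟩ := B.exists_conj (P := P) (j := j + 2) (a := a)
      (F := fun h => l (h.1.1 ((B.phiEquiv a).1.1 (h.1.1.symm x))))
      (fun a ha => hl _ (B.adH_mem_filt ha x)) fun g => congrArg l (by
        rw [B.actEquiv_fst_symm, B.actEquiv_fst]
        refine (B.Phi_adH_Phi_inv g (B.repJ a) x).trans ?_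
        rw [← B.repJ_Ad]
        rfl)
    exact ⟨f, h1, h2 g⟩
  · let P : 𝔊J ω 𝔵 →ₗ[k] k :=
      { toFun := fun a => l ((B.phiEquiv a).1.2 m)
        map_add' := fun a b => by rw [map_add]; exact map_add l _ _
        map_smul' := fun t a => by rw [map_smul]; exact map_smul l t _ }
    obtain ⟨f, h1, h2⟩ := B.exists_conj (P := P) (j := j + 2) (a := a)
      (F := fun h => l (h.1.2 ((B.phiEquiv a).1.2 (h.1.2.symm m))))
      (fun a ha => hl _ (B.actH_mem_filtMod_of_repJ ha m)) fun g => congrArg l (by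
        rw [B.actEquiv_snd_symm, B.actEquiv_snd]
        exact B.actMod_actH_actMod_inv g a m)
    exact ⟨f, h1, h2 g⟩

theorem chi_val (B : Darboux ω 𝔵 ι) (g : GJ ω 𝔵) :
    (B.chi g : k) * LinearMap.det (B.resX g) = 1 := by
  rw [← congrFun B.charPow_chi_neg_one g]
  simp [charPow]

theorem Phi_inr_mem_JIdeal (B : Darboux ω 𝔵 ι) {p : Sp ω} (hp : ∀ v ∈ 𝔵, p.1 v ∈ 𝔵) {x : FWeyl ω}
    (hx : x ∈ JIdeal ω 𝔵) : B.Phi (1, SemidirectProduct.inr p) x ∈ JIdeal ω 𝔵 := by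
  obtain ⟨y, hy⟩ := mem_JIdeal_iff.1 hx
  refine mem_JIdeal_iff.2 ⟨B.Phi (1, SemidirectProduct.inr p) y, ?_⟩
  have e : B.Phi (1, SemidirectProduct.inr p) (FWeyl.hbar ω) = FWeyl.hbar ω :=
    (B.Phi (1, SemidirectProduct.inr p)).commutes _
  rw [B.mem_leftIdeal] at hy ⊢
  rw [← e, ← map_mul (B.Phi (1, SemidirectProduct.inr p)), ← map_sub, B.Phi_inr, ← thetaS_rho]
  exact thetaS_mem_serIdeal hp hy

theorem inr_mem_GJ (B : Darboux ω 𝔵 ι) {p : Sp ω} (hp : ∀ v ∈ 𝔵, p.1 v ∈ 𝔵) :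
    ((1, SemidirectProduct.inr p) : 𝒢 ω) ∈ GJ ω 𝔵 := by
  refine B.mem_GJ_iff.2 fun x => ⟨fun hx => ?_, B.Phi_inr_mem_JIdeal hp⟩
  have hp' : ∀ v ∈ 𝔵, (p⁻¹ : Sp ω).1 v ∈ 𝔵 := fun v hv => by
    have := B.finiteDimensional
    have h1 : Function.Injective ((p.1 : V →ₗ[k] V).restrict hp) := fun a b h =>
      Subtype.ext (p.1.injective (congrArg Subtype.val h))
    obtain ⟨w, hw⟩ := LinearMap.injective_iff_surjective.1 h1 ⟨v, hv⟩
    obtain rfl : p.1 w.1 = v := congrArg Subtype.val hw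
    change p.1.symm (p.1 w.1) ∈ 𝔵
    rw [LinearEquiv.symm_apply_apply]
    exact w.2
  have h := B.Phi_inr_mem_JIdeal hp' hx
  have e : ((1, SemidirectProduct.inr p⁻¹) : 𝒢 ω) = (1, SemidirectProduct.inr p)⁻¹ :=
    Prod.ext inv_one.symm (map_inv SemidirectProduct.inr p)
  rw [e, map_inv B.Phi] at h
  rwa [show (B.Phi (1, SemidirectProduct.inr p))⁻¹ (B.Phi (1, SemidirectProduct.inr p) x) = x from
    (B.Phi (1, SemidirectProduct.inr p)).symm_apply_apply x] at h

theorem onParabolic (B : Darboux ω 𝔵 ι) [Nonempty ι] : OnParabolic B.PhiDM := by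
  intro p hp r hr
  have hr0 : r ≠ 0 := fun h => by simp [h] at hr
  let g : GJ ω 𝔵 := ⟨_, B.inr_mem_GJ hp⟩
  have hχ : Units.mk0 r hr0 ^ 2 = B.chi g := by
    have h1 := B.chi_val g
    have h2 : LinearMap.det (B.resX g) ≠ 0 := right_ne_zero_of_mul_eq_one h1
    exact Units.ext (mul_right_cancel₀ h2 (hr.trans h1.symm))
  refine ⟨g, B.actEquiv (scalGJ ω 𝔵 (Units.mk0 r hr0) * g), rfl, fun x => ?_, fun x => ?_,
    fun f => B.pullPhi_eq_of_sq f hχ⟩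
  · rw [B.actEquiv_fst, B.Phi_scalGJ_mul]
    exact B.Phi_inr 1 p x
  · rw [B.actEquiv_snd]
    refine (B.actMod_mk_eq_iff _ (y := r • thetaF p x)).2 ?_
    have e : serMap (scalGJ ω 𝔵 (Units.mk0 r hr0) * g).1 (rho x) = r • thetaS p (rho x) := by
      rw [serMap, scalGJ_mul_snd]
      change (r * 1) • ((1 : WSer ω) * thetaS p (rho x)) = _
      rw [mul_one, one_mul]
    rw [e, rho_smul, thetaS_rho, sub_self]
    exact zero_mem _

theorem chi_centralGJ (B : Darboux ω 𝔵 ι) (c : k⟦X⟧ˣ) : B.chi (B.centralGJ c) = 1 := by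
  have h := B.chi_val (B.centralGJ c)
  have e : B.resX (B.centralGJ c) = 1 := LinearMap.ext fun v => Subtype.ext (by
    change (B.centralGJ c).1.2.right.1 v.1 = v.1
    rw [B.centralGJ_right]
    rfl)
  rw [e, map_one, mul_one] at h
  exact Units.ext h

end Darboux

end Equivariance

end LabelExt

open LabelExt in
theorem proposition3p5 {k : Type*} {V : Type*} [Field k] [CharZero k] [AddCommGroup V] [Module k V]
    [FiniteDimensional k V] [Nontrivial V] (ω : SymplecticForm k V) (𝔵 : Submodule k V)
    (h𝔵 : IsLagrangian ω 𝔵) :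
    ∃ (U : UpperRow ω 𝔵) (L : LowerRow ω 𝔵)
      (Φ : ProalgIso (OGJpm ω 𝔵) (OAutDMpm ω 𝔵)) (φ : 𝔊J ω 𝔵 ≃ₗ⁅k⁆ DerDM ω 𝔵),
      -- `φ` is the isomorphism `φ_{𝒟,𝓜}`
      IsPhiDM φ ∧
      -- `⟨Φ, φ⟩` is a morphism of Harish-Chandra pairs
      DifferentialEq Φ φ ∧ Equivariant U Φ φ ∧
      -- the square on the left commutes
      (∀ (c : k⟦X⟧ˣ) (f : OAutDMpm ω 𝔵), (Φ.pull f).1 (U.grp.inl c) = f.1 (L.grp.inl c)) ∧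
      (∀ c : k⟦X⟧, φ (embK ω 𝔵 c) = epsDer ω 𝔵 c) ∧
      -- the square on the right commutes
      (∀ f ∈ OAutJ ω 𝔵, ∃ f' : OAutDMpm ω 𝔵,
        (∀ h : AutDM ω 𝔵, f'.1 h = f (L.grp.rightHom h)) ∧
        ∀ g : GJ ω 𝔵, (Φ.pull f').1 g = f (U.grp.rightHom g)) ∧
      (∀ a : 𝔊J ω 𝔵, L.f (φ a) = U.phi a) ∧
      -- `Φ` involves a square root of the determinant on the parabolic
      OnParabolic Φ := by
  obtain ⟨B⟩ := exists_darboux h𝔵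
  have : Nonempty (Fin (Module.finrank k 𝔵)) := by
    by_contra h
    rw [not_nonempty_iff] at h
    have := B.basis.repr.toEquiv.subsingleton
    exact not_subsingleton V this
  refine ⟨B.upperRow, B.lowerRow, B.PhiDM, B.phiEquiv, B.isPhiDM, B.differentialEq, B.equivariant,
    fun c f => ?_, B.phiHom_embK, fun f hf => ?_, fun _ => rfl, B.onParabolic⟩
  · refine (B.pullPhi_eq_of_sq f ((one_pow 2).trans (B.chi_centralGJ c).symm)).trans ?_
    rw [map_one (scalGJ ω 𝔵), one_mul, B.actEquiv_centralGJ]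
    rfl
  · obtain ⟨f', h1, h2⟩ := B.exists_invariant (F := fun h => f (B.lowerRow.grp.rightHom h))
      (B.lowerRow.F_regular f hf) fun t g => congrArg f
        (Subtype.ext (AlgEquiv.ext fun x => B.Phi_scalGJ_mul t g x))
    exact ⟨f', h1, fun g => h2 g⟩
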